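/- Let $(M,g)$ be a smooth 4-dimensional Hausdorff, $\sigma$-compact Lorentzian manifold of signature $(+---)$ that is oriented, time-oriented, satisfies $\mathrm{Ric}(g)=0$ and is of Petrov type D: the Weyl tensor $C$ vanishes nowhere, and there are global smooth, future-directed, pointwise linearly independent null vector fields $V^\pm$ with $C(V^\pm,v,V^\pm,\cdot)=0$ for all $v\perp V^\pm$ (e.g. the subextreme Kerr exterior together with the future horizon and the interior up to the inner horizon). The curvature convention is $R(X,Y)Z=[\nabla_X,\nabla_Y]Z-\nabla_{[X,Y]}Z$ and $R_{abcd}u^av^bw^cz^d=g(u,R(w,z)v)$. Let $\mathfrak N_0$ be the bundle of null frames $(l,n,m)$ with $l,n$ real, future directed and collinear to $V^+$, $V^-$ respectively, $m$ complex, $g(l,n)=-g(m,\overline m)=1$, all other products zero, and $\left(2^{-1/2}(n+l),\Re m,-\Im m,2^{-1/2}(l-n)\right)$ positively oriented; $\mathbb C^*$ acts by $(l,n,m)\cdot z=(|z|l,|z|^{-1}n,z|z|^{-1}m)$. For integers $s,w$ let $\mathcal B(s,w)$ be the line bundle associated with $\mathfrak N_0$ and the representation $\rho_{(s,w)}(z)=|z|^{-(w-s)}z^{-s}$;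 its sections are the functions $f$ on $\mathfrak N_0$ with $f(a\cdot z)=\rho_{(s,w)}(z^{-1})f(a)$. On $\mathcal B(s,w)$ let, in a local frame, $$\Theta_a=\nabla_a-(w+s)w_a-(w-s)\overline w_a,\qquad w_a=\tfrac12\left(n^b\nabla_al_b+m^b\nabla_a\overline m_b\right),$$ and put $\text{þ}=l^a\Theta_a$, $\text{þ}'=n^a\Theta_a$, $\eth=m^a\Theta_a$, $\eth'=\overline m^a\Theta_a$, $\rho=m^a\overline m^b\nabla_bl_a$, $\rho'=\overline m^am^b\nabla_bn_a$, $\tau=m^an^b\nabla_bl_a$, $\tau'=\overline m^al^b\nabla_bn_a$, $\Psi_2=C_{abcd}m^al^b\overline m^cn^d$. For $s\in\mathbb Z$ the Teukolsky operator on $\Gamma(\mathcal B(s,s))$ is $$T_s=2\left[(\text{þ}-2s\rho-\overline\rho)(\text{þ}'-\rho')-(\eth-2s\tau-\overline{\tau}')(\eth'-\tau')\right]-(4s^2-6s+2)\Psi_2 .$$ Let $\overline{T_{-s}}f=\overline{T_{-s}\overline f}$ for $f\in\Gamma(\mathcal B(s,-s))$, let $\mathcal V_s=\mathcal B(s,s)\oplus\mathcal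 B(s,-s)$ and $\mathcal P_s=T_s\oplus\overline{T_{-s}}$. For $u=(u_1,u_2)$, $v=(v_1,v_2)\in\mathcal V_{s,x}$ let $\langle u,v\rangle_x=\overline{u_1}v_2+\overline{u_2}v_1$, the components being taken in a common frame in $\mathfrak N_{0,x}$. Then, for every $s\in\mathbb Z$: 1. The measure $dvol_g$ of the metric volume form is well defined, as is $\langle\cdot,\cdot\rangle_x$ (the fibres of $\mathfrak N_0$ are non-empty and the value is independent of the frame), and $\langle\cdot,\cdot\rangle_x$ is hermitian, non-degenerate and indefinite on every fibre of $\mathcal V_s$. The operator $T_s$ maps smooth sections of $\mathcal B(s,s)$ to smooth sections of $\mathcal B(s,s)$, and $\mathcal P_s$ maps smooth sections of $\mathcal V_s$ to smooth sections of $\mathcal V_s$. 2. $\overline{T_{-s}}$ is the formal anti-dual of $T_s$: for all $f\in\Gamma(\mathcal B(s,-s))$ and $h\in\Gamma(\mathcal B(s,s))$ with $\operatorname{supp}f\cap\operatorname{supp}h$ compact, $$\int_M f\,\overline{T_sh}\;dvol_g=\int_M\left(\overline{T_{-s}}f\right)\overline h\;dvol_g ,$$ both integrands being integrable (they are scalar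 functions: the product of the components in any common frame). 3. $\mathcal P_s$ is formally hermitian: for all $F,H\in\Gamma(\mathcal V_s)$ with $\operatorname{supp}F\cap\operatorname{supp}H$ compact, $$\int_M\langle F,\mathcal P_sH\rangle_x\,dvol_g=\int_M\langle\mathcal P_sF,H\rangle_x\,dvol_g ,$$ both integrands being integrable. -/

import Mathlib

open Bundle MeasureTheory
open scoped Manifold ContDiff Topology

noncomputable section

namespace Teukolsky

/-- The model space of four-dimensional manifolds. -/
abbrev E4 : Type := EuclideanSpace ℝ (Fin 4)

section Metric

variable {M : Type*} [TopologicalSpace M] [ChartedSpace E4 M] [IsManifold (𝓡 4) ∞ M]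

/-- The signs of the signature `(+ - - -)`. -/
def eta (i : Fin 4) : ℝ := if i = 0 then 1 else -1

variable (M) in
/-- Smooth Lorentzian metrics of signature `(+ - - -)` on a 4-manifold. -/
structure LorentzMetric where
  val (x : M) : TangentSpace (𝓡 4) x →L[ℝ] TangentSpace (𝓡 4) x →L[ℝ] ℝ
  symm (x : M) (v w : TangentSpace (𝓡 4) x) : val x v w = val x w v
  contMDiff : ContMDiff (𝓡 4) ((𝓡 4).prod 𝓘(ℝ, E4 →L[ℝ] E4 →L[ℝ] ℝ)) ∞
    (fun x ↦ TotalSpace.mk' (E4 →L[ℝ] E4 →L[ℝ] ℝ) x (val x))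
  signature (x : M) : ∃ e : Fin 4 → TangentSpace (𝓡 4) x,
    ∀ i j, val x (e i) (e j) = if i = j then eta i else 0

variable (M) in
/-- (Not necessarily smooth) real vector fields. -/
abbrev VField : Type _ := (x : M) → TangentSpace (𝓡 4) x

/-- Smoothness of a real vector field on a set. -/
def VField.SmoothOn (X : VField M) (U : Set M) : Prop :=
  ContMDiffOn (𝓡 4) (𝓡 4).tangent ∞ (fun x ↦ (⟨x, X x⟩ : TangentBundle (𝓡 4) M)) U

/-- Differentiability of a real vector field at a point. -/
def VField.DiffAt (X : VField M) (x : M) : Prop :=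
  MDifferentiableAt (𝓡 4) (𝓡 4).tangent (fun x ↦ (⟨x, X x⟩ : TangentBundle (𝓡 4) M)) x

/-- The directional derivative `X(f)` of a real function. -/
def vderiv (X : VField M) (f : M → ℝ) (x : M) : ℝ := mvfderiv (𝓡 4) f x (X x)

namespace LorentzMetric

variable (g : LorentzMetric M)

/-- The right-hand side of the Koszul formula for `2 g(∇_X Y, Z)`. -/
def koszul (X Y Z : VField M) (x : M) : ℝ :=
  vderiv X (fun y ↦ g.val y (Y y) (Z y)) x + vderiv Y (fun y ↦ g.val y (X y) (Z y)) x
    - vderiv Z (fun y ↦ g.val y (X y) (Y y)) x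
    + g.val x (VectorField.mlieBracket (𝓡 4) X Y x) (Z x)
    - g.val x (VectorField.mlieBracket (𝓡 4) X Z x) (Y x)
    - g.val x (VectorField.mlieBracket (𝓡 4) Y Z x) (X x)

/-- The Levi-Civita covariant derivative `∇_X Y`: its value at `x` is the (unique) vector
satisfying the Koszul formula against every vector field `Z` that is differentiable at `x`. -/
def nabla (X Y : VField M) : VField M := fun x ↦
  Classical.epsilon fun u : TangentSpace (𝓡 4) x ↦
    ∀ Z : VField M, Z.DiffAt x → 2 * g.val x u (Z x) = g.koszul X Y Z x

/-- `R(X, Y) Z = ∇_X ∇_Y Z - ∇_Y ∇_X Z - ∇_[X, Y] Z`. -/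
def curvatureOp (X Y Z : VField M) : VField M := fun x ↦
  g.nabla X (g.nabla Y Z) x - g.nabla Y (g.nabla X Z) x
    - g.nabla (VectorField.mlieBracket (𝓡 4) X Y) Z x

/-- The Riemann tensor `R_{abcd} u^a v^b w^c z^d = g(u, R(w, z) v)`, computed with smooth
extensions of the tangent vectors. -/
def riemann (x : M) (u v w z : TangentSpace (𝓡 4) x) : ℝ :=
  g.val x u (g.curvatureOp (FiberBundle.extend E4 w) (FiberBundle.extend E4 z)
    (FiberBundle.extend E4 v) x)

/-- The metric trace `g^{ab} B_{ab}` of a bilinear form on the tangent space. -/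
def metricTrace (x : M) (B : TangentSpace (𝓡 4) x → TangentSpace (𝓡 4) x → ℝ) : ℝ :=
  ∑ i, eta i * B ((g.signature x).choose i) ((g.signature x).choose i)

/-- The Ricci tensor `R_{bd} = g^{ac} R_{abcd}`. -/
def ricci (x : M) (v z : TangentSpace (𝓡 4) x) : ℝ :=
  g.metricTrace x fun u w ↦ g.riemann x u v w z

/-- The Ricci scalar. -/
def scalarCurvature (x : M) : ℝ := g.metricTrace x (g.ricci x)

/-- The Weyl tensor `C_{abcd}` in dimension four. -/
def weyl (x : M) (u v w z : TangentSpace (𝓡 4) x) : ℝ :=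
  g.riemann x u v w z
    - (1 / 2) * (g.val x u w * g.ricci x v z - g.val x u z * g.ricci x v w
        - g.val x v w * g.ricci x u z + g.val x v z * g.ricci x u w)
    + (g.scalarCurvature x / 6) * (g.val x u w * g.val x v z - g.val x u z * g.val x v w)

/-- `k` spans a principal null direction of multiplicity at least two. -/
def IsPrincipalNull (x : M) (k : TangentSpace (𝓡 4) x) : Prop :=
  k ≠ 0 ∧ g.val x k k = 0 ∧
    ∀ v w : TangentSpace (𝓡 4) x, g.val x v k = 0 → g.weyl x k v k w = 0

/-- The determinant of the matrix `g_{ij}` of the metric in the chart at `x₀`, as a function of the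
coordinates `y`. -/
def gramDet (x₀ : M) (y : E4) : ℝ :=
  Matrix.det (Matrix.of fun i j : Fin 4 ↦
    g.val ((extChartAt (𝓡 4) x₀).symm y)
      (mfderiv 𝓘(ℝ, E4) (𝓡 4) (extChartAt (𝓡 4) x₀).symm y (EuclideanSpace.single i (1 : ℝ)))
      (mfderiv 𝓘(ℝ, E4) (𝓡 4) (extChartAt (𝓡 4) x₀).symm y (EuclideanSpace.single j (1 : ℝ))))

variable [MeasurableSpace M]

/-- `μ` is the measure of the metric volume form: it is `√|det g_{ij}| d⁴y` in every chart of the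
(covering) family `chartAt`. -/
def IsVolumeMeasure (μ : Measure M) : Prop :=
  ∀ x₀ : M, ∀ S : Set M, MeasurableSet S → S ⊆ (chartAt E4 x₀).source →
    μ S = ∫⁻ y in extChartAt (𝓡 4) x₀ '' S, ENNReal.ofReal (Real.sqrt |g.gramDet x₀ y|)

/-- The measure of the metric volume form `dvol_g`. -/
def volumeMeasure : Measure M := Classical.epsilon fun μ ↦ g.IsVolumeMeasure μ

end LorentzMetric

/-! ### Complexified tangent vectors -/

/-- The complexified tangent space `T_ℂ,x M`; the pair `(u, v)` stands for `u + i v`. -/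
abbrev CTangent (x : M) : Type := TangentSpace (𝓡 4) x × TangentSpace (𝓡 4) x

variable (M) in
/-- Complex vector fields. -/
abbrev CVField : Type _ := (x : M) → CTangent x

/-- A real tangent vector as a complex one. -/
def ofReal {x : M} (u : TangentSpace (𝓡 4) x) : CTangent x := (u, 0)

/-- Complex conjugation. -/
def conjT {x : M} (u : CTangent x) : CTangent x := (u.1, -u.2)

/-- Multiplication by a complex number. -/
def smulT {x : M} (z : ℂ) (u : CTangent x) : CTangent x :=
  (z.re • u.1 - z.im • u.2, z.re • u.2 + z.im • u.1)

/-- Real part (index 0) and imaginary part (index 1). -/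
def part {x : M} (u : CTangent x) (i : Fin 2) : TangentSpace (𝓡 4) x := if i = 0 then u.1 else u.2

/-- The derivative of a complex function along a complex vector field. -/
def cderiv (X : CVField M) (f : M → ℂ) (x : M) : ℂ :=
  mvfderiv (𝓡 4) f x (X x).1 + Complex.I * mvfderiv (𝓡 4) f x (X x).2

namespace LorentzMetric

variable (g : LorentzMetric M)

/-- The complex bilinear extension of the metric. -/
def cval (x : M) (u v : CTangent x) : ℂ :=
  ∑ i : Fin 2, ∑ j : Fin 2,
    Complex.I ^ (i.val + j.val) * (g.val x (part u i) (part v j) : ℂ)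

/-- The complex multilinear extension of the Weyl tensor. -/
def cweyl (x : M) (u v w z : CTangent x) : ℂ :=
  ∑ i : Fin 2, ∑ j : Fin 2, ∑ k : Fin 2, ∑ l : Fin 2,
    Complex.I ^ (i.val + j.val + k.val + l.val) *
      (g.weyl x (part u i) (part v j) (part w k) (part z l) : ℂ)

/-- The complex bilinear extension of the Levi-Civita covariant derivative `∇_X Y`. -/
def cnabla (X Y : CVField M) : CVField M := fun x ↦
  (g.nabla (fun y ↦ (X y).1) (fun y ↦ (Y y).1) x - g.nabla (fun y ↦ (X y).2) (fun y ↦ (Y y).2) x,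
   g.nabla (fun y ↦ (X y).1) (fun y ↦ (Y y).2) x + g.nabla (fun y ↦ (X y).2) (fun y ↦ (Y y).1) x)

end LorentzMetric

variable (M) in
/-- A vacuum background of Petrov type D: a Lorentzian metric, an orientation (given by a
representing 4-form), a time orientation (given by a representing timelike 1-form) and a global
smooth choice of the two repeated principal null directions. -/
structure Background where
  g : LorentzMetric M
  orient (x : M) : TangentSpace (𝓡 4) x [⋀^Fin 4]→ₗ[ℝ] ℝ
  orient_smooth (U : Set M) (hU : IsOpen U) (X : Fin 4 → VField M)
    (hX : ∀ i, (X i).SmoothOn U) :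
    ContMDiffOn (𝓡 4) 𝓘(ℝ, ℝ) ∞ (fun x ↦ orient x fun i ↦ X i x) U
  orient_ne_zero (x : M) : orient x ≠ 0
  time (x : M) : TangentSpace (𝓡 4) x →ₗ[ℝ] ℝ
  time_smooth (U : Set M) (hU : IsOpen U) (X : VField M) (hX : X.SmoothOn U) :
    ContMDiffOn (𝓡 4) 𝓘(ℝ, ℝ) ∞ (fun x ↦ time x (X x)) U
  time_timelike (x : M) : ∃ t : TangentSpace (𝓡 4) x,
    0 < g.val x t t ∧ ∀ v, time x v = g.val x t v
  /-- The vacuum Einstein equations. -/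
  vacuum (x : M) (v w : TangentSpace (𝓡 4) x) : g.ricci x v w = 0
  /-- The Weyl tensor vanishes nowhere (type D, not type O). -/
  weyl_ne_zero (x : M) : ∃ u v w z : TangentSpace (𝓡 4) x, g.weyl x u v w z ≠ 0
  Vplus : VField M
  Vminus : VField M
  Vplus_smooth : Vplus.SmoothOn Set.univ
  Vminus_smooth : Vminus.SmoothOn Set.univ
  Vplus_principal (x : M) : g.IsPrincipalNull x (Vplus x)
  Vminus_principal (x : M) : g.IsPrincipalNull x (Vminus x)
  Vplus_future (x : M) : 0 < time x (Vplus x)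
  Vminus_future (x : M) : 0 < time x (Vminus x)
  V_independent (x : M) : LinearIndependent ℝ ![Vplus x, Vminus x]

/-- The fibre at `x` of the bundle `𝔑₀` of oriented, normalized principal null frames `(l, n, m)`
with `l` and `n` future directed and collinear to `V⁺` and `V⁻`. -/
@[ext] structure NullTetrad (𝔐 : Background M) (x : M) where
  l : TangentSpace (𝓡 4) x
  n : TangentSpace (𝓡 4) x
  m : CTangent x
  l_collinear : ∃ c : ℝ, l = c • 𝔐.Vplus x
  n_collinear : ∃ c : ℝ, n = c • 𝔐.Vminus x
  l_future : 0 < 𝔐.time x l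
  n_future : 0 < 𝔐.time x n
  l_n : 𝔐.g.val x l n = 1
  m_conj_m : 𝔐.g.cval x m (conjT m) = -1
  m_m : 𝔐.g.cval x m m = 0
  l_l : 𝔐.g.val x l l = 0
  n_n : 𝔐.g.val x n n = 0
  l_m : 𝔐.g.cval x (ofReal l) m = 0
  n_m : 𝔐.g.cval x (ofReal n) m = 0
  oriented : 0 < 𝔐.orient x ![(Real.sqrt 2)⁻¹ • (n + l), m.1, -m.2, (Real.sqrt 2)⁻¹ • (l - n)]

variable (𝔐 : Background M)

/-- The relation `b = a · z` of the right action of `ℂ*` on `𝔑₀`: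
`(l, n, m) · z = (|z| l, |z|⁻¹ n, z |z|⁻¹ m)`. -/
def Rotates {𝔐 : Background M} {x : M} (z : ℂ) (a b : NullTetrad 𝔐 x) : Prop :=
  b.l = ‖z‖ • a.l ∧ b.n = ‖z‖⁻¹ • a.n ∧ b.m = smulT (z * (‖z‖ : ℂ)⁻¹) a.m

/-! ### Spin-weighted scalars -/

/-- The representation `ρ_(s,w)(z) = |z|^{-(w-s)} z^{-s}` of `ℂ*` on `ℂ`. -/
def spinRep (s w : ℤ) (z : ℂ) : ℂ := (‖z‖ : ℂ) ^ (-(w - s)) * z ^ (-s)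

/-- The fibre at `x` of the line bundle `𝓑(s,w)` associated with `𝔑₀` and `ρ_(s,w)`. The element
`[a, c]` is identified with the equivariant function on `𝔑₀,ₓ` that takes the value `c` at `a`. -/
def spinFibre (s w : ℤ) (x : M) : Submodule ℂ (NullTetrad 𝔐 x → ℂ) where
  carrier := {c | ∀ (a b : NullTetrad 𝔐 x) (z : ℂ), z ≠ 0 → Rotates z a b →
    c b = spinRep s w z⁻¹ * c a}
  add_mem' := by
    intro c d hc hd a b z hz h
    simp only [Pi.add_apply, hc a b z hz h, hd a b z hz h, mul_add]
  zero_mem' := by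
    intro a b z _ _
    simp
  smul_mem' := by
    intro r c hc a b z hz h
    simp only [Pi.smul_apply, smul_eq_mul, hc a b z hz h]
    ring

/-- Complex valued functions on `𝔑₀`, among them the spin-weighted functions. -/
abbrev SWF : Type _ := (x : M) → NullTetrad 𝔐 x → ℂ

/-- (Not necessarily smooth) sections of `𝔑₀`. -/
abbrev TetradField : Type _ := (x : M) → NullTetrad 𝔐 x

variable {𝔐}

/-- The section of `𝔑₀` is smooth on a neighbourhood of `x`. -/
def TetradField.SmoothNear (A : TetradField 𝔐) (x : M) : Prop :=
  ∃ U : Set M, IsOpen U ∧ x ∈ U ∧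
    VField.SmoothOn (fun y ↦ (A y).l) U ∧ VField.SmoothOn (fun y ↦ (A y).n) U ∧
    VField.SmoothOn (fun y ↦ (A y).m.1) U ∧ VField.SmoothOn (fun y ↦ (A y).m.2) U

/-- `f` is a smooth section of `𝓑(s,w)`: it takes values in the fibres, and its component in every
local smooth section of `𝔑₀` is smooth. -/
def IsSection (s w : ℤ) (f : SWF 𝔐) : Prop :=
  (∀ x, f x ∈ spinFibre 𝔐 s w x) ∧
    ∀ (A : TetradField 𝔐) (x : M), A.SmoothNear x →
      ContMDiffAt (𝓡 4) 𝓘(ℝ, ℂ) ∞ (fun y ↦ f y (A y)) x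

/-- The complex conjugation `𝓑(s,w) → 𝓑(-s,w)`, on a fibre. -/
def conjFib {x : M} (c : NullTetrad 𝔐 x → ℂ) : NullTetrad 𝔐 x → ℂ := fun a ↦ star (c a)

/-- The complex conjugation `𝓑(s,w) → 𝓑(-s,w)`, on sections. -/
def conjSec (f : SWF 𝔐) : SWF 𝔐 := fun x ↦ conjFib (f x)

/-! ### The connection, the GHP operators and the spin coefficients -/

open Classical in
/-- Evaluate an expression that depends on a local smooth section `A` of `𝔑₀` through `a ∈ 𝔑₀,ₓ`,
for some such `A`. It is used only for expressions whose value depends on `a` alone. -/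
def inLocalTetrad {x : M} (a : NullTetrad 𝔐 x) (Φ : TetradField 𝔐 → ℂ) : ℂ :=
  if h : ∃ A : TetradField 𝔐, A.SmoothNear x ∧ A x = a then Φ h.choose else 0

namespace TetradField

variable (A : TetradField 𝔐)

/-- The complex vector field `l` of the tetrad. -/
def L : CVField M := fun y ↦ ofReal (A y).l

/-- The complex vector field `n` of the tetrad. -/
def N : CVField M := fun y ↦ ofReal (A y).n

/-- The complex vector field `m` of the tetrad. -/
def Mv : CVField M := fun y ↦ (A y).m

/-- The complex vector field `m̄` of the tetrad. -/
def Mbar : CVField M := fun y ↦ conjT (A y).m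

/-- The connection form `w_a = (n^b ∇_a l_b + m^b ∇_a m̄_b) / 2`, contracted with `X`. -/
def wForm (X : CVField M) (x : M) : ℂ :=
  (1 / 2) * (𝔐.g.cval x (A.N x) (𝔐.g.cnabla X A.L x)
    + 𝔐.g.cval x (A.Mv x) (𝔐.g.cnabla X A.Mbar x))

/-- The complex conjugate connection form `w̄_a`, contracted with `X`. -/
def wBarForm (X : CVField M) (x : M) : ℂ := star (A.wForm (fun y ↦ conjT (X y)) x)

/-- `X^a Θ_a f`, with `Θ_a = ∇_a - (w + s) w_a - (w - s) w̄_a` acting on the component of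
`f ∈ Γ(𝓑(s,w))` in the trivialization given by `A`. -/
def theta (s w : ℤ) (X : CVField M) (f : SWF 𝔐) (x : M) : ℂ :=
  cderiv X (fun y ↦ f y (A y)) x - ((w + s : ℤ) : ℂ) * A.wForm X x * f x (A x)
    - ((w - s : ℤ) : ℂ) * A.wBarForm X x * f x (A x)

end TetradField

/-- `þ = l^a Θ_a : Γ(𝓑(s,w)) → Γ(𝓑(s,w+1))`. -/
def tho (s w : ℤ) (f : SWF 𝔐) : SWF 𝔐 := fun x a ↦
  inLocalTetrad a fun A ↦ A.theta s w A.L f x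

/-- `þ' = n^a Θ_a : Γ(𝓑(s,w)) → Γ(𝓑(s,w-1))`. -/
def thoP (s w : ℤ) (f : SWF 𝔐) : SWF 𝔐 := fun x a ↦
  inLocalTetrad a fun A ↦ A.theta s w A.N f x

/-- `ð = m^a Θ_a : Γ(𝓑(s,w)) → Γ(𝓑(s+1,w))`. -/
def edt (s w : ℤ) (f : SWF 𝔐) : SWF 𝔐 := fun x a ↦
  inLocalTetrad a fun A ↦ A.theta s w A.Mv f x

/-- `ð' = m̄^a Θ_a : Γ(𝓑(s,w)) → Γ(𝓑(s-1,w))`. -/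
def edtP (s w : ℤ) (f : SWF 𝔐) : SWF 𝔐 := fun x a ↦
  inLocalTetrad a fun A ↦ A.theta s w A.Mbar f x

variable (𝔐)

/-- `ρ = m^a m̄^b ∇_b l_a`. -/
def rho : SWF 𝔐 := fun x a ↦
  inLocalTetrad a fun A ↦ 𝔐.g.cval x (A.Mv x) (𝔐.g.cnabla A.Mbar A.L x)

/-- `ρ' = m̄^a m^b ∇_b n_a`. -/
def rhoP : SWF 𝔐 := fun x a ↦
  inLocalTetrad a fun A ↦ 𝔐.g.cval x (A.Mbar x) (𝔐.g.cnabla A.Mv A.N x)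

/-- `τ = m^a n^b ∇_b l_a`. -/
def tau : SWF 𝔐 := fun x a ↦
  inLocalTetrad a fun A ↦ 𝔐.g.cval x (A.Mv x) (𝔐.g.cnabla A.N A.L x)

/-- `τ' = m̄^a l^b ∇_b n_a`. -/
def tauP : SWF 𝔐 := fun x a ↦
  inLocalTetrad a fun A ↦ 𝔐.g.cval x (A.Mbar x) (𝔐.g.cnabla A.L A.N x)

/-- `Ψ₂ = C_{abcd} m^a l^b m̄^c n^d`. -/
def psi2 : SWF 𝔐 := fun x a ↦
  𝔐.g.cweyl x a.m (ofReal a.l) (conjT a.m) (ofReal a.n)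

variable {𝔐}

/-! ### The Teukolsky operators -/

/-- The Teukolsky operator on `Γ(𝓑(s,s))`:
`T_s = 2[(þ - 2sρ - ρ̄)(þ' - ρ') - (ð - 2sτ - τ̄')(ð' - τ')] - (4s² - 6s + 2)Ψ₂`. -/
def teukolsky (s : ℤ) (f : SWF 𝔐) : SWF 𝔐 :=
  let u : SWF 𝔐 := thoP s s f - rhoP 𝔐 * f
  let v : SWF 𝔐 := edtP s s f - tauP 𝔐 * f
  (2 : ℂ) • ((tho s (s - 1) u - (2 * s : ℂ) • (rho 𝔐 * u) - conjSec (rho 𝔐) * u)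
      - (edt (s - 1) s v - (2 * s : ℂ) • (tau 𝔐 * v) - conjSec (tauP 𝔐) * v))
    - (4 * s ^ 2 - 6 * s + 2 : ℂ) • (psi2 𝔐 * f)

/-- The complex conjugate `P̄ f = conj (P (conj f))` of an operator. -/
def conjOp (P : SWF 𝔐 → SWF 𝔐) (f : SWF 𝔐) : SWF 𝔐 := conjSec (P (conjSec f))

/-- The extended Teukolsky operator `𝓟_s = T_s ⊕ conj(T_{-s})` on `𝓥_s = 𝓑(s,s) ⊕ 𝓑(s,-s)`. -/
def extTeukolsky (s : ℤ) (F : SWF 𝔐 × SWF 𝔐) : SWF 𝔐 × SWF 𝔐 :=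
  (teukolsky s F.1, conjOp (teukolsky (-s)) F.2)

/-! ### The double bundle and its hermitian form -/

variable (𝔐) in
/-- The fibre at `x` of `𝓥_s = 𝓑(s,s) ⊕ 𝓑(s,-s)`. -/
def doubleFibre (s : ℤ) (x : M) : Submodule ℂ ((NullTetrad 𝔐 x → ℂ) × (NullTetrad 𝔐 x → ℂ)) :=
  (spinFibre 𝔐 s s x).prod (spinFibre 𝔐 s (-s) x)

/-- Smooth sections of `𝓥_s`. -/
def IsDoubleSection (s : ℤ) (F : SWF 𝔐 × SWF 𝔐) : Prop :=
  IsSection s s F.1 ∧ IsSection s (-s) F.2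

open Classical in
/-- The duality between `𝓑(-s,-w)` and `𝓑(s,w)`: the product of the components in any common
tetrad. -/
def dualEval {x : M} (d c : NullTetrad 𝔐 x → ℂ) : ℂ :=
  if h : Nonempty (NullTetrad 𝔐 x) then d h.some * c h.some else 0

/-- The fibre pairing `⟨u, v⟩_x` of `𝓥_s`, antilinear in `u` and linear in `v`. -/
def fibreForm {x : M} (u v : (NullTetrad 𝔐 x → ℂ) × (NullTetrad 𝔐 x → ℂ)) : ℂ :=
  dualEval v.2 (conjFib u.1) + dualEval v.1 (conjFib u.2)

/-- The pointwise pairing `x ↦ ⟨F(x), H(x)⟩_x`. -/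
def pointForm (F H : SWF 𝔐 × SWF 𝔐) (x : M) : ℂ :=
  fibreForm (F.1 x, F.2 x) (H.1 x, H.2 x)

/-- The support of a spin-weighted function. -/
def supp (f : SWF 𝔐) : Set M := closure {x | f x ≠ 0}

/-- The support of a section of `𝓥_s`. -/
def suppD (F : SWF 𝔐 × SWF 𝔐) : Set M := closure {x | F.1 x ≠ 0 ∨ F.2 x ≠ 0}

variable [MeasurableSpace M]

/-- `Q`, acting on `Γ(𝓑(s,-s))`, is the formal anti-dual of `P`, acting on `Γ(𝓑(s,s))`:
`∫ f(conj(P h)) dvol = ∫ (Q f)(conj h) dvol` (with both integrals convergent) whenever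
`supp f ∩ supp h` is compact. -/
def IsFormalAntidual (s : ℤ) (P Q : SWF 𝔐 → SWF 𝔐) : Prop :=
  ∀ f h : SWF 𝔐, IsSection s (-s) f → IsSection s s h → IsCompact (supp f ∩ supp h) →
    Integrable (fun x ↦ dualEval (f x) (conjFib (P h x))) 𝔐.g.volumeMeasure ∧
    Integrable (fun x ↦ dualEval (Q f x) (conjFib (h x))) 𝔐.g.volumeMeasure ∧
    ∫ x, dualEval (f x) (conjFib (P h x)) ∂𝔐.g.volumeMeasure
      = ∫ x, dualEval (Q f x) (conjFib (h x)) ∂𝔐.g.volumeMeasure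

/-- `P`, acting on `Γ(𝓥_s)`, is formally hermitian: `⟨F, P H⟩ = ⟨P F, H⟩` (with both integrals
convergent) whenever `supp F ∩ supp H` is compact. -/
def IsFormallyHermitian (s : ℤ) (P : SWF 𝔐 × SWF 𝔐 → SWF 𝔐 × SWF 𝔐) : Prop :=
  ∀ F H : SWF 𝔐 × SWF 𝔐, IsDoubleSection s F → IsDoubleSection s H →
    IsCompact (suppD F ∩ suppD H) →
    Integrable (pointForm F (P H)) 𝔐.g.volumeMeasure ∧
    Integrable (pointForm (P F) H) 𝔐.g.volumeMeasure ∧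
    ∫ x, pointForm F (P H) x ∂𝔐.g.volumeMeasure = ∫ x, pointForm (P F) H x ∂𝔐.g.volumeMeasure

end Metric

end Teukolsky

end

/-!
The heart of the matter is a pointwise Green identity. In a smooth null tetrad the difference
`f · T_s h - h · T_{-s} f` is the divergence of a current `J` that is bilinear in `f`, `h` and of first
order in their derivatives (`FrameField.teukolsky_identity`, with `J = current`). The terms of
second order cancel up to commutators of the frame derivatives. What is left in order zero
consists of the curvature of the connection form `w` in the planes spanned by `l`, `n` and by `m`,
`m̄` (`curvature_ln`, `curvature_mk`) and of the Ricci equation that contains `þ'ρ - ð'τ`,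
together with its primed companion (`ricci_nk`). The potential `(4s² - 6s + 2) Ψ₂` is the one for
which these contributions add up to zero.

These three equations take a closed form because the background is a type D vacuum. The vacuum
equations and the two principal null directions leave `Ψ₂` as the only component of the Weyl
tensor in an adapted frame (`cweyl_ml`, `cweyl_nl_add_mk`), and `Ψ₂` has no zeros since the Weyl
tensor has none (`psi_ne_zero`). The exterior derivative of the structure equation for `g(m, ∇ l)`
then gives `κ Ψ₂ = 0` and `σ Ψ₂ = 0`, which is the part of the Goldberg-Sachs theorem that is
needed (`bianchi_ml`, `kappa_eq_zero`, `sigma_eq_zero`). All of this is carried out in complex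
null frames, a notion invariant under the prime operation and under conjugation, so that each
equation also provides its primed and its conjugate version.

That the operators are well defined rests on two facts. Two null tetrads at a point differ by a
boost and a rotation (`rotatesBy_boost_twist`), and through every null tetrad passes a local
section of `𝔑₀` that is smooth near the point, obtained by the Gram-Schmidt process
(`exists_tetradField`). An expression in a local tetrad that transforms with weights `(s, w)`
therefore defines a section of `𝓑(s,w)` (`inLocalTetrad_spec`); this applies to the four
derivatives because the connection `Θ` is gauge covariant (`theta_gauge`), and to the spin
coefficients `ρ`, `ρ'`, `τ`, `τ'`, and hence to the Teukolsky operator (`teukolsky_spec`).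

The volume measure is patched from countably many charts, in which the change of variables formula
shows it to be consistent (`exists_isVolumeMeasure`). In a chart, the derivative of the density
`√|det g|` along a coordinate field is the density times the trace of the connection
(`vderiv_density`), so that the density times the divergence of `J` is a sum of partial
derivatives and has integral zero when the support of `J` is compact
(`integral_frameDiv_eq_zero`). A partition of unity for `f` globalizes this
(`integral_greenDensity`): only the compact set `supp f ∩ supp h` matters, since both operators
are local. Hence `T_s` and `T_{-s}` are formal transposes of each other. Conjugating one argument
yields the formal anti-dual (`isFormalAntidual_teukolsky`), and two instances of the latter give
the hermiticity of `T_s ⊕ conj T_{-s}` (`isFormallyHermitian_extTeukolsky`).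
-/

set_option linter.unusedSectionVars false

open Bundle MeasureTheory
open scoped Manifold ContDiff Topology

noncomputable section

namespace Teukolsky

section

variable {M : Type*} [TopologicalSpace M] [ChartedSpace E4 M] [IsManifold (𝓡 4) ∞ M]

/-! ### Smooth functions and vector fields at a point -/

/-- Smoothness at a point of a function with values in a normed space. -/
abbrev SmF {F : Type*} [NormedAddCommGroup F] [NormedSpace ℝ F] (f : M → F) (x : M) : Prop :=
  ContMDiffAt (𝓡 4) 𝓘(ℝ, F) ∞ f x

/-- Differentiability at a point of a function with values in a normed space. -/
abbrev DiF {F : Type*} [NormedAddCommGroup F] [NormedSpace ℝ F] (f : M → F) (x : M) : Prop :=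
  MDifferentiableAt (𝓡 4) 𝓘(ℝ, F) f x

/-- Smoothness at a point of a real vector field. -/
def VField.SmAt (X : VField M) (x : M) : Prop :=
  ContMDiffAt (𝓡 4) (𝓡 4).tangent ∞ (fun x ↦ (⟨x, X x⟩ : TangentBundle (𝓡 4) M)) x

/-- Together with the next two instances: the manifold has the classes `∞ + 1` and
`minSmoothness ℝ k` for which Mathlib states the properties of the Lie bracket. -/
instance isManifold_coe_top_add_one :
    IsManifold (𝓡 4) (((⊤ : ℕ∞) : WithTop ℕ∞) + 1) M :=
  inferInstanceAs (IsManifold (𝓡 4) ∞ M)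

instance isManifold_minSmoothness_two : IsManifold (𝓡 4) (minSmoothness ℝ 2) M := by
  rw [minSmoothness_of_isRCLikeNormedField]
  infer_instance

instance isManifold_minSmoothness_three : IsManifold (𝓡 4) (minSmoothness ℝ 3) M := by
  rw [minSmoothness_of_isRCLikeNormedField]
  exact IsManifold.of_le (n := ∞) (WithTop.coe_le_coe.2 le_top)

section Smooth

variable {F : Type*} [NormedAddCommGroup F] [NormedSpace ℝ F]
variable {X Y Z : VField M} {x : M}

lemma SmF.diF {f : M → F} (h : SmF f x) : DiF f x :=
  ContMDiffAt.mdifferentiableAt h (by simp)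

lemma VField.SmAt.diffAt (h : X.SmAt x) : X.DiffAt x :=
  ContMDiffAt.mdifferentiableAt h (by simp)

/-- A function that is smooth at a point is differentiable nearby. Smoothness at a point in the
sense of Mathlib gives each finite order of differentiability on a neighbourhood that depends on
the order, so that smoothness nearby cannot be concluded. -/
lemma SmF.eventually_diF {f : M → F} (h : SmF f x) : ∀ᶠ y in 𝓝 x, DiF f y := by
  have h1 : ContMDiffAt (𝓡 4) 𝓘(ℝ, F) 1 f x := h.of_le (by exact_mod_cast le_top)
  filter_upwards [(contMDiffAt_iff_contMDiffAt_nhds (by simp)).1 h1] with y hy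
  exact hy.mdifferentiableAt (by simp)

lemma VField.SmAt.eventually_diffAt (h : X.SmAt x) : ∀ᶠ y in 𝓝 x, X.DiffAt y := by
  have h1 : ContMDiffAt (𝓡 4) (𝓡 4).tangent 1
    (fun x ↦ (⟨x, X x⟩ : TangentBundle (𝓡 4) M)) x := ContMDiffAt.of_le h (by exact_mod_cast le_top)
  filter_upwards [(contMDiffAt_iff_contMDiffAt_nhds (by simp)).1 h1] with y hy
  exact hy.mdifferentiableAt (by simp)

lemma VField.SmAt.congr (h : X.SmAt x) (e : Y =ᶠ[𝓝 x] X) : Y.SmAt x := by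
  refine ContMDiffAt.congr_of_eventuallyEq h ?_
  filter_upwards [e] with y hy
  rw [hy]

lemma VField.SmAt.add (hX : X.SmAt x) (hY : Y.SmAt x) : VField.SmAt (X + Y) x :=
  ContMDiffAt.add_section hX hY

lemma VField.SmAt.sub (hX : X.SmAt x) (hY : Y.SmAt x) : VField.SmAt (X - Y) x :=
  ContMDiffAt.sub_section hX hY

lemma VField.SmAt.neg (hX : X.SmAt x) : VField.SmAt (-X) x :=
  ContMDiffAt.neg_section hX

lemma VField.SmAt.smul {f : M → ℝ} (hf : SmF f x) (hX : X.SmAt x) : VField.SmAt (f • X) x :=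
  ContMDiffAt.smul_section hf hX

lemma VField.SmAt.const_smul (c : ℝ) (hX : X.SmAt x) : VField.SmAt (c • X) x :=
  ContMDiffAt.const_smul_section hX

lemma VField.DiffAt.add (hX : X.DiffAt x) (hY : Y.DiffAt x) : VField.DiffAt (X + Y) x :=
  mdifferentiableAt_add_section hX hY

lemma VField.DiffAt.smul {f : M → ℝ} (hf : DiF f x) (hX : X.DiffAt x) : VField.DiffAt (f • X) x :=
  MDifferentiableAt.smul_section hf hX

lemma smAt_extend (v : TangentSpace (𝓡 4) x) :
    VField.SmAt (FiberBundle.extend E4 v) x :=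
  FiberBundle.contMDiffAt_extend (I := 𝓡 4) (F := E4) (V := TangentSpace (𝓡 4)) v

lemma smAt_zero : VField.SmAt (0 : VField M) x := by
  have := (smAt_extend (0 : TangentSpace (𝓡 4) x)).const_smul 0
  simpa using this

lemma VField.SmAt.bracket (hX : X.SmAt x) (hY : Y.SmAt x) :
    VField.SmAt (VectorField.mlieBracket (𝓡 4) X Y) x :=
  ContMDiffAt.mlieBracket_vectorField (n := ⊤) (m := ⊤) hX hY (by simp)

lemma smF_mvfderiv {f : M → F} (hf : SmF f x) (hX : X.SmAt x) :
    SmF (fun y ↦ mvfderiv (𝓡 4) f y (X y)) x := by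
  have h1 := ContMDiffAt.mfderiv_const (m := ∞) hf (by simp)
  have h2 := ContMDiffAt.clm_apply_of_inCoordinates (IB₁ := 𝓡 4) (IB₂ := 𝓘(ℝ, F)) (b₁ := id)
    (b₂ := f) (ϕ := fun y ↦ mfderiv (𝓡 4) 𝓘(ℝ, F) f y) (v := X) h1 hX hf
  exact ((contMDiff_snd_tangentBundle_modelSpace F 𝓘(ℝ, F)).contMDiffAt).comp x h2

lemma SmF.vderiv {f : M → ℝ} (hf : SmF f x) (hX : X.SmAt x) : SmF (vderiv X f) x :=
  smF_mvfderiv hf hX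

lemma vderiv_add {f g : M → ℝ} (hf : DiF f x) (hg : DiF g x) :
    vderiv X (f + g) x = vderiv X f x + vderiv X g x := by
  simp [Teukolsky.vderiv, mvfderiv_add hf hg]

lemma vderiv_mul {f g : M → ℝ} (hf : DiF f x) (hg : DiF g x) :
    vderiv X (f * g) x = f x * vderiv X g x + g x * vderiv X f x := by
  simp [Teukolsky.vderiv, mvfderiv_mul hf hg]

lemma mvfderiv_congr {f g : M → F} (h : f =ᶠ[𝓝 x] g) :
    mvfderiv (𝓡 4) f x = mvfderiv (𝓡 4) g x := by
  unfold mvfderiv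
  rw [h.mfderiv_eq]
  have : f x = g x := h.eq_of_nhds
  congr 2

lemma vderiv_congr {f g : M → ℝ} (h : f =ᶠ[𝓝 x] g) :
    Teukolsky.vderiv X f x = Teukolsky.vderiv X g x := by
  simp [Teukolsky.vderiv, mvfderiv_congr h]

lemma VField.SmAt.contMDiffAt_two (h : X.SmAt x) : ContMDiffAt (𝓡 4) (𝓡 4).tangent
    (minSmoothness ℝ 2) (fun x ↦ (⟨x, X x⟩ : TangentBundle (𝓡 4) M)) x := by
  refine ContMDiffAt.of_le h ?_
  rw [minSmoothness_of_isRCLikeNormedField]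
  exact WithTop.coe_le_coe.2 le_top

lemma bracket_jacobi (hX : X.SmAt x) (hY : Y.SmAt x) (hZ : Z.SmAt x) :
    VectorField.mlieBracket (𝓡 4) X (VectorField.mlieBracket (𝓡 4) Y Z) x
      = VectorField.mlieBracket (𝓡 4) (VectorField.mlieBracket (𝓡 4) X Y) Z x
        + VectorField.mlieBracket (𝓡 4) Y (VectorField.mlieBracket (𝓡 4) X Z) x :=
  VectorField.leibniz_identity_mlieBracket_apply hX.contMDiffAt_two hY.contMDiffAt_two
    hZ.contMDiffAt_two

lemma bracket_smul_right {f : M → ℝ} (hf : DiF f x) (hY : Y.DiffAt x) :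
    VectorField.mlieBracket (𝓡 4) X (f • Y) x
      = Teukolsky.vderiv X f x • Y x + f x • VectorField.mlieBracket (𝓡 4) X Y x :=
  VectorField.mlieBracket_smul_right hf hY

lemma bracket_smul_left {f : M → ℝ} (hf : DiF f x) (hX : X.DiffAt x) :
    VectorField.mlieBracket (𝓡 4) (f • X) Y x
      = -(Teukolsky.vderiv Y f x • X x) + f x • VectorField.mlieBracket (𝓡 4) X Y x := by
  rw [VectorField.mlieBracket_smul_left hf hX, neg_smul]; rfl

lemma bracket_add_right (hY : Y.DiffAt x) (hZ : Z.DiffAt x) :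
    VectorField.mlieBracket (𝓡 4) X (Y + Z) x
      = VectorField.mlieBracket (𝓡 4) X Y x + VectorField.mlieBracket (𝓡 4) X Z x :=
  VectorField.mlieBracket_add_right hY hZ

lemma bracket_add_left (hX : X.DiffAt x) (hY : Y.DiffAt x) :
    VectorField.mlieBracket (𝓡 4) (X + Y) Z x
      = VectorField.mlieBracket (𝓡 4) X Z x + VectorField.mlieBracket (𝓡 4) Y Z x :=
  VectorField.mlieBracket_add_left hX hY

/-- The commutator of directional derivatives is the derivative along the Lie bracket. It is read
off from the Jacobi identity for `X`, `Y` and `f Z`. -/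
lemma vderiv_bracket {f : M → ℝ} (hf : SmF f x) (hX : X.SmAt x) (hY : Y.SmAt x) :
    Teukolsky.vderiv (VectorField.mlieBracket (𝓡 4) X Y) f x
      = Teukolsky.vderiv X (Teukolsky.vderiv Y f) x
        - Teukolsky.vderiv Y (Teukolsky.vderiv X f) x := by
  obtain ⟨v, hv⟩ : ∃ v : E4, v ≠ 0 := exists_ne 0
  let Z : VField M := FiberBundle.extend E4 (show TangentSpace (𝓡 4) x from v)
  have hZ : Z.SmAt x := smAt_extend _
  have hZx : Z x = v := FiberBundle.extend_apply_self E4 (show TangentSpace (𝓡 4) x from v)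
  have expand : ∀ {A B : VField M}, A.SmAt x → B.SmAt x →
      VectorField.mlieBracket (𝓡 4) A (VectorField.mlieBracket (𝓡 4) B (f • Z)) x
      = Teukolsky.vderiv A (Teukolsky.vderiv B f) x • Z x
        + Teukolsky.vderiv B f x • VectorField.mlieBracket (𝓡 4) A Z x
        + (Teukolsky.vderiv A f x • VectorField.mlieBracket (𝓡 4) B Z x
        + f x • VectorField.mlieBracket (𝓡 4) A (VectorField.mlieBracket (𝓡 4) B Z) x) := by
    intro A B hA hB
    have e : VectorField.mlieBracket (𝓡 4) B (f • Z) =ᶠ[𝓝 x]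
        Teukolsky.vderiv B f • Z + f • VectorField.mlieBracket (𝓡 4) B Z := by
      filter_upwards [hf.eventually_diF, hZ.eventually_diffAt] with y h1 h2
      exact bracket_smul_right h1 h2
    refine ((Filter.EventuallyEq.refl _ A).mlieBracket_vectorField_eq e).trans ?_
    rw [bracket_add_right ((hf.vderiv hB).diF |>.smul_section hZ.diffAt)
        (hf.diF.smul_section (hB.bracket hZ).diffAt),
      bracket_smul_right (hf.vderiv hB).diF hZ.diffAt,
      bracket_smul_right hf.diF (hB.bracket hZ).diffAt]
  have J := bracket_jacobi hX hY (hZ.smul hf)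
  rw [expand hX hY, expand hY hX, bracket_smul_right hf.diF hZ.diffAt,
    bracket_jacobi hX hY hZ] at J
  have J' : (Teukolsky.vderiv (VectorField.mlieBracket (𝓡 4) X Y) f x
      - (Teukolsky.vderiv X (Teukolsky.vderiv Y f) x
        - Teukolsky.vderiv Y (Teukolsky.vderiv X f) x)) • Z x = 0 := by
    rw [sub_smul, sub_smul]
    rw [smul_add] at J
    linear_combination (norm := module) (-1 : ℝ) • J
  have := (smul_eq_zero.1 J').resolve_right (by rw [hZx]; exact hv)
  linarith

end Smooth

/-! ### The Levi-Civita connection -/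

namespace LorentzMetric

variable (g : LorentzMetric M) {X Y Z X' Y' Z' : VField M} {x : M}

lemma smF_val (hX : X.SmAt x) (hY : Y.SmAt x) : SmF (fun y ↦ g.val y (X y) (Y y)) x := by
  have := ContMDiffAt.clm_bundle_apply₂ (F₁ := E4) (F₂ := E4) (F₃ := ℝ)
    (E₃ := fun _ : M ↦ ℝ) (b := fun y : M ↦ y) (g.contMDiff.contMDiffAt (x := x)) hX hY
  exact (Bundle.contMDiffAt_totalSpace.1 this).2

lemma diF_val (hX : X.DiffAt x) (hY : Y.DiffAt x) : DiF (fun y ↦ g.val y (X y) (Y y)) x := by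
  have := MDifferentiableAt.clm_bundle_apply₂ (F₁ := E4) (F₂ := E4) (F₃ := ℝ)
    (E₃ := fun _ : M ↦ ℝ) (b := fun y : M ↦ y)
    ((g.contMDiff.contMDiffAt (x := x)).mdifferentiableAt (by simp)) hX hY
  exact ((mdifferentiableAt_totalSpace _ _).1 this).2

lemma val_sum_smul {e : Fin 4 → TangentSpace (𝓡 4) x}
    (he : ∀ i j, g.val x (e i) (e j) = if i = j then eta i else 0) (c : Fin 4 → ℝ) (j : Fin 4) :
    g.val x (∑ i, c i • e i) (e j) = c j * eta j := by
  simp [map_sum, he, Finset.sum_ite_eq']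

/-- Four vectors that are orthonormal in the sense of the signature form a basis. -/
lemma exists_basis_of_orthonormal {e : Fin 4 → TangentSpace (𝓡 4) x}
    (he : ∀ i j, g.val x (e i) (e j) = if i = j then eta i else 0) :
    ∃ b : Module.Basis (Fin 4) ℝ (TangentSpace (𝓡 4) x), ⇑b = e := by
  have hη : ∀ i, eta i * eta i = 1 := by intro i; unfold eta; split_ifs <;> norm_num
  have hli : LinearIndependent ℝ e := by
    rw [Fintype.linearIndependent_iff]
    intro c hc i
    have := g.val_sum_smul he c i
    rw [hc] at this
    simp only [map_zero, zero_apply] at this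
    have h2 : c i = c i * eta i * eta i := by rw [mul_assoc, hη, mul_one]
    rw [h2, ← this, zero_mul]
  have hfin : Module.finrank ℝ (TangentSpace (𝓡 4) x) = 4 :=
    (finrank_euclideanSpace_fin : Module.finrank ℝ E4 = 4)
  exact ⟨basisOfLinearIndependentOfCardEqFinrank hli (by simp [hfin]), by simp⟩

/-- The components in an orthonormal frame are given by inner products. -/
lemma expand_of_orthonormal {e : Fin 4 → TangentSpace (𝓡 4) x}
    (he : ∀ i j, g.val x (e i) (e j) = if i = j then eta i else 0) (u : TangentSpace (𝓡 4) x) :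
    u = ∑ i, (eta i * g.val x u (e i)) • e i := by
  have hη : ∀ i, eta i * eta i = 1 := by intro i; unfold eta; split_ifs <;> norm_num
  obtain ⟨b, hb⟩ := g.exists_basis_of_orthonormal he
  have hu := b.sum_repr u
  simp only [hb] at hu
  have hc : ∀ i, b.repr u i = eta i * g.val x u (e i) := by
    intro i
    conv_rhs => rw [← hu]
    rw [g.val_sum_smul he, mul_comm (b.repr u i), ← mul_assoc, hη, one_mul]
  conv_lhs => rw [← hu]
  simp only [hc]

lemma eq_of_val_eq {u v : TangentSpace (𝓡 4) x} (h : ∀ w, g.val x u w = g.val x v w) : u = v := by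
  obtain ⟨e, he⟩ := g.signature x
  rw [g.expand_of_orthonormal he u, g.expand_of_orthonormal he v]
  simp only [h]

/-- Every linear form is the inner product with some vector. -/
lemma exists_val_eq (φ : TangentSpace (𝓡 4) x →L[ℝ] ℝ) : ∃ u, ∀ w, g.val x u w = φ w := by
  obtain ⟨e, he⟩ := g.signature x
  refine ⟨∑ i, (eta i * φ (e i)) • e i, fun w ↦ ?_⟩
  conv_rhs => rw [g.expand_of_orthonormal he w]
  simp only [map_sum, map_smul, sum_apply, smul_apply,
    smul_eq_mul]
  refine Finset.sum_congr rfl fun i _ ↦ ?_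
  rw [g.symm x w]; ring

lemma val_smul_fun (f : M → ℝ) (X Y : VField M) :
    (fun y ↦ g.val y ((f • X) y) (Y y)) = f * fun y ↦ g.val y (X y) (Y y) := by
  ext y; simp

lemma val_fun_smul (f : M → ℝ) (X Y : VField M) :
    (fun y ↦ g.val y (X y) ((f • Y) y)) = f * fun y ↦ g.val y (X y) (Y y) := by
  ext y; simp

lemma val_add_fun (X Y Z : VField M) :
    (fun y ↦ g.val y ((X + Y) y) (Z y))
      = (fun y ↦ g.val y (X y) (Z y)) + fun y ↦ g.val y (Y y) (Z y) := by
  ext y; simp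

lemma val_fun_add (X Y Z : VField M) :
    (fun y ↦ g.val y (Z y) ((X + Y) y))
      = (fun y ↦ g.val y (Z y) (X y)) + fun y ↦ g.val y (Z y) (Y y) := by
  ext y; simp

/-- The Koszul expression is tensorial in its last argument, so that it is represented by a
vector. -/
lemma tensorialAt_koszul (hX : X.DiffAt x) (hY : Y.DiffAt x) :
    TensorialAt (𝓡 4) E4 (fun Z ↦ g.koszul X Y Z x) x where
  smul {f Z} hf hZ := by
    have h1 := vderiv_mul (X := X) hf (g.diF_val hY hZ)
    have h2 := vderiv_mul (X := Y) hf (g.diF_val hX hZ)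
    simp only [koszul, val_fun_smul]
    rw [h1, h2]
    simp only [bracket_smul_right hf hZ, map_add, map_smul,
      add_apply, smul_apply, smul_eq_mul, Pi.smul_apply']
    have h3 : ∀ h : M → ℝ, vderiv (f • Z) h x = f x * vderiv Z h x := by
      intro h; simp [vderiv]
    rw [h3, g.symm x (Z x) (Y x), g.symm x (Z x) (X x)]
    ring
  add {Z W} hZ hW := by
    have h1 := vderiv_add (X := X) (g.diF_val hY hZ) (g.diF_val hY hW)
    have h2 := vderiv_add (X := Y) (g.diF_val hX hZ) (g.diF_val hX hW)
    simp only [koszul, val_fun_add]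
    rw [h1, h2]
    simp only [bracket_add_right hZ hW, map_add,
      add_apply, Pi.add_apply]
    have h3 : ∀ h : M → ℝ, vderiv (Z + W) h x = vderiv Z h x + vderiv W h x := by
      intro h; simp [vderiv]
    rw [h3]
    ring

/-- The Koszul formula holds for the Levi-Civita derivative of differentiable vector fields. -/
lemma nabla_spec (hX : X.DiffAt x) (hY : Y.DiffAt x) (hZ : Z.DiffAt x) :
    2 * g.val x (g.nabla X Y x) (Z x) = g.koszul X Y Z x := by
  have hT := g.tensorialAt_koszul hX hY
  obtain ⟨u, hu⟩ := g.exists_val_eq ((1 / 2 : ℝ) • TensorialAt.mkHom _ x hT)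
  have h : ∃ u : TangentSpace (𝓡 4) x,
      ∀ Z : VField M, Z.DiffAt x → 2 * g.val x u (Z x) = g.koszul X Y Z x := by
    refine ⟨u, fun Z hZ ↦ ?_⟩
    rw [hu, smul_apply, TensorialAt.mkHom_apply hT hZ, smul_eq_mul]
    ring
  exact Classical.epsilon_spec h Z hZ

lemma eq_of_val_field_eq {u v : TangentSpace (𝓡 4) x}
    (h : ∀ Z : VField M, Z.SmAt x → g.val x u (Z x) = g.val x v (Z x)) : u = v := by
  refine g.eq_of_val_eq fun w ↦ ?_
  have := h _ (smAt_extend w)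
  rwa [FiberBundle.extend_apply_self] at this

lemma nabla_congr (eX : X =ᶠ[𝓝 x] X') (eY : Y =ᶠ[𝓝 x] Y') :
    g.nabla X Y x = g.nabla X' Y' x := by
  have : ∀ Z : VField M, g.koszul X Y Z x = g.koszul X' Y' Z x := by
    intro Z
    have e1 : (fun y ↦ g.val y (Y y) (Z y)) =ᶠ[𝓝 x] fun y ↦ g.val y (Y' y) (Z y) := by
      filter_upwards [eY] with y hy; rw [hy]
    have e2 : (fun y ↦ g.val y (X y) (Z y)) =ᶠ[𝓝 x] fun y ↦ g.val y (X' y) (Z y) := by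
      filter_upwards [eX] with y hy; rw [hy]
    have e3 : (fun y ↦ g.val y (X y) (Y y)) =ᶠ[𝓝 x] fun y ↦ g.val y (X' y) (Y' y) := by
      filter_upwards [eX, eY] with y hy hy'; rw [hy, hy']
    have h1 : ∀ h, vderiv X h x = vderiv X' h x := by intro h; simp [vderiv, eX.eq_of_nhds]
    have h2 : ∀ h, vderiv Y h x = vderiv Y' h x := by intro h; simp [vderiv, eY.eq_of_nhds]
    simp only [koszul, vderiv_congr e1, vderiv_congr e2, vderiv_congr e3, h1, h2,
      eX.mlieBracket_vectorField_eq eY,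
      eX.mlieBracket_vectorField_eq (Filter.EventuallyEq.refl _ Z),
      eY.mlieBracket_vectorField_eq (Filter.EventuallyEq.refl _ Z), eX.eq_of_nhds, eY.eq_of_nhds]
  simp only [nabla, this]

/-- The connection is compatible with the metric. -/
lemma nabla_metric (hX : X.DiffAt x) (hY : Y.DiffAt x) (hZ : Z.DiffAt x) :
    vderiv X (fun y ↦ g.val y (Y y) (Z y)) x
      = g.val x (g.nabla X Y x) (Z x) + g.val x (Y x) (g.nabla X Z x) := by
  have h1 := g.nabla_spec hX hY hZ
  have h2 := g.nabla_spec hX hZ hY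
  rw [g.symm x (Y x)]
  have e : (fun y ↦ g.val y (Z y) (Y y)) = fun y ↦ g.val y (Y y) (Z y) := by
    ext y; exact g.symm y _ _
  simp only [koszul] at h1 h2
  rw [e, VectorField.mlieBracket_swap_apply (V := Z) (W := Y)] at h2
  simp only [map_neg, neg_apply] at h2
  linarith

/-- The connection is free of torsion. -/
lemma nabla_torsion (hX : X.DiffAt x) (hY : Y.DiffAt x) :
    g.nabla X Y x - g.nabla Y X x = VectorField.mlieBracket (𝓡 4) X Y x := by
  refine g.eq_of_val_field_eq fun Z hZ ↦ ?_
  have h1 := g.nabla_spec hX hY hZ.diffAt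
  have h2 := g.nabla_spec hY hX hZ.diffAt
  have e : (fun y ↦ g.val y (Y y) (X y)) = fun y ↦ g.val y (X y) (Y y) := by
    ext y; exact g.symm y _ _
  simp only [koszul] at h1 h2
  rw [e, VectorField.mlieBracket_swap_apply (V := Y) (W := X)] at h2
  simp only [map_neg, neg_apply] at h2
  simp only [map_sub, sub_apply]
  linarith

lemma nabla_add_right (hX : X.DiffAt x) (hY : Y.DiffAt x) (hZ : Z.DiffAt x) :
    g.nabla X (Y + Z) x = g.nabla X Y x + g.nabla X Z x := by
  refine g.eq_of_val_field_eq fun W hW ↦ ?_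
  have h1 := g.nabla_metric hX (hY.add hZ) hW.diffAt
  have h2 := g.nabla_metric hX hY hW.diffAt
  have h3 := g.nabla_metric hX hZ hW.diffAt
  rw [val_add_fun, vderiv_add (g.diF_val hY hW.diffAt) (g.diF_val hZ hW.diffAt)] at h1
  simp only [map_add, add_apply, Pi.add_apply] at h1 ⊢
  linarith

lemma nabla_smul_right {f : M → ℝ} (hf : DiF f x) (hX : X.DiffAt x) (hY : Y.DiffAt x) :
    g.nabla X (f • Y) x = vderiv X f x • Y x + f x • g.nabla X Y x := by
  refine g.eq_of_val_field_eq fun W hW ↦ ?_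
  have h1 := g.nabla_metric hX (hY.smul hf) hW.diffAt
  have h2 := g.nabla_metric hX hY hW.diffAt
  rw [val_smul_fun, vderiv_mul hf (g.diF_val hY hW.diffAt)] at h1
  simp only [map_add, add_apply, Pi.smul_apply', map_smul,
    smul_apply, smul_eq_mul] at h1 ⊢
  linear_combination -h1 + f x * h2

lemma tensorialAt_nabla (hY : Y.DiffAt x) :
    TensorialAt (𝓡 4) E4 (fun X ↦ g.nabla X Y x) x where
  smul {f X} hf hX := by
    have h1 := g.nabla_torsion (VField.DiffAt.smul hf hX) hY
    have h2 := g.nabla_torsion hX hY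
    rw [bracket_smul_left hf hX, g.nabla_smul_right hf hY hX, ← h2] at h1
    rw [sub_eq_iff_eq_add] at h1
    rw [h1, smul_sub]; abel
  add {X X'} hX hX' := by
    have h1 := g.nabla_torsion (VField.DiffAt.add hX hX') hY
    rw [bracket_add_left hX hX', g.nabla_add_right hY hX hX', ← g.nabla_torsion hX hY,
      ← g.nabla_torsion hX' hY] at h1
    rw [sub_eq_iff_eq_add] at h1
    rw [h1]; abel

lemma nabla_add_left (hX : X.DiffAt x) (hX' : X'.DiffAt x) (hY : Y.DiffAt x) :
    g.nabla (X + X') Y x = g.nabla X Y x + g.nabla X' Y x :=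
  (g.tensorialAt_nabla hY).add hX hX'

lemma nabla_smul_left {f : M → ℝ} (hf : DiF f x) (hX : X.DiffAt x) (hY : Y.DiffAt x) :
    g.nabla (f • X) Y x = f x • g.nabla X Y x :=
  (g.tensorialAt_nabla hY).smul hf hX

end LorentzMetric

/-! ### Linear algebra of the Lorentzian tangent spaces -/

namespace LorentzMetric

variable (g : LorentzMetric M) {x : M}

/-- The orthogonal complement of a timelike vector is negative definite. -/
lemma neg_of_orthogonal_timelike {t u : TangentSpace (𝓡 4) x} (ht : 0 < g.val x t t)
    (htu : g.val x t u = 0) (hu : u ≠ 0) : g.val x u u < 0 := by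
  obtain ⟨e, he⟩ := g.signature x
  have hval : ∀ v w, g.val x v w = ∑ i, eta i * g.val x v (e i) * g.val x w (e i) := by
    intro v w
    conv_lhs => rw [g.expand_of_orthonormal he v]
    simp only [map_sum, map_smul, sum_apply, smul_apply, smul_eq_mul]
    exact Finset.sum_congr rfl fun i _ ↦ by rw [g.symm x (e i) w]
  rw [hval] at ht htu ⊢
  simp only [Fin.sum_univ_four, eta, Fin.isValue, ↓reduceIte, one_ne_zero, Fin.reduceEq] at *
  have hu' : ¬ (g.val x u (e 0) = 0 ∧ g.val x u (e 1) = 0 ∧ g.val x u (e 2) = 0 ∧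
      g.val x u (e 3) = 0) := by
    rintro ⟨h0, h1, h2, h3⟩
    apply hu
    rw [g.expand_of_orthonormal he u]
    simp [Fin.sum_univ_four, h0, h1, h2, h3]
  generalize g.val x t (e 0) = t0 at *
  generalize g.val x t (e 1) = t1 at *
  generalize g.val x t (e 2) = t2 at *
  generalize g.val x t (e 3) = t3 at *
  generalize g.val x u (e 0) = u0 at *
  generalize g.val x u (e 1) = u1 at *
  generalize g.val x u (e 2) = u2 at *
  generalize g.val x u (e 3) = u3 at *
  have ht0 : t0 ≠ 0 := by
    rintro rfl; nlinarith [sq_nonneg t1, sq_nonneg t2, sq_nonneg t3]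
  have h1 : u0 * t0 = u1 * t1 + u2 * t2 + u3 * t3 := by linarith
  have hS : 0 < u1 ^ 2 + u2 ^ 2 + u3 ^ 2 := by
    by_contra hS
    have hz : u1 = 0 ∧ u2 = 0 ∧ u3 = 0 := by
      refine ⟨?_, ?_, ?_⟩ <;>
        nlinarith [sq_nonneg u1, sq_nonneg u2, sq_nonneg u3]
    obtain ⟨h1', h2', h3'⟩ := hz
    subst h1' h2' h3'
    have : u0 = 0 := by
      have : u0 * t0 = 0 := by linarith
      exact (mul_eq_zero.1 this).resolve_right ht0
    exact hu' ⟨this, rfl, rfl, rfl⟩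
  -- the Cauchy-Schwarz inequality for the spatial components
  have hcs : (u1 * t1 + u2 * t2 + u3 * t3) ^ 2
      ≤ (u1 ^ 2 + u2 ^ 2 + u3 ^ 2) * (t1 ^ 2 + t2 ^ 2 + t3 ^ 2) := by
    nlinarith [sq_nonneg (u1 * t2 - u2 * t1), sq_nonneg (u1 * t3 - u3 * t1),
      sq_nonneg (u2 * t3 - u3 * t2)]
  have ht2 : 0 < t0 ^ 2 := by positivity
  have h3 : u0 ^ 2 * t0 ^ 2 < (u1 ^ 2 + u2 ^ 2 + u3 ^ 2) * t0 ^ 2 := by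
    calc u0 ^ 2 * t0 ^ 2 = (u1 * t1 + u2 * t2 + u3 * t3) ^ 2 := by rw [← h1]; ring
      _ ≤ _ := hcs
      _ < _ := by apply mul_lt_mul_of_pos_left _ hS; linarith
  have := lt_of_mul_lt_mul_right h3 ht2.le
  linarith

end LorentzMetric

section Tetrad

variable {𝔐 : Background M} {x : M}

/-- Independent future directed null vectors have positive inner product. -/
lemma Background.val_pos_of_null {l n : TangentSpace (𝓡 4) x} (hl : 𝔐.g.val x l l = 0)
    (hn : 𝔐.g.val x n n = 0) (fl : 0 < 𝔐.time x l) (fn : 0 < 𝔐.time x n)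
    (hli : LinearIndependent ℝ ![l, n]) : 0 < 𝔐.g.val x l n := by
  obtain ⟨t, ht, htime⟩ := 𝔐.time_timelike x
  -- for the time form `τ`, the vector `τ(n) l - τ(l) n` is orthogonal to a timelike vector, so
  -- that it is spacelike
  have hne : 𝔐.time x n • l + (-𝔐.time x l) • n ≠ 0 := by
    intro h
    have := LinearIndependent.pair_iff.1 hli _ _ h
    exact fn.ne' this.1
  have h := 𝔐.g.neg_of_orthogonal_timelike ht (u := 𝔐.time x n • l + (-𝔐.time x l) • n)
    (by simp only [map_add, map_smul, ← htime, smul_eq_mul]; ring) hne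
  simp only [map_add, map_smul, add_apply, smul_apply, smul_eq_mul, hl, hn, 𝔐.g.symm x n l] at h
  nlinarith [mul_pos fl fn]

lemma Background.val_Vplus_Vminus_pos (𝔐 : Background M) (x : M) :
    0 < 𝔐.g.val x (𝔐.Vplus x) (𝔐.Vminus x) :=
  Background.val_pos_of_null (𝔐.Vplus_principal x).2.1 (𝔐.Vminus_principal x).2.1
    (𝔐.Vplus_future x) (𝔐.Vminus_future x) (𝔐.V_independent x)

lemma LorentzMetric.cval_eq (g : LorentzMetric M) (u v : CTangent x) :
    g.cval x u v = ((g.val x u.1 v.1 - g.val x u.2 v.2 : ℝ) : ℂ)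
      + Complex.I * ((g.val x u.1 v.2 + g.val x u.2 v.1 : ℝ) : ℂ) := by
  simp only [cval, Fin.sum_univ_two, part]
  simp
  ring

lemma LorentzMetric.cval_re (g : LorentzMetric M) (u v : CTangent x) :
    (g.cval x u v).re = g.val x u.1 v.1 - g.val x u.2 v.2 := by simp [cval_eq]

lemma LorentzMetric.cval_im (g : LorentzMetric M) (u v : CTangent x) :
    (g.cval x u v).im = g.val x u.1 v.2 + g.val x u.2 v.1 := by simp [cval_eq]

namespace NullTetrad

variable (a : NullTetrad 𝔐 x)

lemma val_m1_m1 : 𝔐.g.val x a.m.1 a.m.1 = -1 / 2 := by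
  have h1 := congrArg Complex.re a.m_conj_m
  have h2 := congrArg Complex.re a.m_m
  rw [LorentzMetric.cval_re] at h1 h2
  simp [conjT] at h1 h2
  linarith

lemma val_m2_m2 : 𝔐.g.val x a.m.2 a.m.2 = -1 / 2 := by
  have h1 := congrArg Complex.re a.m_conj_m
  have h2 := congrArg Complex.re a.m_m
  rw [LorentzMetric.cval_re] at h1 h2
  simp [conjT] at h1 h2
  linarith

lemma val_m1_m2 : 𝔐.g.val x a.m.1 a.m.2 = 0 := by
  have h2 := congrArg Complex.im a.m_m
  rw [LorentzMetric.cval_im, 𝔐.g.symm x a.m.2] at h2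
  simp at h2
  linarith

lemma val_l_m1 : 𝔐.g.val x a.l a.m.1 = 0 := by
  simpa [LorentzMetric.cval_re, ofReal] using congrArg Complex.re a.l_m

lemma val_l_m2 : 𝔐.g.val x a.l a.m.2 = 0 := by
  simpa [LorentzMetric.cval_im, ofReal] using congrArg Complex.im a.l_m

lemma val_n_m1 : 𝔐.g.val x a.n a.m.1 = 0 := by
  simpa [LorentzMetric.cval_re, ofReal] using congrArg Complex.re a.n_m

lemma val_n_m2 : 𝔐.g.val x a.n a.m.2 = 0 := by
  simpa [LorentzMetric.cval_im, ofReal] using congrArg Complex.im a.n_m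

end NullTetrad

/-- The frame associated with a null tetrad is orthonormal. -/
lemma orthonormal_of_null (g : LorentzMetric M) {l n m1 m2 : TangentSpace (𝓡 4) x}
    (ll : g.val x l l = 0) (nn : g.val x n n = 0) (ln : g.val x l n = 1)
    (l1 : g.val x l m1 = 0) (l2 : g.val x l m2 = 0) (n1 : g.val x n m1 = 0)
    (n2 : g.val x n m2 = 0) (m11 : g.val x m1 m1 = -1 / 2) (m22 : g.val x m2 m2 = -1 / 2)
    (m12 : g.val x m1 m2 = 0) (i j : Fin 4) :
    g.val x (![(Real.sqrt 2)⁻¹ • (n + l), Real.sqrt 2 • m1, Real.sqrt 2 • m2,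
      (Real.sqrt 2)⁻¹ • (l - n)] i) (![(Real.sqrt 2)⁻¹ • (n + l), Real.sqrt 2 • m1,
      Real.sqrt 2 • m2, (Real.sqrt 2)⁻¹ • (l - n)] j) = if i = j then eta i else 0 := by
  have h2 : Real.sqrt 2 * Real.sqrt 2 = 2 := Real.mul_self_sqrt (by norm_num)
  have h3 : (Real.sqrt 2)⁻¹ * (Real.sqrt 2)⁻¹ = 1 / 2 := by rw [← mul_inv, h2]; norm_num
  have nl := g.symm x n l
  have e1 := g.symm x m1 l
  have e2 := g.symm x m2 l
  have e3 := g.symm x m1 n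
  have e4 := g.symm x m2 n
  have e5 := g.symm x m2 m1
  fin_cases i <;> fin_cases j <;>
    simp only [Fin.zero_eta, Fin.mk_one, Fin.reduceFinMk, Fin.isValue, Matrix.cons_val_zero,
      Matrix.cons_val_one, Matrix.cons_val, map_smul, map_add, map_sub, smul_apply,
      add_apply, sub_apply, smul_eq_mul, ll, nn, ln, l1, l2, n1, n2, m11, m22, m12, nl, e1, e2, e3,
      e4, e5, eta, Fin.reduceEq, ↓reduceIte, one_ne_zero, zero_ne_one] <;>
    first
    | ring1
    | linear_combination (-1 / 2) * h2
    | linear_combination 2 * h3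
    | linear_combination -2 * h3

/-- The expansion of a vector in the real basis `l, n, Re m, Im m` given by a null tetrad. -/
lemma expand_of_null (g : LorentzMetric M) {l n m1 m2 : TangentSpace (𝓡 4) x}
    (ll : g.val x l l = 0) (nn : g.val x n n = 0) (ln : g.val x l n = 1)
    (l1 : g.val x l m1 = 0) (l2 : g.val x l m2 = 0) (n1 : g.val x n m1 = 0)
    (n2 : g.val x n m2 = 0) (m11 : g.val x m1 m1 = -1 / 2) (m22 : g.val x m2 m2 = -1 / 2)
    (m12 : g.val x m1 m2 = 0) (u : TangentSpace (𝓡 4) x) :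
    u = g.val x u n • l + g.val x u l • n + (-2 * g.val x u m1) • m1
      + (-2 * g.val x u m2) • m2 := by
  have h2 : Real.sqrt 2 * Real.sqrt 2 = 2 := Real.mul_self_sqrt (by norm_num)
  have h3 : (Real.sqrt 2)⁻¹ * (Real.sqrt 2)⁻¹ = 1 / 2 := by rw [← mul_inv, h2]; norm_num
  have h := g.expand_of_orthonormal (orthonormal_of_null g ll nn ln l1 l2 n1 n2 m11 m22 m12) u
  simp only [Fin.sum_univ_four, Fin.isValue, Matrix.cons_val_zero,
      Matrix.cons_val_one, Matrix.cons_val, map_smul, map_add, map_sub, smul_eq_mul, eta,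
      Fin.reduceEq, ↓reduceIte, one_ne_zero] at h
  conv_lhs => rw [h]
  simp only [smul_smul, smul_add, smul_sub]
  have k1 : ∀ c : ℝ, -1 * (Real.sqrt 2 * c) * Real.sqrt 2 = -2 * c := by
    intro c; linear_combination (-c) * h2
  have k2 : ∀ c : ℝ, 1 * ((Real.sqrt 2)⁻¹ * c) * (Real.sqrt 2)⁻¹ = 1 / 2 * c := by
    intro c; linear_combination c * h3
  have k3 : ∀ c : ℝ, -1 * ((Real.sqrt 2)⁻¹ * c) * (Real.sqrt 2)⁻¹ = -1 / 2 * c := by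
    intro c; linear_combination (-c) * h3
  rw [k1, k1, k2, k3]
  module

lemma NullTetrad.expand (a : NullTetrad 𝔐 x) (u : TangentSpace (𝓡 4) x) :
    u = 𝔐.g.val x u a.n • a.l + 𝔐.g.val x u a.l • a.n + (-2 * 𝔐.g.val x u a.m.1) • a.m.1
      + (-2 * 𝔐.g.val x u a.m.2) • a.m.2 :=
  expand_of_null 𝔐.g a.l_l a.n_n a.l_n a.val_l_m1 a.val_l_m2 a.val_n_m1 a.val_n_m2 a.val_m1_m1
    a.val_m2_m2 a.val_m1_m2 u

section Alternating

variable (o : TangentSpace (𝓡 4) x [⋀^Fin 4]→ₗ[ℝ] ℝ) (a b c d p q : TangentSpace (𝓡 4) x) (r t : ℝ)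

lemma alt_lin_zero : o ![r • p + t • q, b, c, d] = r * o ![p, b, c, d] + t * o ![q, b, c, d] := by
  have e : ∀ w, ![w, b, c, d] = Function.update ![p, b, c, d] 0 w := by
    intro w; ext1 i; fin_cases i <;> rfl
  rw [e, o.map_update_add, o.map_update_smul, o.map_update_smul, ← e, ← e]; rfl

lemma alt_lin_one : o ![a, r • p + t • q, c, d] = r * o ![a, p, c, d] + t * o ![a, q, c, d] := by
  have e : ∀ w, ![a, w, c, d] = Function.update ![a, p, c, d] 1 w := by
    intro w; ext1 i; fin_cases i <;> rfl
  rw [e, o.map_update_add, o.map_update_smul, o.map_update_smul, ← e, ← e]; rfl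

lemma alt_lin_two : o ![a, b, r • p + t • q, d] = r * o ![a, b, p, d] + t * o ![a, b, q, d] := by
  have e : ∀ w, ![a, b, w, d] = Function.update ![a, b, p, d] 2 w := by
    intro w; ext1 i; fin_cases i <;> rfl
  rw [e, o.map_update_add, o.map_update_smul, o.map_update_smul, ← e, ← e]; rfl

lemma alt_lin_three : o ![a, b, c, r • p + t • q] = r * o ![a, b, c, p] + t * o ![a, b, c, q] := by
  have e : ∀ w, ![a, b, c, w] = Function.update ![a, b, c, p] 3 w := by
    intro w; ext1 i; fin_cases i <;> rfl
  rw [e, o.map_update_add, o.map_update_smul, o.map_update_smul, ← e, ← e]; rfl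

lemma alt_swap_outer : o ![d, b, c, a] = -o ![a, b, c, d] := by
  rw [← o.map_swap ![a, b, c, d] (show (0 : Fin 4) ≠ 3 by decide)]
  congr 1; ext1 i; fin_cases i <;> rfl

lemma alt_swap_inner : o ![a, c, b, d] = -o ![a, b, c, d] := by
  rw [← o.map_swap ![a, b, c, d] (show (1 : Fin 4) ≠ 2 by decide)]
  congr 1; ext1 i; fin_cases i <;> rfl

lemma alt_outer_self : o ![a, b, c, a] = 0 := by
  have := alt_swap_outer o a b c a
  linarith

lemma alt_inner_self : o ![a, b, b, d] = 0 := by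
  have := alt_swap_inner o a b b d
  linarith

end Alternating

/-- The volume of the oriented frame, in terms of the null vectors themselves. -/
lemma orient_frame (o : TangentSpace (𝓡 4) x [⋀^Fin 4]→ₗ[ℝ] ℝ)
    (l n u v : TangentSpace (𝓡 4) x) :
    o ![(Real.sqrt 2)⁻¹ • (n + l), u, v, (Real.sqrt 2)⁻¹ • (l - n)] = o ![n, u, v, l] := by
  have h2 : Real.sqrt 2 * Real.sqrt 2 = 2 := Real.mul_self_sqrt (by norm_num)
  have h3 : (Real.sqrt 2)⁻¹ * (Real.sqrt 2)⁻¹ = 1 / 2 := by rw [← mul_inv, h2]; norm_num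
  rw [show (Real.sqrt 2)⁻¹ • (n + l) = (Real.sqrt 2)⁻¹ • n + (Real.sqrt 2)⁻¹ • l by module,
    show (Real.sqrt 2)⁻¹ • (l - n) = (Real.sqrt 2)⁻¹ • l + (-(Real.sqrt 2)⁻¹) • n by module,
    alt_lin_zero, alt_lin_three, alt_lin_three, alt_outer_self, alt_outer_self,
    alt_swap_outer o n u v l]
  linear_combination 2 * o ![n, u, v, l] * h3

lemma NullTetrad.orient_pos (a : NullTetrad 𝔐 x) :
    0 < 𝔐.orient x ![a.n, a.m.1, -a.m.2, a.l] := by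
  have := a.oriented
  rwa [orient_frame] at this

/-- A matrix with orthonormal rows and positive determinant is a rotation. -/
lemma rotation_of_orthonormal {α β γ δ : ℝ} (h1 : α ^ 2 + β ^ 2 = 1) (h2 : γ ^ 2 + δ ^ 2 = 1)
    (h3 : α * γ + β * δ = 0) (hdet : 0 < α * δ - β * γ) : δ = α ∧ γ = -β := by
  have h4 : (α * δ - β * γ) ^ 2 = 1 := by
    linear_combination h1 * (γ ^ 2 + δ ^ 2) + h2 - h3 * (α * γ + β * δ)
  have h5 : α * δ - β * γ = 1 := by
    have h : (α * δ - β * γ - 1) * (α * δ - β * γ + 1) = 0 := by linear_combination h4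
    linarith [(mul_eq_zero.1 h).resolve_right (by linarith)]
  have h6 : (α - δ) ^ 2 + (β + γ) ^ 2 = 0 := by linear_combination h1 + h2 - 2 * h5
  have h7 : (α - δ) ^ 2 = 0 := by linarith [sq_nonneg (α - δ), sq_nonneg (β + γ)]
  have h8 : (β + γ) ^ 2 = 0 := by linarith [sq_nonneg (α - δ), sq_nonneg (β + γ)]
  exact ⟨by linarith [pow_eq_zero_iff (two_ne_zero) |>.1 h7],
    by linarith [pow_eq_zero_iff (two_ne_zero) |>.1 h8]⟩

/-- Two null tetrads at the same point differ by the boost `lam` and the rotation `zeta`. -/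
structure RotatesBy (a b : NullTetrad 𝔐 x) (lam : ℝ) (zeta : ℂ) : Prop where
  lam_pos : 0 < lam
  norm_zeta : ‖zeta‖ = 1
  l_eq : b.l = lam • a.l
  n_eq : b.n = lam⁻¹ • a.n
  m_eq : b.m = smulT zeta a.m

/-- The boost parameter of `b` relative to `a`. -/
def boost (a b : NullTetrad 𝔐 x) : ℝ := 𝔐.g.val x b.l a.n

/-- The rotation parameter of `b` relative to `a`. -/
def twist (a b : NullTetrad 𝔐 x) : ℂ := -𝔐.g.cval x b.m (conjT a.m)

/-- The structure group acts transitively on the null tetrads at a point. -/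
lemma rotatesBy_boost_twist (a b : NullTetrad 𝔐 x) :
    RotatesBy a b (boost a b) (twist a b) := by
  obtain ⟨c, hc⟩ := a.l_collinear
  obtain ⟨c', hc'⟩ := b.l_collinear
  obtain ⟨d, hd⟩ := a.n_collinear
  obtain ⟨d', hd'⟩ := b.n_collinear
  have pos : ∀ {c : ℝ} {V k : TangentSpace (𝓡 4) x}, 0 < 𝔐.time x V → 0 < 𝔐.time x k →
      k = c • V → 0 < c := by
    intro c V k hV hk h
    rw [h, map_smul, smul_eq_mul] at hk
    exact (mul_pos_iff_of_pos_right hV).1 hk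
  have c_pos := pos (𝔐.Vplus_future x) a.l_future hc
  have c'_pos := pos (𝔐.Vplus_future x) b.l_future hc'
  have d_pos := pos (𝔐.Vminus_future x) a.n_future hd
  have d'_pos := pos (𝔐.Vminus_future x) b.n_future hd'
  have hl : b.l = (c' / c) • a.l := by
    rw [hc, smul_smul, div_mul_cancel₀ _ c_pos.ne', hc']
  have hn : b.n = (d' / d) • a.n := by
    rw [hd, smul_smul, div_mul_cancel₀ _ d_pos.ne', hd']
  -- `a` and `b` are both adapted to the directions of `V⁺` and `V⁻`, so that `l` and `n` are
  -- rescaled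
  have hboost : boost a b = c' / c := by
    simp [boost, hl, a.l_n]
  have hprod : (c' / c) * (d' / d) = 1 := by
    have := b.l_n
    rw [hl, hn] at this
    simpa [a.l_n, mul_comm] using this
  have hn' : b.n = (boost a b)⁻¹ • a.n := by
    rw [hboost, hn, inv_eq_of_mul_eq_one_right hprod]
  have hlpos : 0 < boost a b := by rw [hboost]; positivity
  have hl' : b.l = boost a b • a.l := by rw [hboost, hl]
  have la : ∀ u, 𝔐.g.val x b.l u = 0 → 𝔐.g.val x u a.l = 0 := by
    intro u hu
    rw [hl', map_smul, smul_apply, smul_eq_mul] at hu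
    rw [𝔐.g.symm]
    exact (mul_eq_zero.1 hu).resolve_left hlpos.ne'
  have na : ∀ u, 𝔐.g.val x b.n u = 0 → 𝔐.g.val x u a.n = 0 := by
    intro u hu
    rw [hn', map_smul, smul_apply, smul_eq_mul] at hu
    rw [𝔐.g.symm]
    exact (mul_eq_zero.1 hu).resolve_left (inv_pos.2 hlpos).ne'
  -- `m` spans the orthogonal complement of `l` and `n`, which the tetrads share
  have e1 := a.expand b.m.1
  have e2 := a.expand b.m.2
  rw [la _ b.val_l_m1, na _ b.val_n_m1, zero_smul, zero_smul, zero_add, zero_add] at e1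
  rw [la _ b.val_l_m2, na _ b.val_n_m2, zero_smul, zero_smul, zero_add, zero_add] at e2
  set α := -2 * 𝔐.g.val x b.m.1 a.m.1 with hα
  set β := -2 * 𝔐.g.val x b.m.1 a.m.2 with hβ
  set γ := -2 * 𝔐.g.val x b.m.2 a.m.1 with hγ
  set δ := -2 * 𝔐.g.val x b.m.2 a.m.2 with hδ
  have m21 := 𝔐.g.symm x a.m.2 a.m.1
  have g11 := b.val_m1_m1
  have g22 := b.val_m2_m2
  have g12 := b.val_m1_m2
  rw [e1] at g11 g12
  rw [e2] at g22 g12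
  simp only [map_add, map_smul, add_apply, smul_apply, smul_eq_mul, a.val_m1_m1, a.val_m2_m2,
    a.val_m1_m2, m21] at g11 g22 g12
  -- the orientation excludes reflections
  have ho := b.orient_pos
  rw [hl', hn', e1, e2, show -(γ • a.m.1 + δ • a.m.2) = (-γ) • a.m.1 + (-δ) • a.m.2 by module,
    show (boost a b)⁻¹ • a.n = (boost a b)⁻¹ • a.n + (0 : ℝ) • a.n by module,
    show boost a b • a.l = boost a b • a.l + (0 : ℝ) • a.l by module,
    alt_lin_zero, alt_lin_three, alt_lin_two, alt_lin_one, alt_lin_one, alt_inner_self,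
    alt_inner_self, alt_swap_inner _ a.n a.m.1 a.m.2 a.l] at ho
  have hoa := a.orient_pos
  rw [show -a.m.2 = (-1 : ℝ) • a.m.2 + (0 : ℝ) • a.m.2 by module, alt_lin_two] at hoa
  have hdet : 0 < α * δ - β * γ := by
    have : (boost a b)⁻¹ * boost a b = 1 := inv_mul_cancel₀ hlpos.ne'
    set w := 𝔐.orient x ![a.n, a.m.1, a.m.2, a.l]
    have hw : 0 < -w := by linarith
    have : 0 < (α * δ - β * γ) * (-w) := by
      refine lt_of_lt_of_eq ho ?_
      linear_combination (-(α * δ - β * γ) * w) * this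
    exact (mul_pos_iff_of_pos_right hw).1 this
  obtain ⟨hδα, hγβ⟩ := rotation_of_orthonormal (α := α) (β := β) (γ := γ) (δ := δ)
    (by linarith) (by linarith) (by linarith) hdet
  have htw : twist a b = ⟨α, -β⟩ := by
    apply Complex.ext
    · simp only [twist, Complex.neg_re, LorentzMetric.cval_re, conjT, map_neg]
      linarith
    · simp only [twist, Complex.neg_im, LorentzMetric.cval_im, conjT, map_neg]
      linarith
  refine ⟨hlpos, ?_, hl', hn', ?_⟩
  · rw [htw, ← sq_eq_sq₀ (norm_nonneg _) zero_le_one, Complex.sq_norm, Complex.normSq_mk]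
    linarith
  · rw [htw]
    refine Prod.ext ?_ ?_
    · simp only [smulT]; rw [e1]; module
    · simp only [smulT]; rw [e2, hδα, hγβ]; module

end Tetrad

/-! ### Smooth local tetrads -/

variable {𝔐 : Background M} {x : M}

/-- Three vectors do not span the tangent space. -/
lemma exists_notMem_span (l n m : TangentSpace (𝓡 4) x) :
    ∃ v, ∀ a b c : ℝ, v ≠ a • l + b • n + c • m := by
  by_contra! h
  have hfin : Module.finrank ℝ (TangentSpace (𝓡 4) x) = 4 :=
    (finrank_euclideanSpace_fin : Module.finrank ℝ E4 = 4)
  have htop : Submodule.span ℝ (Set.range ![l, n, m]) = ⊤ := by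
    rw [eq_top_iff]
    intro v _
    obtain ⟨a, b, c, rfl⟩ := h v
    have mem : ∀ i, ![l, n, m] i ∈ Submodule.span ℝ (Set.range ![l, n, m]) :=
      fun i ↦ Submodule.subset_span ⟨i, rfl⟩
    exact add_mem (add_mem (Submodule.smul_mem _ _ (mem 0)) (Submodule.smul_mem _ _ (mem 1)))
      (Submodule.smul_mem _ _ (mem 2))
  have h1 := finrank_range_le_card (R := ℝ) ![l, n, m]
  rw [Set.finrank, htop, finrank_top, hfin] at h1
  simp at h1

namespace LorentzMetric

variable (g : LorentzMetric M)

/-- The component of `u` orthogonal to the null vectors `l`, `n` with `g(l, n) = 1`. -/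
def perp (l n u : TangentSpace (𝓡 4) x) : TangentSpace (𝓡 4) x :=
  u - g.val x u n • l - g.val x u l • n

lemma eq_perp_add (l n u : TangentSpace (𝓡 4) x) :
    u = g.perp l n u + g.val x u n • l + g.val x u l • n := by
  simp only [perp]; module

/-- The multiple of a spacelike vector `u` with inner square `-1/2`. -/
def unitize (u : TangentSpace (𝓡 4) x) : TangentSpace (𝓡 4) x :=
  (Real.sqrt (-2 * g.val x u u))⁻¹ • u

/-- The second vector of the Gram-Schmidt process in the orthogonal complement of `l`, `n`. -/
def perp₂ (l n m v : TangentSpace (𝓡 4) x) : TangentSpace (𝓡 4) x :=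
  g.perp l n v + (2 * g.val x (g.perp l n v) m) • m

lemma unitize_self {u : TangentSpace (𝓡 4) x} (h : g.val x u u < 0) :
    g.val x (g.unitize u) (g.unitize u) = -1 / 2 := by
  have h1 : Real.sqrt (-2 * g.val x u u) * Real.sqrt (-2 * g.val x u u) = -2 * g.val x u u :=
    Real.mul_self_sqrt (by linarith)
  have h2 : Real.sqrt (-2 * g.val x u u) ≠ 0 := (Real.sqrt_pos.2 (by linarith)).ne'
  simp only [unitize, map_smul, smul_apply, smul_eq_mul]
  generalize Real.sqrt (-2 * g.val x u u) = r at *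
  rw [show g.val x u u = -(r * r) / 2 by linarith]
  field_simp

lemma val_unitize {k u : TangentSpace (𝓡 4) x} (h : g.val x k u = 0) :
    g.val x k (g.unitize u) = 0 := by
  rw [unitize, map_smul, h, smul_zero]

lemma val_l_perp {l n : TangentSpace (𝓡 4) x} (ll : g.val x l l = 0)
    (ln : g.val x l n = 1) (u : TangentSpace (𝓡 4) x) : g.val x l (g.perp l n u) = 0 := by
  simp [perp, ll, ln, g.symm x l u]

lemma val_n_perp {l n : TangentSpace (𝓡 4) x} (nn : g.val x n n = 0)
    (ln : g.val x l n = 1) (u : TangentSpace (𝓡 4) x) : g.val x n (g.perp l n u) = 0 := by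
  simp [perp, nn, g.symm x n l, ln, g.symm x n u]

lemma val_perp_neg {l n : TangentSpace (𝓡 4) x} (ll : g.val x l l = 0) (nn : g.val x n n = 0)
    (ln : g.val x l n = 1) {u : TangentSpace (𝓡 4) x} (hl : g.val x l u = 0)
    (hn : g.val x n u = 0) (hu : u ≠ 0) : g.val x u u < 0 := by
  refine g.neg_of_orthogonal_timelike (t := l + n) ?_ ?_ hu
  · simp [ll, nn, ln, g.symm x n l]
  · simp [hl, hn]

lemma val_perp₂ {k l n m v : TangentSpace (𝓡 4) x} (h1 : g.val x k (g.perp l n v) = 0)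
    (h2 : g.val x k m = 0) : g.val x k (g.perp₂ l n m v) = 0 := by
  rw [perp₂, map_add, map_smul, h1, h2, smul_zero, add_zero]

end LorentzMetric

/-- A null tetrad from its real and imaginary parts. -/
def NullTetrad.ofVectors {c : ℝ} (hc : 0 < c) {l n m1 m2 : TangentSpace (𝓡 4) x}
    (hl : l = c • 𝔐.Vplus x)
    (hn : n = (c * 𝔐.g.val x (𝔐.Vplus x) (𝔐.Vminus x))⁻¹ • 𝔐.Vminus x)
    (l1 : 𝔐.g.val x l m1 = 0) (l2 : 𝔐.g.val x l m2 = 0) (n1 : 𝔐.g.val x n m1 = 0)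
    (n2 : 𝔐.g.val x n m2 = 0) (m11 : 𝔐.g.val x m1 m1 = -1 / 2)
    (m22 : 𝔐.g.val x m2 m2 = -1 / 2) (m12 : 𝔐.g.val x m1 m2 = 0)
    (ho : 0 < 𝔐.orient x ![n, m1, -m2, l]) : NullTetrad 𝔐 x where
  l := l
  n := n
  m := (m1, m2)
  l_collinear := ⟨_, hl⟩
  n_collinear := ⟨_, hn⟩
  l_future := by rw [hl, map_smul]; exact mul_pos hc (𝔐.Vplus_future x)
  n_future := by
    rw [hn, map_smul]
    exact mul_pos (inv_pos.2 (mul_pos hc (𝔐.val_Vplus_Vminus_pos x))) (𝔐.Vminus_future x)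
  l_n := by
    have h := (𝔐.val_Vplus_Vminus_pos x).ne'
    rw [hl, hn]
    simp only [map_smul, smul_apply, smul_eq_mul]
    field_simp
  m_conj_m := by
    apply Complex.ext
    · norm_num [LorentzMetric.cval_re, conjT, m11, m22]
    · simp [LorentzMetric.cval_im, conjT, m12, 𝔐.g.symm x m2 m1]
  m_m := by
    apply Complex.ext
    · simp [LorentzMetric.cval_re, m11, m22]
    · simp [LorentzMetric.cval_im, m12, 𝔐.g.symm x m2 m1]
  l_l := by rw [hl]; simp [(𝔐.Vplus_principal x).2.1]
  n_n := by rw [hn]; simp [(𝔐.Vminus_principal x).2.1]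
  l_m := by
    apply Complex.ext
    · simp [LorentzMetric.cval_re, ofReal, l1]
    · simp [LorentzMetric.cval_im, ofReal, l2]
  n_m := by
    apply Complex.ext
    · simp [LorentzMetric.cval_re, ofReal, n1]
    · simp [LorentzMetric.cval_im, ofReal, n2]
  oriented := by rwa [orient_frame]

/-- The first null vector of the Gram-Schmidt tetrad field. -/
def gsL (𝔐 : Background M) (c : ℝ) : VField M := c • 𝔐.Vplus

/-- The second null vector of the Gram-Schmidt tetrad field. -/
def gsN (𝔐 : Background M) (c : ℝ) : VField M :=
  (fun y ↦ (c * 𝔐.g.val y (𝔐.Vplus y) (𝔐.Vminus y))⁻¹) • 𝔐.Vminus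

/-- The orthogonal part of the first spacelike input field. -/
def gsP (𝔐 : Background M) (c : ℝ) (B : VField M) : VField M :=
  fun y ↦ 𝔐.g.perp (gsL 𝔐 c y) (gsN 𝔐 c y) (B y)

/-- The real part of `m` in the Gram-Schmidt tetrad field. -/
def gsM (𝔐 : Background M) (c : ℝ) (B : VField M) : VField M := fun y ↦ 𝔐.g.unitize (gsP 𝔐 c B y)

/-- The orthogonal part of the second spacelike input field. -/
def gsQ (𝔐 : Background M) (c : ℝ) (B B' : VField M) : VField M :=
  fun y ↦ 𝔐.g.perp₂ (gsL 𝔐 c y) (gsN 𝔐 c y) (gsM 𝔐 c B y) (B' y)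

/-- The imaginary part of `m` in the Gram-Schmidt tetrad field, up to a sign. -/
def gsM' (𝔐 : Background M) (c : ℝ) (B B' : VField M) : VField M :=
  fun y ↦ 𝔐.g.unitize (gsQ 𝔐 c B B' y)

lemma gsL_gsL (c : ℝ) : 𝔐.g.val x (gsL 𝔐 c x) (gsL 𝔐 c x) = 0 := by
  simp [gsL, (𝔐.Vplus_principal x).2.1]

lemma gsN_gsN (c : ℝ) : 𝔐.g.val x (gsN 𝔐 c x) (gsN 𝔐 c x) = 0 := by
  simp [gsN, (𝔐.Vminus_principal x).2.1]

lemma gsL_gsN {c : ℝ} (hc : 0 < c) : 𝔐.g.val x (gsL 𝔐 c x) (gsN 𝔐 c x) = 1 := by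
  have h := (𝔐.val_Vplus_Vminus_pos x).ne'
  simp only [gsL, gsN, Pi.smul_apply, Pi.smul_apply', map_smul, smul_apply, smul_eq_mul]
  field_simp

lemma val_gsL_gsM {c : ℝ} (hc : 0 < c) (B : VField M) :
    𝔐.g.val x (gsL 𝔐 c x) (gsM 𝔐 c B x) = 0 :=
  𝔐.g.val_unitize (𝔐.g.val_l_perp (gsL_gsL c) (gsL_gsN hc) _)

lemma val_gsN_gsM {c : ℝ} (hc : 0 < c) (B : VField M) :
    𝔐.g.val x (gsN 𝔐 c x) (gsM 𝔐 c B x) = 0 :=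
  𝔐.g.val_unitize (𝔐.g.val_n_perp (gsN_gsN c) (gsL_gsN hc) _)

lemma val_gsL_gsQ {c : ℝ} (hc : 0 < c) (B B' : VField M) :
    𝔐.g.val x (gsL 𝔐 c x) (gsQ 𝔐 c B B' x) = 0 :=
  𝔐.g.val_perp₂ (𝔐.g.val_l_perp (gsL_gsL c) (gsL_gsN hc) _) (val_gsL_gsM hc B)

lemma val_gsN_gsQ {c : ℝ} (hc : 0 < c) (B B' : VField M) :
    𝔐.g.val x (gsN 𝔐 c x) (gsQ 𝔐 c B B' x) = 0 :=
  𝔐.g.val_perp₂ (𝔐.g.val_n_perp (gsN_gsN c) (gsL_gsN hc) _) (val_gsN_gsM hc B)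

/-- Gram-Schmidt produces a null tetrad wherever the two orthogonalized fields are spacelike and
the frame is oriented. The sign `e` of the imaginary part of `m` serves to achieve the latter. -/
def gsTetrad {c e : ℝ} (hc : 0 < c) (he : e * e = 1) {B B' : VField M}
    (h1 : 𝔐.g.val x (gsP 𝔐 c B x) (gsP 𝔐 c B x) < 0)
    (h2 : 𝔐.g.val x (gsQ 𝔐 c B B' x) (gsQ 𝔐 c B B' x) < 0)
    (ho : 0 < 𝔐.orient x ![gsN 𝔐 c x, gsM 𝔐 c B x, -(e • gsM' 𝔐 c B B' x), gsL 𝔐 c x]) :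
    NullTetrad 𝔐 x := by
  have m11 : 𝔐.g.val x (gsM 𝔐 c B x) (gsM 𝔐 c B x) = -1 / 2 := 𝔐.g.unitize_self h1
  refine NullTetrad.ofVectors (m1 := gsM 𝔐 c B x) (m2 := e • gsM' 𝔐 c B B' x) hc rfl rfl
    (val_gsL_gsM hc B) ?_ (val_gsN_gsM hc B) ?_ m11 ?_ ?_ ho
  · exact (map_smul _ _ _).trans
      (smul_eq_zero_of_right _ (𝔐.g.val_unitize (val_gsL_gsQ hc B B')))
  · exact (map_smul _ _ _).trans
      (smul_eq_zero_of_right _ (𝔐.g.val_unitize (val_gsN_gsQ hc B B')))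
  · have : 𝔐.g.val x (gsM' 𝔐 c B B' x) (gsM' 𝔐 c B B' x) = -1 / 2 := 𝔐.g.unitize_self h2
    rw [map_smul, map_smul, smul_apply, this, smul_eq_mul, smul_eq_mul]
    linear_combination (-1 / 2) * he
  · have : 𝔐.g.val x (gsM 𝔐 c B x) (gsQ 𝔐 c B B' x) = 0 := by
      rw [gsQ, LorentzMetric.perp₂, map_add, map_smul, m11, smul_eq_mul,
        𝔐.g.symm x (gsM 𝔐 c B x)]
      ring
    rw [map_smul, gsM', 𝔐.g.val_unitize this, smul_zero]

lemma smF_inv {f : M → ℝ} (hf : SmF f x) (h : f x ≠ 0) : SmF (fun y ↦ (f y)⁻¹) x :=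
  ((contDiffAt_inv ℝ h).contMDiffAt).comp x hf

lemma smF_sqrt {f : M → ℝ} (hf : SmF f x) (h : f x ≠ 0) : SmF (fun y ↦ Real.sqrt (f y)) x :=
  ((Real.contDiffAt_sqrt h).contMDiffAt).comp x hf

lemma smF_const_mul {f : M → ℝ} (c : ℝ) (hf : SmF f x) : SmF (fun y ↦ c * f y) x :=
  contMDiffAt_const.mul hf

lemma VField.SmoothOn.smAt {X : VField M} {U : Set M} (h : X.SmoothOn U) (hU : U ∈ 𝓝 x) :
    X.SmAt x := ContMDiffOn.contMDiffAt h hU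

lemma smAt_Vplus (𝔐 : Background M) (x : M) : 𝔐.Vplus.SmAt x := 𝔐.Vplus_smooth.smAt Filter.univ_mem

lemma smAt_Vminus (𝔐 : Background M) (x : M) : 𝔐.Vminus.SmAt x :=
  𝔐.Vminus_smooth.smAt Filter.univ_mem

lemma smAt_unitize (g : LorentzMetric M) {X : VField M} (hX : X.SmAt x)
    (h : g.val x (X x) (X x) < 0) : VField.SmAt (fun y ↦ g.unitize (X y)) x := by
  have h1 : SmF (fun y ↦ (Real.sqrt (-2 * g.val y (X y) (X y)))⁻¹) x :=
    smF_inv (smF_sqrt (smF_const_mul (-2) (g.smF_val hX hX)) (by nlinarith))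
      (Real.sqrt_pos.2 (by linarith)).ne'
  exact hX.smul h1

lemma smAt_perp (g : LorentzMetric M) {L N X : VField M} (hL : L.SmAt x) (hN : N.SmAt x)
    (hX : X.SmAt x) : VField.SmAt (fun y ↦ g.perp (L y) (N y) (X y)) x :=
  (hX.sub (hL.smul (g.smF_val hX hN))).sub (hN.smul (g.smF_val hX hL))

lemma smAt_perp₂ (g : LorentzMetric M) {L N P X : VField M} (hL : L.SmAt x) (hN : N.SmAt x)
    (hP : P.SmAt x) (hX : X.SmAt x) : VField.SmAt (fun y ↦ g.perp₂ (L y) (N y) (P y) (X y)) x :=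
  (smAt_perp g hL hN hX).add
    (hP.smul (smF_const_mul 2 (g.smF_val (smAt_perp g hL hN hX) hP)))

lemma smAt_gsL (c : ℝ) : (gsL 𝔐 c).SmAt x := (smAt_Vplus 𝔐 x).const_smul c

lemma smAt_gsN {c : ℝ} (hc : 0 < c) : (gsN 𝔐 c).SmAt x :=
  (smAt_Vminus 𝔐 x).smul (smF_inv
    (smF_const_mul c (𝔐.g.smF_val (smAt_Vplus 𝔐 x) (smAt_Vminus 𝔐 x)))
    (mul_pos hc (𝔐.val_Vplus_Vminus_pos x)).ne')

lemma smAt_gsP {c : ℝ} (hc : 0 < c) {B : VField M} (hB : B.SmAt x) : (gsP 𝔐 c B).SmAt x :=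
  smAt_perp 𝔐.g (smAt_gsL c) (smAt_gsN hc) hB

lemma smAt_gsM {c : ℝ} (hc : 0 < c) {B : VField M} (hB : B.SmAt x)
    (h1 : 𝔐.g.val x (gsP 𝔐 c B x) (gsP 𝔐 c B x) < 0) : (gsM 𝔐 c B).SmAt x :=
  smAt_unitize 𝔐.g (smAt_gsP hc hB) h1

lemma smAt_gsQ {c : ℝ} (hc : 0 < c) {B B' : VField M} (hB : B.SmAt x) (hB' : B'.SmAt x)
    (h1 : 𝔐.g.val x (gsP 𝔐 c B x) (gsP 𝔐 c B x) < 0) : (gsQ 𝔐 c B B').SmAt x :=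
  smAt_perp₂ 𝔐.g (smAt_gsL c) (smAt_gsN hc) (smAt_gsM hc hB h1) hB'

lemma smAt_gsM' {c : ℝ} (hc : 0 < c) {B B' : VField M} (hB : B.SmAt x) (hB' : B'.SmAt x)
    (h1 : 𝔐.g.val x (gsP 𝔐 c B x) (gsP 𝔐 c B x) < 0)
    (h2 : 𝔐.g.val x (gsQ 𝔐 c B B' x) (gsQ 𝔐 c B B' x) < 0) : (gsM' 𝔐 c B B').SmAt x :=
  smAt_unitize 𝔐.g (smAt_gsQ hc hB hB' h1) h2

/-- A vector is the value of a vector field that is smooth on a neighbourhood. -/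
lemma eventually_smAt_extend (v : TangentSpace (𝓡 4) x) :
    ∀ᶠ y in 𝓝 x, VField.SmAt (FiberBundle.extend E4 v) y := by
  obtain ⟨s, hs, h⟩ := FiberBundle.exists_contMDiffOn_extend (I := 𝓡 4) (F := E4)
    (V := TangentSpace (𝓡 4)) (k := ∞) v
  filter_upwards [eventually_eventually_nhds.2 hs] with y hy
  exact h.contMDiffAt hy

/-- The conditions under which Gram-Schmidt produces a null tetrad are open. -/
lemma gsTetrad_conditions_eventually {c e : ℝ} (hc : 0 < c) {B B' : VField M}
    (hB : ∀ᶠ y in 𝓝 x, B.SmAt y) (hB' : ∀ᶠ y in 𝓝 x, B'.SmAt y)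
    (h1 : 𝔐.g.val x (gsP 𝔐 c B x) (gsP 𝔐 c B x) < 0)
    (h2 : 𝔐.g.val x (gsQ 𝔐 c B B' x) (gsQ 𝔐 c B B' x) < 0)
    (ho : 0 < 𝔐.orient x ![gsN 𝔐 c x, gsM 𝔐 c B x, -(e • gsM' 𝔐 c B B' x), gsL 𝔐 c x]) :
    ∀ᶠ y in 𝓝 x, B.SmAt y ∧ B'.SmAt y ∧ 𝔐.g.val y (gsP 𝔐 c B y) (gsP 𝔐 c B y) < 0 ∧
      𝔐.g.val y (gsQ 𝔐 c B B' y) (gsQ 𝔐 c B B' y) < 0 ∧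
      0 < 𝔐.orient y ![gsN 𝔐 c y, gsM 𝔐 c B y, -(e • gsM' 𝔐 c B B' y), gsL 𝔐 c y] := by
  have hBx := hB.self_of_nhds
  have hBx' := hB'.self_of_nhds
  have e1 : ∀ᶠ y in 𝓝 x, 𝔐.g.val y (gsP 𝔐 c B y) (gsP 𝔐 c B y) < 0 :=
    (𝔐.g.smF_val (smAt_gsP hc hBx) (smAt_gsP hc hBx)).continuousAt.eventually_lt
      continuousAt_const h1
  have e2 : ∀ᶠ y in 𝓝 x, 𝔐.g.val y (gsQ 𝔐 c B B' y) (gsQ 𝔐 c B B' y) < 0 :=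
    (𝔐.g.smF_val (smAt_gsQ hc hBx hBx' h1) (smAt_gsQ hc hBx hBx' h1)).continuousAt.eventually_lt
      continuousAt_const h2
  obtain ⟨U, hU, hUo, hxU⟩ := eventually_nhds_iff.1 (hB.and (hB'.and (e1.and e2)))
  let X : Fin 4 → VField M := ![gsN 𝔐 c, gsM 𝔐 c B, -(e • gsM' 𝔐 c B B'), gsL 𝔐 c]
  have hX : ∀ i, (X i).SmoothOn U := by
    intro i y hy
    obtain ⟨b, b', q1, q2⟩ := hU y hy
    have : (X i).SmAt y := by
      fin_cases i
      · exact smAt_gsN hc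
      · exact smAt_gsM hc b q1
      · exact ((smAt_gsM' hc b b' q1 q2).const_smul e).neg
      · exact smAt_gsL c
    exact ContMDiffAt.contMDiffWithinAt this
  have e3 : ∀ᶠ y in 𝓝 x, 0 < 𝔐.orient y fun i ↦ X i y := by
    have hc := ((𝔐.orient_smooth U hUo X hX).contMDiffAt (hUo.mem_nhds hxU)).continuousAt
    refine continuousAt_const.eventually_lt hc ?_
    have : (fun i ↦ X i x)
        = ![gsN 𝔐 c x, gsM 𝔐 c B x, -(e • gsM' 𝔐 c B B' x), gsL 𝔐 c x] := by
      ext1 i; fin_cases i <;> rfl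
    rwa [this]
  filter_upwards [hB, hB', e1, e2, e3] with y a1 a2 a3 a4 a5
  have : (fun i ↦ X i y)
      = ![gsN 𝔐 c y, gsM 𝔐 c B y, -(e • gsM' 𝔐 c B B' y), gsL 𝔐 c y] := by
    ext1 i; fin_cases i <;> rfl
  rw [this] at a5
  exact ⟨a1, a2, a3, a4, a5⟩

/-- The fibres of the bundle of null tetrads are non-empty. -/
lemma nonempty_nullTetrad (𝔐 : Background M) (x : M) : Nonempty (NullTetrad 𝔐 x) := by
  have ll := gsL_gsL (𝔐 := 𝔐) (x := x) 1
  have nn := gsN_gsN (𝔐 := 𝔐) (x := x) 1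
  have ln := gsL_gsN (𝔐 := 𝔐) (x := x) one_pos
  -- the part orthogonal to `l` and `n` of a vector outside their span is nonzero, hence spacelike
  obtain ⟨b, hb⟩ := exists_notMem_span (gsL 𝔐 1 x) (gsN 𝔐 1 x) 0
  let B : VField M := FiberBundle.extend E4 b
  have hB : B x = b := FiberBundle.extend_apply_self E4 b
  have h1 : 𝔐.g.val x (gsP 𝔐 1 B x) (gsP 𝔐 1 B x) < 0 := by
    refine 𝔐.g.val_perp_neg ll nn ln (𝔐.g.val_l_perp ll ln _) (𝔐.g.val_n_perp nn ln _) ?_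
    intro h
    rw [gsP, hB] at h
    have e := 𝔐.g.eq_perp_add (gsL 𝔐 1 x) (gsN 𝔐 1 x) b
    apply hb (𝔐.g.val x b (gsN 𝔐 1 x)) (𝔐.g.val x b (gsL 𝔐 1 x)) 0
    rw [h] at e
    linear_combination (norm := module) e
  obtain ⟨b', hb'⟩ := exists_notMem_span (gsL 𝔐 1 x) (gsN 𝔐 1 x) (gsM 𝔐 1 B x)
  let B' : VField M := FiberBundle.extend E4 b'
  have hB' : B' x = b' := FiberBundle.extend_apply_self E4 b'
  have h2 : 𝔐.g.val x (gsQ 𝔐 1 B B' x) (gsQ 𝔐 1 B B' x) < 0 := by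
    refine 𝔐.g.val_perp_neg ll nn ln (val_gsL_gsQ one_pos B B') (val_gsN_gsQ one_pos B B') ?_
    intro h
    rw [gsQ, LorentzMetric.perp₂, hB'] at h
    apply hb' (𝔐.g.val x b' (gsN 𝔐 1 x)) (𝔐.g.val x b' (gsL 𝔐 1 x))
      (-(2 * 𝔐.g.val x (𝔐.g.perp (gsL 𝔐 1 x) (gsN 𝔐 1 x) b') (gsM 𝔐 1 B x)))
    have e1 := eq_neg_of_add_eq_zero_left h
    have e2 : b' = 𝔐.g.perp (gsL 𝔐 1 x) (gsN 𝔐 1 x) b' + 𝔐.g.val x b' (gsN 𝔐 1 x) • gsL 𝔐 1 x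
        + 𝔐.g.val x b' (gsL 𝔐 1 x) • gsN 𝔐 1 x := 𝔐.g.eq_perp_add _ _ _
    refine e2.trans ?_
    conv_lhs => rw [e1]
    module
  have key : ∀ e : ℝ, 𝔐.orient x ![gsN 𝔐 1 x, gsM 𝔐 1 B x, -(e • gsM' 𝔐 1 B B' x), gsL 𝔐 1 x]
      = -e * 𝔐.orient x ![gsN 𝔐 1 x, gsM 𝔐 1 B x, gsM' 𝔐 1 B B' x, gsL 𝔐 1 x] := by
    intro e
    rw [show -(e • gsM' 𝔐 1 B B' x) = (-e) • gsM' 𝔐 1 B B' x + (0 : ℝ) • gsM' 𝔐 1 B B' x by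
      module, alt_lin_two]
    ring
  have hne : 𝔐.orient x ![gsN 𝔐 1 x, gsM 𝔐 1 B x, gsM' 𝔐 1 B B' x, gsL 𝔐 1 x] ≠ 0 := by
    have m11 : 𝔐.g.val x (gsM 𝔐 1 B x) (gsM 𝔐 1 B x) = -1 / 2 := 𝔐.g.unitize_self h1
    have m12 : 𝔐.g.val x (gsM 𝔐 1 B x) (gsQ 𝔐 1 B B' x) = 0 := by
      rw [gsQ, LorentzMetric.perp₂, map_add, map_smul, m11, smul_eq_mul,
        𝔐.g.symm x (gsM 𝔐 1 B x)]
      ring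
    obtain ⟨β, hβ⟩ := 𝔐.g.exists_basis_of_orthonormal (orthonormal_of_null 𝔐.g ll nn ln
      (val_gsL_gsM one_pos B) (𝔐.g.val_unitize (val_gsL_gsQ one_pos B B'))
      (val_gsN_gsM one_pos B) (𝔐.g.val_unitize (val_gsN_gsQ one_pos B B')) m11
      (𝔐.g.unitize_self h2) (𝔐.g.val_unitize m12))
    have := (AlternatingMap.map_basis_ne_zero_iff β (𝔐.orient x)).2 (𝔐.orient_ne_zero x)
    rw [hβ, orient_frame] at this
    intro h0
    apply this
    rw [show Real.sqrt 2 • gsM 𝔐 1 B x = Real.sqrt 2 • gsM 𝔐 1 B x + (0 : ℝ) • gsM 𝔐 1 B x by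
        module,
      show Real.sqrt 2 • 𝔐.g.unitize (gsQ 𝔐 1 B B' x) = Real.sqrt 2 • gsM' 𝔐 1 B B' x
        + (0 : ℝ) • gsM' 𝔐 1 B B' x by rw [gsM']; module, alt_lin_one, alt_lin_two, h0]
    ring
  -- the orientation determines the sign of the imaginary part of `m`
  rcases lt_or_gt_of_ne hne with h | h
  · exact ⟨gsTetrad one_pos (e := 1) (by norm_num) h1 h2 (by rw [key]; linarith)⟩
  · exact ⟨gsTetrad one_pos (e := -1) (by norm_num) h1 h2 (by rw [key]; linarith)⟩

/-- Every null tetrad is the value of a section of `𝔑₀` that is smooth near the point. -/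
lemma exists_tetradField (a : NullTetrad 𝔐 x) :
    ∃ A : TetradField 𝔐, A.SmoothNear x ∧ A x = a := by
  classical
  obtain ⟨c, hc⟩ := a.l_collinear
  have c_pos : 0 < c := by
    have := a.l_future
    rw [hc, map_smul, smul_eq_mul] at this
    exact (mul_pos_iff_of_pos_right (𝔐.Vplus_future x)).1 this
  let B : VField M := FiberBundle.extend E4 a.m.1
  let B' : VField M := FiberBundle.extend E4 a.m.2
  have hB : B x = a.m.1 := FiberBundle.extend_apply_self E4 _
  have hB' : B' x = a.m.2 := FiberBundle.extend_apply_self E4 _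
  -- Gram-Schmidt fixes vectors that are orthonormal already, so that the field takes the value
  -- `a` at `x`
  have eL : gsL 𝔐 c x = a.l := hc.symm
  have eN : gsN 𝔐 c x = a.n := by
    obtain ⟨d, hd⟩ := a.n_collinear
    have h := a.l_n
    rw [hc, hd] at h
    simp only [map_smul, smul_apply, smul_eq_mul] at h
    have h0 := mul_pos c_pos (𝔐.val_Vplus_Vminus_pos x)
    rw [gsN, Pi.smul_apply', hd]
    congr 1
    exact (eq_inv_of_mul_eq_one_left h).symm
  have hunit : ∀ u : TangentSpace (𝓡 4) x, 𝔐.g.val x u u = -1 / 2 → 𝔐.g.unitize u = u := by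
    intro u hu
    rw [LorentzMetric.unitize, hu]
    norm_num
  have eP : gsP 𝔐 c B x = a.m.1 := by
    rw [gsP, LorentzMetric.perp, eL, eN, hB, 𝔐.g.symm, a.val_n_m1, 𝔐.g.symm, a.val_l_m1]
    module
  have eM : gsM 𝔐 c B x = a.m.1 := by rw [gsM, eP, hunit _ a.val_m1_m1]
  have eQ : gsQ 𝔐 c B B' x = a.m.2 := by
    rw [gsQ, LorentzMetric.perp₂, LorentzMetric.perp, eL, eN, eM, hB', 𝔐.g.symm x a.m.2 a.n,
      a.val_n_m2, 𝔐.g.symm x a.m.2 a.l, a.val_l_m2, zero_smul, zero_smul, sub_zero, sub_zero,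
      𝔐.g.symm, a.val_m1_m2]
    module
  have eM' : gsM' 𝔐 c B B' x = a.m.2 := by rw [gsM', eQ, hunit _ a.val_m2_m2]
  have hev := gsTetrad_conditions_eventually (𝔐 := 𝔐) (e := 1) c_pos
    (eventually_smAt_extend a.m.1) (eventually_smAt_extend a.m.2)
    (by rw [eP, a.val_m1_m1]; norm_num) (by rw [eQ, a.val_m2_m2]; norm_num)
    (by rw [eM, eM', eL, eN, one_smul]; exact a.orient_pos)
  obtain ⟨U, hU, hUo, hxU⟩ := eventually_nhds_iff.1 hev
  let A : TetradField 𝔐 := fun y ↦ if h : y ∈ U then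
      gsTetrad c_pos (one_mul 1) (hU y h).2.2.1 (hU y h).2.2.2.1 (hU y h).2.2.2.2
    else (nonempty_nullTetrad 𝔐 y).some
  have hA : ∀ y (h : y ∈ U), A y =
      gsTetrad c_pos (one_mul 1) (hU y h).2.2.1 (hU y h).2.2.2.1 (hU y h).2.2.2.2 :=
    fun y h ↦ dif_pos h
  have sm : ∀ {X Y : VField M}, (∀ y ∈ U, Y.SmAt y) → (∀ y ∈ U, X y = Y y) → X.SmoothOn U := by
    intro X Y h e y hy
    exact ContMDiffAt.contMDiffWithinAt
      ((h y hy).congr (by filter_upwards [hUo.mem_nhds hy] with z hz using e z hz))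
  refine ⟨A, ⟨U, hUo, hxU, ?_, ?_, ?_, ?_⟩, ?_⟩
  · exact sm (Y := gsL 𝔐 c) (fun y _ ↦ smAt_gsL c) fun y h ↦ by simp only [hA y h]; rfl
  · exact sm (Y := gsN 𝔐 c) (fun y _ ↦ smAt_gsN c_pos) fun y h ↦ by simp only [hA y h]; rfl
  · exact sm (Y := gsM 𝔐 c B) (fun y h ↦ smAt_gsM c_pos (hU y h).1 (hU y h).2.2.1)
      fun y h ↦ by simp only [hA y h]; rfl
  · exact sm (Y := gsM' 𝔐 c B B') (fun y h ↦ smAt_gsM' c_pos (hU y h).1 (hU y h).2.1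
      (hU y h).2.2.1 (hU y h).2.2.2.1) fun y h ↦ by simp only [hA y h]; exact one_smul ℝ _
  · rw [hA x hxU]
    refine NullTetrad.ext eL eN (Prod.ext eM ?_)
    exact (one_smul ℝ _).trans eM'

/-! ### Smoothness of the Levi-Civita connection and tensoriality of the curvature -/

section Curvature

variable {𝔐 : Background M} {x : M} {X Y Z W : VField M}

lemma TetradField.SmoothNear.smAt {A : TetradField 𝔐} (hA : A.SmoothNear x) :
    VField.SmAt (fun y ↦ (A y).l) x ∧ VField.SmAt (fun y ↦ (A y).n) x ∧
      VField.SmAt (fun y ↦ (A y).m.1) x ∧ VField.SmAt (fun y ↦ (A y).m.2) x := by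
  obtain ⟨U, hU, hx, h1, h2, h3, h4⟩ := hA
  have hU' := hU.mem_nhds hx
  exact ⟨h1.smAt hU', h2.smAt hU', h3.smAt hU', h4.smAt hU'⟩

lemma TetradField.SmoothNear.eventually {A : TetradField 𝔐} (hA : A.SmoothNear x) :
    ∀ᶠ y in 𝓝 x, A.SmoothNear y := by
  obtain ⟨U, hU, hx, h⟩ := hA
  filter_upwards [hU.mem_nhds hx] with y hy
  exact ⟨U, hU, hy, h⟩

/-- Through every point passes a tetrad field that is smooth near the point. -/
lemma exists_smoothNear (𝔐 : Background M) (x : M) : ∃ A : TetradField 𝔐, A.SmoothNear x := by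
  obtain ⟨a⟩ := nonempty_nullTetrad 𝔐 x
  obtain ⟨A, hA, -⟩ := exists_tetradField a
  exact ⟨A, hA⟩

/-- A vector field is smooth if its inner products with smooth vector fields are. -/
lemma smAt_of_smF_val (h : ∀ Z : VField M, Z.SmAt x → SmF (fun y ↦ 𝔐.g.val y (X y) (Z y)) x) :
    X.SmAt x := by
  obtain ⟨A, hA⟩ := exists_smoothNear 𝔐 x
  obtain ⟨h1, h2, h3, h4⟩ := hA.smAt
  have := (((h1.smul (h _ h2)).add (h2.smul (h _ h1))).add
    (h3.smul (smF_const_mul (-2) (h _ h3)))).add (h4.smul (smF_const_mul (-2) (h _ h4)))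
  refine this.congr (Filter.Eventually.of_forall fun y ↦ ?_)
  exact (A y).expand (X y)

lemma SmF.sub' {f g : M → ℝ} (hf : SmF f x) (hg : SmF g x) : SmF (fun y ↦ f y - g y) x :=
  ContMDiffAt.sub hf hg

lemma SmF.add' {f g : M → ℝ} (hf : SmF f x) (hg : SmF g x) : SmF (fun y ↦ f y + g y) x :=
  ContMDiffAt.add hf hg

lemma LorentzMetric.smF_koszul (g : LorentzMetric M) (hX : X.SmAt x) (hY : Y.SmAt x)
    (hZ : Z.SmAt x) : SmF (g.koszul X Y Z) x := by
  have h1 := (g.smF_val hY hZ).vderiv hX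
  have h2 := (g.smF_val hX hZ).vderiv hY
  have h3 := (g.smF_val hX hY).vderiv hZ
  have h4 := g.smF_val (hX.bracket hY) hZ
  have h5 := g.smF_val (hX.bracket hZ) hY
  have h6 := g.smF_val (hY.bracket hZ) hX
  exact ((((h1.add' h2).sub' h3).add' h4).sub' h5).sub' h6

/-- The covariant derivative of a smooth vector field is smooth. -/
lemma smAt_nabla (𝔐 : Background M) (hX : X.SmAt x) (hY : Y.SmAt x) :
    (𝔐.g.nabla X Y).SmAt x := by
  refine smAt_of_smF_val (𝔐 := 𝔐) fun Z hZ ↦ ?_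
  refine ContMDiffAt.congr_of_eventuallyEq
    (smF_const_mul (1 / 2) (𝔐.g.smF_koszul hX hY hZ)) ?_
  filter_upwards [hX.eventually_diffAt, hY.eventually_diffAt, hZ.eventually_diffAt] with y h1 h2 h3
  have := 𝔐.g.nabla_spec h1 h2 h3
  linarith

/-- An additive functional on vector fields that is linear over the smooth functions depends only
on the value of the vector field at the point. -/
lemma eq_of_smooth_tensorial (𝔐 : Background M) {V : Type*} [AddCommGroup V] [Module ℝ V]
    (Φ : VField M → V) (hcongr : ∀ Z Z' : VField M, Z =ᶠ[𝓝 x] Z' → Φ Z = Φ Z')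
    (hadd : ∀ Z Z' : VField M, Z.SmAt x → Z'.SmAt x → Φ (Z + Z') = Φ Z + Φ Z')
    (hsmul : ∀ (f : M → ℝ) (Z : VField M), SmF f x → Z.SmAt x → Φ (f • Z) = f x • Φ Z)
    (hX : X.SmAt x) (hY : Y.SmAt x) (h : X x = Y x) : Φ X = Φ Y := by
  obtain ⟨A, hA⟩ := exists_smoothNear 𝔐 x
  obtain ⟨h1, h2, h3, h4⟩ := hA.smAt
  have key : ∀ {Z : VField M}, Z.SmAt x → Φ Z =
      𝔐.g.val x (Z x) (A x).n • Φ (fun y ↦ (A y).l) + 𝔐.g.val x (Z x) (A x).l • Φ (fun y ↦ (A y).n)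
      + (-2 * 𝔐.g.val x (Z x) (A x).m.1) • Φ (fun y ↦ (A y).m.1)
      + (-2 * 𝔐.g.val x (Z x) (A x).m.2) • Φ (fun y ↦ (A y).m.2) := by
    intro Z hZ
    have c1 := 𝔐.g.smF_val hZ h2
    have c2 := 𝔐.g.smF_val hZ h1
    have c3 := smF_const_mul (-2) (𝔐.g.smF_val hZ h3)
    have c4 := smF_const_mul (-2) (𝔐.g.smF_val hZ h4)
    rw [← hsmul _ _ c1 h1, ← hsmul _ _ c2 h2, ← hsmul _ _ c3 h3, ← hsmul _ _ c4 h4,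
      ← hadd _ _ (h1.smul c1) (h2.smul c2), ← hadd _ _ ((h1.smul c1).add (h2.smul c2)) (h3.smul c3),
      ← hadd _ _ (((h1.smul c1).add (h2.smul c2)).add (h3.smul c3)) (h4.smul c4)]
    exact hcongr _ _ (Filter.Eventually.of_forall fun y ↦ (A y).expand (Z y))
  rw [key hX, key hY, h]

namespace LorentzMetric

lemma nabla_neg_left (g : LorentzMetric M) (hX : X.DiffAt x) (hY : Y.DiffAt x) :
    g.nabla (-X) Y x = -g.nabla X Y x := by
  have h := g.nabla_smul_left (f := fun _ ↦ (-1 : ℝ))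
    (contMDiffAt_const (n := ∞) |>.mdifferentiableAt (by simp)) hX hY
  have e : (fun _ : M ↦ (-1 : ℝ)) • X = -X := by ext1 y; simp
  rw [e] at h
  simpa using h

lemma nabla_congr_left (g : LorentzMetric M) (Y : VField M) {X X' : VField M} (e : X =ᶠ[𝓝 x] X') :
    g.nabla X Y x = g.nabla X' Y x := g.nabla_congr e .rfl

lemma nabla_congr_right (g : LorentzMetric M) (X : VField M) {Y Y' : VField M}
    (e : Y =ᶠ[𝓝 x] Y') : g.nabla X Y x = g.nabla X Y' x := g.nabla_congr .rfl e

lemma nabla_sub_left (g : LorentzMetric M) (hX : X.DiffAt x) (hY : Y.DiffAt x) (hZ : Z.DiffAt x) :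
    g.nabla (X - Y) Z x = g.nabla X Z x - g.nabla Y Z x := by
  have e : X = (X - Y) + Y := by ext1; simp
  have hXY : VField.DiffAt (X - Y) x := mdifferentiableAt_sub_section hX hY
  have := g.nabla_add_left hXY hY hZ
  rw [← e] at this
  rw [this]; abel

lemma nabla_sub_right (g : LorentzMetric M) (hX : X.DiffAt x) (hY : Y.DiffAt x) (hZ : Z.DiffAt x) :
    g.nabla X (Y - Z) x = g.nabla X Y x - g.nabla X Z x := by
  have e : Y = (Y - Z) + Z := by ext1; simp
  have hYZ : VField.DiffAt (Y - Z) x := mdifferentiableAt_sub_section hY hZ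
  have := g.nabla_add_right hX hYZ hZ
  rw [← e] at this
  rw [this]; abel

lemma curvatureOp_swap (g : LorentzMetric M) (hX : X.SmAt x) (hY : Y.SmAt x) (hZ : Z.SmAt x) :
    g.curvatureOp X Y Z x = -g.curvatureOp Y X Z x := by
  have e : VectorField.mlieBracket (𝓡 4) X Y = -VectorField.mlieBracket (𝓡 4) Y X :=
    VectorField.mlieBracket_swap
  simp only [curvatureOp]
  rw [e, g.nabla_neg_left (hY.bracket hX).diffAt hZ.diffAt]
  abel

lemma curvatureOp_congr (g : LorentzMetric M) {X' Y' Z' : VField M} (eX : X =ᶠ[𝓝 x] X')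
    (eY : Y =ᶠ[𝓝 x] Y') (eZ : Z =ᶠ[𝓝 x] Z') :
    g.curvatureOp X Y Z x = g.curvatureOp X' Y' Z' x := by
  have e1 : g.nabla Y Z =ᶠ[𝓝 x] g.nabla Y' Z' := by
    filter_upwards [eY.eventuallyEq_nhds, eZ.eventuallyEq_nhds] with y h1 h2
    exact g.nabla_congr h1 h2
  have e2 : g.nabla X Z =ᶠ[𝓝 x] g.nabla X' Z' := by
    filter_upwards [eX.eventuallyEq_nhds, eZ.eventuallyEq_nhds] with y h1 h2
    exact g.nabla_congr h1 h2
  have e3 : VectorField.mlieBracket (𝓡 4) X Y =ᶠ[𝓝 x] VectorField.mlieBracket (𝓡 4) X' Y' := by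
    filter_upwards [eX.eventuallyEq_nhds, eY.eventuallyEq_nhds] with y h1 h2
    exact h1.mlieBracket_vectorField_eq h2
  simp only [curvatureOp]
  rw [g.nabla_congr eX e1, g.nabla_congr eY e2, g.nabla_congr e3 eZ]

end LorentzMetric

lemma curvatureOp_add_right (hX : X.SmAt x) (hY : Y.SmAt x) (hZ : Z.SmAt x) (hW : W.SmAt x) :
    𝔐.g.curvatureOp X Y (Z + W) x = 𝔐.g.curvatureOp X Y Z x + 𝔐.g.curvatureOp X Y W x := by
  have e : ∀ {X : VField M}, X.SmAt x →
      𝔐.g.nabla X (Z + W) =ᶠ[𝓝 x] 𝔐.g.nabla X Z + 𝔐.g.nabla X W := by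
    intro X hX
    filter_upwards [hX.eventually_diffAt, hZ.eventually_diffAt, hW.eventually_diffAt]
      with y h1 h2 h3
    exact 𝔐.g.nabla_add_right h1 h2 h3
  simp only [LorentzMetric.curvatureOp]
  rw [𝔐.g.nabla_congr_right _ (e hY), 𝔐.g.nabla_congr_right _ (e hX),
    𝔐.g.nabla_add_right hX.diffAt (smAt_nabla 𝔐 hY hZ).diffAt (smAt_nabla 𝔐 hY hW).diffAt,
    𝔐.g.nabla_add_right hY.diffAt (smAt_nabla 𝔐 hX hZ).diffAt (smAt_nabla 𝔐 hX hW).diffAt,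
    𝔐.g.nabla_add_right (hX.bracket hY).diffAt hZ.diffAt hW.diffAt]
  abel

lemma curvatureOp_smul_right {f : M → ℝ} (hf : SmF f x) (hX : X.SmAt x) (hY : Y.SmAt x)
    (hZ : Z.SmAt x) : 𝔐.g.curvatureOp X Y (f • Z) x = f x • 𝔐.g.curvatureOp X Y Z x := by
  have e : ∀ {X : VField M}, X.SmAt x →
      𝔐.g.nabla X (f • Z) =ᶠ[𝓝 x] vderiv X f • Z + f • 𝔐.g.nabla X Z := by
    intro X hX
    filter_upwards [hX.eventually_diffAt, hZ.eventually_diffAt, hf.eventually_diF] with y h1 h2 h3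
    exact 𝔐.g.nabla_smul_right h3 h1 h2
  have key : ∀ {X Y : VField M}, X.SmAt x → Y.SmAt x → 𝔐.g.nabla X (𝔐.g.nabla Y (f • Z)) x =
      vderiv X (vderiv Y f) x • Z x + vderiv Y f x • 𝔐.g.nabla X Z x
        + (vderiv X f x • 𝔐.g.nabla Y Z x + f x • 𝔐.g.nabla X (𝔐.g.nabla Y Z) x) := by
    intro X Y hX hY
    rw [𝔐.g.nabla_congr_right _ (e hY), 𝔐.g.nabla_add_right hX.diffAt
      (hZ.smul (hf.vderiv hY)).diffAt ((smAt_nabla 𝔐 hY hZ).smul hf).diffAt,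
      𝔐.g.nabla_smul_right (hf.vderiv hY).diF hX.diffAt hZ.diffAt,
      𝔐.g.nabla_smul_right hf.diF hX.diffAt (smAt_nabla 𝔐 hY hZ).diffAt]
  simp only [LorentzMetric.curvatureOp]
  rw [key hX hY, key hY hX, 𝔐.g.nabla_smul_right hf.diF (hX.bracket hY).diffAt hZ.diffAt,
    vderiv_bracket hf hX hY]
  module

lemma curvatureOp_add_left (hX : X.SmAt x) (hY : Y.SmAt x) (hZ : Z.SmAt x) (hW : W.SmAt x) :
    𝔐.g.curvatureOp (X + Y) W Z x = 𝔐.g.curvatureOp X W Z x + 𝔐.g.curvatureOp Y W Z x := by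
  have e : 𝔐.g.nabla (X + Y) Z =ᶠ[𝓝 x] 𝔐.g.nabla X Z + 𝔐.g.nabla Y Z := by
    filter_upwards [hX.eventually_diffAt, hZ.eventually_diffAt, hY.eventually_diffAt]
      with y h1 h2 h3
    exact 𝔐.g.nabla_add_left h1 h3 h2
  have e2 : VectorField.mlieBracket (𝓡 4) (X + Y) W =ᶠ[𝓝 x]
      VectorField.mlieBracket (𝓡 4) X W + VectorField.mlieBracket (𝓡 4) Y W := by
    filter_upwards [hX.eventually_diffAt, hY.eventually_diffAt] with y h1 h2
    exact bracket_add_left h1 h2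
  simp only [LorentzMetric.curvatureOp]
  rw [𝔐.g.nabla_congr_right _ e, 𝔐.g.nabla_congr_left _ e2,
    𝔐.g.nabla_add_left hX.diffAt hY.diffAt (smAt_nabla 𝔐 hW hZ).diffAt,
    𝔐.g.nabla_add_right hW.diffAt (smAt_nabla 𝔐 hX hZ).diffAt (smAt_nabla 𝔐 hY hZ).diffAt,
    𝔐.g.nabla_add_left (hX.bracket hW).diffAt (hY.bracket hW).diffAt hZ.diffAt]
  abel

lemma curvatureOp_smul_left {f : M → ℝ} (hf : SmF f x) (hX : X.SmAt x) (hZ : Z.SmAt x)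
    (hW : W.SmAt x) : 𝔐.g.curvatureOp (f • X) W Z x = f x • 𝔐.g.curvatureOp X W Z x := by
  have e : 𝔐.g.nabla (f • X) Z =ᶠ[𝓝 x] f • 𝔐.g.nabla X Z := by
    filter_upwards [hX.eventually_diffAt, hZ.eventually_diffAt, hf.eventually_diF] with y h1 h2 h3
    exact 𝔐.g.nabla_smul_left h3 h1 h2
  have e2 : VectorField.mlieBracket (𝓡 4) (f • X) W =ᶠ[𝓝 x]
      f • VectorField.mlieBracket (𝓡 4) X W - vderiv W f • X := by
    filter_upwards [hX.eventually_diffAt, hf.eventually_diF] with y h1 h2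
    rw [bracket_smul_left h2 h1]
    simp only [Pi.sub_apply, Pi.smul_apply']
    abel
  simp only [LorentzMetric.curvatureOp]
  rw [𝔐.g.nabla_congr_right _ e, 𝔐.g.nabla_congr_left _ e2,
    𝔐.g.nabla_smul_left hf.diF hX.diffAt (smAt_nabla 𝔐 hW hZ).diffAt,
    𝔐.g.nabla_smul_right hf.diF hW.diffAt (smAt_nabla 𝔐 hX hZ).diffAt,
    𝔐.g.nabla_sub_left ((hX.bracket hW).smul hf).diffAt (hX.smul (hf.vderiv hW)).diffAt hZ.diffAt,
    𝔐.g.nabla_smul_left hf.diF (hX.bracket hW).diffAt hZ.diffAt,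
    𝔐.g.nabla_smul_left (hf.vderiv hW).diF hX.diffAt hZ.diffAt]
  module

/-- The curvature is a tensor. -/
lemma curvatureOp_tensorial {X' Y' Z' : VField M} (hX : X.SmAt x) (hX' : X'.SmAt x)
    (hY : Y.SmAt x) (hY' : Y'.SmAt x) (hZ : Z.SmAt x) (hZ' : Z'.SmAt x)
    (eX : X x = X' x) (eY : Y x = Y' x) (eZ : Z x = Z' x) :
    𝔐.g.curvatureOp X Y Z x = 𝔐.g.curvatureOp X' Y' Z' x := by
  have left : ∀ {X X' W : VField M}, X.SmAt x → X'.SmAt x → W.SmAt x → X x = X' x →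
      𝔐.g.curvatureOp X W Z x = 𝔐.g.curvatureOp X' W Z x := by
    intro X X' W hX hX' hW e
    refine eq_of_smooth_tensorial 𝔐 (fun V ↦ 𝔐.g.curvatureOp V W Z x) ?_ ?_ ?_ hX hX' e
    · intro V V' h; exact 𝔐.g.curvatureOp_congr h .rfl .rfl
    · intro V V' h h'; exact curvatureOp_add_left h h' hZ hW
    · intro f V hf h; exact curvatureOp_smul_left hf h hZ hW
  rw [left hX hX' hY eX, 𝔐.g.curvatureOp_swap hX' hY hZ, left hY hY' hX' eY,
    ← 𝔐.g.curvatureOp_swap hX' hY' hZ]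
  refine eq_of_smooth_tensorial 𝔐 (fun V ↦ 𝔐.g.curvatureOp X' Y' V x) ?_ ?_ ?_ hZ hZ' eZ
  · intro V V' h; exact 𝔐.g.curvatureOp_congr .rfl .rfl h
  · intro V V' h h'; exact curvatureOp_add_right hX' hY' h h'
  · intro f V hf h; exact curvatureOp_smul_right hf hX' hY' h

/-- Any smooth extensions of the vectors compute the curvature tensor. -/
lemma riemann_eq (u : TangentSpace (𝓡 4) x) (hX : X.SmAt x) (hY : Y.SmAt x) (hZ : Z.SmAt x) :
    𝔐.g.riemann x u (Z x) (X x) (Y x) = 𝔐.g.val x u (𝔐.g.curvatureOp X Y Z x) := by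
  rw [LorentzMetric.riemann, curvatureOp_tensorial (smAt_extend _) hX (smAt_extend _) hY
    (smAt_extend _) hZ] <;> exact FiberBundle.extend_apply_self _ _

/-! ### Symmetries of the curvature tensor -/

variable (𝔐)

lemma riemann_swap_right (u v w z : TangentSpace (𝓡 4) x) :
    𝔐.g.riemann x u v w z = -𝔐.g.riemann x u v z w := by
  rw [LorentzMetric.riemann, 𝔐.g.curvatureOp_swap (smAt_extend _) (smAt_extend _) (smAt_extend _),
    map_neg, LorentzMetric.riemann]

lemma riemann_add_fst (u u' v w z : TangentSpace (𝓡 4) x) :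
    𝔐.g.riemann x (u + u') v w z = 𝔐.g.riemann x u v w z + 𝔐.g.riemann x u' v w z := by
  simp [LorentzMetric.riemann]

lemma riemann_smul_fst (c : ℝ) (u v w z : TangentSpace (𝓡 4) x) :
    𝔐.g.riemann x (c • u) v w z = c * 𝔐.g.riemann x u v w z := by
  simp [LorentzMetric.riemann]

/-- Metric compatibility makes the curvature operators skew-adjoint. -/
lemma riemann_swap_left (u v w z : TangentSpace (𝓡 4) x) :
    𝔐.g.riemann x u v w z = -𝔐.g.riemann x v u w z := by
  let X : VField M := FiberBundle.extend E4 w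
  let Y : VField M := FiberBundle.extend E4 z
  let U : VField M := FiberBundle.extend E4 u
  let V : VField M := FiberBundle.extend E4 v
  have hX : X.SmAt x := smAt_extend _
  have hY : Y.SmAt x := smAt_extend _
  have hU : U.SmAt x := smAt_extend _
  have hV : V.SmAt x := smAt_extend _
  have eX : X x = w := FiberBundle.extend_apply_self _ _
  have eY : Y x = z := FiberBundle.extend_apply_self _ _
  have eU : U x = u := FiberBundle.extend_apply_self _ _
  have eV : V x = v := FiberBundle.extend_apply_self _ _
  rw [← eX, ← eY, ← eU, ← eV, riemann_eq _ hX hY hV, riemann_eq _ hX hY hU]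
  -- the second derivative of `g(U, V)`, whose antisymmetrization vanishes up to the bracket
  have key : ∀ {X Y : VField M}, X.SmAt x → Y.SmAt x →
      vderiv X (vderiv Y (fun y ↦ 𝔐.g.val y (U y) (V y))) x
        = 𝔐.g.val x (𝔐.g.nabla X (𝔐.g.nabla Y U) x) (V x)
          + 𝔐.g.val x (𝔐.g.nabla Y U x) (𝔐.g.nabla X V x)
          + (𝔐.g.val x (𝔐.g.nabla X U x) (𝔐.g.nabla Y V x)
          + 𝔐.g.val x (U x) (𝔐.g.nabla X (𝔐.g.nabla Y V) x)) := by
    intro X Y hX hY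
    have hYU := smAt_nabla 𝔐 hY hU
    have hYV := smAt_nabla 𝔐 hY hV
    have e : vderiv Y (fun y ↦ 𝔐.g.val y (U y) (V y)) =ᶠ[𝓝 x]
        (fun y ↦ 𝔐.g.val y (𝔐.g.nabla Y U y) (V y))
          + fun y ↦ 𝔐.g.val y (U y) (𝔐.g.nabla Y V y) := by
      filter_upwards [hY.eventually_diffAt, hU.eventually_diffAt, hV.eventually_diffAt]
        with y h1 h2 h3
      exact 𝔐.g.nabla_metric h1 h2 h3
    rw [vderiv_congr e, vderiv_add (𝔐.g.diF_val hYU.diffAt hV.diffAt)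
      (𝔐.g.diF_val hU.diffAt hYV.diffAt), 𝔐.g.nabla_metric hX.diffAt hYU.diffAt hV.diffAt,
      𝔐.g.nabla_metric hX.diffAt hU.diffAt hYV.diffAt]
  have h := vderiv_bracket (𝔐.g.smF_val hU hV) hX hY
  rw [key hX hY, key hY hX, 𝔐.g.nabla_metric (hX.bracket hY).diffAt hU.diffAt hV.diffAt] at h
  simp only [LorentzMetric.curvatureOp, map_sub]
  rw [𝔐.g.symm x (V x), 𝔐.g.symm x (V x), 𝔐.g.symm x (V x)]
  linarith

/-- The first Bianchi identity. -/
lemma riemann_cyclic (u v w z : TangentSpace (𝓡 4) x) :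
    𝔐.g.riemann x u v w z + 𝔐.g.riemann x u w z v + 𝔐.g.riemann x u z v w = 0 := by
  let X : VField M := FiberBundle.extend E4 w
  let Y : VField M := FiberBundle.extend E4 z
  let V : VField M := FiberBundle.extend E4 v
  have hX : X.SmAt x := smAt_extend _
  have hY : Y.SmAt x := smAt_extend _
  have hV : V.SmAt x := smAt_extend _
  have eX : X x = w := FiberBundle.extend_apply_self _ _
  have eY : Y x = z := FiberBundle.extend_apply_self _ _
  have eV : V x = v := FiberBundle.extend_apply_self _ _
  rw [← eX, ← eY, ← eV, riemann_eq _ hX hY hV, riemann_eq _ hY hV hX, riemann_eq _ hV hX hY,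
    ← map_add, ← map_add]
  -- by the vanishing of the torsion, used twice, the cyclic sum is reduced to the Jacobi identity
  have tors : ∀ {X Y V : VField M}, X.SmAt x → Y.SmAt x → V.SmAt x →
      𝔐.g.nabla X (𝔐.g.nabla Y V) x - 𝔐.g.nabla X (𝔐.g.nabla V Y) x
        = 𝔐.g.nabla (VectorField.mlieBracket (𝓡 4) Y V) X x
          + VectorField.mlieBracket (𝓡 4) X (VectorField.mlieBracket (𝓡 4) Y V) x := by
    intro X Y V hX hY hV
    have e : VectorField.mlieBracket (𝓡 4) Y V =ᶠ[𝓝 x] 𝔐.g.nabla Y V - 𝔐.g.nabla V Y := by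
      filter_upwards [hY.eventually_diffAt, hV.eventually_diffAt] with y h1 h2
      exact (𝔐.g.nabla_torsion h1 h2).symm
    rw [← 𝔐.g.nabla_sub_right hX.diffAt (smAt_nabla 𝔐 hY hV).diffAt (smAt_nabla 𝔐 hV hY).diffAt,
      ← 𝔐.g.nabla_congr (.refl _ X) e, ← 𝔐.g.nabla_torsion hX.diffAt (hY.bracket hV).diffAt]
    abel
  have h1 := tors hX hY hV
  have h2 := tors hY hV hX
  have h3 := tors hV hX hY
  have J := bracket_jacobi hX hY hV
  have s1 : VectorField.mlieBracket (𝓡 4) (VectorField.mlieBracket (𝓡 4) X Y) V x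
      = -VectorField.mlieBracket (𝓡 4) V (VectorField.mlieBracket (𝓡 4) X Y) x :=
    VectorField.mlieBracket_swap_apply
  have s2 : VectorField.mlieBracket (𝓡 4) Y (VectorField.mlieBracket (𝓡 4) X V) x
      = -VectorField.mlieBracket (𝓡 4) Y (VectorField.mlieBracket (𝓡 4) V X) x := by
    rw [VectorField.mlieBracket_swap (V := X) (W := V)]
    have := bracket_smul_right (X := Y) (f := fun _ : M ↦ (-1 : ℝ)) (x := x)
      (contMDiffAt_const (n := ∞) |>.mdifferentiableAt (by simp)) (hV.bracket hX).diffAt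
    have e : (fun _ : M ↦ (-1 : ℝ)) • VectorField.mlieBracket (𝓡 4) V X
      = -VectorField.mlieBracket (𝓡 4) V X := by ext1 y; simp
    rw [e] at this
    have h0 : vderiv Y (fun _ : M ↦ (-1 : ℝ)) x = 0 := by
      simp only [vderiv, mvfderiv_const]; rfl
    simpa [h0] using this
  rw [s1, s2] at J
  have : 𝔐.g.curvatureOp X Y V x + 𝔐.g.curvatureOp Y V X x + 𝔐.g.curvatureOp V X Y x = 0 := by
    simp only [LorentzMetric.curvatureOp]
    linear_combination (norm := module) h1 + h2 + h3 + J
  rw [this, map_zero]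

/-- The curvature tensor is symmetric under the exchange of its pairs: this follows from the skew
symmetries and the four instances of the first Bianchi identity for `u, v, w, z`. -/
lemma riemann_pair (u v w z : TangentSpace (𝓡 4) x) :
    𝔐.g.riemann x u v w z = 𝔐.g.riemann x w z u v := by
  have h1 := riemann_cyclic 𝔐 u v w z
  have h2 := riemann_cyclic 𝔐 v w z u
  have h3 := riemann_cyclic 𝔐 w z u v
  have h4 := riemann_cyclic 𝔐 z u v w
  have a := riemann_swap_left 𝔐 (x := x)
  have b := riemann_swap_right 𝔐 (x := x)
  have e1 := b v w z u
  have e2 := a v z u w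
  have e3 := a v u w z
  have e4 := a w u v z
  have e5 := b u w v z
  have e6 := a w v z u
  have e7 := a z u v w
  have e8 := b z v w u
  have e9 := a z w u v
  linarith

end Curvature

/-! ### The vacuum curvature tensor -/

section Vacuum

variable (𝔐 : Background M) {x : M}

/-- In vacuum the Weyl tensor is the curvature tensor. -/
lemma weyl_eq_riemann (u v w z : TangentSpace (𝓡 4) x) :
    𝔐.g.weyl x u v w z = 𝔐.g.riemann x u v w z := by
  have h : 𝔐.g.ricci x = fun _ _ ↦ 0 := by ext v w; exact 𝔐.vacuum x v w
  have h2 : 𝔐.g.scalarCurvature x = 0 := by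
    simp [LorentzMetric.scalarCurvature, LorentzMetric.metricTrace, h]
  simp [LorentzMetric.weyl, h, h2]

lemma weyl_swap_right (u v w z : TangentSpace (𝓡 4) x) :
    𝔐.g.weyl x u v w z = -𝔐.g.weyl x u v z w := by
  simp only [weyl_eq_riemann]; exact riemann_swap_right 𝔐 u v w z

lemma weyl_pair (u v w z : TangentSpace (𝓡 4) x) :
    𝔐.g.weyl x u v w z = 𝔐.g.weyl x w z u v := by
  simp only [weyl_eq_riemann]; exact riemann_pair 𝔐 u v w z

lemma weyl_cyclic (u v w z : TangentSpace (𝓡 4) x) :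
    𝔐.g.weyl x u v w z + 𝔐.g.weyl x u w z v + 𝔐.g.weyl x u z v w = 0 := by
  simp only [weyl_eq_riemann]; exact riemann_cyclic 𝔐 u v w z

lemma weyl_lin_fst (c d : ℝ) (u u' v w z : TangentSpace (𝓡 4) x) :
    𝔐.g.weyl x (c • u + d • u') v w z = c * 𝔐.g.weyl x u v w z + d * 𝔐.g.weyl x u' v w z := by
  simp only [weyl_eq_riemann, riemann_add_fst, riemann_smul_fst]

lemma weyl_zero_fst (v w z : TangentSpace (𝓡 4) x) : 𝔐.g.weyl x 0 v w z = 0 := by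
  simpa using weyl_lin_fst 𝔐 0 0 (0 : TangentSpace (𝓡 4) x) 0 v w z

lemma weyl_lin_trd (c d : ℝ) (u v w w' z : TangentSpace (𝓡 4) x) :
    𝔐.g.weyl x u v (c • w + d • w') z = c * 𝔐.g.weyl x u v w z + d * 𝔐.g.weyl x u v w' z := by
  rw [weyl_pair, weyl_lin_fst, weyl_pair 𝔐 w, weyl_pair 𝔐 w']

variable {𝔐}

/-- The metric trace of a bilinear form in a null tetrad. -/
lemma metricTrace_eq (a : NullTetrad 𝔐 x)
    (B : TangentSpace (𝓡 4) x → TangentSpace (𝓡 4) x → ℝ)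
    (h1 : ∀ c d u u' v, B (c • u + d • u') v = c * B u v + d * B u' v)
    (h2 : ∀ c d u v v', B u (c • v + d • v') = c * B u v + d * B u v') :
    𝔐.g.metricTrace x B = B a.l a.n + B a.n a.l - 2 * B a.m.1 a.m.1 - 2 * B a.m.2 a.m.2 := by
  have he := (𝔐.g.signature x).choose_spec
  set e := (𝔐.g.signature x).choose with e_def
  have zero : ∀ v, B 0 v = 0 := by intro v; simpa using h1 0 0 0 0 v
  have sm : ∀ (c : ℝ) u v, B (c • u) v = c * B u v := by
    intro c u v; simpa [zero] using h1 c 0 u 0 v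
  have ad : ∀ u u' v, B (u + u') v = B u v + B u' v := by
    intro u u' v; simpa using h1 1 1 u u' v
  -- summing the expansion of the first slot over the orthonormal basis
  have key : ∀ u v : TangentSpace (𝓡 4) x,
      B u v = ∑ i, eta i * 𝔐.g.val x u (e i) * B (e i) v := by
    intro u v
    conv_lhs => rw [𝔐.g.expand_of_orthonormal he u]
    simp only [Fin.sum_univ_four, ad, sm]
  have term : ∀ i, B (e i) (e i) = 𝔐.g.val x a.n (e i) * B (e i) a.l
      + 𝔐.g.val x a.l (e i) * B (e i) a.n + (-2 * 𝔐.g.val x a.m.1 (e i)) * B (e i) a.m.1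
      + (-2 * 𝔐.g.val x a.m.2 (e i)) * B (e i) a.m.2 := by
    intro i
    have e3 : ∀ (c d r t : ℝ) (p q s k : TangentSpace (𝓡 4) x),
        B (e i) (c • p + d • q + r • s + t • k)
          = c * B (e i) p + d * B (e i) q + r * B (e i) s + t * B (e i) k := by
      intro c d r t p q s k
      have := h2 1 t (e i) (c • p + d • q + r • s) k
      have h4 := h2 1 r (e i) (c • p + d • q) s
      rw [one_smul] at this h4
      rw [this, h4, h2]; ring
    have := e3 (𝔐.g.val x (e i) a.n) (𝔐.g.val x (e i) a.l) (-2 * 𝔐.g.val x (e i) a.m.1)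
      (-2 * 𝔐.g.val x (e i) a.m.2) a.l a.n a.m.1 a.m.2
    rw [← a.expand (e i)] at this
    rw [this, 𝔐.g.symm x a.n, 𝔐.g.symm x a.l, 𝔐.g.symm x a.m.1, 𝔐.g.symm x a.m.2]
  rw [LorentzMetric.metricTrace, key a.l a.n, key a.n a.l, key a.m.1 a.m.1, key a.m.2 a.m.2,
    ← e_def]
  simp only [term, Fin.sum_univ_four]
  ring

/-- The vacuum equations in a null tetrad. -/
lemma ricci_tetrad (a : NullTetrad 𝔐 x) (v z : TangentSpace (𝓡 4) x) :
    𝔐.g.weyl x a.l v a.n z + 𝔐.g.weyl x a.n v a.l z - 2 * 𝔐.g.weyl x a.m.1 v a.m.1 z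
      - 2 * 𝔐.g.weyl x a.m.2 v a.m.2 z = 0 := by
  have h := 𝔐.vacuum x v z
  have h2 := metricTrace_eq a (fun u w ↦ 𝔐.g.weyl x u v w z)
    (fun c d u u' w ↦ weyl_lin_fst 𝔐 c d u u' v w z)
    (fun c d u w w' ↦ weyl_lin_trd 𝔐 c d u v w w' z)
  rw [← h2, ← h, LorentzMetric.ricci]
  simp only [weyl_eq_riemann]

/-! ### Complexified tensors -/

lemma smulT_eq (z : ℂ) (u : CTangent x) :
    smulT z u = (z.re • u.1 - z.im • u.2, z.re • u.2 + z.im • u.1) := rfl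

lemma cweyl_split (u v w z : CTangent x) :
    𝔐.g.cweyl x u v w z = 𝔐.g.cweyl x (ofReal u.1) v w z
      + Complex.I * 𝔐.g.cweyl x (ofReal u.2) v w z := by
  simp [LorentzMetric.cweyl, part, ofReal, weyl_zero_fst, pow_add]
  ring_nf
  rw [Complex.I_sq]
  ring

lemma cweyl_ofReal_lin (c d : ℝ) (p q : TangentSpace (𝓡 4) x) (v w z : CTangent x) :
    𝔐.g.cweyl x (ofReal (c • p + d • q)) v w z = c * 𝔐.g.cweyl x (ofReal p) v w z
      + d * 𝔐.g.cweyl x (ofReal q) v w z := by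
  simp [LorentzMetric.cweyl, part, ofReal, weyl_zero_fst, weyl_lin_fst, pow_add]
  ring

lemma cweyl_add_fst (u u' v w z : CTangent x) :
    𝔐.g.cweyl x (u + u') v w z = 𝔐.g.cweyl x u v w z + 𝔐.g.cweyl x u' v w z := by
  have h1 := cweyl_ofReal_lin (𝔐 := 𝔐) 1 1 u.1 u'.1 v w z
  have h2 := cweyl_ofReal_lin (𝔐 := 𝔐) 1 1 u.2 u'.2 v w z
  simp only [one_smul, Complex.ofReal_one, one_mul] at h1 h2
  rw [cweyl_split (u + u'), cweyl_split u, cweyl_split u', Prod.fst_add, Prod.snd_add, h1, h2]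
  ring

lemma cweyl_smul_fst (c : ℂ) (u v w z : CTangent x) :
    𝔐.g.cweyl x (smulT c u) v w z = c * 𝔐.g.cweyl x u v w z := by
  have h1 := cweyl_ofReal_lin (𝔐 := 𝔐) c.re (-c.im) u.1 u.2 v w z
  have h2 := cweyl_ofReal_lin (𝔐 := 𝔐) c.re c.im u.2 u.1 v w z
  rw [cweyl_split (smulT c u), cweyl_split u]
  simp only [smulT_eq]
  rw [sub_eq_add_neg, ← neg_smul, h1, h2]
  conv_rhs => rw [← Complex.re_add_im c]
  push_cast
  linear_combination (-(c.im : ℂ) * 𝔐.g.cweyl x (ofReal u.2) v w z) * Complex.I_sq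

lemma cweyl_swap_right (u v w z : CTangent x) :
    𝔐.g.cweyl x u v w z = -𝔐.g.cweyl x u v z w := by
  simp only [LorentzMetric.cweyl, ← Finset.sum_neg_distrib]
  refine Finset.sum_congr rfl fun i _ ↦ Finset.sum_congr rfl fun j _ ↦ ?_
  rw [Finset.sum_comm]
  refine Finset.sum_congr rfl fun k _ ↦ Finset.sum_congr rfl fun l _ ↦ ?_
  rw [weyl_swap_right, add_right_comm]; push_cast; ring

lemma cweyl_pair (u v w z : CTangent x) :
    𝔐.g.cweyl x u v w z = 𝔐.g.cweyl x w z u v := by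
  have e : ∀ i j k l, 𝔐.g.weyl x (part u i) (part v j) (part w k) (part z l)
    = 𝔐.g.weyl x (part w k) (part z l) (part u i) (part v j) := fun i j k l ↦ weyl_pair 𝔐 _ _ _ _
  simp only [LorentzMetric.cweyl, Fin.sum_univ_two, e, pow_add]
  ring

lemma cweyl_cyclic (u v w z : CTangent x) :
    𝔐.g.cweyl x u v w z + 𝔐.g.cweyl x u w z v + 𝔐.g.cweyl x u z v w = 0 := by
  have e : ∀ i j k l, (𝔐.g.weyl x (part u i) (part v j) (part w k) (part z l) : ℂ)
    = - 𝔐.g.weyl x (part u i) (part w k) (part z l) (part v j)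
      - 𝔐.g.weyl x (part u i) (part z l) (part v j) (part w k) := by
    intro i j k l
    have := weyl_cyclic 𝔐 (part u i) (part v j) (part w k) (part z l)
    rw [← Complex.ofReal_neg, ← Complex.ofReal_sub]
    congr 1; linarith
  simp only [LorentzMetric.cweyl, Fin.sum_univ_two, e, pow_add]
  ring

lemma cweyl_swap_left (u v w z : CTangent x) :
    𝔐.g.cweyl x u v w z = -𝔐.g.cweyl x v u w z := by
  rw [cweyl_pair, cweyl_swap_right, cweyl_pair w z]

lemma cweyl_conj (u v w z : CTangent x) :
    𝔐.g.cweyl x (conjT u) (conjT v) (conjT w) (conjT z) = star (𝔐.g.cweyl x u v w z) := by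
  have h1 : ∀ v w z : TangentSpace (𝓡 4) x, ∀ u, 𝔐.g.weyl x (-u) v w z = -𝔐.g.weyl x u v w z := by
    intro v w z u
    simpa using weyl_lin_fst 𝔐 (-1) 0 u 0 v w z
  have h3 : ∀ u v z w : TangentSpace (𝓡 4) x, 𝔐.g.weyl x u v (-w) z = -𝔐.g.weyl x u v w z := by
    intro u v z w; rw [weyl_pair, h1, weyl_pair]
  have h4 : ∀ u v w z : TangentSpace (𝓡 4) x, 𝔐.g.weyl x u v w (-z) = -𝔐.g.weyl x u v w z := by
    intro u v w z; rw [weyl_swap_right, h3, weyl_swap_right, neg_neg]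
  have h2 : ∀ u w z v : TangentSpace (𝓡 4) x, 𝔐.g.weyl x u (-v) w z = -𝔐.g.weyl x u v w z := by
    intro u w z v; rw [weyl_pair, h4, weyl_pair]
  simp only [LorentzMetric.cweyl, Fin.sum_univ_two, part, conjT]
  simp [h1, h2, h3, h4]

lemma cval_symm (g : LorentzMetric M) (u v : CTangent x) : g.cval x u v = g.cval x v u := by
  simp only [LorentzMetric.cval_eq, g.symm x v.1, g.symm x v.2]
  push_cast; ring

lemma cval_add_left (g : LorentzMetric M) (u u' v : CTangent x) :
    g.cval x (u + u') v = g.cval x u v + g.cval x u' v := by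
  simp only [LorentzMetric.cval_eq, Prod.fst_add, Prod.snd_add, map_add, add_apply]
  push_cast; ring

lemma cval_smul_left (g : LorentzMetric M) (c : ℂ) (u v : CTangent x) :
    g.cval x (smulT c u) v = c * g.cval x u v := by
  simp only [LorentzMetric.cval_eq, smulT_eq, map_add, map_sub, map_smul, add_apply, sub_apply,
    smul_apply, smul_eq_mul]
  conv_rhs => rw [← Complex.re_add_im c]
  push_cast
  linear_combination (-(c.im : ℂ) * (g.val x u.1 v.2 + g.val x u.2 v.1)) * Complex.I_sq

lemma cval_add_right (g : LorentzMetric M) (u v v' : CTangent x) :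
    g.cval x u (v + v') = g.cval x u v + g.cval x u v' := by
  rw [cval_symm, cval_add_left, cval_symm g v, cval_symm g v']

lemma cval_smul_right (g : LorentzMetric M) (c : ℂ) (u v : CTangent x) :
    g.cval x u (smulT c v) = c * g.cval x u v := by
  rw [cval_symm, cval_smul_left, cval_symm]

lemma neg_eq_smulT (u : CTangent x) : -u = smulT (-1) u := by
  ext1 <;> simp [smulT]

lemma cval_sub_left (g : LorentzMetric M) (u u' v : CTangent x) :
    g.cval x (u - u') v = g.cval x u v - g.cval x u' v := by
  rw [sub_eq_add_neg, neg_eq_smulT, cval_add_left, cval_smul_left]; ring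

lemma cval_sub_right (g : LorentzMetric M) (u v v' : CTangent x) :
    g.cval x u (v - v') = g.cval x u v - g.cval x u v' := by
  rw [cval_symm, cval_sub_left, cval_symm g v, cval_symm g v']

lemma cval_conj (g : LorentzMetric M) (u v : CTangent x) :
    g.cval x (conjT u) (conjT v) = star (g.cval x u v) := by
  apply Complex.ext <;>
    simp [LorentzMetric.cval_re, LorentzMetric.cval_im, conjT]
  ring

lemma conjT_conjT (u : CTangent x) : conjT (conjT u) = u := by ext1 <;> simp [conjT]

lemma conjT_ofReal (u : TangentSpace (𝓡 4) x) : conjT (ofReal u) = ofReal u := by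
  simp [conjT, ofReal]

lemma cval_ofReal (g : LorentzMetric M) (u v : TangentSpace (𝓡 4) x) :
    g.cval x (ofReal u) (ofReal v) = g.val x u v := by
  simp [LorentzMetric.cval_eq, ofReal]

end Vacuum

/-! ### Calculus of complex vector fields -/

/-- Smoothness at a point of a complex vector field. -/
structure CVField.SmAt (X : CVField M) (x : M) : Prop where
  fst : VField.SmAt (fun y ↦ (X y).1) x
  snd : VField.SmAt (fun y ↦ (X y).2) x

/-- The complex bilinear extension of the Lie bracket. -/
def cbracket (X Y : CVField M) : CVField M := fun x ↦
  (VectorField.mlieBracket (𝓡 4) (fun y ↦ (X y).1) (fun y ↦ (Y y).1) x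
    - VectorField.mlieBracket (𝓡 4) (fun y ↦ (X y).2) (fun y ↦ (Y y).2) x,
   VectorField.mlieBracket (𝓡 4) (fun y ↦ (X y).1) (fun y ↦ (Y y).2) x
    + VectorField.mlieBracket (𝓡 4) (fun y ↦ (X y).2) (fun y ↦ (Y y).1) x)

section CDeriv

variable {𝔐 : Background M} {x : M} {X Y Z W : CVField M} {f h : M → ℂ}

lemma mvfderiv_clm {F G : Type*} [NormedAddCommGroup F] [NormedSpace ℝ F] [NormedAddCommGroup G]
    [NormedSpace ℝ G] (L : F →L[ℝ] G) {f : M → F} (hf : DiF f x) (v : TangentSpace (𝓡 4) x) :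
    mvfderiv (𝓡 4) (fun y ↦ L (f y)) x v = L (mvfderiv (𝓡 4) f x v) := by
  have h := (L.hasMFDerivAt (x := f x)).comp x hf.hasMFDerivAt
  have e : mfderiv (𝓡 4) 𝓘(ℝ, G) (fun y ↦ L (f y)) x = _ := h.mfderiv
  simp only [mvfderiv]
  rw [e]
  rfl

lemma SmF.re (hf : SmF f x) : SmF (fun y ↦ (f y).re) x :=
  (Complex.reCLM.contDiff.contMDiff.contMDiffAt).comp x hf

lemma SmF.im (hf : SmF f x) : SmF (fun y ↦ (f y).im) x :=
  (Complex.imCLM.contDiff.contMDiff.contMDiffAt).comp x hf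

lemma smF_ofReal {f : M → ℝ} (hf : SmF f x) : SmF (fun y ↦ (f y : ℂ)) x :=
  (Complex.ofRealCLM.contDiff.contMDiff.contMDiffAt).comp x hf

lemma SmF.cadd (hf : SmF f x) (hh : SmF h x) : SmF (fun y ↦ f y + h y) x := ContMDiffAt.add hf hh
lemma SmF.csub (hf : SmF f x) (hh : SmF h x) : SmF (fun y ↦ f y - h y) x := ContMDiffAt.sub hf hh
lemma SmF.cmul (hf : SmF f x) (hh : SmF h x) : SmF (fun y ↦ f y * h y) x :=
  (contDiff_mul (𝕜 := ℝ) (𝔸 := ℂ)).contMDiff.contMDiffAt.comp x (hf.prodMk_space hh)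
lemma smF_const (c : ℂ) : SmF (fun _ : M ↦ c) x := contMDiffAt_const
lemma SmF.star (hf : SmF f x) : SmF (fun y ↦ star (f y)) x :=
  (Complex.conjCLE.contDiff.contMDiff.contMDiffAt).comp x hf

lemma cderiv_re (hf : DiF f x) :
    (cderiv X f x).re = vderiv (fun y ↦ (X y).1) (fun y ↦ (f y).re) x
      - vderiv (fun y ↦ (X y).2) (fun y ↦ (f y).im) x := by
  have h1 := mvfderiv_clm Complex.reCLM hf (X x).1
  have h2 := mvfderiv_clm Complex.imCLM hf (X x).2
  simp only [Complex.reCLM_apply, Complex.imCLM_apply] at h1 h2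
  simp [cderiv, vderiv, h1, h2, sub_eq_add_neg]

lemma cderiv_im (hf : DiF f x) :
    (cderiv X f x).im = vderiv (fun y ↦ (X y).1) (fun y ↦ (f y).im) x
      + vderiv (fun y ↦ (X y).2) (fun y ↦ (f y).re) x := by
  have h1 := mvfderiv_clm Complex.imCLM hf (X x).1
  have h2 := mvfderiv_clm Complex.reCLM hf (X x).2
  simp only [Complex.reCLM_apply, Complex.imCLM_apply] at h1 h2
  simp [cderiv, vderiv, h1, h2]

lemma SmF.cderiv (hf : SmF f x) (hX : X.SmAt x) : SmF (cderiv X f) x :=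
  (smF_mvfderiv hf hX.fst).cadd ((smF_const Complex.I).cmul (smF_mvfderiv hf hX.snd))

lemma cderiv_congr (e : f =ᶠ[𝓝 x] h) : Teukolsky.cderiv X f x = Teukolsky.cderiv X h x := by
  simp only [Teukolsky.cderiv, mvfderiv_congr e]

lemma cderiv_add (hf : DiF f x) (hh : DiF h x) :
    Teukolsky.cderiv X (fun y ↦ f y + h y) x
      = Teukolsky.cderiv X f x + Teukolsky.cderiv X h x := by
  have := mvfderiv_add hf hh
  change mvfderiv (𝓡 4) (fun y ↦ f y + h y) x = _ at this
  simp only [Teukolsky.cderiv, this, add_apply]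
  ring

lemma cderiv_sub (hf : DiF f x) (hh : DiF h x) :
    Teukolsky.cderiv X (fun y ↦ f y - h y) x
      = Teukolsky.cderiv X f x - Teukolsky.cderiv X h x := by
  have := mvfderiv_sub hf hh
  change mvfderiv (𝓡 4) (fun y ↦ f y - h y) x = _ at this
  simp only [Teukolsky.cderiv, this, sub_apply]
  ring

lemma cderiv_mul (hf : DiF f x) (hh : DiF h x) :
    Teukolsky.cderiv X (fun y ↦ f y * h y) x
      = f x * Teukolsky.cderiv X h x + h x * Teukolsky.cderiv X f x := by
  have key : ∀ v, mvfderiv (𝓡 4) (fun y ↦ f y * h y) x v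
      = f x * mvfderiv (𝓡 4) h x v + h x * mvfderiv (𝓡 4) f x v := by
    intro v
    have := (hf.hasMFDerivAt.mul hh.hasMFDerivAt).mfderiv
    change mfderiv (𝓡 4) 𝓘(ℝ, ℂ) (fun y ↦ f y * h y) x = _ at this
    simp only [mvfderiv]
    rw [this]
    rfl
  simp only [Teukolsky.cderiv, key]
  ring

lemma cderiv_const (c : ℂ) : Teukolsky.cderiv X (fun _ : M ↦ c) x = 0 := by
  simp only [Teukolsky.cderiv, mvfderiv_const]
  simp

lemma cderiv_const_mul (c : ℂ) (hf : DiF f x) :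
    Teukolsky.cderiv X (fun y ↦ c * f y) x = c * Teukolsky.cderiv X f x := by
  rw [cderiv_mul (contMDiffAt_const (n := ∞) |>.mdifferentiableAt (by simp)) hf, cderiv_const]
  ring

/-- The derivative along a complex vector field is linear in the vector. -/
lemma cderiv_smulT (c : M → ℂ) :
    Teukolsky.cderiv (fun y ↦ smulT (c y) (X y)) f x = c x * Teukolsky.cderiv X f x := by
  simp only [Teukolsky.cderiv, smulT, map_add, map_sub, map_smul, Complex.real_smul]
  conv_rhs => rw [← Complex.re_add_im (c x)]
  linear_combination (-((c x).im : ℂ) * mvfderiv (𝓡 4) f x (X x).2) * Complex.I_sq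

lemma CVField.SmAt.add (hX : X.SmAt x) (hY : Y.SmAt x) : CVField.SmAt (fun y ↦ X y + Y y) x :=
  ⟨hX.fst.add hY.fst, hX.snd.add hY.snd⟩

lemma CVField.SmAt.smulT (hf : SmF f x) (hX : X.SmAt x) :
    CVField.SmAt (fun y ↦ smulT (f y) (X y)) x :=
  ⟨(hX.fst.smul hf.re).sub (hX.snd.smul hf.im), (hX.snd.smul hf.re).add (hX.fst.smul hf.im)⟩

lemma CVField.SmAt.conjT (hX : X.SmAt x) : CVField.SmAt (fun y ↦ conjT (X y)) x :=
  ⟨hX.fst, hX.snd.neg⟩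

lemma VField.SmAt.ofReal {X : VField M} (hX : X.SmAt x) : CVField.SmAt (fun y ↦ ofReal (X y)) x :=
  ⟨hX, smAt_zero⟩

lemma CVField.SmAt.bracket (hX : X.SmAt x) (hY : Y.SmAt x) : (cbracket X Y).SmAt x :=
  ⟨(hX.fst.bracket hY.fst).sub (hX.snd.bracket hY.snd),
    (hX.fst.bracket hY.snd).add (hX.snd.bracket hY.fst)⟩

lemma CVField.SmAt.nabla (hX : X.SmAt x) (hY : Y.SmAt x) : (𝔐.g.cnabla X Y).SmAt x :=
  ⟨(smAt_nabla 𝔐 hX.fst hY.fst).sub (smAt_nabla 𝔐 hX.snd hY.snd),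
    (smAt_nabla 𝔐 hX.fst hY.snd).add (smAt_nabla 𝔐 hX.snd hY.fst)⟩

lemma smF_cval (g : LorentzMetric M) (hX : X.SmAt x) (hY : Y.SmAt x) :
    SmF (fun y ↦ g.cval y (X y) (Y y)) x := by
  simp only [LorentzMetric.cval_eq]
  exact (smF_ofReal ((g.smF_val hX.fst hY.fst).sub' (g.smF_val hX.snd hY.snd))).cadd
    ((smF_const Complex.I).cmul
      (smF_ofReal ((g.smF_val hX.fst hY.snd).add' (g.smF_val hX.snd hY.fst))))

lemma vderiv_add_left (X Y : VField M) (f : M → ℝ) :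
    vderiv (X + Y) f x = vderiv X f x + vderiv Y f x := by simp [vderiv]

lemma vderiv_sub_left (X Y : VField M) (f : M → ℝ) :
    vderiv (X - Y) f x = vderiv X f x - vderiv Y f x := by simp [vderiv]

lemma vderiv_sub {X : VField M} {f g : M → ℝ} (hf : DiF f x) (hg : DiF g x) :
    vderiv X (f - g) x = vderiv X f x - vderiv X g x := by
  simp [vderiv, mvfderiv_sub hf hg]

/-- The bracket of complex vector fields is the commutator of the derivations. -/
lemma cderiv_bracket (hf : SmF f x) (hX : X.SmAt x) (hY : Y.SmAt x) :
    Teukolsky.cderiv (cbracket X Y) f x = Teukolsky.cderiv X (Teukolsky.cderiv Y f) x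
      - Teukolsky.cderiv Y (Teukolsky.cderiv X f) x := by
  have e : ∀ {X : CVField M}, X.SmAt x →
      (fun y ↦ (Teukolsky.cderiv X f y).re) =ᶠ[𝓝 x] vderiv (fun y ↦ (X y).1) (fun y ↦ (f y).re)
        - vderiv (fun y ↦ (X y).2) (fun y ↦ (f y).im) ∧
      (fun y ↦ (Teukolsky.cderiv X f y).im) =ᶠ[𝓝 x] vderiv (fun y ↦ (X y).1) (fun y ↦ (f y).im)
        + vderiv (fun y ↦ (X y).2) (fun y ↦ (f y).re) := by
    intro X hX
    constructor <;> filter_upwards [hf.eventually_diF] with y hy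
    · exact cderiv_re hy
    · exact cderiv_im hy
  have r1 := hf.re.vderiv hX.fst
  have r2 := hf.re.vderiv hX.snd
  have i1 := hf.im.vderiv hX.fst
  have i2 := hf.im.vderiv hX.snd
  have r1' := hf.re.vderiv hY.fst
  have r2' := hf.re.vderiv hY.snd
  have i1' := hf.im.vderiv hY.fst
  have i2' := hf.im.vderiv hY.snd
  have b1 : (fun y ↦ (cbracket X Y y).1) = VectorField.mlieBracket (𝓡 4) (fun y ↦ (X y).1)
    (fun y ↦ (Y y).1) - VectorField.mlieBracket (𝓡 4) (fun y ↦ (X y).2) (fun y ↦ (Y y).2) := rfl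
  have b2 : (fun y ↦ (cbracket X Y y).2) = VectorField.mlieBracket (𝓡 4) (fun y ↦ (X y).1)
    (fun y ↦ (Y y).2) + VectorField.mlieBracket (𝓡 4) (fun y ↦ (X y).2) (fun y ↦ (Y y).1) := rfl
  apply Complex.ext
  · rw [Complex.sub_re, cderiv_re hf.diF, cderiv_re (hf.cderiv hY).diF,
      cderiv_re (hf.cderiv hX).diF, vderiv_congr (e hY).1, vderiv_congr (e hX).1,
      vderiv_congr (e hY).2, vderiv_congr (e hX).2, vderiv_sub r1'.diF i2'.diF,
      vderiv_sub r1.diF i2.diF, vderiv_add i1'.diF r2'.diF, vderiv_add i1.diF r2.diF, b1, b2,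
      vderiv_sub_left, vderiv_add_left, vderiv_bracket hf.re hX.fst hY.fst,
      vderiv_bracket hf.re hX.snd hY.snd, vderiv_bracket hf.im hX.fst hY.snd,
      vderiv_bracket hf.im hX.snd hY.fst]
    ring
  · rw [Complex.sub_im, cderiv_im hf.diF, cderiv_im (hf.cderiv hY).diF,
      cderiv_im (hf.cderiv hX).diF, vderiv_congr (e hY).1, vderiv_congr (e hX).1,
      vderiv_congr (e hY).2, vderiv_congr (e hX).2, vderiv_sub r1'.diF i2'.diF,
      vderiv_sub r1.diF i2.diF, vderiv_add i1'.diF r2'.diF, vderiv_add i1.diF r2.diF, b1, b2,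
      vderiv_sub_left, vderiv_add_left, vderiv_bracket hf.im hX.fst hY.fst,
      vderiv_bracket hf.im hX.snd hY.snd, vderiv_bracket hf.re hX.fst hY.snd,
      vderiv_bracket hf.re hX.snd hY.fst]
    ring

/-- The complexified connection is free of torsion. -/
lemma cnabla_torsion (hX : X.SmAt x) (hY : Y.SmAt x) :
    𝔐.g.cnabla X Y x - 𝔐.g.cnabla Y X x = cbracket X Y x := by
  have t11 := 𝔐.g.nabla_torsion hX.fst.diffAt hY.fst.diffAt
  have t12 := 𝔐.g.nabla_torsion hX.fst.diffAt hY.snd.diffAt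
  have t21 := 𝔐.g.nabla_torsion hX.snd.diffAt hY.fst.diffAt
  have t22 := 𝔐.g.nabla_torsion hX.snd.diffAt hY.snd.diffAt
  simp only [cbracket, LorentzMetric.cnabla, ← t11, ← t12, ← t21, ← t22]
  ext1
  · simp only [Prod.fst_sub]; abel
  · simp only [Prod.snd_sub]; abel

/-- The complexified connection is compatible with the metric. -/
lemma cnabla_metric (hX : X.SmAt x) (hY : Y.SmAt x) (hZ : Z.SmAt x) :
    Teukolsky.cderiv X (fun y ↦ 𝔐.g.cval y (Y y) (Z y)) x
      = 𝔐.g.cval x (𝔐.g.cnabla X Y x) (Z x) + 𝔐.g.cval x (Y x) (𝔐.g.cnabla X Z x) := by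
  have hs := (smF_cval 𝔐.g hY hZ).diF
  have er : (fun y ↦ (𝔐.g.cval y (Y y) (Z y)).re) = (fun y ↦ 𝔐.g.val y (Y y).1 (Z y).1)
      - fun y ↦ 𝔐.g.val y (Y y).2 (Z y).2 := by ext y; exact 𝔐.g.cval_re _ _
  have ei : (fun y ↦ (𝔐.g.cval y (Y y) (Z y)).im) = (fun y ↦ 𝔐.g.val y (Y y).1 (Z y).2)
      + fun y ↦ 𝔐.g.val y (Y y).2 (Z y).1 := by ext y; exact 𝔐.g.cval_im _ _
  have d11 := 𝔐.g.smF_val hY.fst hZ.fst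
  have d12 := 𝔐.g.smF_val hY.fst hZ.snd
  have d21 := 𝔐.g.smF_val hY.snd hZ.fst
  have d22 := 𝔐.g.smF_val hY.snd hZ.snd
  have met : ∀ {X Y Z : VField M}, X.SmAt x → Y.SmAt x → Z.SmAt x → _ :=
    fun {X Y Z} hX hY hZ ↦ 𝔐.g.nabla_metric (X := X) (Y := Y) (Z := Z) (x := x) hX.diffAt hY.diffAt
      hZ.diffAt
  apply Complex.ext
  · rw [cderiv_re hs, er, ei, vderiv_sub d11.diF d22.diF, vderiv_add d12.diF d21.diF,
      met hX.fst hY.fst hZ.fst, met hX.fst hY.snd hZ.snd, met hX.snd hY.fst hZ.snd,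
      met hX.snd hY.snd hZ.fst, Complex.add_re, 𝔐.g.cval_re, 𝔐.g.cval_re]
    simp only [LorentzMetric.cnabla, map_sub, map_add, add_apply, sub_apply]
    ring
  · rw [cderiv_im hs, er, ei, vderiv_sub d11.diF d22.diF, vderiv_add d12.diF d21.diF,
      met hX.snd hY.fst hZ.fst, met hX.snd hY.snd hZ.snd, met hX.fst hY.fst hZ.snd,
      met hX.fst hY.snd hZ.fst, Complex.add_im, 𝔐.g.cval_im, 𝔐.g.cval_im]
    simp only [LorentzMetric.cnabla, map_sub, map_add, add_apply, sub_apply]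
    ring

lemma cnabla_smulT_right (hf : SmF f x) (hX : X.SmAt x) (hY : Y.SmAt x) :
    𝔐.g.cnabla X (fun y ↦ smulT (f y) (Y y)) x
      = smulT (Teukolsky.cderiv X f x) (Y x) + smulT (f x) (𝔐.g.cnabla X Y x) := by
  have key : ∀ {X : VField M}, X.SmAt x →
      𝔐.g.nabla X (fun y ↦ (f y).re • (Y y).1 - (f y).im • (Y y).2) x
        = vderiv X (fun y ↦ (f y).re) x • (Y x).1 + (f x).re • 𝔐.g.nabla X (fun y ↦ (Y y).1) x
        - (vderiv X (fun y ↦ (f y).im) x • (Y x).2 + (f x).im • 𝔐.g.nabla X (fun y ↦ (Y y).2) x) ∧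
      𝔐.g.nabla X (fun y ↦ (f y).re • (Y y).2 + (f y).im • (Y y).1) x
        = vderiv X (fun y ↦ (f y).re) x • (Y x).2 + (f x).re • 𝔐.g.nabla X (fun y ↦ (Y y).2) x
        + (vderiv X (fun y ↦ (f y).im) x • (Y x).1
          + (f x).im • 𝔐.g.nabla X (fun y ↦ (Y y).1) x) := by
    intro X hX
    rw [← 𝔐.g.nabla_smul_right hf.re.diF hX.diffAt hY.fst.diffAt,
      ← 𝔐.g.nabla_smul_right hf.re.diF hX.diffAt hY.snd.diffAt,
      ← 𝔐.g.nabla_smul_right hf.im.diF hX.diffAt hY.fst.diffAt,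
      ← 𝔐.g.nabla_smul_right hf.im.diF hX.diffAt hY.snd.diffAt]
    exact ⟨𝔐.g.nabla_sub_right hX.diffAt (hY.fst.smul hf.re).diffAt (hY.snd.smul hf.im).diffAt,
      𝔐.g.nabla_add_right hX.diffAt (hY.snd.smul hf.re).diffAt (hY.fst.smul hf.im).diffAt⟩
  have k1 := key hX.fst
  have k2 := key hX.snd
  ext1
  · simp only [LorentzMetric.cnabla, smulT, cderiv_re hf.diF, cderiv_im hf.diF, k1.1, k2.2,
      Prod.fst_add]
    module
  · simp only [LorentzMetric.cnabla, smulT, cderiv_re hf.diF, cderiv_im hf.diF, k1.2, k2.1,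
      Prod.snd_add]
    module

lemma cnabla_add_right (hX : X.SmAt x) (hY : Y.SmAt x) (hZ : Z.SmAt x) :
    𝔐.g.cnabla X (fun y ↦ Y y + Z y) x = 𝔐.g.cnabla X Y x + 𝔐.g.cnabla X Z x := by
  have ad : ∀ {X Y Z : VField M}, X.SmAt x → Y.SmAt x → Z.SmAt x →
      𝔐.g.nabla X (fun y ↦ Y y + Z y) x = 𝔐.g.nabla X Y x + 𝔐.g.nabla X Z x :=
    fun {X Y Z} hX hY hZ ↦ 𝔐.g.nabla_add_right hX.diffAt hY.diffAt hZ.diffAt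
  ext1
  · simp only [LorentzMetric.cnabla, Prod.fst_add, Prod.snd_add, ad hX.fst hY.fst hZ.fst,
      ad hX.snd hY.snd hZ.snd]; abel
  · simp only [LorentzMetric.cnabla, Prod.fst_add, Prod.snd_add, ad hX.fst hY.snd hZ.snd,
      ad hX.snd hY.fst hZ.fst]; abel

lemma cnabla_add_left (hX : X.SmAt x) (hY : Y.SmAt x) (hZ : Z.SmAt x) :
    𝔐.g.cnabla (fun y ↦ X y + Y y) Z x = 𝔐.g.cnabla X Z x + 𝔐.g.cnabla Y Z x := by
  have ad : ∀ {X Y Z : VField M}, X.SmAt x → Y.SmAt x → Z.SmAt x →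
      𝔐.g.nabla (fun y ↦ X y + Y y) Z x = 𝔐.g.nabla X Z x + 𝔐.g.nabla Y Z x :=
    fun {X Y Z} hX hY hZ ↦ 𝔐.g.nabla_add_left hX.diffAt hY.diffAt hZ.diffAt
  ext1
  · simp only [LorentzMetric.cnabla, Prod.fst_add, Prod.snd_add, ad hX.fst hY.fst hZ.fst,
      ad hX.snd hY.snd hZ.snd]; abel
  · simp only [LorentzMetric.cnabla, Prod.fst_add, Prod.snd_add, ad hX.fst hY.fst hZ.snd,
      ad hX.snd hY.snd hZ.fst]; abel

lemma cnabla_smulT_left (hf : SmF f x) (hX : X.SmAt x) (hZ : Z.SmAt x) :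
    𝔐.g.cnabla (fun y ↦ smulT (f y) (X y)) Z x = smulT (f x) (𝔐.g.cnabla X Z x) := by
  have key : ∀ {Z : VField M}, Z.SmAt x →
      𝔐.g.nabla (fun y ↦ (f y).re • (X y).1 - (f y).im • (X y).2) Z x
        = (f x).re • 𝔐.g.nabla (fun y ↦ (X y).1) Z x - (f x).im • 𝔐.g.nabla (fun y ↦ (X y).2) Z x ∧
      𝔐.g.nabla (fun y ↦ (f y).re • (X y).2 + (f y).im • (X y).1) Z x
        = (f x).re • 𝔐.g.nabla (fun y ↦ (X y).2) Z x
          + (f x).im • 𝔐.g.nabla (fun y ↦ (X y).1) Z x := by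
    intro Z hZ
    rw [← 𝔐.g.nabla_smul_left hf.re.diF hX.fst.diffAt hZ.diffAt,
      ← 𝔐.g.nabla_smul_left hf.re.diF hX.snd.diffAt hZ.diffAt,
      ← 𝔐.g.nabla_smul_left hf.im.diF hX.fst.diffAt hZ.diffAt,
      ← 𝔐.g.nabla_smul_left hf.im.diF hX.snd.diffAt hZ.diffAt]
    exact ⟨𝔐.g.nabla_sub_left (hX.fst.smul hf.re).diffAt (hX.snd.smul hf.im).diffAt hZ.diffAt,
      𝔐.g.nabla_add_left (hX.snd.smul hf.re).diffAt (hX.fst.smul hf.im).diffAt hZ.diffAt⟩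
  have k1 := key hZ.fst
  have k2 := key hZ.snd
  ext1
  · simp only [LorentzMetric.cnabla, smulT, k1.1, k2.2]
    module
  · simp only [LorentzMetric.cnabla, smulT, k1.2, k2.1]
    module

/-- The complexified connection is real. -/
lemma cnabla_conjT (hX : X.SmAt x) (hY : Y.SmAt x) :
    𝔐.g.cnabla (fun y ↦ conjT (X y)) (fun y ↦ conjT (Y y)) x = conjT (𝔐.g.cnabla X Y x) := by
  have nl : ∀ {X Y : VField M}, X.SmAt x → Y.SmAt x →
      𝔐.g.nabla (fun y ↦ -X y) Y x = -𝔐.g.nabla X Y x :=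
    fun {X Y} hX hY ↦ 𝔐.g.nabla_neg_left hX.diffAt hY.diffAt
  have nr : ∀ {X Y : VField M}, X.SmAt x → Y.SmAt x →
      𝔐.g.nabla X (fun y ↦ -Y y) x = -𝔐.g.nabla X Y x := by
    intro X Y hX hY
    have h := 𝔐.g.nabla_sub_right (Z := Y) hX.diffAt smAt_zero.diffAt hY.diffAt
    have h0 := 𝔐.g.nabla_sub_right (Z := Y) hX.diffAt hY.diffAt hY.diffAt
    rw [sub_self, sub_self] at h0
    rw [h0, zero_sub, zero_sub] at h
    exact h
  ext1
  · simp only [LorentzMetric.cnabla, conjT]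
    have := nl (Y := fun y ↦ -(Y y).2) hX.snd hY.snd.neg
    rw [this, nr hX.snd hY.snd, neg_neg]
  · simp only [LorentzMetric.cnabla, conjT, nl hX.snd hY.fst, nr hX.fst hY.snd]
    abel

lemma cnabla_congr {X' Y' : CVField M} (eX : ∀ᶠ y in 𝓝 x, X y = X' y)
    (eY : ∀ᶠ y in 𝓝 x, Y y = Y' y) : 𝔐.g.cnabla X Y x = 𝔐.g.cnabla X' Y' x := by
  have a1 := eX.mono fun _ h ↦ congrArg Prod.fst h
  have a2 := eX.mono fun _ h ↦ congrArg Prod.snd h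
  have b1 := eY.mono fun _ h ↦ congrArg Prod.fst h
  have b2 := eY.mono fun _ h ↦ congrArg Prod.snd h
  ext1
  · exact congrArg₂ (· - ·) (𝔐.g.nabla_congr a1 b1) (𝔐.g.nabla_congr a2 b2)
  · exact congrArg₂ (· + ·) (𝔐.g.nabla_congr a1 b2) (𝔐.g.nabla_congr a2 b1)

/-- The complex bilinear extension of the curvature operator. -/
def LorentzMetric.ccurv (g : LorentzMetric M) (X Y Z : CVField M) (x : M) : CTangent x :=
  g.cnabla X (g.cnabla Y Z) x - g.cnabla Y (g.cnabla X Z) x - g.cnabla (cbracket X Y) Z x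

end CDeriv

/-! ### The curvature of type D vacuum in a null frame -/

section NullFrame

variable {𝔐 : Background M} {x : M}

/-- The complexified curvature operator in terms of real and imaginary parts. -/
lemma ccurv_eq {X Y Z : CVField M} (hX : X.SmAt x) (hY : Y.SmAt x) (hZ : Z.SmAt x) :
    𝔐.g.ccurv X Y Z x =
      (𝔐.g.curvatureOp (fun y ↦ (X y).1) (fun y ↦ (Y y).1) (fun y ↦ (Z y).1) x
        - 𝔐.g.curvatureOp (fun y ↦ (X y).2) (fun y ↦ (Y y).2) (fun y ↦ (Z y).1) x
        - 𝔐.g.curvatureOp (fun y ↦ (X y).2) (fun y ↦ (Y y).1) (fun y ↦ (Z y).2) x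
        - 𝔐.g.curvatureOp (fun y ↦ (X y).1) (fun y ↦ (Y y).2) (fun y ↦ (Z y).2) x,
       𝔐.g.curvatureOp (fun y ↦ (X y).1) (fun y ↦ (Y y).1) (fun y ↦ (Z y).2) x
        + 𝔐.g.curvatureOp (fun y ↦ (X y).1) (fun y ↦ (Y y).2) (fun y ↦ (Z y).1) x
        + 𝔐.g.curvatureOp (fun y ↦ (X y).2) (fun y ↦ (Y y).1) (fun y ↦ (Z y).1) x
        - 𝔐.g.curvatureOp (fun y ↦ (X y).2) (fun y ↦ (Y y).2) (fun y ↦ (Z y).2) x) := by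
  have sm : ∀ {X Y Z : VField M}, X.SmAt x → Y.SmAt x → Z.SmAt x →
      𝔐.g.nabla X (fun y ↦ Y y - Z y) x = 𝔐.g.nabla X Y x - 𝔐.g.nabla X Z x :=
    fun {X Y Z} hX hY hZ ↦ 𝔐.g.nabla_sub_right hX.diffAt hY.diffAt hZ.diffAt
  have am : ∀ {X Y Z : VField M}, X.SmAt x → Y.SmAt x → Z.SmAt x →
      𝔐.g.nabla X (fun y ↦ Y y + Z y) x = 𝔐.g.nabla X Y x + 𝔐.g.nabla X Z x :=
    fun {X Y Z} hX hY hZ ↦ 𝔐.g.nabla_add_right hX.diffAt hY.diffAt hZ.diffAt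
  have sl : ∀ {X Y Z : VField M}, X.SmAt x → Y.SmAt x → Z.SmAt x →
      𝔐.g.nabla (fun y ↦ X y - Y y) Z x = 𝔐.g.nabla X Z x - 𝔐.g.nabla Y Z x :=
    fun {X Y Z} hX hY hZ ↦ 𝔐.g.nabla_sub_left hX.diffAt hY.diffAt hZ.diffAt
  have al : ∀ {X Y Z : VField M}, X.SmAt x → Y.SmAt x → Z.SmAt x →
      𝔐.g.nabla (fun y ↦ X y + Y y) Z x = 𝔐.g.nabla X Z x + 𝔐.g.nabla Y Z x :=
    fun {X Y Z} hX hY hZ ↦ 𝔐.g.nabla_add_left hX.diffAt hY.diffAt hZ.diffAt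
  have key : ∀ {X Y : CVField M}, X.SmAt x → Y.SmAt x →
      𝔐.g.cnabla X (𝔐.g.cnabla Y Z) x
      = (𝔐.g.nabla (fun y ↦ (X y).1) (𝔐.g.nabla (fun y ↦ (Y y).1) (fun y ↦ (Z y).1)) x
          - 𝔐.g.nabla (fun y ↦ (X y).1) (𝔐.g.nabla (fun y ↦ (Y y).2) (fun y ↦ (Z y).2)) x
          - (𝔐.g.nabla (fun y ↦ (X y).2) (𝔐.g.nabla (fun y ↦ (Y y).1) (fun y ↦ (Z y).2)) x
          + 𝔐.g.nabla (fun y ↦ (X y).2) (𝔐.g.nabla (fun y ↦ (Y y).2) (fun y ↦ (Z y).1)) x),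
        𝔐.g.nabla (fun y ↦ (X y).1) (𝔐.g.nabla (fun y ↦ (Y y).1) (fun y ↦ (Z y).2)) x
          + 𝔐.g.nabla (fun y ↦ (X y).1) (𝔐.g.nabla (fun y ↦ (Y y).2) (fun y ↦ (Z y).1)) x
          + (𝔐.g.nabla (fun y ↦ (X y).2) (𝔐.g.nabla (fun y ↦ (Y y).1) (fun y ↦ (Z y).1)) x
          - 𝔐.g.nabla (fun y ↦ (X y).2) (𝔐.g.nabla (fun y ↦ (Y y).2) (fun y ↦ (Z y).2)) x)) := by
    intro X Y hX hY
    have s11 := smAt_nabla 𝔐 hY.fst hZ.fst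
    have s12 := smAt_nabla 𝔐 hY.fst hZ.snd
    have s21 := smAt_nabla 𝔐 hY.snd hZ.fst
    have s22 := smAt_nabla 𝔐 hY.snd hZ.snd
    rw [← sm hX.fst s11 s22, ← am hX.snd s12 s21, ← am hX.fst s12 s21, ← sm hX.snd s11 s22]
    rfl
  have kb : 𝔐.g.cnabla (cbracket X Y) Z x =
      (𝔐.g.nabla (VectorField.mlieBracket (𝓡 4) (fun y ↦ (X y).1) (fun y ↦ (Y y).1))
          (fun y ↦ (Z y).1) x
        - 𝔐.g.nabla (VectorField.mlieBracket (𝓡 4) (fun y ↦ (X y).2) (fun y ↦ (Y y).2))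
          (fun y ↦ (Z y).1) x
        - (𝔐.g.nabla (VectorField.mlieBracket (𝓡 4) (fun y ↦ (X y).1) (fun y ↦ (Y y).2))
          (fun y ↦ (Z y).2) x
        + 𝔐.g.nabla (VectorField.mlieBracket (𝓡 4) (fun y ↦ (X y).2) (fun y ↦ (Y y).1))
          (fun y ↦ (Z y).2) x),
       𝔐.g.nabla (VectorField.mlieBracket (𝓡 4) (fun y ↦ (X y).1) (fun y ↦ (Y y).1))
          (fun y ↦ (Z y).2) x
        - 𝔐.g.nabla (VectorField.mlieBracket (𝓡 4) (fun y ↦ (X y).2) (fun y ↦ (Y y).2))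
          (fun y ↦ (Z y).2) x
        + (𝔐.g.nabla (VectorField.mlieBracket (𝓡 4) (fun y ↦ (X y).1) (fun y ↦ (Y y).2))
          (fun y ↦ (Z y).1) x
        + 𝔐.g.nabla (VectorField.mlieBracket (𝓡 4) (fun y ↦ (X y).2) (fun y ↦ (Y y).1))
          (fun y ↦ (Z y).1) x)) := by
    have b11 := hX.fst.bracket hY.fst
    have b12 := hX.fst.bracket hY.snd
    have b21 := hX.snd.bracket hY.fst
    have b22 := hX.snd.bracket hY.snd
    rw [← sl b11 b22 hZ.fst, ← al b12 b21 hZ.snd, ← sl b11 b22 hZ.snd, ← al b12 b21 hZ.fst]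
    rfl
  rw [LorentzMetric.ccurv, key hX hY, key hY hX, kb]
  ext1
  · simp only [LorentzMetric.curvatureOp, Prod.fst_sub]; abel
  · simp only [LorentzMetric.curvatureOp, Prod.snd_sub]; abel

/-- The curvature operator computes the complexified Weyl tensor of the vacuum background. -/
lemma cval_ccurv {X Y Z : CVField M} (W : CTangent x) (hX : X.SmAt x) (hY : Y.SmAt x)
    (hZ : Z.SmAt x) : 𝔐.g.cval x W (𝔐.g.ccurv X Y Z x) = 𝔐.g.cweyl x W (Z x) (X x) (Y x) := by
  have r : ∀ (u : TangentSpace (𝓡 4) x) {X Y Z : VField M} {v w z : TangentSpace (𝓡 4) x},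
      X.SmAt x → Y.SmAt x → Z.SmAt x → Z x = v → X x = w → Y x = z →
      𝔐.g.weyl x u v w z = 𝔐.g.val x u (𝔐.g.curvatureOp X Y Z x) := by
    intro u X Y Z v w z hX hY hZ e1 e2 e3
    rw [weyl_eq_riemann, ← e1, ← e2, ← e3, riemann_eq u hX hY hZ]
  rw [ccurv_eq hX hY hZ, LorentzMetric.cval_eq]
  simp only [LorentzMetric.cweyl, Fin.sum_univ_two, part, if_true,
    if_neg (show (1 : Fin 2) ≠ 0 by decide), Fin.val_zero, Fin.val_one, pow_add, pow_zero, pow_one]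
  rw [r _ hX.fst hY.fst hZ.fst rfl rfl rfl, r _ hX.fst hY.snd hZ.fst rfl rfl rfl,
    r _ hX.snd hY.fst hZ.fst rfl rfl rfl, r _ hX.snd hY.snd hZ.fst rfl rfl rfl,
    r _ hX.fst hY.fst hZ.snd rfl rfl rfl, r _ hX.fst hY.snd hZ.snd rfl rfl rfl,
    r _ hX.snd hY.fst hZ.snd rfl rfl rfl, r _ hX.snd hY.snd hZ.snd rfl rfl rfl,
    r _ hX.fst hY.fst hZ.fst rfl rfl rfl, r _ hX.fst hY.snd hZ.fst rfl rfl rfl,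
    r _ hX.snd hY.fst hZ.fst rfl rfl rfl, r _ hX.snd hY.snd hZ.fst rfl rfl rfl,
    r _ hX.fst hY.fst hZ.snd rfl rfl rfl, r _ hX.fst hY.snd hZ.snd rfl rfl rfl,
    r _ hX.snd hY.fst hZ.snd rfl rfl rfl, r _ hX.snd hY.snd hZ.snd rfl rfl rfl]
  simp only [map_sub, map_add]
  push_cast
  ring_nf
  simp only [show Complex.I ^ 3 = -Complex.I by rw [pow_succ, Complex.I_sq]; ring,
    show Complex.I ^ 4 = 1 from Complex.I_pow_four, Complex.I_sq]
  ring

variable (𝔐 x) in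
/-- A complex null frame adapted to the principal null directions of a type D vacuum metric. The
conditions are invariant under the prime operation, which exchanges `l` with `n` and `m` with `k`,
and under complex conjugation, which exchanges `m` with `k`. -/
structure NullFrame (l n m k : CTangent x) : Prop where
  ll : 𝔐.g.cval x l l = 0
  nn : 𝔐.g.cval x n n = 0
  mm : 𝔐.g.cval x m m = 0
  kk : 𝔐.g.cval x k k = 0
  ln : 𝔐.g.cval x l n = 1
  m_k : 𝔐.g.cval x m k = -1
  lm : 𝔐.g.cval x l m = 0
  lk : 𝔐.g.cval x l k = 0
  nm : 𝔐.g.cval x n m = 0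
  nk : 𝔐.g.cval x n k = 0
  expand (u : CTangent x) : u = smulT (𝔐.g.cval x u n) l + smulT (𝔐.g.cval x u l) n
    + smulT (-𝔐.g.cval x u k) m + smulT (-𝔐.g.cval x u m) k
  principal_l (v w : CTangent x) : 𝔐.g.cval x v l = 0 → 𝔐.g.cweyl x l v l w = 0
  principal_n (v w : CTangent x) : 𝔐.g.cval x v n = 0 → 𝔐.g.cweyl x n v n w = 0
  ricci (u v : CTangent x) : 𝔐.g.cweyl x l u n v + 𝔐.g.cweyl x n u l v - 𝔐.g.cweyl x m u k v
    - 𝔐.g.cweyl x k u m v = 0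

lemma weyl_neg_fst (u v w z : TangentSpace (𝓡 4) x) :
    𝔐.g.weyl x (-u) v w z = -𝔐.g.weyl x u v w z := by
  simpa using weyl_lin_fst 𝔐 (-1) 0 u 0 v w z

lemma weyl_neg_trd (u v w z : TangentSpace (𝓡 4) x) :
    𝔐.g.weyl x u v (-w) z = -𝔐.g.weyl x u v w z := by
  simpa using weyl_lin_trd 𝔐 (-1) 0 u v w 0 z

lemma weyl_zero_trd (u v z : TangentSpace (𝓡 4) x) : 𝔐.g.weyl x u v 0 z = 0 := by
  simpa using weyl_lin_trd 𝔐 0 0 u v 0 0 z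

/-- The condition on a principal null direction, for complex arguments. -/
lemma cweyl_principal {l V : TangentSpace (𝓡 4) x} (hV : 𝔐.g.IsPrincipalNull x V)
    (hl : ∃ c : ℝ, l = c • V) (h0 : l ≠ 0) (v w : CTangent x)
    (hv : 𝔐.g.cval x v (ofReal l) = 0) : 𝔐.g.cweyl x (ofReal l) v (ofReal l) w = 0 := by
  obtain ⟨c, rfl⟩ := hl
  have hc : c ≠ 0 := by rintro rfl; simp at h0
  have h1 : 𝔐.g.val x v.1 V = 0 := by
    have := congrArg Complex.re hv
    rw [LorentzMetric.cval_re] at this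
    simpa [ofReal, hc] using this
  have h2 : 𝔐.g.val x v.2 V = 0 := by
    have := congrArg Complex.im hv
    rw [LorentzMetric.cval_im] at this
    simpa [ofReal, hc] using this
  have key : ∀ v w : TangentSpace (𝓡 4) x, 𝔐.g.val x v V = 0 →
      𝔐.g.weyl x (c • V) v (c • V) w = 0 := by
    intro v w hv
    have e1 := weyl_lin_fst 𝔐 c 0 V 0 v (c • V) w
    have e2 := weyl_lin_trd 𝔐 c 0 V v V 0 w
    rw [zero_smul, add_zero, zero_mul, add_zero] at e1 e2
    rw [e1, e2, hV.2.2 v w hv]; ring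
  simp [LorentzMetric.cweyl, Fin.sum_univ_two, part, ofReal, weyl_zero_fst, weyl_zero_trd,
    key _ _ h1, key _ _ h2]

/-- A null tetrad of a type D vacuum background is an adapted complex null frame. -/
lemma NullTetrad.nullFrame (a : NullTetrad 𝔐 x) :
    NullFrame 𝔐 x (ofReal a.l) (ofReal a.n) a.m (conjT a.m) where
  ll := by rw [cval_ofReal, a.l_l, Complex.ofReal_zero]
  nn := by rw [cval_ofReal, a.n_n, Complex.ofReal_zero]
  mm := a.m_m
  kk := by rw [cval_conj, a.m_m, star_zero]
  ln := by rw [cval_ofReal, a.l_n, Complex.ofReal_one]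
  m_k := a.m_conj_m
  lm := a.l_m
  lk := by rw [← conjT_ofReal, cval_conj, a.l_m, star_zero]
  nm := a.n_m
  nk := by rw [← conjT_ofReal, cval_conj, a.n_m, star_zero]
  expand u := by
    ext1
    · simp only [smulT, Prod.fst_add, Complex.neg_re, Complex.neg_im, LorentzMetric.cval_re,
        LorentzMetric.cval_im, ofReal, conjT, map_zero, map_neg]
      conv_lhs => rw [a.expand u.1]
      module
    · simp only [smulT, Prod.snd_add, Complex.neg_re, Complex.neg_im, LorentzMetric.cval_re,
        LorentzMetric.cval_im, ofReal, conjT, map_zero, map_neg]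
      conv_lhs => rw [a.expand u.2]
      module
  principal_l := cweyl_principal (𝔐.Vplus_principal x) a.l_collinear
    (by intro h; have := a.l_n; simp [h] at this)
  principal_n := cweyl_principal (𝔐.Vminus_principal x) a.n_collinear
    (by intro h; have := a.l_n; simp [h] at this)
  ricci u v := by
    have key : ∀ v z : TangentSpace (𝓡 4) x, ((𝔐.g.weyl x a.l v a.n z + 𝔐.g.weyl x a.n v a.l z
      - 2 * 𝔐.g.weyl x a.m.1 v a.m.1 z - 2 * 𝔐.g.weyl x a.m.2 v a.m.2 z : ℝ) : ℂ) = 0 := by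
      intro v z; rw [ricci_tetrad a v z, Complex.ofReal_zero]
    push_cast at key
    simp [LorentzMetric.cweyl, part, ofReal, conjT, weyl_zero_fst, weyl_zero_trd,
      weyl_neg_fst, weyl_neg_trd, pow_add]
    have k11 := key u.1 v.1
    have k12 := key u.1 v.2
    have k21 := key u.2 v.1
    have k22 := key u.2 v.2
    linear_combination k11 + Complex.I * k12 + Complex.I * k21 - k22

namespace NullFrame

variable {l n m k : CTangent x}

/-- The prime operation, which exchanges `l` with `n` and `m` with `m̄`. -/
lemma prime (h : NullFrame 𝔐 x l n m k) : NullFrame 𝔐 x n l k m where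
  ll := h.nn
  nn := h.ll
  mm := h.kk
  kk := h.mm
  ln := by rw [cval_symm, h.ln]
  m_k := by rw [cval_symm, h.m_k]
  lm := h.nk
  lk := h.nm
  nm := h.lk
  nk := h.lm
  expand u := by conv_lhs => rw [h.expand u]
                 abel
  principal_l := h.principal_n
  principal_n := h.principal_l
  ricci u v := by linear_combination h.ricci u v

/-- Conjugation, which exchanges `m` with `m̄`. -/
lemma bar (h : NullFrame 𝔐 x l n m k) : NullFrame 𝔐 x l n k m where
  ll := h.ll
  nn := h.nn
  mm := h.kk
  kk := h.mm
  ln := h.ln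
  m_k := by rw [cval_symm, h.m_k]
  lm := h.lk
  lk := h.lm
  nm := h.nk
  nk := h.nm
  expand u := by conv_lhs => rw [h.expand u]
                 abel
  principal_l := h.principal_l
  principal_n := h.principal_n
  ricci u v := by linear_combination h.ricci u v

/-- The metric in a null frame. -/
lemma cval_eq (h : NullFrame 𝔐 x l n m k) (u v : CTangent x) : 𝔐.g.cval x u v
    = 𝔐.g.cval x u n * 𝔐.g.cval x l v + 𝔐.g.cval x u l * 𝔐.g.cval x n v
      - 𝔐.g.cval x u k * 𝔐.g.cval x m v - 𝔐.g.cval x u m * 𝔐.g.cval x k v := by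
  conv_lhs => rw [h.expand u]
  simp only [cval_add_left, cval_smul_left]
  ring

end NullFrame

/-- Complex bilinear alternating forms. That a form alternates is expressed by its skew symmetry. -/
structure IsCAlt (B : CTangent x → CTangent x → ℂ) : Prop where
  add (u u' v : CTangent x) : B (u + u') v = B u v + B u' v
  smul (c : ℂ) (u v : CTangent x) : B (smulT c u) v = c * B u v
  swap (u v : CTangent x) : B u v = -B v u

lemma isCAlt_cweyl (u v : CTangent x) : IsCAlt (𝔐.g.cweyl x u v) where
  add w w' z := by rw [cweyl_pair, cweyl_add_fst, cweyl_pair w, cweyl_pair w']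
  smul c w z := by rw [cweyl_pair, cweyl_smul_fst, cweyl_pair w]
  swap w z := cweyl_swap_right u v w z

lemma isCAlt_cweyl' (w z : CTangent x) : IsCAlt (fun u v ↦ 𝔐.g.cweyl x u v w z) where
  add u u' v := cweyl_add_fst u u' v w z
  smul c u v := cweyl_smul_fst c u v w z
  swap u v := cweyl_swap_left u v w z

lemma IsCAlt.add' {B B' : CTangent x → CTangent x → ℂ} (h : IsCAlt B) (h' : IsCAlt B') :
    IsCAlt (fun u v ↦ B u v + B' u v) where
  add u u' v := by rw [h.add, h'.add]; ring
  smul c u v := by rw [h.smul, h'.smul]; ring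
  swap u v := by rw [h.swap, h'.swap]; ring

lemma IsCAlt.const_mul {B : CTangent x → CTangent x → ℂ} (c : ℂ) (h : IsCAlt B) :
    IsCAlt (fun u v ↦ c * B u v) where
  add u u' v := by rw [h.add]; ring
  smul d u v := by rw [h.smul]; ring
  swap u v := by rw [h.swap]; ring

lemma isCAlt_wedge (p q : CTangent x) :
    IsCAlt (fun u v ↦ 𝔐.g.cval x u p * 𝔐.g.cval x v q - 𝔐.g.cval x u q * 𝔐.g.cval x v p) where
  add u u' v := by simp only [cval_add_left]; ring
  smul c u v := by simp only [cval_smul_left]; ring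
  swap u v := by ring

lemma isCAlt_zero : IsCAlt (fun _ _ : CTangent x ↦ (0 : ℂ)) := ⟨by simp, by simp, by simp⟩

lemma IsCAlt.self {B : CTangent x → CTangent x → ℂ} (h : IsCAlt B) (u : CTangent x) :
    B u u = 0 := self_eq_neg.1 (h.swap u u)

/-- An alternating form is determined by its six components in a null frame. -/
lemma NullFrame.alt_ext {l n m k : CTangent x} (fr : NullFrame 𝔐 x l n m k)
    {B B' : CTangent x → CTangent x → ℂ} (h : IsCAlt B) (h' : IsCAlt B')
    (h1 : B l n = B' l n) (h2 : B l m = B' l m) (h3 : B l k = B' l k) (h4 : B n m = B' n m)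
    (h5 : B n k = B' n k) (h6 : B m k = B' m k) (u v : CTangent x) : B u v = B' u v := by
  have lin : ∀ {B : CTangent x → CTangent x → ℂ}, IsCAlt B → ∀ u v, B u v
      = 𝔐.g.cval x u n * B l v + 𝔐.g.cval x u l * B n v - 𝔐.g.cval x u k * B m v
        - 𝔐.g.cval x u m * B k v := by
    intro B h u v
    conv_lhs => rw [fr.expand u]
    simp only [h.add, h.smul]; ring
  have lin2 : ∀ {B : CTangent x → CTangent x → ℂ}, IsCAlt B → ∀ u v, B u v
      = 𝔐.g.cval x v n * B u l + 𝔐.g.cval x v l * B u n - 𝔐.g.cval x v k * B u m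
        - 𝔐.g.cval x v m * B u k := by
    intro B h u v
    rw [h.swap u v, lin h v u, h.swap u l, h.swap u n, h.swap u m, h.swap u k]; ring
  rw [lin h, lin h']
  rw [lin2 h l, lin2 h n, lin2 h m, lin2 h k, lin2 h' l, lin2 h' n, lin2 h' m, lin2 h' k]
  simp only [h.self, h'.self, h.swap n l, h'.swap n l, h.swap m l, h'.swap m l, h.swap k l,
    h'.swap k l, h.swap m n, h'.swap m n, h.swap k n, h'.swap k n, h.swap k m, h'.swap k m,
    h1, h2, h3, h4, h5, h6]

namespace NullFrame

variable {l n m k : CTangent x}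

lemma cweyl_lmn (fr : NullFrame 𝔐 x l n m k) : 𝔐.g.cweyl x l m n m = 0 := by
  have h := fr.ricci m m
  rw [(isCAlt_cweyl' k m).self m, (isCAlt_cweyl k m).self m, cweyl_pair n m l m] at h
  linear_combination (1 / 2) * h

lemma cweyl_mlk (fr : NullFrame 𝔐 x l n m k) : 𝔐.g.cweyl x m l k m = 0 := by
  have h := fr.ricci l m
  have h0 : 𝔐.g.cweyl x l m l n = 0 := fr.principal_l m n (by rw [cval_symm, fr.lm])
  have h1 : 𝔐.g.cweyl x l n l m = 0 := by rw [cweyl_pair, h0]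
  rw [(isCAlt_cweyl' n m).self l, (isCAlt_cweyl k l).self m, cweyl_swap_left n l l m, h1] at h
  linear_combination -h

/-- The self-dual curvature form attached to `l` and `m` has a single component. -/
lemma cweyl_ml (fr : NullFrame 𝔐 x l n m k) (u v : CTangent x) :
    𝔐.g.cweyl x m l u v = 𝔐.g.cweyl x m l k n *
      (𝔐.g.cval x u l * 𝔐.g.cval x v m - 𝔐.g.cval x u m * 𝔐.g.cval x v l) := by
  have pl : ∀ w, 𝔐.g.cweyl x l m l w = 0 := fun w ↦ fr.principal_l m w (by rw [cval_symm, fr.lm])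
  have e1 : 𝔐.g.cval x n l = 1 := by rw [cval_symm, fr.ln]
  have e2 : 𝔐.g.cval x k m = -1 := by rw [cval_symm, fr.m_k]
  have e3 : 𝔐.g.cval x m l = 0 := by rw [cval_symm, fr.lm]
  have e4 : 𝔐.g.cval x k l = 0 := by rw [cval_symm, fr.lk]
  refine fr.alt_ext (isCAlt_cweyl m l) ((isCAlt_wedge l m).const_mul _) ?_ ?_ ?_ ?_ ?_ ?_ u v
  · rw [cweyl_swap_left, pl, fr.ll, fr.lm]; ring
  · rw [cweyl_swap_left, pl, fr.ll, fr.lm]; ring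
  · rw [cweyl_swap_left, pl, fr.ll, fr.lm]; ring
  · rw [cweyl_swap_left, fr.cweyl_lmn, fr.nm, fr.mm]; ring
  · rw [cweyl_swap_right, e1, e2, fr.nm]; ring
  · rw [cweyl_swap_right, fr.cweyl_mlk, fr.mm, e3, e4]; ring

/-- The self-dual curvature form that is the curvature of the connection form. -/
lemma cweyl_nl_add_mk (fr : NullFrame 𝔐 x l n m k) (u v : CTangent x) :
    𝔐.g.cweyl x n l u v + 𝔐.g.cweyl x m k u v = 2 * 𝔐.g.cweyl x m l k n *
      ((𝔐.g.cval x u n * 𝔐.g.cval x v l - 𝔐.g.cval x u l * 𝔐.g.cval x v n)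
        + (-1) * (𝔐.g.cval x u k * 𝔐.g.cval x v m - 𝔐.g.cval x u m * 𝔐.g.cval x v k)) := by
  have pl : ∀ w, 𝔐.g.cweyl x l m l w = 0 := fun w ↦ fr.principal_l m w (by rw [cval_symm, fr.lm])
  have pl' : ∀ w, 𝔐.g.cweyl x l k l w = 0 := fun w ↦ fr.principal_l k w (by rw [cval_symm, fr.lk])
  have pn : ∀ w, 𝔐.g.cweyl x n m n w = 0 := fun w ↦ fr.principal_n m w (by rw [cval_symm, fr.nm])
  have pn' : ∀ w, 𝔐.g.cweyl x n k n w = 0 := fun w ↦ fr.principal_n k w (by rw [cval_symm, fr.nk])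
  have e1 : 𝔐.g.cval x n l = 1 := by rw [cval_symm, fr.ln]
  have e2 : 𝔐.g.cval x k m = -1 := by rw [cval_symm, fr.m_k]
  have e3 : 𝔐.g.cval x m l = 0 := by rw [cval_symm, fr.lm]
  have e4 : 𝔐.g.cval x k l = 0 := by rw [cval_symm, fr.lk]
  have e5 : 𝔐.g.cval x m n = 0 := by rw [cval_symm, fr.nm]
  have e6 : 𝔐.g.cval x k n = 0 := by rw [cval_symm, fr.nk]
  have c1 : 𝔐.g.cweyl x m k l n = 𝔐.g.cweyl x m l k n - 𝔐.g.cweyl x m n k l := by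
    have := cweyl_cyclic (𝔐 := 𝔐) m k l n
    rw [cweyl_swap_right m l n k] at this
    linear_combination this
  have c2 : 𝔐.g.cweyl x l n n l = 𝔐.g.cweyl x m n k l + 𝔐.g.cweyl x m l k n := by
    have := fr.ricci n l
    rw [(isCAlt_cweyl n n).self l, cweyl_pair k n m l] at this
    linear_combination this
  have c3 : 𝔐.g.cweyl x m k m k = -𝔐.g.cweyl x m l k n - 𝔐.g.cweyl x m n k l := by
    have := fr.ricci m k
    rw [(isCAlt_cweyl' k k).self m, cweyl_swap_left k m m k, cweyl_swap_left l m n k,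
      cweyl_swap_right m l n k, cweyl_swap_left n m l k, cweyl_swap_right m n l k] at this
    linear_combination this
  refine fr.alt_ext ((isCAlt_cweyl n l).add' (isCAlt_cweyl m k))
    (((isCAlt_wedge n l).add' ((isCAlt_wedge k m).const_mul (-1))).const_mul _)
    ?_ ?_ ?_ ?_ ?_ ?_ u v
  · rw [cweyl_swap_left n l, cweyl_swap_right l n l n, c2, c1, fr.ll, fr.ln, fr.lk, fr.lm, e1,
      fr.nn]; ring
  · rw [cweyl_pair n l l m, cweyl_swap_right l m n l, pl, cweyl_pair m k l m,
      cweyl_swap_left l m m k, cweyl_swap_right m l m k, fr.cweyl_mlk, fr.ll, fr.ln, fr.lk, fr.lm,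
      e3, e5]; ring
  · rw [cweyl_pair n l l k, cweyl_swap_right l k n l, pl', cweyl_pair m k l k,
      cweyl_swap_left l k m k, fr.bar.cweyl_mlk, fr.ll, fr.ln, fr.lk, fr.lm,
      e4, e6]; ring
  · rw [cweyl_pair n l n m, pn, cweyl_pair m k n m,
      cweyl_swap_left n m m k, cweyl_swap_right m n m k, fr.prime.bar.cweyl_mlk, fr.nn, e1, fr.nk,
      fr.nm, e3, e5]; ring
  · rw [cweyl_pair n l n k, pn', cweyl_pair m k n k,
      cweyl_swap_left n k m k, fr.prime.cweyl_mlk, fr.nn, e1, fr.nk,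
      fr.nm, e4, e6]; ring
  · rw [cweyl_pair n l m k, cweyl_swap_right m k n l, c1, c3, e5, e4, e3, e6, fr.m_k, e2, fr.mm]
    ring

end NullFrame

/-- The only curvature component of a type D vacuum metric does not vanish. -/
lemma NullTetrad.psi_ne_zero (a : NullTetrad 𝔐 x) :
    𝔐.g.cweyl x a.m (ofReal a.l) (conjT a.m) (ofReal a.n) ≠ 0 := by
  intro h0
  -- if `Ψ₂` were zero, all curvature two-forms would vanish
  have fr := a.nullFrame
  have h0' : 𝔐.g.cweyl x (conjT a.m) (ofReal a.l) a.m (ofReal a.n) = 0 := by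
    have := cweyl_conj (𝔐 := 𝔐) a.m (ofReal a.l) (conjT a.m) (ofReal a.n)
    rwa [h0, conjT_conjT, conjT_ofReal, conjT_ofReal, star_zero] at this
  have h1 := fun u v ↦ fr.cweyl_ml u v
  have h2 := fun u v ↦ fr.bar.cweyl_ml u v
  have h3 := fun u v ↦ fr.prime.cweyl_ml u v
  have h4 := fun u v ↦ fr.prime.bar.cweyl_ml u v
  have h5 := fun u v ↦ fr.cweyl_nl_add_mk u v
  have h6 := fun u v ↦ fr.bar.cweyl_nl_add_mk u v
  have e3 : 𝔐.g.cweyl x (conjT a.m) (ofReal a.n) a.m (ofReal a.l) = 0 := by rw [cweyl_pair, h0]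
  have e4 : 𝔐.g.cweyl x a.m (ofReal a.n) (conjT a.m) (ofReal a.l) = 0 := by rw [cweyl_pair, h0']
  simp only [h0, h0', e3, e4, mul_zero, zero_mul] at h1 h2 h3 h4 h5 h6
  have h7 : ∀ u v, 𝔐.g.cweyl x (ofReal a.n) (ofReal a.l) u v = 0 := by
    intro u v
    have e := h5 u v
    have e' := h6 u v
    rw [cweyl_swap_left (conjT a.m)] at e'
    linear_combination (1 / 2) * (e + e')
  have h8 : ∀ u v, 𝔐.g.cweyl x a.m (conjT a.m) u v = 0 := by
    intro u v
    linear_combination h5 u v - h7 u v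
  obtain ⟨u, v, w, z, hne⟩ := 𝔐.weyl_ne_zero x
  apply hne
  have key := fr.alt_ext (isCAlt_cweyl' (𝔐 := 𝔐) (ofReal w) (ofReal z)) isCAlt_zero
    (by rw [cweyl_swap_left, h7, neg_zero]) (by rw [cweyl_swap_left, h1, neg_zero])
    (by rw [cweyl_swap_left, h2, neg_zero]) (by rw [cweyl_swap_left, h4, neg_zero])
    (by rw [cweyl_swap_left, h3, neg_zero]) (h8 _ _) (ofReal u) (ofReal v)
  have hz : ∀ u v w : TangentSpace (𝓡 4) x, 𝔐.g.weyl x u 0 v w = 0 ∧ 𝔐.g.weyl x u v w 0 = 0 := by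
    intro u v w
    constructor
    · rw [weyl_pair, weyl_swap_right, weyl_zero_trd, neg_zero]
    · rw [weyl_swap_right, weyl_zero_trd, neg_zero]
  simpa [LorentzMetric.cweyl, part, ofReal, weyl_zero_fst, weyl_zero_trd, hz] using key

end NullFrame

/-! ### Structure equations in a null frame field -/

section FrameField

variable {𝔐 : Background M}

variable (𝔐) in
/-- The connection coefficient `g(P, ∇_X Q)`. -/
def con (P Q X : CVField M) (y : M) : ℂ := 𝔐.g.cval y (P y) (𝔐.g.cnabla X Q y)

variable (𝔐) in
/-- The connection form `w(X) = (g(n, ∇_X l) + g(m, ∇_X k)) / 2` of a null frame field. -/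
def wconn (l n m k X : CVField M) (y : M) : ℂ := (1 / 2) * (con 𝔐 n l X y + con 𝔐 m k X y)

variable (𝔐) in
/-- A null frame field that is smooth on an open set. -/
structure FrameField (U : Set M) (l n m k : CVField M) : Prop where
  isOpen : IsOpen U
  smooth_l {y : M} : y ∈ U → l.SmAt y
  smooth_n {y : M} : y ∈ U → n.SmAt y
  smooth_m {y : M} : y ∈ U → m.SmAt y
  smooth_k {y : M} : y ∈ U → k.SmAt y
  frame (y : M) : NullFrame 𝔐 y (l y) (n y) (m y) (k y)

section Con

variable {x : M} {P Q X Y Z : CVField M} {f : M → ℂ}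

lemma smF_con (hP : P.SmAt x) (hQ : Q.SmAt x) (hX : X.SmAt x) : SmF (con 𝔐 P Q X) x :=
  smF_cval 𝔐.g hP (hX.nabla hQ)

/-- Compatibility with the metric, for vector fields with constant inner product. -/
lemma con_skew {c : ℂ} (h : ∀ y, 𝔐.g.cval y (P y) (Q y) = c) (hP : P.SmAt x) (hQ : Q.SmAt x)
    (hX : X.SmAt x) : con 𝔐 P Q X x = -con 𝔐 Q P X x := by
  have e : (fun y ↦ 𝔐.g.cval y (P y) (Q y)) = fun _ ↦ c := funext h
  have := cnabla_metric (𝔐 := 𝔐) hX hP hQ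
  rw [e, cderiv_const, cval_symm 𝔐.g (𝔐.g.cnabla X P x)] at this
  simp only [con]
  linear_combination -this

lemma con_self {c : ℂ} (h : ∀ y, 𝔐.g.cval y (P y) (P y) = c) (hP : P.SmAt x) (hX : X.SmAt x) :
    con 𝔐 P P X x = 0 := self_eq_neg.1 (con_skew h hP hP hX)

lemma con_add (hX : X.SmAt x) (hY : Y.SmAt x) (hQ : Q.SmAt x) :
    con 𝔐 P Q (fun y ↦ X y + Y y) x = con 𝔐 P Q X x + con 𝔐 P Q Y x := by
  simp only [con, cnabla_add_left hX hY hQ, cval_add_right]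

lemma con_smulT (hf : SmF f x) (hX : X.SmAt x) (hQ : Q.SmAt x) :
    con 𝔐 P Q (fun y ↦ smulT (f y) (X y)) x = f x * con 𝔐 P Q X x := by
  simp only [con, cnabla_smulT_left hf hX hQ, cval_smul_right]

lemma cval_bracket (P : CTangent x) (hX : X.SmAt x) (hY : Y.SmAt x) :
    𝔐.g.cval x (cbracket X Y x) P
      = 𝔐.g.cval x P (𝔐.g.cnabla X Y x) - 𝔐.g.cval x P (𝔐.g.cnabla Y X x) := by
  rw [cval_symm, ← cval_sub_right, cnabla_torsion hX hY]

lemma cderiv_add_left : cderiv (fun y ↦ X y + Y y) f x = cderiv X f x + cderiv Y f x := by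
  simp only [cderiv, Prod.fst_add, Prod.snd_add, map_add]; ring

/-- The Jacobi identity for complex vector fields. -/
lemma cbracket_jacobi (hX : X.SmAt x) (hY : Y.SmAt x) (hZ : Z.SmAt x) :
    cbracket (cbracket X Y) Z x + cbracket (cbracket Y Z) X x
      + cbracket (cbracket Z X) Y x = 0 := by
  have sl : ∀ {X Y Z : VField M}, X.SmAt x → Y.SmAt x → Z.SmAt x →
      VectorField.mlieBracket (𝓡 4) (fun y ↦ X y - Y y) Z x
        = VectorField.mlieBracket (𝓡 4) X Z x - VectorField.mlieBracket (𝓡 4) Y Z x := by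
    intro X Y Z hX hY hZ
    have := bracket_add_left (X := X - Y) (Y := Y) (Z := Z) (hX.sub hY).diffAt hY.diffAt
    rw [sub_add_cancel] at this
    rw [this]
    exact (add_sub_cancel_right _ _).symm
  have al : ∀ {X Y Z : VField M}, X.SmAt x → Y.SmAt x → Z.SmAt x →
      VectorField.mlieBracket (𝓡 4) (fun y ↦ X y + Y y) Z x
        = VectorField.mlieBracket (𝓡 4) X Z x + VectorField.mlieBracket (𝓡 4) Y Z x :=
    fun {X Y Z} hX hY _ ↦ bracket_add_left (Z := Z) hX.diffAt hY.diffAt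
  have J : ∀ {X Y Z : VField M}, X.SmAt x → Y.SmAt x → Z.SmAt x →
      VectorField.mlieBracket (𝓡 4) (VectorField.mlieBracket (𝓡 4) X Y) Z x
      + VectorField.mlieBracket (𝓡 4) (VectorField.mlieBracket (𝓡 4) Y Z) X x
      + VectorField.mlieBracket (𝓡 4) (VectorField.mlieBracket (𝓡 4) Z X) Y x = 0 := by
    intro X Y Z hX hY hZ
    have J := bracket_jacobi hX hY hZ
    have s1 : VectorField.mlieBracket (𝓡 4) X (VectorField.mlieBracket (𝓡 4) Y Z) x
        = -VectorField.mlieBracket (𝓡 4) (VectorField.mlieBracket (𝓡 4) Y Z) X x :=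
      VectorField.mlieBracket_swap_apply
    have s2 : VectorField.mlieBracket (𝓡 4) Y (VectorField.mlieBracket (𝓡 4) X Z) x
        = VectorField.mlieBracket (𝓡 4) (VectorField.mlieBracket (𝓡 4) Z X) Y x := by
      rw [VectorField.mlieBracket_swap_apply]
      have e : VectorField.mlieBracket (𝓡 4) X Z =
          fun y ↦ 0 - VectorField.mlieBracket (𝓡 4) Z X y := by
        ext1 y
        rw [VectorField.mlieBracket_swap_apply, zero_sub]
      have h0 := sl (hZ.bracket hX) (hZ.bracket hX) hY
      simp only [sub_self] at h0
      have := sl smAt_zero (hZ.bracket hX) hY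
      simp only [Pi.zero_apply] at this
      rw [e, this]
      have h00 : VectorField.mlieBracket (𝓡 4) (0 : VField M) Y x = 0 := h0
      rw [h00]; abel
    rw [s1, s2] at J
    linear_combination (norm := module) (-1 : ℝ) • J
  have E : ∀ {X Y Z : CVField M}, X.SmAt x → Y.SmAt x → Z.SmAt x →
      cbracket (cbracket X Y) Z x =
      (VectorField.mlieBracket (𝓡 4) (VectorField.mlieBracket (𝓡 4) (fun y ↦ (X y).1)
          (fun y ↦ (Y y).1)) (fun y ↦ (Z y).1) x
        - VectorField.mlieBracket (𝓡 4) (VectorField.mlieBracket (𝓡 4) (fun y ↦ (X y).2)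
          (fun y ↦ (Y y).2)) (fun y ↦ (Z y).1) x
        - (VectorField.mlieBracket (𝓡 4) (VectorField.mlieBracket (𝓡 4) (fun y ↦ (X y).1)
          (fun y ↦ (Y y).2)) (fun y ↦ (Z y).2) x
        + VectorField.mlieBracket (𝓡 4) (VectorField.mlieBracket (𝓡 4) (fun y ↦ (X y).2)
          (fun y ↦ (Y y).1)) (fun y ↦ (Z y).2) x),
       VectorField.mlieBracket (𝓡 4) (VectorField.mlieBracket (𝓡 4) (fun y ↦ (X y).1)
          (fun y ↦ (Y y).1)) (fun y ↦ (Z y).2) x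
        - VectorField.mlieBracket (𝓡 4) (VectorField.mlieBracket (𝓡 4) (fun y ↦ (X y).2)
          (fun y ↦ (Y y).2)) (fun y ↦ (Z y).2) x
        + (VectorField.mlieBracket (𝓡 4) (VectorField.mlieBracket (𝓡 4) (fun y ↦ (X y).1)
          (fun y ↦ (Y y).2)) (fun y ↦ (Z y).1) x
        + VectorField.mlieBracket (𝓡 4) (VectorField.mlieBracket (𝓡 4) (fun y ↦ (X y).2)
          (fun y ↦ (Y y).1)) (fun y ↦ (Z y).1) x)) := by
    intro X Y Z hX hY hZ
    have b11 := hX.fst.bracket hY.fst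
    have b12 := hX.fst.bracket hY.snd
    have b21 := hX.snd.bracket hY.fst
    have b22 := hX.snd.bracket hY.snd
    rw [← sl b11 b22 hZ.fst, ← al b12 b21 hZ.snd, ← sl b11 b22 hZ.snd, ← al b12 b21 hZ.fst]
    rfl
  rw [E hX hY hZ, E hY hZ hX, E hZ hX hY]
  have j111 := J hX.fst hY.fst hZ.fst
  have j221 := J hX.snd hY.snd hZ.fst
  have j122 := J hX.fst hY.snd hZ.snd
  have j212 := J hX.snd hY.fst hZ.snd
  have j112 := J hX.fst hY.fst hZ.snd
  have j121 := J hX.fst hY.snd hZ.fst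
  have j211 := J hX.snd hY.fst hZ.fst
  have j222 := J hX.snd hY.snd hZ.snd
  ext1
  · simp only [Prod.fst_add, Prod.fst_zero]
    linear_combination (norm := module) j111 - j221 - j122 - j212
  · simp only [Prod.snd_add, Prod.snd_zero]
    linear_combination (norm := module) j112 + j121 + j211 - j222

end Con

namespace FrameField

variable {U : Set M} {l n m k : CVField M} {x : M} {X Y Z : CVField M} {f : M → ℂ}

/-- The prime operation, which exchanges `l` with `n` and `m` with `m̄`. -/
lemma prime (h : FrameField 𝔐 U l n m k) : FrameField 𝔐 U n l k m :=
  ⟨h.isOpen, h.smooth_n, h.smooth_l, h.smooth_k, h.smooth_m, fun y ↦ (h.frame y).prime⟩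

/-- Conjugation, which exchanges `m` with `m̄`. -/
lemma bar (h : FrameField 𝔐 U l n m k) : FrameField 𝔐 U l n k m :=
  ⟨h.isOpen, h.smooth_l, h.smooth_n, h.smooth_k, h.smooth_m, fun y ↦ (h.frame y).bar⟩

lemma con_ll (h : FrameField 𝔐 U l n m k) (hx : x ∈ U) (hX : X.SmAt x) : con 𝔐 l l X x = 0 :=
  con_self (fun y ↦ (h.frame y).ll) (h.smooth_l hx) hX

lemma con_mm (h : FrameField 𝔐 U l n m k) (hx : x ∈ U) (hX : X.SmAt x) : con 𝔐 m m X x = 0 :=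
  con_self (fun y ↦ (h.frame y).mm) (h.smooth_m hx) hX

lemma con_lm (h : FrameField 𝔐 U l n m k) (hx : x ∈ U) (hX : X.SmAt x) :
    con 𝔐 l m X x = -con 𝔐 m l X x :=
  con_skew (fun y ↦ (h.frame y).lm) (h.smooth_l hx) (h.smooth_m hx) hX

lemma con_ln (h : FrameField 𝔐 U l n m k) (hx : x ∈ U) (hX : X.SmAt x) :
    con 𝔐 l n X x = -con 𝔐 n l X x :=
  con_skew (fun y ↦ (h.frame y).ln) (h.smooth_l hx) (h.smooth_n hx) hX

lemma con_km (h : FrameField 𝔐 U l n m k) (hx : x ∈ U) (hX : X.SmAt x) :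
    con 𝔐 k m X x = -con 𝔐 m k X x :=
  con_skew (fun y ↦ (h.bar.frame y).m_k) (h.smooth_k hx) (h.smooth_m hx) hX

lemma wconn_prime (h : FrameField 𝔐 U l n m k) (hx : x ∈ U) (hX : X.SmAt x) :
    wconn 𝔐 n l k m X x = -wconn 𝔐 l n m k X x := by
  simp only [wconn, h.con_ln hx hX, h.con_km hx hX]; ring

/-- The covariant derivatives of frame vectors, paired with each other. -/
lemma cval_nabla (h : FrameField 𝔐 U l n m k) (P Q X Y : CVField M) (x : M) :
    𝔐.g.cval x (𝔐.g.cnabla X P x) (𝔐.g.cnabla Y Q x)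
      = con 𝔐 n P X x * con 𝔐 l Q Y x + con 𝔐 l P X x * con 𝔐 n Q Y x
        - con 𝔐 k P X x * con 𝔐 m Q Y x - con 𝔐 m P X x * con 𝔐 k Q Y x := by
  rw [(h.frame x).cval_eq]
  simp only [cval_symm 𝔐.g (𝔐.g.cnabla X P x), con]

lemma eq_expand (h : FrameField 𝔐 U l n m k) (X : CVField M) :
    X = fun y ↦ smulT (𝔐.g.cval y (X y) (n y)) (l y)
    + smulT (𝔐.g.cval y (X y) (l y)) (n y) + smulT (-𝔐.g.cval y (X y) (k y)) (m y)
    + smulT (-𝔐.g.cval y (X y) (m y)) (k y) := funext fun y ↦ (h.frame y).expand (X y)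

lemma con_expand (h : FrameField 𝔐 U l n m k) (P : CVField M) {Q : CVField M}
    (hx : x ∈ U) (hX : X.SmAt x) (hQ : Q.SmAt x) :
    con 𝔐 P Q X x = 𝔐.g.cval x (X x) (n x) * con 𝔐 P Q l x
      + 𝔐.g.cval x (X x) (l x) * con 𝔐 P Q n x - 𝔐.g.cval x (X x) (k x) * con 𝔐 P Q m x
      - 𝔐.g.cval x (X x) (m x) * con 𝔐 P Q k x := by
  have sl := h.smooth_l hx
  have sn := h.smooth_n hx
  have sm := h.smooth_m hx
  have sk := h.smooth_k hx
  have f1 := smF_cval 𝔐.g hX sn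
  have f2 := smF_cval 𝔐.g hX sl
  have f3 : SmF (fun y ↦ -𝔐.g.cval y (X y) (k y)) x := (smF_cval 𝔐.g hX sk).neg
  have f4 : SmF (fun y ↦ -𝔐.g.cval y (X y) (m y)) x := (smF_cval 𝔐.g hX sm).neg
  conv_lhs => rw [h.eq_expand X]
  rw [con_add (((sl.smulT f1).add (sn.smulT f2)).add (sm.smulT f3)) (sk.smulT f4) hQ,
    con_add ((sl.smulT f1).add (sn.smulT f2)) (sm.smulT f3) hQ,
    con_add (sl.smulT f1) (sn.smulT f2) hQ, con_smulT f1 sl hQ, con_smulT f2 sn hQ,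
    con_smulT f3 sm hQ, con_smulT f4 sk hQ]
  ring

lemma cderiv_expand (h : FrameField 𝔐 U l n m k) (f : M → ℂ) (X : CVField M) (x : M) :
    cderiv X f x = 𝔐.g.cval x (X x) (n x) * cderiv l f x
      + 𝔐.g.cval x (X x) (l x) * cderiv n f x - 𝔐.g.cval x (X x) (k x) * cderiv m f x
      - 𝔐.g.cval x (X x) (m x) * cderiv k f x := by
  conv_lhs => rw [h.eq_expand X]
  simp only [cderiv_add_left]
  rw [cderiv_smulT, cderiv_smulT, cderiv_smulT, cderiv_smulT]
  ring

/-- The second covariant derivative, by metric compatibility. -/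
lemma cval_nabla_nabla {P Q : CVField M} (hP : P.SmAt x) (hQ : Q.SmAt x) (hX : X.SmAt x)
    (hY : Y.SmAt x) : 𝔐.g.cval x (P x) (𝔐.g.cnabla X (𝔐.g.cnabla Y Q) x)
      = cderiv X (con 𝔐 P Q Y) x - 𝔐.g.cval x (𝔐.g.cnabla X P x) (𝔐.g.cnabla Y Q x) := by
  have := cnabla_metric (𝔐 := 𝔐) hX hP (hY.nabla (𝔐 := 𝔐) hQ)
  have e : (fun y ↦ 𝔐.g.cval y (P y) (𝔐.g.cnabla Y Q y)) = con 𝔐 P Q Y := rfl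
  rw [e] at this
  linear_combination -this

/-- The curvature in terms of connection coefficients. -/
lemma cweyl_eq {P Q : CVField M} (hP : P.SmAt x) (hQ : Q.SmAt x) (hX : X.SmAt x)
    (hY : Y.SmAt x) : 𝔐.g.cweyl x (P x) (Q x) (X x) (Y x)
      = cderiv X (con 𝔐 P Q Y) x - cderiv Y (con 𝔐 P Q X) x - con 𝔐 P Q (cbracket X Y) x
        - 𝔐.g.cval x (𝔐.g.cnabla X P x) (𝔐.g.cnabla Y Q x)
        + 𝔐.g.cval x (𝔐.g.cnabla Y P x) (𝔐.g.cnabla X Q x) := by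
  rw [← cval_ccurv (P x) hX hY hQ, LorentzMetric.ccurv, cval_sub_right, cval_sub_right,
    cval_nabla_nabla hP hQ hX hY, cval_nabla_nabla hP hQ hY hX]
  simp only [con]
  ring

/-- The structure equation of the form `g(m, ∇ l)`. -/
lemma structure_ml (h : FrameField 𝔐 U l n m k) (hx : x ∈ U) (hX : X.SmAt x) (hY : Y.SmAt x) :
    𝔐.g.cweyl x (m x) (l x) (X x) (Y x)
      = cderiv X (con 𝔐 m l Y) x - cderiv Y (con 𝔐 m l X) x - con 𝔐 m l (cbracket X Y) x
        + 2 * (con 𝔐 m l X x * wconn 𝔐 l n m k Y x - con 𝔐 m l Y x * wconn 𝔐 l n m k X x) := by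
  rw [cweyl_eq (h.smooth_m hx) (h.smooth_l hx) hX hY, h.cval_nabla, h.cval_nabla,
    h.con_ll hx hX, h.con_ll hx hY, h.con_mm hx hX, h.con_mm hx hY, h.con_lm hx hX,
    h.con_lm hx hY, h.con_km hx hX, h.con_km hx hY]
  simp only [wconn]
  ring

/-- The curvature of the connection form. -/
lemma structure_wconn (h : FrameField 𝔐 U l n m k) (hx : x ∈ U) (hX : X.SmAt x) (hY : Y.SmAt x) :
    𝔐.g.cweyl x (n x) (l x) (X x) (Y x) + 𝔐.g.cweyl x (m x) (k x) (X x) (Y x)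
      = 2 * (cderiv X (wconn 𝔐 l n m k Y) x - cderiv Y (wconn 𝔐 l n m k X) x
          - wconn 𝔐 l n m k (cbracket X Y) x
          + con 𝔐 k n X x * con 𝔐 m l Y x - con 𝔐 m l X x * con 𝔐 k n Y x) := by
  have sl := h.smooth_l hx
  have sn := h.smooth_n hx
  have sm := h.smooth_m hx
  have sk := h.smooth_k hx
  have e : ∀ {X Y : CVField M}, X.SmAt x → Y.SmAt x → cderiv X (wconn 𝔐 l n m k Y) x
      = (1 / 2) * (cderiv X (con 𝔐 n l Y) x + cderiv X (con 𝔐 m k Y) x) := by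
    intro X Y _ hY
    have d1 := smF_con (𝔐 := 𝔐) sn sl hY
    have d2 := smF_con (𝔐 := 𝔐) sm sk hY
    rw [← cderiv_add d1.diF d2.diF, ← cderiv_const_mul _ (d1.cadd d2).diF]
    rfl
  rw [cweyl_eq sn sl hX hY, cweyl_eq sm sk hX hY, h.cval_nabla, h.cval_nabla, h.cval_nabla,
    h.cval_nabla, e hX hY, e hY hX, h.con_ll hx hX, h.con_ll hx hY, h.con_mm hx hX, h.con_mm hx hY,
    h.prime.con_ll hx hX, h.prime.con_ll hx hY, h.bar.con_mm hx hX, h.bar.con_mm hx hY,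
    h.con_lm hx hX, h.con_lm hx hY, h.con_km hx hX, h.con_km hx hY, h.con_ln hx hX, h.con_ln hx hY,
    h.bar.con_lm hx hX, h.bar.con_lm hx hY, h.prime.con_lm hx hX, h.prime.con_lm hx hY,
    h.prime.bar.con_lm hx hX, h.prime.bar.con_lm hx hY]
  simp only [wconn]
  ring

/-- The exterior derivative of the structure equation of `g(m, ∇ l)`, for three vector fields that
pairwise annihilate the curvature form: the curvature is then constrained algebraically. -/
lemma bianchi_ml (h : FrameField 𝔐 U l n m k) (hx : x ∈ U)
    (hX : ∀ y ∈ U, X.SmAt y) (hY : ∀ y ∈ U, Y.SmAt y)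
    (hZ : ∀ y ∈ U, Z.SmAt y) (hXY : ∀ y, 𝔐.g.cweyl y (m y) (l y) (X y) (Y y) = 0)
    (hYZ : ∀ y, 𝔐.g.cweyl y (m y) (l y) (Y y) (Z y) = 0)
    (hZX : ∀ y, 𝔐.g.cweyl y (m y) (l y) (Z y) (X y) = 0) :
    con 𝔐 m l Z x * (𝔐.g.cweyl x (n x) (l x) (X x) (Y x) + 𝔐.g.cweyl x (m x) (k x) (X x) (Y x))
    + con 𝔐 m l X x * (𝔐.g.cweyl x (n x) (l x) (Y x) (Z x) + 𝔐.g.cweyl x (m x) (k x) (Y x) (Z x))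
    + con 𝔐 m l Y x * (𝔐.g.cweyl x (n x) (l x) (Z x) (X x) + 𝔐.g.cweyl x (m x) (k x) (Z x) (X x))
    = 𝔐.g.cweyl x (m x) (l x) (cbracket X Y x) (Z x)
      + 𝔐.g.cweyl x (m x) (l x) (cbracket Y Z x) (X x)
      + 𝔐.g.cweyl x (m x) (l x) (cbracket Z X x) (Y x) := by
  have sl := h.smooth_l hx
  have sm := h.smooth_m hx
  have sa : ∀ {X : CVField M}, X.SmAt x → SmF (con 𝔐 m l X) x := fun hX ↦ smF_con sm sl hX
  have sw : ∀ {X : CVField M}, X.SmAt x → SmF (wconn 𝔐 l n m k X) x := fun hX ↦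
    (smF_const _).cmul ((smF_con (h.smooth_n hx) sl hX).cadd (smF_con sm (h.smooth_k hx) hX))
  -- the derivative of `da(Y, Z)`, which is `-2 (a ∧ w)(Y, Z)` on all of `U`
  have D : ∀ {X Y Z : CVField M}, (∀ y ∈ U, X.SmAt y) → (∀ y ∈ U, Y.SmAt y) → (∀ y ∈ U, Z.SmAt y) →
      (∀ y, 𝔐.g.cweyl y (m y) (l y) (Y y) (Z y) = 0) →
      cderiv X (cderiv Y (con 𝔐 m l Z)) x - cderiv X (cderiv Z (con 𝔐 m l Y)) x
        - cderiv X (con 𝔐 m l (cbracket Y Z)) x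
      = -2 * (con 𝔐 m l Y x * cderiv X (wconn 𝔐 l n m k Z) x
          + wconn 𝔐 l n m k Z x * cderiv X (con 𝔐 m l Y) x
          - (con 𝔐 m l Z x * cderiv X (wconn 𝔐 l n m k Y) x
          + wconn 𝔐 l n m k Y x * cderiv X (con 𝔐 m l Z) x)) := by
    intro X Y Z hX hY hZ h0
    have hXx := hX x hx
    have hYx := hY x hx
    have hZx := hZ x hx
    have e : (fun y ↦ cderiv Y (con 𝔐 m l Z) y - cderiv Z (con 𝔐 m l Y) y
        - con 𝔐 m l (cbracket Y Z) y) =ᶠ[𝓝 x] fun y ↦ (-2 : ℂ) * (con 𝔐 m l Y y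
          * wconn 𝔐 l n m k Z y - con 𝔐 m l Z y * wconn 𝔐 l n m k Y y) := by
      filter_upwards [h.isOpen.mem_nhds hx] with y hy
      have := h.structure_ml hy (hY y hy) (hZ y hy)
      rw [h0 y] at this
      linear_combination -this
    have e2 := cderiv_congr (X := X) e
    have s1 := (sa hYx).cmul (sw hZx)
    have s2 := (sa hZx).cmul (sw hYx)
    rw [cderiv_sub (((sa hZx).cderiv hYx).csub ((sa hYx).cderiv hZx)).diF
      (sa (hYx.bracket hZx)).diF, cderiv_sub ((sa hZx).cderiv hYx).diF ((sa hYx).cderiv hZx).diF,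
      cderiv_const_mul _ (s1.csub s2).diF, cderiv_sub s1.diF s2.diF,
      cderiv_mul (sa hYx).diF (sw hZx).diF, cderiv_mul (sa hZx).diF (sw hYx).diF] at e2
    exact e2
  have d1 := D hX hY hZ hYZ
  have d2 := D hY hZ hX hZX
  have d3 := D hZ hX hY hXY
  have hXx := hX x hx
  have hYx := hY x hx
  have hZx := hZ x hx
  have c1 := cderiv_bracket (sa hZx) hXx hYx
  have c2 := cderiv_bracket (sa hXx) hYx hZx
  have c3 := cderiv_bracket (sa hYx) hZx hXx
  have t1 := h.structure_ml hx (hXx.bracket hYx) hZx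
  have t2 := h.structure_ml hx (hYx.bracket hZx) hXx
  have t3 := h.structure_ml hx (hZx.bracket hXx) hYx
  have u1 := h.structure_ml hx hXx hYx
  have u2 := h.structure_ml hx hYx hZx
  have u3 := h.structure_ml hx hZx hXx
  rw [hXY] at u1
  rw [hYZ] at u2
  rw [hZX] at u3
  have v1 := h.structure_wconn hx hXx hYx
  have v2 := h.structure_wconn hx hYx hZx
  have v3 := h.structure_wconn hx hZx hXx
  -- the iterated brackets contribute zero by the Jacobi identity
  have j : con 𝔐 m l (cbracket (cbracket X Y) Z) x + con 𝔐 m l (cbracket (cbracket Y Z) X) x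
      + con 𝔐 m l (cbracket (cbracket Z X) Y) x = 0 := by
    rw [h.con_expand m hx ((hXx.bracket hYx).bracket hZx) sl,
      h.con_expand m hx ((hYx.bracket hZx).bracket hXx) sl,
      h.con_expand m hx ((hZx.bracket hXx).bracket hYx) sl]
    have J := cbracket_jacobi hXx hYx hZx
    have e : ∀ P : CTangent x, 𝔐.g.cval x (cbracket (cbracket X Y) Z x) P
        + 𝔐.g.cval x (cbracket (cbracket Y Z) X x) P
        + 𝔐.g.cval x (cbracket (cbracket Z X) Y x) P = 0 := by
      intro P
      rw [← cval_add_left, ← cval_add_left, J]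
      simp [LorentzMetric.cval_eq]
    linear_combination con 𝔐 m l l x * e (n x) + con 𝔐 m l n x * e (l x)
      - con 𝔐 m l m x * e (k x) - con 𝔐 m l k x * e (m x)
  rw [v1, v2, v3, t1, t2, t3]
  linear_combination -d1 - d2 - d3 - c1 - c2 - c3 + j
    - 2 * (wconn 𝔐 l n m k Z x * u1 + wconn 𝔐 l n m k X x * u2 + wconn 𝔐 l n m k Y x * u3)

end FrameField

end FrameField

/-! ### Goldberg-Sachs and the Teukolsky identity in a null frame field -/

section Identity

variable {𝔐 : Background M}

variable (𝔐) in
/-- The divergence of a complex vector field, computed in a null frame. -/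
def frameDiv (l n m k X : CVField M) (y : M) : ℂ :=
  con 𝔐 n X l y + con 𝔐 l X n y - con 𝔐 k X m y - con 𝔐 m X k y

variable (𝔐) in
/-- The factor `þ' - ρ'` of the Teukolsky operator, in a null frame field. -/
def frameU (l n m k : CVField M) (s : ℂ) (h : M → ℂ) (y : M) : ℂ :=
  cderiv n h y - 2 * s * wconn 𝔐 l n m k n y * h y - con 𝔐 k n m y * h y

variable (𝔐) in
/-- The factor `ð' - τ'` of the Teukolsky operator, in a null frame field. -/
def frameV (l n m k : CVField M) (s : ℂ) (h : M → ℂ) (y : M) : ℂ :=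
  cderiv k h y - 2 * s * wconn 𝔐 l n m k k y * h y - con 𝔐 k n l y * h y

variable (𝔐) in
/-- The Teukolsky operator in a null frame field. The conjugate connection form is the connection
form of the conjugate frame. -/
def frameTeukolsky (l n m k : CVField M) (s : ℂ) (h : M → ℂ) (y : M) : ℂ :=
  2 * ((cderiv l (frameU 𝔐 l n m k s h) y
      - ((2 * s - 1) * wconn 𝔐 l n m k l y - wconn 𝔐 l n k m l y + 2 * s * con 𝔐 m l k y
        + con 𝔐 k l m y) * frameU 𝔐 l n m k s h y)
    - (cderiv m (frameV 𝔐 l n m k s h) y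
      - ((2 * s - 1) * wconn 𝔐 l n m k m y + wconn 𝔐 l n k m m y + 2 * s * con 𝔐 m l n y
        + con 𝔐 m n l y) * frameV 𝔐 l n m k s h y))
    - (4 * s ^ 2 - 6 * s + 2) * 𝔐.g.cweyl y (m y) (l y) (k y) (n y) * h y

variable (𝔐) in
/-- The component of the current of the Teukolsky operators along `n`. -/
def frameY (l n m k : CVField M) (s : ℂ) (f : M → ℂ) (y : M) : ℂ :=
  cderiv l f y + 2 * s * wconn 𝔐 l n m k l y * f y + (2 * s - 1) * con 𝔐 m l k y * f y

variable (𝔐) in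
/-- The component of the current of the Teukolsky operators along `m̄`. -/
def frameZ (l n m k : CVField M) (s : ℂ) (f : M → ℂ) (y : M) : ℂ :=
  cderiv m f y + 2 * s * wconn 𝔐 l n m k m y * f y + (2 * s - 1) * con 𝔐 m l n y * f y

variable (𝔐) in
/-- The current whose divergence is the difference of the Teukolsky operators. -/
def current (l n m k : CVField M) (s : ℂ) (f h : M → ℂ) : CVField M := fun y ↦
  smulT (2 * (f y * frameU 𝔐 l n m k s h y)) (l y)
    + smulT (-2 * (h y * frameY 𝔐 l n m k s f y)) (n y)
    + smulT (-2 * (f y * frameV 𝔐 l n m k s h y)) (m y)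
    + smulT (2 * (h y * frameZ 𝔐 l n m k s f y)) (k y)

namespace FrameField

variable {U : Set M} {l n m k : CVField M} {x : M} {X Y : CVField M}

lemma cval_bracket_frame (P : CVField M) (hX : X.SmAt x) (hY : Y.SmAt x) :
    𝔐.g.cval x (cbracket X Y x) (P x) = con 𝔐 P Y X x - con 𝔐 P X Y x :=
  cval_bracket (P x) hX hY

/-- The principal null direction `l` is geodesic: `bianchi_ml` for `l, m, m̄` reads `3 κ Ψ₂ = 0`,
where `κ = g(m, ∇_l l)`. -/
lemma kappa_eq_zero (fr : FrameField 𝔐 U l n m k) (hx : x ∈ U)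
    (hψ : 𝔐.g.cweyl x (m x) (l x) (k x) (n x) ≠ 0) : con 𝔐 m l l x = 0 := by
  have F := fun y ↦ fr.frame y
  have e3 : ∀ y, 𝔐.g.cval y (m y) (l y) = 0 := fun y ↦ by rw [cval_symm, (F y).lm]
  have e4 : ∀ y, 𝔐.g.cval y (k y) (l y) = 0 := fun y ↦ by rw [cval_symm, (F y).lk]
  have e6 : 𝔐.g.cval x (k x) (n x) = 0 := by rw [cval_symm, (F x).nk]
  have e7 : 𝔐.g.cval x (k x) (m x) = -1 := by rw [cval_symm, (F x).m_k]
  have e8 : 𝔐.g.cval x (m x) (n x) = 0 := by rw [cval_symm, (F x).nm]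
  have B := fr.bianchi_ml hx (X := l) (Y := m) (Z := k) (fun y ↦ fr.smooth_l) (fun y ↦ fr.smooth_m)
    (fun y ↦ fr.smooth_k)
    (fun y ↦ by rw [(F y).cweyl_ml, (F y).ll, (F y).lm]; ring)
    (fun y ↦ by rw [(F y).cweyl_ml, (F y).mm, e3, e4]; ring)
    (fun y ↦ by rw [(F y).cweyl_ml, (F y).ll, e4, (F y).lm]; ring)
  rw [(F x).cweyl_nl_add_mk, (F x).cweyl_nl_add_mk, (F x).cweyl_nl_add_mk,
    (F x).cweyl_ml (cbracket l m x),
    (F x).cweyl_ml (cbracket m k x), (F x).cweyl_ml (cbracket k l x),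
    cval_bracket_frame l (fr.smooth_l hx) (fr.smooth_m hx)] at B
  have k1 := fr.con_lm hx (fr.smooth_l hx)
  have k2 := fr.con_ll hx (fr.smooth_m hx)
  simp only [(F x).ll, (F x).ln, (F x).lk, (F x).lm, (F x).mm, (F x).kk, (F x).m_k, e3, e4, e6, e7,
    e8, k1, k2] at B
  have : 𝔐.g.cweyl x (m x) (l x) (k x) (n x) * con 𝔐 m l l x = 0 := by
    linear_combination -(1 / 3) * B
  exact (mul_eq_zero.1 this).resolve_left hψ

/-- The principal null direction `l` is shear free: `bianchi_ml` for `l, n, m` reads `3 σ Ψ₂ = 0`,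
where `σ = g(m, ∇_m l)`. -/
lemma sigma_eq_zero (fr : FrameField 𝔐 U l n m k) (hx : x ∈ U)
    (hψ : 𝔐.g.cweyl x (m x) (l x) (k x) (n x) ≠ 0) : con 𝔐 m l m x = 0 := by
  have F := fun y ↦ fr.frame y
  have e3 : ∀ y, 𝔐.g.cval y (m y) (l y) = 0 := fun y ↦ by rw [cval_symm, (F y).lm]
  have e8 : ∀ y, 𝔐.g.cval y (m y) (n y) = 0 := fun y ↦ by rw [cval_symm, (F y).nm]
  have e5 : ∀ y, 𝔐.g.cval y (n y) (l y) = 1 := fun y ↦ by rw [cval_symm, (F y).ln]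
  have B := fr.bianchi_ml hx (X := l) (Y := n) (Z := m) (fun y ↦ fr.smooth_l) (fun y ↦ fr.smooth_n)
    (fun y ↦ fr.smooth_m)
    (fun y ↦ by rw [(F y).cweyl_ml, (F y).ll, (F y).lm]; ring)
    (fun y ↦ by rw [(F y).cweyl_ml, (F y).mm, e3, (F y).nm]; ring)
    (fun y ↦ by rw [(F y).cweyl_ml, (F y).mm, e3]; ring)
  rw [(F x).cweyl_nl_add_mk, (F x).cweyl_nl_add_mk, (F x).cweyl_nl_add_mk,
    (F x).cweyl_ml (cbracket l n x),
    (F x).cweyl_ml (cbracket n m x), (F x).cweyl_ml (cbracket m l x),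
    cval_bracket_frame m (fr.smooth_m hx) (fr.smooth_l hx)] at B
  have k2 := fr.con_mm hx (fr.smooth_l hx)
  simp only [(F x).ll, (F x).ln, (F x).lk, (F x).lm, (F x).mm, (F x).nn, (F x).nk, (F x).nm,
    (F x).m_k, e3, e5, e8, k2] at B
  have : 𝔐.g.cweyl x (m x) (l x) (k x) (n x) * con 𝔐 m l m x = 0 := by
    linear_combination (1 / 3) * B
  exact (mul_eq_zero.1 this).resolve_left hψ

lemma smF_wconn (fr : FrameField 𝔐 U l n m k) (hx : x ∈ U) (hX : X.SmAt x) :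
    SmF (wconn 𝔐 l n m k X) x :=
  (smF_const _).cmul ((smF_con (fr.smooth_n hx) (fr.smooth_l hx) hX).cadd
    (smF_con (fr.smooth_m hx) (fr.smooth_k hx) hX))

lemma smF_frameU (fr : FrameField 𝔐 U l n m k) (hx : x ∈ U) (s : ℂ) {h : M → ℂ} (hh : SmF h x) :
    SmF (frameU 𝔐 l n m k s h) x :=
  ((hh.cderiv (fr.smooth_n hx)).csub
    (((smF_const _).cmul (fr.smF_wconn hx (fr.smooth_n hx))).cmul hh)).csub
    ((smF_con (fr.smooth_k hx) (fr.smooth_n hx) (fr.smooth_m hx)).cmul hh)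

lemma smF_frameV (fr : FrameField 𝔐 U l n m k) (hx : x ∈ U) (s : ℂ) {h : M → ℂ} (hh : SmF h x) :
    SmF (frameV 𝔐 l n m k s h) x :=
  ((hh.cderiv (fr.smooth_k hx)).csub
    (((smF_const _).cmul (fr.smF_wconn hx (fr.smooth_k hx))).cmul hh)).csub
    ((smF_con (fr.smooth_k hx) (fr.smooth_n hx) (fr.smooth_l hx)).cmul hh)

lemma smF_frameY (fr : FrameField 𝔐 U l n m k) (hx : x ∈ U) (s : ℂ) {h : M → ℂ} (hh : SmF h x) :
    SmF (frameY 𝔐 l n m k s h) x :=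
  ((hh.cderiv (fr.smooth_l hx)).cadd
    (((smF_const _).cmul (fr.smF_wconn hx (fr.smooth_l hx))).cmul hh)).cadd
    (((smF_const _).cmul (smF_con (fr.smooth_m hx) (fr.smooth_l hx) (fr.smooth_k hx))).cmul hh)

lemma smF_frameZ (fr : FrameField 𝔐 U l n m k) (hx : x ∈ U) (s : ℂ) {h : M → ℂ} (hh : SmF h x) :
    SmF (frameZ 𝔐 l n m k s h) x :=
  ((hh.cderiv (fr.smooth_m hx)).cadd
    (((smF_const _).cmul (fr.smF_wconn hx (fr.smooth_m hx))).cmul hh)).cadd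
    (((smF_const _).cmul (smF_con (fr.smooth_m hx) (fr.smooth_l hx) (fr.smooth_n hx))).cmul hh)

/-- The divergence of a multiple of a vector field. -/
lemma frameDiv_smulT (fr : FrameField 𝔐 U l n m k) (hx : x ∈ U) {q : M → ℂ} (hq : SmF q x)
    (hX : X.SmAt x) : frameDiv 𝔐 l n m k (fun y ↦ smulT (q y) (X y)) x
      = q x * frameDiv 𝔐 l n m k X x + cderiv X q x := by
  have e : ∀ P Y : CVField M, Y.SmAt x → con 𝔐 P (fun y ↦ smulT (q y) (X y)) Y x
      = cderiv Y q x * 𝔐.g.cval x (P x) (X x) + q x * con 𝔐 P X Y x := by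
    intro P Y hY
    simp only [con, cnabla_smulT_right hq hY hX, cval_add_right, cval_smul_right]
  rw [fr.cderiv_expand q X]
  simp only [frameDiv, e _ _ (fr.smooth_l hx), e _ _ (fr.smooth_n hx), e _ _ (fr.smooth_m hx),
    e _ _ (fr.smooth_k hx), cval_symm 𝔐.g (X x)]
  ring

lemma frameDiv_add (fr : FrameField 𝔐 U l n m k) (hx : x ∈ U) (hX : X.SmAt x) (hY : Y.SmAt x) :
    frameDiv 𝔐 l n m k (fun y ↦ X y + Y y) x
      = frameDiv 𝔐 l n m k X x + frameDiv 𝔐 l n m k Y x := by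
  simp only [frameDiv, con, cnabla_add_right (fr.smooth_l hx) hX hY,
    cnabla_add_right (fr.smooth_n hx) hX hY, cnabla_add_right (fr.smooth_m hx) hX hY,
    cnabla_add_right (fr.smooth_k hx) hX hY, cval_add_right]
  ring

lemma smAt_current (fr : FrameField 𝔐 U l n m k) (hx : x ∈ U) (s : ℂ) {f h : M → ℂ}
    (hf : SmF f x) (hh : SmF h x) : (current 𝔐 l n m k s f h).SmAt x :=
  ((((fr.smooth_l hx).smulT ((smF_const _).cmul (hf.cmul (fr.smF_frameU hx s hh)))).add
    ((fr.smooth_n hx).smulT ((smF_const _).cmul (hh.cmul (fr.smF_frameY hx s hf))))).add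
    ((fr.smooth_m hx).smulT ((smF_const _).cmul (hf.cmul (fr.smF_frameV hx s hh))))).add
    ((fr.smooth_k hx).smulT ((smF_const _).cmul (hh.cmul (fr.smF_frameZ hx s hf))))

/-- The divergence of the current by the Leibniz rule. The three connection coefficients that
accompany each component are the divergence of the frame vector. -/
lemma frameDiv_current (fr : FrameField 𝔐 U l n m k) (hx : x ∈ U) (s : ℂ) {f h : M → ℂ}
    (hf : SmF f x) (hh : SmF h x) : frameDiv 𝔐 l n m k (current 𝔐 l n m k s f h) x
      = 2 * (f x * frameU 𝔐 l n m k s h x * (con 𝔐 n l l x - con 𝔐 k l m x - con 𝔐 m l k x)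
        + f x * cderiv l (frameU 𝔐 l n m k s h) x + frameU 𝔐 l n m k s h x * cderiv l f x)
      - 2 * (h x * frameY 𝔐 l n m k s f x * (-con 𝔐 n l n x - con 𝔐 k n m x - con 𝔐 m n k x)
        + h x * cderiv n (frameY 𝔐 l n m k s f) x + frameY 𝔐 l n m k s f x * cderiv n h x)
      - 2 * (f x * frameV 𝔐 l n m k s h x * (-con 𝔐 m n l x - con 𝔐 m l n x + con 𝔐 m k m x)
        + f x * cderiv m (frameV 𝔐 l n m k s h) x + frameV 𝔐 l n m k s h x * cderiv m f x)
      + 2 * (h x * frameZ 𝔐 l n m k s f x * (-con 𝔐 k n l x - con 𝔐 k l n x - con 𝔐 m k k x)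
        + h x * cderiv k (frameZ 𝔐 l n m k s f) x + frameZ 𝔐 l n m k s f x * cderiv k h x) := by
  have sl := fr.smooth_l hx
  have sn := fr.smooth_n hx
  have sm := fr.smooth_m hx
  have sk := fr.smooth_k hx
  have sU := fr.smF_frameU hx s hh
  have sV := fr.smF_frameV hx s hh
  have sY := fr.smF_frameY hx s hf
  have sZ := fr.smF_frameZ hx s hf
  have q1 := (smF_const 2).cmul (hf.cmul sU)
  have q2 := (smF_const (-2)).cmul (hh.cmul sY)
  have q3 := (smF_const (-2)).cmul (hf.cmul sV)
  have q4 := (smF_const 2).cmul (hh.cmul sZ)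
  have v1 := sl.smulT q1
  have v2 := sn.smulT q2
  have v3 := sm.smulT q3
  have v4 := sk.smulT q4
  have E := fr.frameDiv_add hx ((v1.add v2).add v3) v4
  rw [fr.frameDiv_add hx (v1.add v2) v3, fr.frameDiv_add hx v1 v2, fr.frameDiv_smulT hx q1 sl,
    fr.frameDiv_smulT hx q2 sn, fr.frameDiv_smulT hx q3 sm, fr.frameDiv_smulT hx q4 sk,
    cderiv_const_mul _ (hf.cmul sU).diF, cderiv_const_mul _ (hh.cmul sY).diF,
    cderiv_const_mul _ (hf.cmul sV).diF, cderiv_const_mul _ (hh.cmul sZ).diF,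
    cderiv_mul hf.diF sU.diF, cderiv_mul hh.diF sY.diF, cderiv_mul hf.diF sV.diF,
    cderiv_mul hh.diF sZ.diF] at E
  refine E.trans ?_
  simp only [frameDiv]
  rw [fr.con_ll hx sn, fr.prime.con_ll hx sl, fr.con_ln hx sn, fr.con_mm hx sk, fr.con_km hx sm,
    fr.bar.con_mm hx sm, fr.prime.bar.con_lm hx sl, fr.con_lm hx sn, fr.prime.con_lm hx sl,
    fr.bar.con_lm hx sn]
  ring

/-- The commutator of the derivatives along `l` and `n`. -/
lemma commutator_ln (fr : FrameField 𝔐 U l n m k) (hx : x ∈ U) {f : M → ℂ} (hf : SmF f x) :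
    cderiv l (cderiv n f) x - cderiv n (cderiv l f) x
      = -con 𝔐 n l n x * cderiv l f x - con 𝔐 n l l x * cderiv n f x
        - (con 𝔐 k n l x - con 𝔐 k l n x) * cderiv m f x
        - (con 𝔐 m n l x - con 𝔐 m l n x) * cderiv k f x := by
  have sl := fr.smooth_l hx
  have sn := fr.smooth_n hx
  have b := fun P ↦ cval_bracket_frame (𝔐 := 𝔐) P sl sn
  rw [← cderiv_bracket hf sl sn, fr.cderiv_expand f (cbracket l n), b n, b l, b k, b m,
    fr.con_ll hx sn, fr.prime.con_ll hx sl, fr.con_ln hx sl]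
  ring

/-- The commutator of the derivatives along `m` and `k`. -/
lemma commutator_mk (fr : FrameField 𝔐 U l n m k) (hx : x ∈ U) {f : M → ℂ} (hf : SmF f x) :
    cderiv m (cderiv k f) x - cderiv k (cderiv m f) x
      = (con 𝔐 m n k x - con 𝔐 k n m x) * cderiv l f x
        + (con 𝔐 m l k x - con 𝔐 k l m x) * cderiv n f x
        - con 𝔐 m k k x * cderiv m f x - con 𝔐 m k m x * cderiv k f x := by
  have sm := fr.smooth_m hx
  have sk := fr.smooth_k hx
  have b := fun P ↦ cval_bracket_frame (𝔐 := 𝔐) P sm sk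
  rw [← cderiv_bracket hf sm sk, fr.cderiv_expand f (cbracket m k), b n, b l, b k, b m,
    fr.con_mm hx sk, fr.bar.con_mm hx sm, fr.con_km hx sk, fr.prime.con_lm hx sm,
    fr.prime.bar.con_lm hx sk, fr.bar.con_lm hx sm, fr.con_lm hx sk]
  ring

lemma wconn_expand (fr : FrameField 𝔐 U l n m k) (hx : x ∈ U) (hX : X.SmAt x) :
    wconn 𝔐 l n m k X x = 𝔐.g.cval x (X x) (n x) * wconn 𝔐 l n m k l x
      + 𝔐.g.cval x (X x) (l x) * wconn 𝔐 l n m k n x - 𝔐.g.cval x (X x) (k x) * wconn 𝔐 l n m k m x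
      - 𝔐.g.cval x (X x) (m x) * wconn 𝔐 l n m k k x := by
  simp only [wconn]
  rw [fr.con_expand n hx hX (fr.smooth_l hx), fr.con_expand m hx hX (fr.smooth_k hx)]
  ring

/-- The component of the curvature of the connection form in the `(l, n)` plane. -/
lemma curvature_ln (fr : FrameField 𝔐 U l n m k) (hx : x ∈ U)
    (hψ : 𝔐.g.cweyl x (m x) (l x) (k x) (n x) ≠ 0) :
    cderiv l (wconn 𝔐 l n m k n) x - cderiv n (wconn 𝔐 l n m k l) x
      = 𝔐.g.cweyl x (m x) (l x) (k x) (n x) - con 𝔐 n l n x * wconn 𝔐 l n m k l x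
        - con 𝔐 n l l x * wconn 𝔐 l n m k n x
        - (con 𝔐 k n l x - con 𝔐 k l n x) * wconn 𝔐 l n m k m x
        - (con 𝔐 m n l x - con 𝔐 m l n x) * wconn 𝔐 l n m k k x
        - con 𝔐 k n l x * con 𝔐 m l n x := by
  have sl := fr.smooth_l hx
  have sn := fr.smooth_n hx
  have F := fr.frame x
  have e1 : 𝔐.g.cval x (n x) (l x) = 1 := by rw [cval_symm, F.ln]
  have b := fun P ↦ cval_bracket_frame (𝔐 := 𝔐) P sl sn
  have w := fr.structure_wconn hx sl sn
  rw [F.cweyl_nl_add_mk, fr.wconn_expand hx (sl.bracket sn), b n, b l, b k, b m,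
    fr.con_ll hx sn, fr.prime.con_ll hx sl, fr.con_ln hx sl, fr.kappa_eq_zero hx hψ] at w
  simp only [F.ll, F.ln, F.lm, F.lk, F.nn, F.nm, F.nk, e1] at w
  linear_combination -(1 / 2) * w

/-- The component of the curvature of the connection form in the `(m, k)` plane. -/
lemma curvature_mk (fr : FrameField 𝔐 U l n m k) (hx : x ∈ U)
    (hψ : 𝔐.g.cweyl x (m x) (l x) (k x) (n x) ≠ 0) :
    cderiv m (wconn 𝔐 l n m k k) x - cderiv k (wconn 𝔐 l n m k m) x
      = -𝔐.g.cweyl x (m x) (l x) (k x) (n x) + (con 𝔐 m n k x - con 𝔐 k n m x) * wconn 𝔐 l n m k l x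
        + (con 𝔐 m l k x - con 𝔐 k l m x) * wconn 𝔐 l n m k n x
        - con 𝔐 m k k x * wconn 𝔐 l n m k m x - con 𝔐 m k m x * wconn 𝔐 l n m k k x
        - con 𝔐 k n m x * con 𝔐 m l k x := by
  have sm := fr.smooth_m hx
  have sk := fr.smooth_k hx
  have F := fr.frame x
  have e2 : 𝔐.g.cval x (k x) (m x) = -1 := by rw [cval_symm, F.m_k]
  have e3 : 𝔐.g.cval x (m x) (l x) = 0 := by rw [cval_symm, F.lm]
  have e4 : 𝔐.g.cval x (k x) (l x) = 0 := by rw [cval_symm, F.lk]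
  have e5 : 𝔐.g.cval x (m x) (n x) = 0 := by rw [cval_symm, F.nm]
  have e6 : 𝔐.g.cval x (k x) (n x) = 0 := by rw [cval_symm, F.nk]
  have b := fun P ↦ cval_bracket_frame (𝔐 := 𝔐) P sm sk
  have w := fr.structure_wconn hx sm sk
  rw [F.cweyl_nl_add_mk, fr.wconn_expand hx (sm.bracket sk), b n, b l, b k, b m,
    fr.con_mm hx sk, fr.bar.con_mm hx sm, fr.con_km hx sk, fr.prime.con_lm hx sm,
    fr.prime.bar.con_lm hx sk, fr.bar.con_lm hx sm, fr.con_lm hx sk, fr.sigma_eq_zero hx hψ] at w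
  simp only [F.mm, F.kk, F.m_k, e2, e3, e4, e5, e6] at w
  linear_combination -(1 / 2) * w

/-- The vacuum Ricci equation that contains `þ'ρ - ð'τ`. -/
lemma ricci_nk (fr : FrameField 𝔐 U l n m k) (hx : x ∈ U)
    (hψ : 𝔐.g.cweyl x (m x) (l x) (k x) (n x) ≠ 0) :
    cderiv n (con 𝔐 m l k) x - cderiv k (con 𝔐 m l n) x
      = -𝔐.g.cweyl x (m x) (l x) (k x) (n x) + (con 𝔐 n l k x - con 𝔐 k l n x) * con 𝔐 m l n x
        - (con 𝔐 m k n x - con 𝔐 m n k x) * con 𝔐 m l k x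
        - 2 * (con 𝔐 m l n x * wconn 𝔐 l n m k k x - con 𝔐 m l k x * wconn 𝔐 l n m k n x) := by
  have sl := fr.smooth_l hx
  have sn := fr.smooth_n hx
  have sk := fr.smooth_k hx
  have F := fr.frame x
  have e1 : 𝔐.g.cval x (n x) (l x) = 1 := by rw [cval_symm, F.ln]
  have e2 : 𝔐.g.cval x (k x) (m x) = -1 := by rw [cval_symm, F.m_k]
  have b := fun P ↦ cval_bracket_frame (𝔐 := 𝔐) P sn sk
  have w := fr.structure_ml hx sn sk
  rw [F.cweyl_ml, fr.con_expand m hx (sn.bracket sk) sl, b n, b l, b k, b m,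
    fr.prime.con_ll hx sk, fr.bar.con_mm hx sn, fr.con_ln hx sk, fr.bar.con_lm hx sn,
    fr.kappa_eq_zero hx hψ, fr.sigma_eq_zero hx hψ] at w
  simp only [F.nm, e1, e2] at w
  linear_combination -w

/-- The Leibniz rule for the factors `frameU`, `frameV` of the operator and the components
`frameY`, `frameZ` of the current, here and in the next three lemmas. -/
lemma cderiv_frameU (fr : FrameField 𝔐 U l n m k) (hx : x ∈ U) (s : ℂ) {h : M → ℂ}
    (hh : SmF h x) : cderiv l (frameU 𝔐 l n m k s h) x = cderiv l (cderiv n h) x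
        - 2 * s * (wconn 𝔐 l n m k n x * cderiv l h x + h x * cderiv l (wconn 𝔐 l n m k n) x)
        - (con 𝔐 k n m x * cderiv l h x + h x * cderiv l (con 𝔐 k n m) x) := by
  have s1 := hh.cderiv (fr.smooth_n hx)
  have s2 := fr.smF_wconn hx (fr.smooth_n hx)
  have s3 := smF_con (𝔐 := 𝔐) (fr.smooth_k hx) (fr.smooth_n hx) (fr.smooth_m hx)
  have E := cderiv_sub (X := l) (s1.csub (((smF_const (2 * s)).cmul s2).cmul hh)).diF
    (s3.cmul hh).diF
  rw [cderiv_sub s1.diF (((smF_const (2 * s)).cmul s2).cmul hh).diF,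
    cderiv_mul ((smF_const (2 * s)).cmul s2).diF hh.diF, cderiv_const_mul _ s2.diF,
    cderiv_mul s3.diF hh.diF] at E
  refine E.trans ?_
  ring

lemma cderiv_frameV (fr : FrameField 𝔐 U l n m k) (hx : x ∈ U) (s : ℂ) {h : M → ℂ}
    (hh : SmF h x) : cderiv m (frameV 𝔐 l n m k s h) x = cderiv m (cderiv k h) x
        - 2 * s * (wconn 𝔐 l n m k k x * cderiv m h x + h x * cderiv m (wconn 𝔐 l n m k k) x)
        - (con 𝔐 k n l x * cderiv m h x + h x * cderiv m (con 𝔐 k n l) x) := by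
  have s1 := hh.cderiv (fr.smooth_k hx)
  have s2 := fr.smF_wconn hx (fr.smooth_k hx)
  have s3 := smF_con (𝔐 := 𝔐) (fr.smooth_k hx) (fr.smooth_n hx) (fr.smooth_l hx)
  have E := cderiv_sub (X := m) (s1.csub (((smF_const (2 * s)).cmul s2).cmul hh)).diF
    (s3.cmul hh).diF
  rw [cderiv_sub s1.diF (((smF_const (2 * s)).cmul s2).cmul hh).diF,
    cderiv_mul ((smF_const (2 * s)).cmul s2).diF hh.diF, cderiv_const_mul _ s2.diF,
    cderiv_mul s3.diF hh.diF] at E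
  refine E.trans ?_
  ring

lemma cderiv_frameY (fr : FrameField 𝔐 U l n m k) (hx : x ∈ U) (s : ℂ) {f : M → ℂ}
    (hf : SmF f x) : cderiv n (frameY 𝔐 l n m k s f) x = cderiv n (cderiv l f) x
        + 2 * s * (wconn 𝔐 l n m k l x * cderiv n f x + f x * cderiv n (wconn 𝔐 l n m k l) x)
        + (2 * s - 1) * (con 𝔐 m l k x * cderiv n f x + f x * cderiv n (con 𝔐 m l k) x) := by
  have s1 := hf.cderiv (fr.smooth_l hx)
  have s2 := fr.smF_wconn hx (fr.smooth_l hx)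
  have s3 := smF_con (𝔐 := 𝔐) (fr.smooth_m hx) (fr.smooth_l hx) (fr.smooth_k hx)
  have E := cderiv_add (X := n) (s1.cadd (((smF_const (2 * s)).cmul s2).cmul hf)).diF
    (((smF_const (2 * s - 1)).cmul s3).cmul hf).diF
  rw [cderiv_add s1.diF (((smF_const (2 * s)).cmul s2).cmul hf).diF,
    cderiv_mul ((smF_const (2 * s)).cmul s2).diF hf.diF, cderiv_const_mul _ s2.diF,
    cderiv_mul ((smF_const (2 * s - 1)).cmul s3).diF hf.diF, cderiv_const_mul _ s3.diF] at E
  refine E.trans ?_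
  ring

lemma cderiv_frameZ (fr : FrameField 𝔐 U l n m k) (hx : x ∈ U) (s : ℂ) {f : M → ℂ}
    (hf : SmF f x) : cderiv k (frameZ 𝔐 l n m k s f) x = cderiv k (cderiv m f) x
        + 2 * s * (wconn 𝔐 l n m k m x * cderiv k f x + f x * cderiv k (wconn 𝔐 l n m k m) x)
        + (2 * s - 1) * (con 𝔐 m l n x * cderiv k f x + f x * cderiv k (con 𝔐 m l n) x) := by
  have s1 := hf.cderiv (fr.smooth_m hx)
  have s2 := fr.smF_wconn hx (fr.smooth_m hx)
  have s3 := smF_con (𝔐 := 𝔐) (fr.smooth_m hx) (fr.smooth_l hx) (fr.smooth_n hx)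
  have E := cderiv_add (X := k) (s1.cadd (((smF_const (2 * s)).cmul s2).cmul hf)).diF
    (((smF_const (2 * s - 1)).cmul s3).cmul hf).diF
  rw [cderiv_add s1.diF (((smF_const (2 * s)).cmul s2).cmul hf).diF,
    cderiv_mul ((smF_const (2 * s)).cmul s2).diF hf.diF, cderiv_const_mul _ s2.diF,
    cderiv_mul ((smF_const (2 * s - 1)).cmul s3).diF hf.diF, cderiv_const_mul _ s3.diF] at E
  refine E.trans ?_
  ring

/-- The Teukolsky identity: the operators with spins `s` and `-s` are adjoint to each other up to a
divergence. The terms of second order cancel up to commutators, and the remaining terms of zeroth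
order are the curvature of the connection form and the Ricci equation of `ρ` and `τ`. -/
lemma teukolsky_identity (fr : FrameField 𝔐 U l n m k) (hx : x ∈ U)
    (hψ : 𝔐.g.cweyl x (m x) (l x) (k x) (n x) ≠ 0) (s : ℂ) {f h : M → ℂ}
    (hf : SmF f x) (hh : SmF h x) :
    f x * frameTeukolsky 𝔐 l n m k s h x - h x * frameTeukolsky 𝔐 l n m k (-s) f x
      = frameDiv 𝔐 l n m k (current 𝔐 l n m k s f h) x := by
  have sl := fr.smooth_l hx
  have sm := fr.smooth_m hx
  have c1 := fr.commutator_ln hx hf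
  have c2 := fr.commutator_mk hx hf
  have w1 := fr.curvature_ln hx hψ
  have w2 := fr.curvature_mk hx hψ
  have a1 := fr.ricci_nk hx hψ
  have hψ' : 𝔐.g.cweyl x (k x) (n x) (m x) (l x) ≠ 0 := by rwa [cweyl_pair]
  have a2 := fr.prime.ricci_nk hx hψ'
  rw [fr.frameDiv_current hx s hf hh, fr.cderiv_frameY hx s hf, fr.cderiv_frameZ hx s hf]
  simp only [frameTeukolsky]
  rw [fr.cderiv_frameU hx s hh, fr.cderiv_frameV hx s hh, fr.cderiv_frameU hx (-s) hf,
    fr.cderiv_frameV hx (-s) hf]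
  simp only [frameU, frameV, frameY, frameZ]
  -- the connection form of the conjugate frame, and `g(n, ∇ l)`, `g(m, ∇ k)` in terms of both
  have ee : ∀ {X : CVField M}, X.SmAt x → con 𝔐 n l X x
      = wconn 𝔐 l n m k X x + wconn 𝔐 l n k m X x := by
    intro X hX
    simp only [wconn, fr.con_km hx hX]; ring
  have ep : ∀ {X : CVField M}, X.SmAt x → con 𝔐 m k X x
      = wconn 𝔐 l n m k X x - wconn 𝔐 l n k m X x := by
    intro X hX
    simp only [wconn, fr.con_km hx hX]; ring
  have sn := fr.smooth_n hx
  have sk := fr.smooth_k hx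
  rw [ee sl, ee sn] at c1 w1
  rw [ep sm, ep sk] at c2 w2
  rw [ee sk, ep sn] at a1
  rw [cweyl_pair, fr.con_ln hx sm, fr.con_km hx sl, fr.wconn_prime hx sm, fr.wconn_prime hx sl,
    ee sm, ep sl] at a2
  rw [ee sl, ee sn, ep sm, ep sk]
  clear ee ep
  generalize 𝔐.g.cweyl x (m x) (l x) (k x) (n x) = psi at *
  linear_combination -2 * h x * c1 + 2 * h x * c2 - 4 * s * f x * h x * w1 + 4 * s * f x * h x * w2
    + 2 * (2 * s - 1) * f x * h x * a1
    + 2 * f x * h x * a2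

end FrameField

end Identity

/-! ### Change of tetrad and spin-weighted sections -/

section Gauge

variable {𝔐 : Background M} {x : M} {A B : TetradField 𝔐} {X Y P Q : CVField M}

lemma TetradField.SmoothNear.frameField (hA : A.SmoothNear x) :
    ∃ U : Set M, x ∈ U ∧ FrameField 𝔐 U A.L A.N A.Mv A.Mbar := by
  obtain ⟨U, hU, hx, h⟩ := hA
  have s : ∀ {y}, y ∈ U → A.SmoothNear y := fun hy ↦ ⟨U, hU, hy, h⟩
  exact ⟨U, hx, hU, fun hy ↦ (s hy).smAt.1.ofReal, fun hy ↦ (s hy).smAt.2.1.ofReal,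
    fun hy ↦ ⟨(s hy).smAt.2.2.1, (s hy).smAt.2.2.2⟩,
    fun hy ↦ CVField.SmAt.conjT (X := A.Mv) ⟨(s hy).smAt.2.2.1, (s hy).smAt.2.2.2⟩,
    fun y ↦ (A y).nullFrame⟩

lemma ofReal_smul (u : TangentSpace (𝓡 4) x) (r : ℝ) :
    ofReal (r • u) = smulT (r : ℂ) (ofReal u) := by
  ext1 <;> simp [ofReal, smulT]

lemma conjT_smulT (z : ℂ) (u : CTangent x) : conjT (smulT z u) = smulT (star z) (conjT u) := by
  ext1 <;> (simp [conjT, smulT]; try abel)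

lemma wForm_eq : A.wForm X = wconn 𝔐 A.L A.N A.Mv A.Mbar X := rfl

/-- The conjugate of the connection form is the connection form of the conjugate frame. -/
lemma wBarForm_eq (hA : A.SmoothNear x) (hX : X.SmAt x) :
    A.wBarForm X x = wconn 𝔐 A.L A.N A.Mbar A.Mv X x := by
  obtain ⟨U, hx, fr⟩ := hA.frameField
  have e1 := cnabla_conjT (𝔐 := 𝔐) hX.conjT (fr.smooth_l hx)
  have e2 := cnabla_conjT (𝔐 := 𝔐) hX.conjT (fr.smooth_k hx)
  simp only [conjT_conjT] at e1 e2
  have eL : (fun y ↦ conjT (A.L y)) = A.L := funext fun y ↦ conjT_ofReal _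
  have eM : (fun y ↦ conjT (A.Mbar y)) = A.Mv := funext fun y ↦ conjT_conjT _
  have eN : conjT (A.N x) = A.N x := conjT_ofReal _
  rw [eL] at e1
  rw [eM] at e2
  simp only [TetradField.wBarForm, TetradField.wForm, wconn, con, e1, e2, star_mul', star_add,
    ← cval_conj, eN]
  norm_num
  rfl

variable {p q r p' q' : M → ℂ}

/-- The change of a connection coefficient under a rescaling of its arguments. -/
lemma con_gauge (hQ : Q.SmAt x) (hX : X.SmAt x) (hq : SmF q x) (hr : SmF r x) :
    con 𝔐 (fun y ↦ smulT (p y) (P y)) (fun y ↦ smulT (q y) (Q y)) (fun y ↦ smulT (r y) (X y)) x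
      = p x * r x * (q x * con 𝔐 P Q X x + cderiv X q x * 𝔐.g.cval x (P x) (Q x)) := by
  simp only [con, cnabla_smulT_left hr hX (hQ.smulT hq), cnabla_smulT_right hq hX hQ,
    cval_smul_left, cval_smul_right, cval_add_right]
  ring

/-- Powers of a function that is never zero. The inverse is kept as a function `p'` of its own, so
that derivatives involve no quotients. -/
lemma smF_zpow (hp : SmF p x) (hp' : SmF p' x) (e : ∀ y, p y * p' y = 1) (w : ℤ) :
    SmF (fun y ↦ p y ^ w) x ∧
      cderiv X (fun y ↦ p y ^ w) x = w * p x ^ w * p' x * cderiv X p x := by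
  have ne : ∀ y, p y ≠ 0 := fun y ↦ left_ne_zero_of_mul_eq_one (e y)
  have inv : ∀ y, (p y)⁻¹ = p' y := fun y ↦ inv_eq_of_mul_eq_one_right (e y)
  have d' : p x * cderiv X p' x + p' x * cderiv X p x = 0 := by
    rw [← cderiv_mul hp.diF hp'.diF, funext e, cderiv_const]
  induction w using Int.induction_on with
  | zero => simpa using ⟨smF_const 1, cderiv_const 1⟩
  | succ n ih =>
    obtain ⟨h1, h2⟩ := ih
    have E : (fun y ↦ p y ^ ((n : ℤ) + 1)) = fun y ↦ p y ^ (n : ℤ) * p y :=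
      funext fun y ↦ zpow_add_one₀ (ne y) _
    refine ⟨E ▸ h1.cmul hp, ?_⟩
    rw [E, cderiv_mul h1.diF hp.diF, h2, zpow_add_one₀ (ne x)]
    push_cast
    linear_combination (-p x ^ (n : ℤ) * cderiv X p x) * e x
  | pred n ih =>
    obtain ⟨h1, h2⟩ := ih
    have E : (fun y ↦ p y ^ (-(n : ℤ) - 1)) = fun y ↦ p y ^ (-(n : ℤ)) * p' y :=
      funext fun y ↦ by rw [zpow_sub_one₀ (ne y), inv]
    refine ⟨E ▸ h1.cmul hp', ?_⟩
    rw [E, cderiv_mul h1.diF hp'.diF, h2, zpow_sub_one₀ (ne x), inv]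
    have d'' : cderiv X p' x = -p' x * p' x * cderiv X p x := by
      linear_combination p' x * d' - cderiv X p' x * e x
    rw [d'']
    push_cast
    ring

/-- The tetrad field `B` arises from `A` by the boost `p` and the rotation `q`, with inverses `p'`
and `q'`; all of these are smooth at `x`. -/
structure GaugeChange (A B : TetradField 𝔐) (x : M) (p p' q q' : M → ℂ) : Prop where
  smF_p : SmF p x
  smF_p' : SmF p' x
  smF_q : SmF q x
  smF_q' : SmF q' x
  p_mul (y : M) : p y * p' y = 1
  q_mul (y : M) : q y * q' y = 1
  L_eq : B.L = fun y ↦ smulT (p y) (A.L y)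
  N_eq : B.N = fun y ↦ smulT (p' y) (A.N y)
  M_eq : B.Mv = fun y ↦ smulT (q y) (A.Mv y)
  Mbar_eq : B.Mbar = fun y ↦ smulT (q' y) (A.Mbar y)

/-- Two smooth tetrad fields differ by a smooth boost and rotation. -/
lemma exists_gaugeChange (hA : A.SmoothNear x) (hB : B.SmoothNear x) :
    ∃ p p' q q' : M → ℂ, GaugeChange A B x p p' q q' ∧
      (∀ y, p y = boost (A y) (B y)) ∧ ∀ y, q y = twist (A y) (B y) := by
  obtain ⟨U, hx, fA⟩ := hA.frameField
  obtain ⟨V, hy, fB⟩ := hB.frameField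
  have R := fun y ↦ rotatesBy_boost_twist (A y) (B y)
  have sp : SmF (fun y ↦ boost (A y) (B y)) x := 𝔐.g.smF_val hB.smAt.1 hA.smAt.2.1
  have sq : SmF (fun y ↦ twist (A y) (B y)) x := by
    have := (smF_const (-1)).cmul (smF_cval 𝔐.g (fB.smooth_m hy) (fA.smooth_k hx))
    refine this.congr_of_eventuallyEq (Filter.Eventually.of_forall fun y ↦ ?_)
    simp only [twist, neg_one_mul]
    rfl
  have sqq : ∀ y, twist (A y) (B y) * star (twist (A y) (B y)) = 1 := by
    intro y
    rw [Complex.star_def, Complex.mul_conj, Complex.normSq_eq_norm_sq, (R y).norm_zeta]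
    simp
  refine ⟨_, fun y ↦ ((boost (A y) (B y))⁻¹ : ℝ), _, _, ⟨smF_ofReal sp,
    smF_ofReal (smF_inv sp (R x).lam_pos.ne'), sq, sq.star, fun y ↦ ?_, sqq, ?_, ?_, ?_, ?_⟩,
    fun _ ↦ rfl, fun _ ↦ rfl⟩
  · rw [← Complex.ofReal_mul, mul_inv_cancel₀ (R y).lam_pos.ne', Complex.ofReal_one]
  · funext y
    rw [TetradField.L, (R y).l_eq, ofReal_smul]; rfl
  · funext y
    rw [TetradField.N, (R y).n_eq, ofReal_smul]; rfl
  · funext y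
    exact (R y).m_eq
  · funext y
    rw [TetradField.Mbar, (R y).m_eq, conjT_smulT]; rfl

namespace GaugeChange

variable (G : GaugeChange A B x p p' q q') (hA : A.SmoothNear x)

/-- The inhomogeneous transformation of the connection form and its conjugate: half the sum and
half the difference of the logarithmic derivatives of the boost and the rotation. -/
lemma wconn_eq (G : GaugeChange A B x p p' q q') (hA : A.SmoothNear x) (hX : X.SmAt x)
    (hr : SmF r x) :
    wconn 𝔐 B.L B.N B.Mv B.Mbar (fun y ↦ smulT (r y) (X y)) x
      = r x * (wconn 𝔐 A.L A.N A.Mv A.Mbar X x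
        + (1 / 2) * (p' x * cderiv X p x + q' x * cderiv X q x)) ∧
    wconn 𝔐 B.L B.N B.Mbar B.Mv (fun y ↦ smulT (r y) (X y)) x
      = r x * (wconn 𝔐 A.L A.N A.Mbar A.Mv X x
        + (1 / 2) * (p' x * cderiv X p x - q' x * cderiv X q x)) := by
  obtain ⟨U, hx, fr⟩ := hA.frameField
  have F := fr.frame x
  have e1 : 𝔐.g.cval x (A.N x) (A.L x) = 1 := by rw [cval_symm, F.ln]
  have e2 : 𝔐.g.cval x (A.Mbar x) (A.Mv x) = -1 := by rw [cval_symm, F.m_k]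
  have d : q x * cderiv X q' x + q' x * cderiv X q x = 0 := by
    rw [← cderiv_mul G.smF_q.diF G.smF_q'.diF, funext G.q_mul, cderiv_const]
  simp only [wconn, G.L_eq, G.N_eq, G.M_eq, G.Mbar_eq]
  rw [con_gauge (fr.smooth_l hx) hX G.smF_p hr, con_gauge (fr.smooth_k hx) hX G.smF_q' hr,
    con_gauge (fr.smooth_m hx) hX G.smF_q hr, e1, e2, F.m_k]
  constructor
  · linear_combination (1 / 2 * r x * con 𝔐 A.N A.L X x) * G.p_mul x
      + (1 / 2 * r x * con 𝔐 A.Mv A.Mbar X x) * G.q_mul x - (1 / 2 * r x) * d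
  · linear_combination (1 / 2 * r x * con 𝔐 A.N A.L X x) * G.p_mul x
      + (1 / 2 * r x * con 𝔐 A.Mbar A.Mv X x) * G.q_mul x

end GaugeChange

/-- Membership in the fibre of `𝓑(s,w)`, in terms of boosts and rotations. -/
lemma mem_spinFibre_iff {s w : ℤ} {c : NullTetrad 𝔐 x → ℂ} :
    c ∈ spinFibre 𝔐 s w x ↔
      ∀ a b : NullTetrad 𝔐 x, c b = (boost a b : ℂ) ^ w * twist a b ^ s * c a := by
  have rep : ∀ {lam : ℝ} {zeta : ℂ}, 0 < lam → ‖zeta‖ = 1 →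
      spinRep s w (lam * zeta)⁻¹ = (lam : ℂ) ^ w * zeta ^ s := by
    intro lam zeta hl hz
    have hl' : (lam : ℂ) ≠ 0 := by exact_mod_cast hl.ne'
    have hz' : zeta ≠ 0 := by rintro rfl; simp at hz
    simp only [spinRep, norm_inv, norm_mul, hz, Complex.norm_real, Real.norm_of_nonneg hl.le,
      mul_one, Complex.ofReal_inv, inv_zpow', neg_neg, mul_zpow]
    rw [zpow_sub₀ hl']
    field_simp
  constructor
  · intro h a b
    have R := rotatesBy_boost_twist a b
    have nz : ‖(boost a b : ℂ) * twist a b‖ = boost a b := by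
      rw [norm_mul, R.norm_zeta, mul_one, Complex.norm_real, Real.norm_of_nonneg R.lam_pos.le]
    have hl' : (boost a b : ℂ) ≠ 0 := by exact_mod_cast R.lam_pos.ne'
    rw [h a b (boost a b * twist a b) ?_ ⟨?_, ?_, ?_⟩, rep R.lam_pos R.norm_zeta]
    · rw [← norm_ne_zero_iff, nz]; exact R.lam_pos.ne'
    · rw [nz]; exact R.l_eq
    · rw [nz]; exact R.n_eq
    · rw [nz]
      convert R.m_eq using 2
      field_simp
  · intro h a b z hz ⟨h1, h2, h3⟩
    have nz : 0 < ‖z‖ := norm_pos_iff.2 hz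
    have nz' : (‖z‖ : ℂ) ≠ 0 := by exact_mod_cast nz.ne'
    have b1 : boost a b = ‖z‖ := by simp [boost, h1, a.l_n]
    have b2 : twist a b = z * (‖z‖ : ℂ)⁻¹ := by
      rw [twist, h3, cval_smul_left, a.m_conj_m]; ring
    have b3 : z = (‖z‖ : ℝ) * (z * (‖z‖ : ℂ)⁻¹) := by field_simp
    rw [h a b, b1, b2]
    congr 1
    conv_rhs => rw [b3]
    rw [rep nz]
    rw [norm_mul, norm_inv, Complex.norm_real, norm_norm, mul_inv_cancel₀ nz.ne']

lemma boost_self (a : NullTetrad 𝔐 x) : boost a a = 1 := a.l_n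

lemma twist_self (a : NullTetrad 𝔐 x) : twist a a = 1 := by simp [twist, a.m_conj_m]

/-- An expression in a local tetrad field that transforms with weights `(s, w)` and is smooth
defines a section of `𝓑(s,w)`. -/
lemma inLocalTetrad_spec {s w : ℤ} (Φ : TetradField 𝔐 → M → ℂ)
    (hΦ : ∀ (A B : TetradField 𝔐) (x : M) (p p' q q' : M → ℂ), A.SmoothNear x → B.SmoothNear x →
      GaugeChange A B x p p' q q' → Φ B x = p x ^ w * q x ^ s * Φ A x)
    (hs : ∀ (A : TetradField 𝔐) (x : M), A.SmoothNear x → SmF (Φ A) x) :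
    (∀ (A : TetradField 𝔐) (x : M), A.SmoothNear x →
      inLocalTetrad (A x) (fun B ↦ Φ B x) = Φ A x) ∧
    IsSection s w (fun x (a : NullTetrad 𝔐 x) ↦ inLocalTetrad a fun A ↦ Φ A x) := by
  have key : ∀ (A B : TetradField 𝔐) (x : M), A.SmoothNear x → B.SmoothNear x →
      Φ B x = (boost (A x) (B x) : ℂ) ^ w * twist (A x) (B x) ^ s * Φ A x := by
    intro A B x hA hB
    obtain ⟨p, p', q, q', G, e1, e2⟩ := exists_gaugeChange hA hB
    rw [hΦ A B x p p' q q' hA hB G, e1, e2]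
  have ev : ∀ (A : TetradField 𝔐) (x : M), A.SmoothNear x →
      inLocalTetrad (A x) (fun B ↦ Φ B x) = Φ A x := by
    intro A x hA
    have h : ∃ B : TetradField 𝔐, B.SmoothNear x ∧ B x = A x := ⟨A, hA, rfl⟩
    rw [inLocalTetrad, dif_pos h, key A h.choose x hA h.choose_spec.1, h.choose_spec.2, boost_self,
      twist_self]
    simp
  refine ⟨ev, fun x ↦ mem_spinFibre_iff.2 fun a b ↦ ?_, fun A x hA ↦ ?_⟩
  · obtain ⟨A, hA, rfl⟩ := exists_tetradField a
    obtain ⟨B, hB, rfl⟩ := exists_tetradField b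
    have := key A B x hA hB
    rwa [← ev A x hA, ← ev B x hB] at this
  · refine (hs A x hA).congr_of_eventuallyEq ?_
    filter_upwards [hA.eventually] with y hy using ev A y hy

lemma IsSection.comp_gauge {s w : ℤ} {f : SWF 𝔐} (hf : IsSection s w f)
    (G : GaugeChange A B x p p' q q') (y : M) : f y (B y) = p y ^ w * q y ^ s * f y (A y) := by
  have h1 : (boost (A y) (B y) : ℂ) = p y := by
    have : B.L y = smulT (p y) (A.L y) := by rw [G.L_eq]
    have e : 𝔐.g.cval y (B.L y) (A.N y) = p y := by
      rw [this, cval_smul_left]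
      exact (congrArg _ (A y).nullFrame.ln).trans (mul_one _)
    rw [← e, TetradField.L, TetradField.N, cval_ofReal, boost]
  have h2 : twist (A y) (B y) = q y := by
    have : (B y).m = smulT (q y) (A y).m := congrFun G.M_eq y
    rw [twist, this, cval_smul_left, (A y).m_conj_m]; ring
  rw [mem_spinFibre_iff.1 (hf.1 y) (A y) (B y), h1, h2]

/-- The connection `Θ` is gauge covariant. -/
lemma theta_gauge {s w : ℤ} {f : SWF 𝔐} (hf : IsSection s w f) (hA : A.SmoothNear x)
    (hB : B.SmoothNear x) (G : GaugeChange A B x p p' q q') (hX : X.SmAt x) (hr : SmF r x) :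
    B.theta s w (fun y ↦ smulT (r y) (X y)) f x
      = r x * (p x ^ w * q x ^ s * A.theta s w X f x) := by
  obtain ⟨w1, w2⟩ := G.wconn_eq hA hX hr
  have z1 := smF_zpow (X := X) G.smF_p G.smF_p' G.p_mul w
  have z2 := smF_zpow (X := X) G.smF_q G.smF_q' G.q_mul s
  have sf : SmF (fun y ↦ f y (A y)) x := hf.2 A x hA
  have e : (fun y ↦ f y (B y)) = fun y ↦ p y ^ w * q y ^ s * f y (A y) :=
    funext (hf.comp_gauge G)
  have d : cderiv X (fun y ↦ f y (B y)) x
      = p x ^ w * q x ^ s * cderiv X (fun y ↦ f y (A y)) x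
        + f x (A x) * (p x ^ w * (s * q x ^ s * q' x * cderiv X q x)
          + q x ^ s * (w * p x ^ w * p' x * cderiv X p x)) := by
    rw [e, cderiv_mul (z1.1.cmul z2.1).diF sf.diF, cderiv_mul z1.1.diF z2.1.diF, z1.2, z2.2]
  simp only [TetradField.theta]
  rw [wForm_eq, wForm_eq, wBarForm_eq hB (hX.smulT hr), wBarForm_eq hA hX, cderiv_smulT, w1, w2,
    d, hf.comp_gauge G x]
  push_cast
  ring

lemma smF_theta {s w : ℤ} {f : SWF 𝔐} (hf : IsSection s w f) (hA : A.SmoothNear x)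
    (hX' : ∀ᶠ y in 𝓝 x, X.SmAt y) : SmF (A.theta s w X f) x := by
  have hX := hX'.self_of_nhds
  obtain ⟨U, hx, fr⟩ := hA.frameField
  have sf : SmF (fun y ↦ f y (A y)) x := hf.2 A x hA
  have s1 := fr.smF_wconn hx hX
  have s2 := fr.bar.smF_wconn hx hX
  have s2' : SmF (A.wBarForm X) x := by
    refine s2.congr_of_eventuallyEq ?_
    filter_upwards [hA.eventually, hX'] with y h1 h2 using wBarForm_eq h1 h2
  exact ((sf.cderiv hX).csub (((smF_const _).cmul s1).cmul sf)).csub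
    (((smF_const _).cmul s2').cmul sf)

/-! ### The GHP operators and the spin coefficients -/

section Operators

variable {s w : ℤ} {f h : SWF 𝔐}

lemma TetradField.SmoothNear.eventually_smAt (hA : A.SmoothNear x) :
    (∀ᶠ y in 𝓝 x, A.L.SmAt y) ∧ (∀ᶠ y in 𝓝 x, A.N.SmAt y) ∧ (∀ᶠ y in 𝓝 x, A.Mv.SmAt y) ∧
      ∀ᶠ y in 𝓝 x, A.Mbar.SmAt y := by
  obtain ⟨U, hx, fr⟩ := hA.frameField
  have hU := fr.isOpen.mem_nhds hx
  exact ⟨Filter.mem_of_superset hU fun _ ↦ fr.smooth_l,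
    Filter.mem_of_superset hU fun _ ↦ fr.smooth_n,
    Filter.mem_of_superset hU fun _ ↦ fr.smooth_m, Filter.mem_of_superset hU fun _ ↦ fr.smooth_k⟩

lemma GaugeChange.p_ne_zero (G : GaugeChange A B x p p' q q') : p x ≠ 0 :=
  left_ne_zero_of_mul_eq_one (G.p_mul x)

lemma GaugeChange.q_ne_zero (G : GaugeChange A B x p p' q q') : q x ≠ 0 :=
  left_ne_zero_of_mul_eq_one (G.q_mul x)

lemma GaugeChange.p'_eq (G : GaugeChange A B x p p' q q') : p' x = (p x)⁻¹ :=
  (inv_eq_of_mul_eq_one_right (G.p_mul x)).symm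

lemma GaugeChange.q'_eq (G : GaugeChange A B x p p' q q') : q' x = (q x)⁻¹ :=
  (inv_eq_of_mul_eq_one_right (G.q_mul x)).symm

/-- The operator can be computed in any tetrad field that is smooth near the point, and it maps
sections to sections of the shifted weights. The lemmas on the other three derivatives and on the
spin coefficients make the same claims. -/
lemma tho_spec (hf : IsSection s w f) :
    (∀ (A : TetradField 𝔐) (x : M), A.SmoothNear x → tho s w f x (A x) = A.theta s w A.L f x) ∧
    IsSection s (w + 1) (tho s w f) :=
  inLocalTetrad_spec (fun A x ↦ A.theta s w A.L f x)
    (fun A B x p p' q q' hA hB G ↦ by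
      rw [G.L_eq, theta_gauge hf hA hB G hA.eventually_smAt.1.self_of_nhds G.smF_p,
        zpow_add_one₀ G.p_ne_zero]
      ring)
    (fun A x hA ↦ smF_theta hf hA hA.eventually_smAt.1)

lemma thoP_spec (hf : IsSection s w f) :
    (∀ (A : TetradField 𝔐) (x : M), A.SmoothNear x → thoP s w f x (A x) = A.theta s w A.N f x) ∧
    IsSection s (w - 1) (thoP s w f) :=
  inLocalTetrad_spec (fun A x ↦ A.theta s w A.N f x)
    (fun A B x p p' q q' hA hB G ↦ by
      rw [G.N_eq, theta_gauge hf hA hB G hA.eventually_smAt.2.1.self_of_nhds G.smF_p',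
        zpow_sub_one₀ G.p_ne_zero, G.p'_eq]
      ring)
    (fun A x hA ↦ smF_theta hf hA hA.eventually_smAt.2.1)

lemma edt_spec (hf : IsSection s w f) :
    (∀ (A : TetradField 𝔐) (x : M), A.SmoothNear x → edt s w f x (A x) = A.theta s w A.Mv f x) ∧
    IsSection (s + 1) w (edt s w f) :=
  inLocalTetrad_spec (fun A x ↦ A.theta s w A.Mv f x)
    (fun A B x p p' q q' hA hB G ↦ by
      rw [G.M_eq, theta_gauge hf hA hB G hA.eventually_smAt.2.2.1.self_of_nhds G.smF_q,
        zpow_add_one₀ G.q_ne_zero]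
      ring)
    (fun A x hA ↦ smF_theta hf hA hA.eventually_smAt.2.2.1)

lemma edtP_spec (hf : IsSection s w f) :
    (∀ (A : TetradField 𝔐) (x : M), A.SmoothNear x → edtP s w f x (A x) = A.theta s w A.Mbar f x) ∧
    IsSection (s - 1) w (edtP s w f) :=
  inLocalTetrad_spec (fun A x ↦ A.theta s w A.Mbar f x)
    (fun A B x p p' q q' hA hB G ↦ by
      rw [G.Mbar_eq, theta_gauge hf hA hB G hA.eventually_smAt.2.2.2.self_of_nhds G.smF_q',
        zpow_sub_one₀ G.q_ne_zero, G.q'_eq]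
      ring)
    (fun A x hA ↦ smF_theta hf hA hA.eventually_smAt.2.2.2)

lemma rho_spec :
    (∀ (A : TetradField 𝔐) (x : M), A.SmoothNear x →
      rho 𝔐 x (A x) = con 𝔐 A.Mv A.L A.Mbar x) ∧ IsSection 0 1 (rho 𝔐) :=
  inLocalTetrad_spec (fun A x ↦ con 𝔐 A.Mv A.L A.Mbar x)
    (fun A B x p p' q q' hA hB G ↦ by
      obtain ⟨U, hx, fr⟩ := hA.frameField
      rw [G.M_eq, G.L_eq, G.Mbar_eq, con_gauge (fr.smooth_l hx) (fr.smooth_k hx) G.smF_p G.smF_q',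
        cval_symm, (fr.frame x).lm]
      simp only [zpow_zero, zpow_one]
      linear_combination (p x * con 𝔐 A.Mv A.L A.Mbar x) * G.q_mul x)
    (fun A x hA ↦ by
      obtain ⟨U, hx, fr⟩ := hA.frameField
      exact smF_con (fr.smooth_m hx) (fr.smooth_l hx) (fr.smooth_k hx))

lemma rhoP_spec :
    (∀ (A : TetradField 𝔐) (x : M), A.SmoothNear x →
      rhoP 𝔐 x (A x) = con 𝔐 A.Mbar A.N A.Mv x) ∧ IsSection 0 (-1) (rhoP 𝔐) :=
  inLocalTetrad_spec (fun A x ↦ con 𝔐 A.Mbar A.N A.Mv x)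
    (fun A B x p p' q q' hA hB G ↦ by
      obtain ⟨U, hx, fr⟩ := hA.frameField
      rw [G.M_eq, G.N_eq, G.Mbar_eq, con_gauge (fr.smooth_n hx) (fr.smooth_m hx) G.smF_p' G.smF_q,
        cval_symm, (fr.frame x).nk, zpow_neg_one, ← G.p'_eq]
      simp only [zpow_zero]
      linear_combination (p' x * con 𝔐 A.Mbar A.N A.Mv x) * G.q_mul x)
    (fun A x hA ↦ by
      obtain ⟨U, hx, fr⟩ := hA.frameField
      exact smF_con (fr.smooth_k hx) (fr.smooth_n hx) (fr.smooth_m hx))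

lemma tau_spec :
    (∀ (A : TetradField 𝔐) (x : M), A.SmoothNear x →
      tau 𝔐 x (A x) = con 𝔐 A.Mv A.L A.N x) ∧ IsSection 1 0 (tau 𝔐) :=
  inLocalTetrad_spec (fun A x ↦ con 𝔐 A.Mv A.L A.N x)
    (fun A B x p p' q q' hA hB G ↦ by
      obtain ⟨U, hx, fr⟩ := hA.frameField
      rw [G.M_eq, G.L_eq, G.N_eq, con_gauge (fr.smooth_l hx) (fr.smooth_n hx) G.smF_p G.smF_p',
        cval_symm, (fr.frame x).lm]
      simp only [zpow_zero, zpow_one]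
      linear_combination (q x * con 𝔐 A.Mv A.L A.N x) * G.p_mul x)
    (fun A x hA ↦ by
      obtain ⟨U, hx, fr⟩ := hA.frameField
      exact smF_con (fr.smooth_m hx) (fr.smooth_l hx) (fr.smooth_n hx))

lemma tauP_spec :
    (∀ (A : TetradField 𝔐) (x : M), A.SmoothNear x →
      tauP 𝔐 x (A x) = con 𝔐 A.Mbar A.N A.L x) ∧ IsSection (-1) 0 (tauP 𝔐) :=
  inLocalTetrad_spec (fun A x ↦ con 𝔐 A.Mbar A.N A.L x)
    (fun A B x p p' q q' hA hB G ↦ by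
      obtain ⟨U, hx, fr⟩ := hA.frameField
      rw [G.L_eq, G.N_eq, G.Mbar_eq, con_gauge (fr.smooth_n hx) (fr.smooth_l hx) G.smF_p' G.smF_p,
        cval_symm, (fr.frame x).nk, zpow_neg_one, ← G.q'_eq]
      simp only [zpow_zero]
      linear_combination (q' x * con 𝔐 A.Mbar A.N A.L x) * G.p_mul x)
    (fun A x hA ↦ by
      obtain ⟨U, hx, fr⟩ := hA.frameField
      exact smF_con (fr.smooth_k hx) (fr.smooth_n hx) (fr.smooth_l hx))

lemma isSection_psi2 : IsSection 0 0 (psi2 𝔐) := by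
  refine ⟨fun x ↦ mem_spinFibre_iff.2 fun a b ↦ ?_, fun A x hA ↦ ?_⟩
  · have R := rotatesBy_boost_twist a b
    have h1 : (boost a b : ℂ) * ((boost a b)⁻¹ : ℝ) = 1 := by
      rw [← Complex.ofReal_mul, mul_inv_cancel₀ R.lam_pos.ne', Complex.ofReal_one]
    have h2 : twist a b * star (twist a b) = 1 := by
      rw [Complex.star_def, Complex.mul_conj, Complex.normSq_eq_norm_sq, R.norm_zeta]
      simp
    simp only [psi2, R.l_eq, R.n_eq, R.m_eq, conjT_smulT, ofReal_smul]
    rw [cweyl_smul_fst, cweyl_swap_left, cweyl_smul_fst, cweyl_pair, cweyl_smul_fst,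
      cweyl_swap_left, cweyl_smul_fst, cweyl_swap_left, cweyl_pair, cweyl_swap_left a.m]
    simp only [zpow_zero]
    linear_combination (twist a b * star (twist a b) *
      𝔐.g.cweyl x (ofReal a.l) a.m (conjT a.m) (ofReal a.n)) * (-h1)
      - 𝔐.g.cweyl x (ofReal a.l) a.m (conjT a.m) (ofReal a.n) * h2
  · obtain ⟨U, hx, fr⟩ := hA.frameField
    have sl := fr.smooth_l hx
    have sn := fr.smooth_n hx
    have sm := fr.smooth_m hx
    have sk := fr.smooth_k hx
    have s1 := (smF_con (𝔐 := 𝔐) sm sl sk).cderiv sn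
    have s2 := (smF_con (𝔐 := 𝔐) sm sl sn).cderiv sk
    have s3 := ((smF_con (𝔐 := 𝔐) sn sl sk).csub (smF_con (𝔐 := 𝔐) sk sl sn)).cmul
      (smF_con (𝔐 := 𝔐) sm sl sn)
    have s4 := ((smF_con (𝔐 := 𝔐) sm sk sn).csub (smF_con (𝔐 := 𝔐) sm sn sk)).cmul
      (smF_con (𝔐 := 𝔐) sm sl sk)
    have s5 := (smF_const 2).cmul (((smF_con (𝔐 := 𝔐) sm sl sn).cmul (fr.smF_wconn hx sk)).csub
      ((smF_con (𝔐 := 𝔐) sm sl sk).cmul (fr.smF_wconn hx sn)))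
    -- the Ricci equation expresses `Ψ₂` through smooth functions
    refine ((((s3.csub s4).csub s5).csub s1).cadd s2).congr_of_eventuallyEq ?_
    filter_upwards [fr.isOpen.mem_nhds hx] with y hy
    have := fr.ricci_nk hy (A y).psi_ne_zero
    change 𝔐.g.cweyl y (A.Mv y) (A.L y) (A.Mbar y) (A.N y) = _
    linear_combination this

lemma IsSection.sub (hf : IsSection s w f) (hh : IsSection s w h) : IsSection s w (f - h) :=
  ⟨fun x ↦ (spinFibre 𝔐 s w x).sub_mem (hf.1 x) (hh.1 x),
    fun A x hA ↦ SmF.csub (hf.2 A x hA) (hh.2 A x hA)⟩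

lemma IsSection.const_smul (c : ℂ) (hf : IsSection s w f) : IsSection s w (c • f) :=
  ⟨fun x ↦ (spinFibre 𝔐 s w x).smul_mem c (hf.1 x), fun A x hA ↦ (smF_const c).cmul (hf.2 A x hA)⟩

lemma IsSection.mul {s₁ w₁ s₂ w₂ : ℤ} (hf : IsSection s₁ w₁ f) (hh : IsSection s₂ w₂ h) :
    IsSection (s₁ + s₂) (w₁ + w₂) (f * h) := by
  refine ⟨fun x ↦ mem_spinFibre_iff.2 fun a b ↦ ?_,
    fun A x hA ↦ SmF.cmul (hf.2 A x hA) (hh.2 A x hA)⟩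
  have R := rotatesBy_boost_twist a b
  have h1 : (boost a b : ℂ) ≠ 0 := by exact_mod_cast R.lam_pos.ne'
  have h2 : twist a b ≠ 0 := norm_ne_zero_iff.1 (by rw [R.norm_zeta]; exact one_ne_zero)
  simp only [Pi.mul_apply]
  rw [mem_spinFibre_iff.1 (hf.1 x) a b, mem_spinFibre_iff.1 (hh.1 x) a b, zpow_add₀ h1,
    zpow_add₀ h2]
  ring

/-- Conjugation reverses the spin weight and keeps the boost weight. -/
lemma mem_spinFibre_conjFib {c : NullTetrad 𝔐 x → ℂ} (hc : c ∈ spinFibre 𝔐 s w x) :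
    conjFib c ∈ spinFibre 𝔐 (-s) w x := by
  refine mem_spinFibre_iff.2 fun a b ↦ ?_
  have R := rotatesBy_boost_twist a b
  have h2 : (twist a b)⁻¹ = star (twist a b) := by
    rw [Complex.inv_def, Complex.normSq_eq_norm_sq, R.norm_zeta]
    simp
  simp only [conjFib]
  rw [mem_spinFibre_iff.1 hc a b, star_mul', star_mul', star_zpow₀, star_zpow₀, zpow_neg,
    ← inv_zpow, h2]
  simp

lemma IsSection.conj (hf : IsSection s w f) : IsSection (-s) w (conjSec f) :=
  ⟨fun x ↦ mem_spinFibre_conjFib (hf.1 x), fun A x hA ↦ SmF.star (hf.2 A x hA)⟩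

lemma IsSection.cast {s' w' : ℤ} (hf : IsSection s w f) (e1 : s = s' := by ring)
    (e2 : w = w' := by ring) : IsSection s' w' f := e1 ▸ e2 ▸ hf

/-- The factors `þ' - ρ'` and `ð' - τ'` and their expressions in a tetrad field. -/
lemma teukolsky_factor_spec {s : ℤ} (hf : IsSection s s f) :
    IsSection s (s - 1) (thoP s s f - rhoP 𝔐 * f) ∧ IsSection (s - 1) s (edtP s s f - tauP 𝔐 * f) ∧
    ∀ (A : TetradField 𝔐) (x : M), A.SmoothNear x →
      (thoP s s f - rhoP 𝔐 * f) x (A x) = frameU 𝔐 A.L A.N A.Mv A.Mbar s (fun y ↦ f y (A y)) x ∧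
      (edtP s s f - tauP 𝔐 * f) x (A x) = frameV 𝔐 A.L A.N A.Mv A.Mbar s (fun y ↦ f y (A y)) x := by
  refine ⟨(thoP_spec hf).2.sub (rhoP_spec.2.mul hf).cast,
    (edtP_spec hf).2.sub (tauP_spec.2.mul hf).cast, fun A x hA ↦ ⟨?_, ?_⟩⟩
  · simp only [Pi.sub_apply, Pi.mul_apply, frameU]
    rw [(thoP_spec hf).1 A x hA, rhoP_spec.1 A x hA, TetradField.theta, wForm_eq]
    push_cast
    ring
  · simp only [Pi.sub_apply, Pi.mul_apply, frameV]
    rw [(edtP_spec hf).1 A x hA, tauP_spec.1 A x hA, TetradField.theta, wForm_eq]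
    push_cast
    ring

/-- The conjugates of `ρ` and `τ'` are the coefficients of the conjugate frame. -/
lemma star_con (hA : A.SmoothNear x) :
    star (con 𝔐 A.Mv A.L A.Mbar x) = con 𝔐 A.Mbar A.L A.Mv x ∧
      star (con 𝔐 A.Mbar A.N A.L x) = con 𝔐 A.Mv A.N A.L x := by
  obtain ⟨U, hx, fr⟩ := hA.frameField
  have e1 := cnabla_conjT (𝔐 := 𝔐) (fr.smooth_k hx) (fr.smooth_l hx)
  have e2 := cnabla_conjT (𝔐 := 𝔐) (fr.smooth_l hx) (fr.smooth_n hx)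
  have eL : (fun y ↦ conjT (A.L y)) = A.L := funext fun y ↦ conjT_ofReal _
  have eN : (fun y ↦ conjT (A.N y)) = A.N := funext fun y ↦ conjT_ofReal _
  have eM : (fun y ↦ conjT (A.Mbar y)) = A.Mv := funext fun y ↦ conjT_conjT _
  rw [eL, eM] at e1
  rw [eL, eN] at e2
  constructor
  · rw [con, ← cval_conj, ← e1]; rfl
  · rw [con, ← cval_conj, ← e2, con, ← eM]

/-- The Teukolsky operator preserves `𝓑(s,s)`, and its expression in a tetrad field. -/
lemma teukolsky_spec {s : ℤ} (hf : IsSection s s f) :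
    IsSection s s (teukolsky s f) ∧ ∀ (A : TetradField 𝔐) (x : M), A.SmoothNear x →
      teukolsky s f x (A x)
        = frameTeukolsky 𝔐 A.L A.N A.Mv A.Mbar s (fun y ↦ f y (A y)) x := by
  obtain ⟨su, sv, e⟩ := teukolsky_factor_spec hf
  refine ⟨IsSection.sub (IsSection.const_smul _ (IsSection.sub
    ((((tho_spec su).2.cast).sub ((rho_spec.2.mul su).cast.const_smul _)).sub
      (rho_spec.2.conj.mul su).cast)
    ((((edt_spec sv).2.cast).sub ((tau_spec.2.mul sv).cast.const_smul _)).sub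
      (tauP_spec.2.conj.mul sv).cast)))
    ((isSection_psi2.mul hf).cast.const_smul _), fun A x hA ↦ ?_⟩
  have eU : (fun y ↦ (thoP s s f - rhoP 𝔐 * f) y (A y))
      =ᶠ[𝓝 x] frameU 𝔐 A.L A.N A.Mv A.Mbar s (fun y ↦ f y (A y)) := by
    filter_upwards [hA.eventually] with y hy using (e A y hy).1
  have eV : (fun y ↦ (edtP s s f - tauP 𝔐 * f) y (A y))
      =ᶠ[𝓝 x] frameV 𝔐 A.L A.N A.Mv A.Mbar s (fun y ↦ f y (A y)) := by
    filter_upwards [hA.eventually] with y hy using (e A y hy).2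
  obtain ⟨c1, c2⟩ := star_con hA
  have h1 := (tho_spec su).1 A x hA
  have h2 := (edt_spec sv).1 A x hA
  rw [TetradField.theta, wForm_eq, wBarForm_eq hA hA.eventually_smAt.1.self_of_nhds,
    cderiv_congr eU, (e A x hA).1] at h1
  rw [TetradField.theta, wForm_eq, wBarForm_eq hA hA.eventually_smAt.2.2.1.self_of_nhds,
    cderiv_congr eV, (e A x hA).2] at h2
  have h3 : teukolsky s f x (A x) = 2 * ((tho s (s - 1) (thoP s s f - rhoP 𝔐 * f) x (A x)
      - 2 * s * (rho 𝔐 x (A x) * (thoP s s f - rhoP 𝔐 * f) x (A x))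
      - star (rho 𝔐 x (A x)) * (thoP s s f - rhoP 𝔐 * f) x (A x))
    - (edt (s - 1) s (edtP s s f - tauP 𝔐 * f) x (A x)
      - 2 * s * (tau 𝔐 x (A x) * (edtP s s f - tauP 𝔐 * f) x (A x))
      - star (tauP 𝔐 x (A x)) * (edtP s s f - tauP 𝔐 * f) x (A x)))
    - (4 * s ^ 2 - 6 * s + 2 : ℂ) * (psi2 𝔐 x (A x) * f x (A x)) := rfl
  have h4 : psi2 𝔐 x (A x) = 𝔐.g.cweyl x (A.Mv x) (A.L x) (A.Mbar x) (A.N x) := rfl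
  rw [h3, h1, h2, (e A x hA).1, (e A x hA).2, rho_spec.1 A x hA, tau_spec.1 A x hA,
    tauP_spec.1 A x hA, c1, c2, h4, frameTeukolsky]
  push_cast
  ring

end Operators

/-! ### The fibre pairing -/

section Pairing

variable {s w : ℤ}

lemma boost_twist_trans (a b c : NullTetrad 𝔐 x) :
    boost a c = boost a b * boost b c ∧ twist a c = twist a b * twist b c := by
  have R := rotatesBy_boost_twist a b
  have S := rotatesBy_boost_twist b c
  constructor
  · conv_lhs => rw [boost, S.l_eq, R.l_eq]
    simp [a.l_n, mul_comm]
  · conv_lhs => rw [twist, S.m_eq, R.m_eq]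
    rw [cval_smul_left, cval_smul_left, a.m_conj_m]
    ring

/-- The component at one tetrad can be prescribed. -/
lemma exists_mem_spinFibre (s w : ℤ) (a : NullTetrad 𝔐 x) (z : ℂ) :
    ∃ c ∈ spinFibre 𝔐 s w x, c a = z := by
  refine ⟨fun b ↦ (boost a b : ℂ) ^ w * twist a b ^ s * z, mem_spinFibre_iff.2 fun b c ↦ ?_, ?_⟩
  · obtain ⟨h1, h2⟩ := boost_twist_trans a b c
    simp only [h1, h2, Complex.ofReal_mul, mul_zpow]
    ring
  · simp [boost_self, twist_self]

lemma eq_zero_of_mem_spinFibre {c : NullTetrad 𝔐 x → ℂ} (hc : c ∈ spinFibre 𝔐 s w x)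
    (a : NullTetrad 𝔐 x) (h : c a = 0) : c = 0 := by
  funext b
  rw [mem_spinFibre_iff.1 hc a b, h, mul_zero, Pi.zero_apply]

/-- The duality pairing does not depend on the tetrad. -/
lemma dualEval_eq {d c : NullTetrad 𝔐 x → ℂ} (hd : d ∈ spinFibre 𝔐 s w x)
    (hc : c ∈ spinFibre 𝔐 (-s) (-w) x) (a : NullTetrad 𝔐 x) : dualEval d c = d a * c a := by
  have h : Nonempty (NullTetrad 𝔐 x) := ⟨a⟩
  have R := rotatesBy_boost_twist a h.some
  have h1 : (boost a h.some : ℂ) ≠ 0 := by exact_mod_cast R.lam_pos.ne'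
  have h2 : twist a h.some ≠ 0 := norm_ne_zero_iff.1 (by rw [R.norm_zeta]; exact one_ne_zero)
  rw [dualEval, dif_pos h, mem_spinFibre_iff.1 hd a h.some, mem_spinFibre_iff.1 hc a h.some,
    zpow_neg, zpow_neg]
  field_simp

lemma dualEval_conjFib {d c : NullTetrad 𝔐 x → ℂ} (hd : d ∈ spinFibre 𝔐 s w x)
    (hc : c ∈ spinFibre 𝔐 s (-w) x) (a : NullTetrad 𝔐 x) :
    dualEval d (conjFib c) = d a * star (c a) :=
  dualEval_eq hd (mem_spinFibre_conjFib hc) a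

lemma fibreForm_eq {u v : (NullTetrad 𝔐 x → ℂ) × (NullTetrad 𝔐 x → ℂ)}
    (hu : u ∈ doubleFibre 𝔐 s x) (hv : v ∈ doubleFibre 𝔐 s x) (a : NullTetrad 𝔐 x) :
    fibreForm u v = star (u.1 a) * v.2 a + star (u.2 a) * v.1 a := by
  rw [fibreForm, dualEval_conjFib hv.2 (by simpa using hu.1) a, dualEval_conjFib hv.1 hu.2 a]
  ring

lemma fibreForm_conj {u v : (NullTetrad 𝔐 x → ℂ) × (NullTetrad 𝔐 x → ℂ)}
    (hu : u ∈ doubleFibre 𝔐 s x) (hv : v ∈ doubleFibre 𝔐 s x) :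
    fibreForm v u = star (fibreForm u v) := by
  obtain ⟨a⟩ := nonempty_nullTetrad 𝔐 x
  rw [fibreForm_eq hu hv a, fibreForm_eq hv hu a]
  simp only [star_add, star_mul', star_star]
  ring

/-- The fibre pairing is non-degenerate. -/
lemma fibreForm_nondegenerate {v : (NullTetrad 𝔐 x → ℂ) × (NullTetrad 𝔐 x → ℂ)}
    (hv : v ∈ doubleFibre 𝔐 s x) (h : ∀ u ∈ doubleFibre 𝔐 s x, fibreForm u v = 0) : v = 0 := by
  obtain ⟨a⟩ := nonempty_nullTetrad 𝔐 x
  obtain ⟨c, hc, hca⟩ := exists_mem_spinFibre s s a 1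
  obtain ⟨d, hd, hda⟩ := exists_mem_spinFibre s (-s) a 1
  have h1 := h (c, 0) ⟨hc, Submodule.zero_mem _⟩
  have h2 := h (0, d) ⟨Submodule.zero_mem _, hd⟩
  rw [fibreForm_eq ⟨hc, Submodule.zero_mem _⟩ hv a] at h1
  rw [fibreForm_eq ⟨Submodule.zero_mem _, hd⟩ hv a] at h2
  simp only [hca, hda, Pi.zero_apply, star_one, star_zero, one_mul, zero_mul, add_zero,
    zero_add] at h1 h2
  exact Prod.ext (eq_zero_of_mem_spinFibre hv.1 a h2) (eq_zero_of_mem_spinFibre hv.2 a h1)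

/-- The real part of `⟨u, u⟩` takes every real value, so that the fibre pairing is indefinite. -/
lemma exists_fibreForm_self (x : M) (s : ℤ) (r : ℝ) :
    ∃ u ∈ doubleFibre 𝔐 s x, (fibreForm u u).re = 2 * r := by
  obtain ⟨a⟩ := nonempty_nullTetrad 𝔐 x
  obtain ⟨c, hc, hca⟩ := exists_mem_spinFibre s s a 1
  obtain ⟨d, hd, hda⟩ := exists_mem_spinFibre s (-s) a r
  refine ⟨(c, d), ⟨hc, hd⟩, ?_⟩
  rw [fibreForm_eq ⟨hc, hd⟩ ⟨hc, hd⟩ a]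
  simp [hca, hda]
  ring

end Pairing

end Gauge

/-! ### Coordinate vector fields -/

section Coordinates

variable {x₀ x : M} {X : VField M}

instance finite_tangentSpace (x : M) : Module.Finite ℝ (TangentSpace (𝓡 4) x) :=
  inferInstanceAs (Module.Finite ℝ E4)

instance free_tangentSpace (x : M) : Module.Free ℝ (TangentSpace (𝓡 4) x) :=
  inferInstanceAs (Module.Free ℝ E4)

/-- The vector field with constant components `v` in the chart at `x₀`. -/
def coordField (x₀ : M) (v : E4) : VField M := fun x ↦
  (trivializationAt E4 (TangentSpace (𝓡 4)) x₀).symmL ℝ x v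

/-- The components of a tangent vector in the chart at `x₀`. -/
def coordDiff (x₀ x : M) : TangentSpace (𝓡 4) x →L[ℝ] E4 := mvfderiv (𝓡 4) (extChartAt (𝓡 4) x₀) x

/-- Coordinate fields are the images of constant vectors under the inverse chart. -/
lemma coordField_eq (hx : x ∈ (chartAt E4 x₀).source) (v : E4) : coordField x₀ v x
    = (mfderiv 𝓘(ℝ, E4) (𝓡 4) (extChartAt (𝓡 4) x₀).symm (extChartAt (𝓡 4) x₀ x) :
      E4 →L[ℝ] E4) v := by
  have h := TangentBundle.symmL_trivializationAt (𝕜 := ℝ) (I := 𝓡 4) hx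
  have e : mfderiv 𝓘(ℝ, E4) (𝓡 4) (extChartAt (𝓡 4) x₀).symm (extChartAt (𝓡 4) x₀ x)
      = mfderivWithin 𝓘(ℝ, E4) (𝓡 4) (extChartAt (𝓡 4) x₀).symm (Set.range (𝓡 4))
        (extChartAt (𝓡 4) x₀ x) := by
    rw [ModelWithCorners.range_eq_univ, mfderivWithin_univ]
  rw [coordField, e]
  exact congrArg (fun L : E4 →L[ℝ] E4 ↦ L v) h

lemma coordDiff_eq (hx : x ∈ (chartAt E4 x₀).source) :
    coordDiff x₀ x = (trivializationAt E4 (TangentSpace (𝓡 4)) x₀).continuousLinearMapAt ℝ x :=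
  (TangentBundle.continuousLinearMapAt_trivializationAt (𝕜 := ℝ) (I := 𝓡 4) hx).symm

lemma mem_baseSet (hx : x ∈ (chartAt E4 x₀).source) :
    x ∈ (trivializationAt E4 (TangentSpace (𝓡 4)) x₀).baseSet := by
  rwa [TangentBundle.trivializationAt_baseSet]

lemma coordDiff_coordField (hx : x ∈ (chartAt E4 x₀).source) (v : E4) :
    coordDiff x₀ x (coordField x₀ v x) = v := by
  rw [coordDiff_eq hx]
  exact (trivializationAt E4 (TangentSpace (𝓡 4)) x₀).continuousLinearMapAt_symmL (mem_baseSet hx) v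

lemma coordField_coordDiff (hx : x ∈ (chartAt E4 x₀).source) (u : TangentSpace (𝓡 4) x) :
    coordField x₀ (coordDiff x₀ x u) x = u := by
  rw [coordDiff_eq hx]
  exact (trivializationAt E4 (TangentSpace (𝓡 4)) x₀).symmL_continuousLinearMapAt (mem_baseSet hx) u

lemma smAt_coordField (hx : x ∈ (chartAt E4 x₀).source) (v : E4) : (coordField x₀ v).SmAt x := by
  have h : MemTrivializationAtlas (trivializationAt E4 (TangentSpace (𝓡 4) : M → Type _) x₀) :=
    inferInstance
  refine ((trivializationAt E4 (TangentSpace (𝓡 4) : M → Type _) x₀).contMDiffAt_section_iff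
    (IB := 𝓡 4) (n := ∞) (mem_baseSet hx)).2 ?_
  refine (contMDiffAt_const (c := v)).congr_of_eventuallyEq ?_
  filter_upwards [(chartAt E4 x₀).open_source.mem_nhds hx] with y hy
  have := (trivializationAt E4 (TangentSpace (𝓡 4) : M → Type _) x₀).continuousLinearMapAt_symmL
    (R := ℝ) (mem_baseSet hy) v
  rwa [Bundle.Trivialization.continuousLinearMapAt_apply_of_mem ℝ _ (mem_baseSet hy)] at this

/-- The coordinate functions. -/
def coordFun (x₀ : M) (i : Fin 4) : M → ℝ := fun x ↦ extChartAt (𝓡 4) x₀ x i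

lemma smF_extChartAt (hx : x ∈ (chartAt E4 x₀).source) : SmF (extChartAt (𝓡 4) x₀) x :=
  contMDiffAt_extChartAt' hx

lemma smF_coordFun (hx : x ∈ (chartAt E4 x₀).source) (i : Fin 4) : SmF (coordFun x₀ i) x :=
  ((EuclideanSpace.proj i : E4 →L[ℝ] ℝ).contDiff.contMDiff.contMDiffAt).comp x (smF_extChartAt hx)

lemma mvfderiv_coordFun (hx : x ∈ (chartAt E4 x₀).source) (i : Fin 4) (u : TangentSpace (𝓡 4) x) :
    mvfderiv (𝓡 4) (coordFun x₀ i) x u = coordDiff x₀ x u i :=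
  mvfderiv_clm (EuclideanSpace.proj i : E4 →L[ℝ] ℝ) (smF_extChartAt hx).diF u

/-- Coordinate vector fields commute. -/
lemma bracket_coordField (hx : x ∈ (chartAt E4 x₀).source) (v w : E4) :
    VectorField.mlieBracket (𝓡 4) (coordField x₀ v) (coordField x₀ w) x = 0 := by
  have hv := smAt_coordField hx v
  have hw := smAt_coordField hx w
  have e : ∀ (v : E4) (i : Fin 4),
      vderiv (coordField x₀ v) (coordFun x₀ i) =ᶠ[𝓝 x] fun _ ↦ v i := by
    intro v i
    filter_upwards [(chartAt E4 x₀).open_source.mem_nhds hx] with y hy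
    rw [vderiv, mvfderiv_coordFun hy, coordDiff_coordField hy]
  have z : ∀ (v w : E4) (i : Fin 4),
      vderiv (coordField x₀ v) (vderiv (coordField x₀ w) (coordFun x₀ i)) x = 0 := by
    intro v w i
    rw [vderiv_congr (e w i), vderiv, mvfderiv_const]; rfl
  have key : coordDiff x₀ x
      (VectorField.mlieBracket (𝓡 4) (coordField x₀ v) (coordField x₀ w) x) = 0 := by
    ext i
    have := vderiv_bracket (smF_coordFun hx i) hv hw
    rw [z, z, sub_zero, vderiv, mvfderiv_coordFun hx] at this
    exact this
  rw [← coordField_coordDiff hx (VectorField.mlieBracket (𝓡 4) _ _ x), key, coordField, map_zero]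

/-- The coordinate vector fields `∂ᵢ`. -/
def partialField (x₀ : M) (i : Fin 4) : VField M := coordField x₀ (EuclideanSpace.single i 1)

lemma sum_partialField (hx : x ∈ (chartAt E4 x₀).source) (u : TangentSpace (𝓡 4) x) :
    ∑ i, coordDiff x₀ x u i • partialField x₀ i x = u := by
  conv_rhs => rw [← coordField_coordDiff hx u]
  have e : coordDiff x₀ x u = ∑ i, coordDiff x₀ x u i • EuclideanSpace.single i (1 : ℝ) := by
    ext j
    simp [Finset.sum_apply, Pi.single_apply]
  conv_rhs => rw [e]
  simp only [coordField, partialField, map_sum, map_smul]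

/-- The trace of an endomorphism in the coordinate basis. -/
lemma trace_eq_sum_coordDiff (hx : x ∈ (chartAt E4 x₀).source)
    (L : TangentSpace (𝓡 4) x →ₗ[ℝ] TangentSpace (𝓡 4) x) :
    LinearMap.trace ℝ _ L = ∑ i, coordDiff x₀ x (L (partialField x₀ i x)) i := by
  have e : L = ∑ i, ((EuclideanSpace.proj i : E4 →L[ℝ] ℝ).toLinearMap ∘ₗ
      (coordDiff x₀ x).toLinearMap ∘ₗ L).smulRight (partialField x₀ i x) := by
    ext u
    rw [LinearMap.sum_apply]
    exact (sum_partialField hx (L u)).symm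
  conv_lhs => rw [e]
  rw [map_sum]
  exact Finset.sum_congr rfl fun i _ ↦ LinearMap.trace_smulRight _ _

/-- The trace of an endomorphism in the basis given by a null tetrad. -/
lemma trace_eq_sum_tetrad {𝔐 : Background M} (a : NullTetrad 𝔐 x)
    (L : TangentSpace (𝓡 4) x →ₗ[ℝ] TangentSpace (𝓡 4) x) :
    LinearMap.trace ℝ _ L = 𝔐.g.val x a.n (L a.l) + 𝔐.g.val x a.l (L a.n)
      - 2 * 𝔐.g.val x a.m.1 (L a.m.1) - 2 * 𝔐.g.val x a.m.2 (L a.m.2) := by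
  have e : L = ((𝔐.g.val x a.n).toLinearMap ∘ₗ L).smulRight a.l
      + ((𝔐.g.val x a.l).toLinearMap ∘ₗ L).smulRight a.n
      + ((-2 : ℝ) • (𝔐.g.val x a.m.1).toLinearMap ∘ₗ L).smulRight a.m.1
      + ((-2 : ℝ) • (𝔐.g.val x a.m.2).toLinearMap ∘ₗ L).smulRight a.m.2 := by
    ext u
    have := a.expand (L u)
    simp only [𝔐.g.symm x (L u)] at this
    exact this
  conv_lhs => rw [e]
  simp only [map_add, LinearMap.trace_smulRight]
  simp
  ring

end Coordinates

section Jacobi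

/-- Jacobi's formula for the derivative of the determinant. -/
lemma hasFDerivAt_det {E : Type*} [NormedAddCommGroup E] [NormedSpace ℝ E] {n : Type*} [Fintype n]
    [DecidableEq n] {A : E → Matrix n n ℝ} {A' : n → n → E →L[ℝ] ℝ} {x : E}
    (h : ∀ i j, HasFDerivAt (fun y ↦ A y i j) (A' i j) x) :
    HasFDerivAt (fun y ↦ (A y).det) (∑ i, ∑ j, (A x).adjugate i j • A' j i) x := by
  have h1 : HasFDerivAt (fun y ↦ (A y).det) (∑ σ : Equiv.Perm n,
      ((Equiv.Perm.sign σ : ℤ) : ℝ) •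
        ∑ i, (∏ j ∈ Finset.univ.erase i, A x (σ j) j) • A' (σ i) i) x := by
    simp only [Matrix.det_apply']
    exact HasFDerivAt.fun_sum fun σ _ ↦ (HasFDerivAt.finsetProd fun i _ ↦ h (σ i) i).const_mul _
  refine h1.congr_fderiv ?_
  ext v
  simp only [sum_apply, smul_apply, smul_eq_mul]
  have e : ∀ i, ∑ j, (A x).adjugate i j * A' j i v
      = ((A x).updateCol i fun j ↦ A' j i v).det := by
    intro i
    rw [← Matrix.cramer_apply, Matrix.cramer_eq_adjugate_mulVec]
    rfl
  simp only [e, Matrix.det_apply', Finset.mul_sum]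
  rw [Finset.sum_comm]
  refine Finset.sum_congr rfl fun i _ ↦ Finset.sum_congr rfl fun σ _ ↦ ?_
  rw [← Finset.mul_prod_erase _ _ (Finset.mem_univ i), Matrix.updateCol_self]
  have : ∏ j ∈ Finset.univ.erase i, (A x).updateCol i (fun j ↦ A' j i v) (σ j) j
      = ∏ j ∈ Finset.univ.erase i, A x (σ j) j :=
    Finset.prod_congr rfl fun j hj ↦ by rw [Matrix.updateCol_ne (Finset.ne_of_mem_erase hj)]
  rw [this]
  ring

end Jacobi

/-! ### The divergence in coordinates -/

section Divergence

variable {𝔐 : Background M} {x₀ x : M} {X Y : VField M}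

/-- The matrix of the metric in the coordinate basis, as a function on the manifold. -/
def gramMatrix (g : LorentzMetric M) (x₀ x : M) : Matrix (Fin 4) (Fin 4) ℝ :=
  Matrix.of fun i j ↦ g.val x (partialField x₀ i x) (partialField x₀ j x)

/-- The density of the volume form in the chart at `x₀`, as a function on the manifold. -/
def density (g : LorentzMetric M) (x₀ x : M) : ℝ := Real.sqrt |(gramMatrix g x₀ x).det|

/-- The Gram determinant in the chart is that of the coordinate fields on the manifold. -/
lemma gramDet_extChartAt (g : LorentzMetric M) (hx : x ∈ (chartAt E4 x₀).source) :
    g.gramDet x₀ (extChartAt (𝓡 4) x₀ x) = (gramMatrix g x₀ x).det := by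
  have e : ∀ (z : M) (_ : z = x) (u v : E4),
      (g.val z : E4 →L[ℝ] E4 →L[ℝ] ℝ) u v = (g.val x : E4 →L[ℝ] E4 →L[ℝ] ℝ) u v := by
    rintro z rfl u v; rfl
  have hz : (extChartAt (𝓡 4) x₀).symm (extChartAt (𝓡 4) x₀ x) = x :=
    (extChartAt (𝓡 4) x₀).left_inv (by rwa [extChartAt_source])
  rw [LorentzMetric.gramDet]
  congr 1
  ext i j
  simp only [gramMatrix, Matrix.of_apply, partialField]
  rw [coordField_eq hx, coordField_eq hx]
  exact e _ hz _ _

/-- The metric is non-degenerate. -/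
lemma det_gramMatrix_ne_zero (g : LorentzMetric M) (hx : x ∈ (chartAt E4 x₀).source) :
    (gramMatrix g x₀ x).det ≠ 0 := by
  intro h
  obtain ⟨c, hc, h0⟩ := Matrix.exists_mulVec_eq_zero_iff.2 h
  refine hc ?_
  have hu : ∑ i, c i • partialField x₀ i x = 0 := by
    refine g.eq_of_val_eq fun w ↦ ?_
    rw [map_zero, zero_apply, g.symm, ← sum_partialField hx w]
    simp only [map_sum, sum_apply, map_smul, smul_apply, smul_eq_mul, Finset.mul_sum]
    rw [Finset.sum_comm]
    refine Finset.sum_eq_zero fun i _ ↦ ?_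
    have := congrFun h0 i
    simp only [Matrix.mulVec, dotProduct, gramMatrix, Matrix.of_apply, Pi.zero_apply] at this
    rw [← mul_zero (coordDiff x₀ x w i), ← this, Finset.mul_sum]
    exact Finset.sum_congr rfl fun j _ ↦ by ring
  funext j
  have := congrArg (coordDiff x₀ x) hu
  rw [map_sum, map_zero] at this
  have := congrArg (fun v : E4 ↦ v j) this
  simp only [map_smul, partialField, coordDiff_coordField hx] at this
  simpa [Finset.sum_apply, Pi.single_apply] using this

lemma density_pos (g : LorentzMetric M) (hx : x ∈ (chartAt E4 x₀).source) :
    0 < density g x₀ x := Real.sqrt_pos.2 (abs_pos.2 (det_gramMatrix_ne_zero g hx))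

lemma smAt_partialField (hx : x ∈ (chartAt E4 x₀).source) (i : Fin 4) :
    (partialField x₀ i).SmAt x := smAt_coordField hx _

lemma smF_gramMatrix (g : LorentzMetric M) (hx : x ∈ (chartAt E4 x₀).source) (i j : Fin 4) :
    SmF (fun y ↦ gramMatrix g x₀ y i j) x :=
  g.smF_val (smAt_partialField hx i) (smAt_partialField hx j)

lemma smF_det_gramMatrix (g : LorentzMetric M) (hx : x ∈ (chartAt E4 x₀).source) :
    SmF (fun y ↦ (gramMatrix g x₀ y).det) x := by
  simp only [Matrix.det_apply']
  refine contMDiffAt_finsetSum fun σ _ ↦ smF_const_mul _ ?_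
  exact contMDiffAt_finsetProd fun i _ ↦ smF_gramMatrix g hx (σ i) i

lemma smF_density (g : LorentzMetric M) (hx : x ∈ (chartAt E4 x₀).source) :
    SmF (density g x₀) x := by
  have h := det_gramMatrix_ne_zero g hx
  have h1 : SmF (fun y ↦ |(gramMatrix g x₀ y).det|) x :=
    ((contDiffAt_abs h).contMDiffAt).comp x (smF_det_gramMatrix g hx)
  exact smF_sqrt h1 (abs_ne_zero.2 h)

lemma mvfderiv_comp_hasFDerivAt {F G : Type*} [NormedAddCommGroup F] [NormedSpace ℝ F]
    [NormedAddCommGroup G] [NormedSpace ℝ G] {q : F → G} {q' : F →L[ℝ] G} {f : M → F}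
    (hq : HasFDerivAt q q' (f x)) (hf : DiF f x) (v : TangentSpace (𝓡 4) x) :
    mvfderiv (𝓡 4) (fun y ↦ q (f y)) x v = q' (mvfderiv (𝓡 4) f x v) := by
  have h := (hq.hasMFDerivAt).comp x hf.hasMFDerivAt
  have e : mfderiv (𝓡 4) 𝓘(ℝ, G) (fun y ↦ q (f y)) x = _ := h.mfderiv
  simp only [mvfderiv]
  rw [e]
  rfl

/-- Jacobi's formula along a vector field. -/
lemma vderiv_det_gramMatrix (g : LorentzMetric M) (hx : x ∈ (chartAt E4 x₀).source) :
    vderiv X (fun y ↦ (gramMatrix g x₀ y).det) x = ((gramMatrix g x₀ x).adjugate *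
      Matrix.of fun i j ↦ vderiv X (fun y ↦ gramMatrix g x₀ y i j) x).trace := by
  have sG : SmF (fun y i j ↦ gramMatrix g x₀ y i j) x :=
    contMDiffAt_pi_space.2 fun i ↦ contMDiffAt_pi_space.2 fun j ↦ smF_gramMatrix g hx i j
  let P (i j : Fin 4) : (Fin 4 → Fin 4 → ℝ) →L[ℝ] ℝ :=
    (ContinuousLinearMap.proj (R := ℝ) (φ := fun _ : Fin 4 ↦ ℝ) j).comp
      (ContinuousLinearMap.proj (R := ℝ) (φ := fun _ : Fin 4 ↦ Fin 4 → ℝ) i)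
  have h1 := hasFDerivAt_det (A := fun B : Fin 4 → Fin 4 → ℝ ↦ Matrix.of B) (A' := P)
    (x := fun i j ↦ gramMatrix g x₀ x i j) (fun i j ↦ (P i j).hasFDerivAt)
  have h2 := mvfderiv_comp_hasFDerivAt (f := fun y i j ↦ gramMatrix g x₀ y i j) h1 sG.diF (X x)
  have h3 : ∀ i j, P i j (mvfderiv (𝓡 4) (fun y i j ↦ gramMatrix g x₀ y i j) x (X x))
      = vderiv X (fun y ↦ gramMatrix g x₀ y i j) x :=
    fun i j ↦ (mvfderiv_clm (P i j) sG.diF (X x)).symm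
  refine (show vderiv X (fun y ↦ (gramMatrix g x₀ y).det) x = _ from h2).trans ?_
  simp only [sum_apply, smul_apply, h3, Matrix.trace, Matrix.diag, Matrix.mul_apply, smul_eq_mul]
  rfl

/-- The derivative of the density along a coordinate field is the trace of the connection. -/
lemma vderiv_density (hx : x ∈ (chartAt E4 x₀).source) (j : Fin 4) :
    vderiv (partialField x₀ j) (density 𝔐.g x₀) x = density 𝔐.g x₀ x *
      ∑ i, coordDiff x₀ x (𝔐.g.nabla (partialField x₀ j) (partialField x₀ i) x) i := by
  have sp := fun i ↦ smAt_partialField hx i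
  set Γ : Matrix (Fin 4) (Fin 4) ℝ := Matrix.of fun i k ↦
    coordDiff x₀ x (𝔐.g.nabla (partialField x₀ j) (partialField x₀ i) x) k with hΓ
  set G := gramMatrix 𝔐.g x₀ x with hG
  -- compatibility with the metric gives `∂G = Γ G + G Γᵀ` for the matrix `Γ` of `∇_j`
  have eG : (Matrix.of fun i k ↦ vderiv (partialField x₀ j) (fun y ↦ gramMatrix 𝔐.g x₀ y i k) x)
      = Γ * G + G * Γ.transpose := by
    ext i k
    have h := 𝔐.g.nabla_metric (sp j).diffAt (sp i).diffAt (sp k).diffAt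
    have h' : vderiv (partialField x₀ j) (fun y ↦ gramMatrix 𝔐.g x₀ y i k) x = _ := h
    rw [Matrix.of_apply, h']
    conv_lhs => rw [← sum_partialField hx (𝔐.g.nabla (partialField x₀ j) (partialField x₀ i) x),
      ← sum_partialField hx (𝔐.g.nabla (partialField x₀ j) (partialField x₀ k) x)]
    simp only [map_sum, sum_apply, map_smul, smul_apply, smul_eq_mul, Matrix.add_apply,
      Matrix.mul_apply, Matrix.transpose_apply]
    congr 1
    exact Finset.sum_congr rfl fun l _ ↦ mul_comm _ _
  -- Jacobi's formula
  have hd : vderiv (partialField x₀ j) (fun y ↦ (gramMatrix 𝔐.g x₀ y).det) x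
      = 2 * G.det * Γ.trace := by
    rw [vderiv_det_gramMatrix 𝔐.g hx, eG, mul_add, Matrix.trace_add, ← mul_assoc, ← hG,
      ← mul_assoc G.adjugate, Matrix.adjugate_mul, Matrix.trace_mul_cycle, Matrix.mul_adjugate,
      Matrix.smul_mul, Matrix.smul_mul, one_mul, one_mul, Matrix.trace_smul, Matrix.trace_smul,
      Matrix.trace_transpose, smul_eq_mul]
    ring
  have ne : G.det ≠ 0 := det_gramMatrix_ne_zero 𝔐.g hx
  have hs := ((hasDerivAt_abs ne).sqrt (abs_ne_zero.2 ne)).hasFDerivAt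
  have key := mvfderiv_comp_hasFDerivAt (f := fun y ↦ (gramMatrix 𝔐.g x₀ y).det) hs
    (smF_det_gramMatrix 𝔐.g hx).diF (partialField x₀ j x)
  have key' : vderiv (partialField x₀ j) (density 𝔐.g x₀) x = _ := key
  rw [key']
  change vderiv (partialField x₀ j) (fun y ↦ (gramMatrix 𝔐.g x₀ y).det) x * _ = _
  rw [hd]
  have hD : density 𝔐.g x₀ x * density 𝔐.g x₀ x = |G.det| := Real.mul_self_sqrt (abs_nonneg _)
  have hDp := density_pos 𝔐.g hx
  have hsg : SignType.sign G.det * G.det = |G.det| := sign_mul_self _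
  change 2 * G.det * Γ.trace * ((SignType.sign G.det : ℝ) / (2 * density 𝔐.g x₀ x))
    = density 𝔐.g x₀ x * Γ.trace
  field_simp
  rw [pow_two, hD, ← hsg]
  ring

/-- The divergence of a coordinate field is the logarithmic derivative of the density. -/
lemma frameDiv_partialField {A : TetradField 𝔐} (hA : A.SmoothNear x)
    (hx : x ∈ (chartAt E4 x₀).source) (j : Fin 4) :
    (density 𝔐.g x₀ x : ℂ) * frameDiv 𝔐 A.L A.N A.Mv A.Mbar (fun y ↦ ofReal (partialField x₀ j y)) x
      = (vderiv (partialField x₀ j) (density 𝔐.g x₀) x : ℝ) := by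
  have sp := fun i ↦ smAt_partialField hx i
  obtain ⟨sl, sn, s1, s2⟩ := hA.smAt
  -- the divergence of `∂_j` is the trace of `∇ ∂_j`, which is computed in the tetrad and in
  -- coordinates
  set L : TangentSpace (𝓡 4) x →ₗ[ℝ] TangentSpace (𝓡 4) x :=
    ((𝔐.g.tensorialAt_nabla (sp j).diffAt).mkHom _).toLinearMap with hL
  have eL : ∀ {X : VField M}, X.SmAt x → L (X x) = 𝔐.g.nabla X (partialField x₀ j) x :=
    fun {X} hX ↦ TensorialAt.mkHom_apply _ hX.diffAt
  have t1 := trace_eq_sum_coordDiff hx L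
  have t2 := trace_eq_sum_tetrad (A x) L
  rw [t1] at t2
  -- coordinate fields commute, so that `∇_i ∂_j = ∇_j ∂_i`
  have e3 : ∀ i, L (partialField x₀ i x) = 𝔐.g.nabla (partialField x₀ j) (partialField x₀ i) x := by
    intro i
    have := 𝔐.g.nabla_torsion (sp i).diffAt (sp j).diffAt
    rw [partialField, partialField, bracket_coordField hx, sub_eq_zero] at this
    rw [eL (sp i)]
    exact this
  simp only [e3] at t2
  rw [vderiv_density hx, t2, Complex.ofReal_mul]
  congr 1
  rw [eL sl, eL sn, eL s1, eL s2]
  have z1 : ∀ Y : VField M, Y.SmAt x → 𝔐.g.nabla (fun _ ↦ 0) Y x = 0 := by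
    intro Y hY
    have := 𝔐.g.nabla_add_left (X := 0) (X' := 0) (Y := Y)
      smAt_zero.diffAt smAt_zero.diffAt hY.diffAt
    rw [add_zero] at this
    exact left_eq_add.1 this
  have z2 : ∀ Y : VField M, Y.SmAt x → 𝔐.g.nabla Y (fun _ ↦ 0) x = 0 := by
    intro Y hY
    have := 𝔐.g.nabla_add_right (X := Y) (Y := 0) (Z := 0)
      hY.diffAt smAt_zero.diffAt smAt_zero.diffAt
    rw [add_zero] at this
    exact left_eq_add.1 this
  have z0 : 𝔐.g.nabla (fun _ ↦ 0) (fun _ ↦ 0) x = 0 := z1 _ smAt_zero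
  have n1 : 𝔐.g.nabla (fun y ↦ -(A y).m.2) (partialField x₀ j) x
      = -𝔐.g.nabla (fun y ↦ (A y).m.2) (partialField x₀ j) x :=
    𝔐.g.nabla_neg_left s2.diffAt (sp j).diffAt
  have s2' : VField.SmAt (fun y ↦ -(A y).m.2) x := s2.neg
  simp only [frameDiv, con, LorentzMetric.cnabla, TetradField.L, TetradField.N, TetradField.Mv,
    TetradField.Mbar, ofReal, conjT, z1 _ (sp j), z2 _ sl, z2 _ sn, z2 _ s1, z2 _ s2, z2 _ s2', n1,
    z0]
  apply Complex.ext
  · simp [LorentzMetric.cval_re]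
    ring
  · simp [LorentzMetric.cval_im]
    ring

/-- The expansion of a complex vector field in coordinate fields, with the derivatives of the
coordinate functions as components. -/
lemma eq_sum_partialField (hx : x ∈ (chartAt E4 x₀).source) (J : CVField M) :
    J x = smulT (cderiv J (fun z ↦ (coordFun x₀ 0 z : ℂ)) x) (ofReal (partialField x₀ 0 x))
      + smulT (cderiv J (fun z ↦ (coordFun x₀ 1 z : ℂ)) x) (ofReal (partialField x₀ 1 x))
      + smulT (cderiv J (fun z ↦ (coordFun x₀ 2 z : ℂ)) x) (ofReal (partialField x₀ 2 x))
      + smulT (cderiv J (fun z ↦ (coordFun x₀ 3 z : ℂ)) x) (ofReal (partialField x₀ 3 x)) := by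
  have e : ∀ i, cderiv J (fun z ↦ (coordFun x₀ i z : ℂ)) x
      = (⟨coordDiff x₀ x (J x).1 i, coordDiff x₀ x (J x).2 i⟩ : ℂ) := by
    intro i
    have h1 := fun v ↦ mvfderiv_clm Complex.ofRealCLM (smF_coordFun hx i).diF v
    simp only [Complex.ofRealCLM_apply] at h1
    rw [cderiv, h1, h1, mvfderiv_coordFun hx, mvfderiv_coordFun hx]
    apply Complex.ext <;> simp
  have h1 := sum_partialField hx (J x).1
  have h2 := sum_partialField hx (J x).2
  simp only [e, Fin.sum_univ_four] at h1 h2 ⊢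
  ext1
  · simpa [smulT, ofReal] using h1.symm
  · simpa [smulT, ofReal] using h2.symm

/-- The divergence in coordinates. -/
lemma density_mul_frameDiv {A : TetradField 𝔐} (hA : A.SmoothNear x)
    (hx : x ∈ (chartAt E4 x₀).source) {J : CVField M} (hJ : J.SmAt x) :
    (density 𝔐.g x₀ x : ℂ) * frameDiv 𝔐 A.L A.N A.Mv A.Mbar J x
      = ∑ i, cderiv (fun y ↦ ofReal (partialField x₀ i y)) (fun y ↦ (density 𝔐.g x₀ y : ℂ)
        * cderiv J (fun z ↦ (coordFun x₀ i z : ℂ)) y) x := by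
  obtain ⟨U, hU, fr⟩ := hA.frameField
  have sp : ∀ i, CVField.SmAt (fun y ↦ ofReal (partialField x₀ i y)) x :=
    fun i ↦ (smAt_partialField hx i).ofReal
  have sc : ∀ i, SmF (cderiv J (fun z ↦ (coordFun x₀ i z : ℂ))) x :=
    fun i ↦ (smF_ofReal (smF_coordFun hx i)).cderiv hJ
  have sd : SmF (fun y ↦ (density 𝔐.g x₀ y : ℂ)) x := smF_ofReal (smF_density 𝔐.g hx)
  have st := fun i ↦ (sp i).smulT (sc i)
  let c i : CVField M := fun y ↦
    smulT (cderiv J (fun z ↦ (coordFun x₀ i z : ℂ)) y) (ofReal (partialField x₀ i y))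
  have ed : frameDiv 𝔐 A.L A.N A.Mv A.Mbar J x
      = frameDiv 𝔐 A.L A.N A.Mv A.Mbar (fun y ↦ c 0 y + c 1 y + c 2 y + c 3 y) x := by
    have := fun X : CVField M ↦ cnabla_congr (𝔐 := 𝔐) (X := X) (X' := X) (x := x) (Y := J)
      (Y' := fun y ↦ c 0 y + c 1 y + c 2 y + c 3 y) (Filter.Eventually.of_forall fun _ ↦ rfl) (by
        filter_upwards [(chartAt E4 x₀).open_source.mem_nhds hx] with y hy
        using eq_sum_partialField hy J)
    simp only [frameDiv, con, this]
  have dd : ∀ i, cderiv (fun y ↦ ofReal (partialField x₀ i y)) (fun y ↦ (density 𝔐.g x₀ y : ℂ)) x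
      = (vderiv (partialField x₀ i) (density 𝔐.g x₀) x : ℝ) := by
    intro i
    have h1 := fun v ↦ mvfderiv_clm Complex.ofRealCLM (smF_density 𝔐.g hx).diF v
    simp only [Complex.ofRealCLM_apply] at h1
    rw [cderiv, h1, h1]
    simp [ofReal, vderiv]
  rw [ed, fr.frameDiv_add hU (((st 0).add (st 1)).add (st 2)) (st 3),
    fr.frameDiv_add hU ((st 0).add (st 1)) (st 2), fr.frameDiv_add hU (st 0) (st 1),
    fr.frameDiv_smulT hU (sc 0) (sp 0), fr.frameDiv_smulT hU (sc 1) (sp 1),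
    fr.frameDiv_smulT hU (sc 2) (sp 2), fr.frameDiv_smulT hU (sc 3) (sp 3), Fin.sum_univ_four]
  simp only [cderiv_mul sd.diF (sc _).diF, dd, ← frameDiv_partialField hA hx]
  ring

end Divergence

/-! ### The volume measure -/

section Measure

variable {g : LorentzMetric M} {x₀ x : M} {S : Set M}

lemma chart_left_inv (hx : x ∈ (chartAt E4 x₀).source) :
    (extChartAt (𝓡 4) x₀).symm (extChartAt (𝓡 4) x₀ x) = x :=
  (extChartAt (𝓡 4) x₀).left_inv (by rwa [extChartAt_source])

lemma chart_map_target {y : E4} (hy : y ∈ (extChartAt (𝓡 4) x₀).target) :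
    (extChartAt (𝓡 4) x₀).symm y ∈ (chartAt E4 x₀).source := by
  have := (extChartAt (𝓡 4) x₀).map_target hy
  rwa [extChartAt_source] at this

lemma gramDet_eq {y : E4} (hy : y ∈ (extChartAt (𝓡 4) x₀).target) :
    g.gramDet x₀ y = (gramMatrix g x₀ ((extChartAt (𝓡 4) x₀).symm y)).det := by
  rw [← gramDet_extChartAt g (chart_map_target hy), (extChartAt (𝓡 4) x₀).right_inv hy]

lemma sqrt_gramDet_eq {y : E4} (hy : y ∈ (extChartAt (𝓡 4) x₀).target) :
    Real.sqrt |g.gramDet x₀ y| = density g x₀ ((extChartAt (𝓡 4) x₀).symm y) := by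
  rw [gramDet_eq hy, density]

lemma continuousOn_sqrt_gramDet : ContinuousOn (fun y ↦ Real.sqrt |g.gramDet x₀ y|)
    (extChartAt (𝓡 4) x₀).target := by
  have h : ContinuousOn (density g x₀) (chartAt E4 x₀).source :=
    fun x hx ↦ (smF_density g hx).continuousAt.continuousWithinAt
  exact (h.comp (continuousOn_extChartAt_symm x₀) fun y hy ↦ chart_map_target hy).congr
    fun y hy ↦ sqrt_gramDet_eq hy

lemma measurableSet_target : MeasurableSet (extChartAt (𝓡 4) x₀).target :=
  (isOpen_extChartAt_target x₀).measurableSet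

/-- The coordinate change between two charts, infinitesimally. -/
def coordChange (x₀ x₁ x : M) : E4 →L[ℝ] E4 :=
  (coordDiff x₁ x).comp ((trivializationAt E4 (TangentSpace (𝓡 4)) x₀).symmL ℝ x)

/-- The transformation of the Gram determinant under a change of charts. -/
lemma det_gramMatrix_eq {x₁ : M} (h₁ : x ∈ (chartAt E4 x₁).source) :
    (gramMatrix g x₀ x).det = (coordChange x₀ x₁ x).det ^ 2 * (gramMatrix g x₁ x).det := by
  set b := (EuclideanSpace.basisFun (Fin 4) ℝ).toBasis
  let P : Matrix (Fin 4) (Fin 4) ℝ := LinearMap.toMatrix b b (coordChange x₀ x₁ x).toLinearMap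
  have hP : ∀ k i, P k i = coordDiff x₁ x (partialField x₀ i x) k := by
    intro k i
    refine (LinearMap.toMatrix_apply b b _ k i).trans ?_
    simp [b, coordChange, partialField, coordField]
  have e : gramMatrix g x₀ x = P.transpose * gramMatrix g x₁ x * P := by
    ext i j
    simp only [Matrix.mul_apply, Matrix.transpose_apply, hP, gramMatrix, Matrix.of_apply]
    conv_lhs => rw [← sum_partialField h₁ (partialField x₀ i x),
      ← sum_partialField h₁ (partialField x₀ j x)]
    simp only [map_sum, sum_apply, map_smul, smul_apply, smul_eq_mul, Finset.sum_mul,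
      Finset.mul_sum]
    refine Finset.sum_congr rfl fun k _ ↦ Finset.sum_congr rfl fun l _ ↦ ?_
    ring
  have hdet : (coordChange x₀ x₁ x).det = P.det := (LinearMap.det_toMatrix b _).symm
  rw [e, Matrix.det_mul, Matrix.det_mul, Matrix.det_transpose, hdet]
  ring

lemma hasFDerivAt_coordChange {x₁ : M} (h₀ : x ∈ (chartAt E4 x₀).source)
    (h₁ : x ∈ (chartAt E4 x₁).source) :
    HasFDerivAt (fun y ↦ extChartAt (𝓡 4) x₁ ((extChartAt (𝓡 4) x₀).symm y))
      (coordChange x₀ x₁ x) (extChartAt (𝓡 4) x₀ x) := by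
  have hy : extChartAt (𝓡 4) x₀ x ∈ (extChartAt (𝓡 4) x₀).target :=
    (extChartAt (𝓡 4) x₀).map_source (by rwa [extChartAt_source])
  have hz := chart_left_inv h₀
  have d1 : MDifferentiableAt 𝓘(ℝ, E4) (𝓡 4) (extChartAt (𝓡 4) x₀).symm
      (extChartAt (𝓡 4) x₀ x) := by
    have := mdifferentiableWithinAt_extChartAt_symm (I := 𝓡 4) hy
    rwa [ModelWithCorners.range_eq_univ, mdifferentiableWithinAt_univ] at this
  have d2 : MDifferentiableAt (𝓡 4) 𝓘(ℝ, E4) (extChartAt (𝓡 4) x₁)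
      ((extChartAt (𝓡 4) x₀).symm (extChartAt (𝓡 4) x₀ x)) :=
    mdifferentiableAt_extChartAt (by rwa [hz])
  have h := (d2.hasMFDerivAt.comp _ d1.hasMFDerivAt).hasFDerivAt
  refine h.congr_fderiv ?_
  ext1 v
  have e : ∀ (z : M) (_ : z = x) (u : E4),
      (mfderiv (𝓡 4) 𝓘(ℝ, E4) (extChartAt (𝓡 4) x₁) z : E4 →L[ℝ] E4) u
        = (mfderiv (𝓡 4) 𝓘(ℝ, E4) (extChartAt (𝓡 4) x₁) x : E4 →L[ℝ] E4) u := by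
    rintro z rfl u; rfl
  refine (e _ hz _).trans ?_
  exact congrArg (fun u : E4 ↦ (mfderiv (𝓡 4) 𝓘(ℝ, E4) (extChartAt (𝓡 4) x₁) x : E4 →L[ℝ] E4) u)
    (coordField_eq h₀ v).symm

variable [MeasurableSpace M] [BorelSpace M]

lemma image_chart_eq (hS' : S ⊆ (chartAt E4 x₀).source) : extChartAt (𝓡 4) x₀ '' S
    = (extChartAt (𝓡 4) x₀).symm ⁻¹' S ∩ (extChartAt (𝓡 4) x₀).target := by
  rw [(extChartAt (𝓡 4) x₀).image_eq_target_inter_inv_preimage (by rwa [extChartAt_source]),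
    Set.inter_comm]

lemma measurableSet_image_chart (hS : MeasurableSet S) (hS' : S ⊆ (chartAt E4 x₀).source) :
    MeasurableSet (extChartAt (𝓡 4) x₀ '' S) := by
  rw [image_chart_eq hS', Set.inter_comm, ← Subtype.image_preimage_coe]
  refine measurableSet_target.subtype_image ?_
  exact (continuousOn_iff_continuous_domRestrict.1 (continuousOn_extChartAt_symm x₀)).measurable hS

variable (g x₀) in
/-- The volume measure of the domain of the chart at `x₀`. -/
def chartMeasure : Measure M :=
  ((volume.restrict (extChartAt (𝓡 4) x₀).target).withDensity fun y ↦
    ENNReal.ofReal (Real.sqrt |g.gramDet x₀ y|)).map (extChartAt (𝓡 4) x₀).symm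

lemma aemeasurable_chart_symm : AEMeasurable (extChartAt (𝓡 4) x₀).symm
    ((volume.restrict (extChartAt (𝓡 4) x₀).target).withDensity fun y ↦
    ENNReal.ofReal (Real.sqrt |g.gramDet x₀ y|)) :=
  ((continuousOn_extChartAt_symm x₀).aemeasurable measurableSet_target).mono_ac
    (withDensity_absolutelyContinuous _ _)

lemma chartMeasure_apply (hS : MeasurableSet S) (hS' : S ⊆ (chartAt E4 x₀).source) :
    chartMeasure g x₀ S
      = ∫⁻ y in extChartAt (𝓡 4) x₀ '' S, ENNReal.ofReal (Real.sqrt |g.gramDet x₀ y|) := by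
  rw [chartMeasure, Measure.map_apply_of_aemeasurable aemeasurable_chart_symm hS,
    withDensity_apply', Measure.restrict_restrict' measurableSet_target, ← image_chart_eq hS']

/-- The volume measures of two charts agree on the intersection of their domains. -/
lemma chartMeasure_congr {x₁ : M} (hS : MeasurableSet S) (h₀ : S ⊆ (chartAt E4 x₀).source)
    (h₁ : S ⊆ (chartAt E4 x₁).source) : chartMeasure g x₁ S = chartMeasure g x₀ S := by
  rw [chartMeasure_apply hS h₀, chartMeasure_apply hS h₁]
  set T : E4 → E4 := fun y ↦ extChartAt (𝓡 4) x₁ ((extChartAt (𝓡 4) x₀).symm y)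
  have e : extChartAt (𝓡 4) x₁ '' S = T '' (extChartAt (𝓡 4) x₀ '' S) := by
    rw [Set.image_image]
    exact Set.image_congr fun x hx ↦ by simp only [T]; rw [chart_left_inv (h₀ hx)]
  have hm := measurableSet_image_chart hS h₀
  rw [e, lintegral_image_eq_lintegral_abs_det_fderiv_mul volume hm
    (f' := fun y ↦ coordChange x₀ x₁ ((extChartAt (𝓡 4) x₀).symm y))]
  · refine setLIntegral_congr_fun hm ?_
    rintro _ ⟨x, hx, rfl⟩
    simp only [T]
    rw [chart_left_inv (h₀ hx), gramDet_extChartAt g (h₀ hx), gramDet_extChartAt g (h₁ hx),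
      det_gramMatrix_eq (x₀ := x₀) (h₁ hx), ← ENNReal.ofReal_mul (abs_nonneg _), abs_mul, abs_pow,
      Real.sqrt_mul (sq_nonneg _), Real.sqrt_sq (abs_nonneg _)]
  · rintro _ ⟨x, hx, rfl⟩
    rw [chart_left_inv (h₀ hx)]
    exact (hasFDerivAt_coordChange (h₀ hx) (h₁ hx)).hasFDerivWithinAt
  · rintro _ ⟨x, hx, rfl⟩ _ ⟨z, hz, rfl⟩ h
    simp only [T] at h
    rw [chart_left_inv (h₀ hx), chart_left_inv (h₀ hz)] at h
    rw [← chart_left_inv (h₁ hx), h, chart_left_inv (h₁ hz)]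

variable (g) in
/-- Countably many charts cover the manifold, and the volume measure is the sum of the chart
measures restricted to disjoint pieces. -/
lemma exists_isVolumeMeasure [SigmaCompactSpace M] : ∃ μ : Measure M, g.IsVolumeMeasure μ := by
  have : SecondCountableTopology M := ChartedSpace.secondCountable_of_sigmaCompact E4 M
  rcases isEmpty_or_nonempty M with hM | hM
  · exact ⟨0, fun x₀ ↦ isEmptyElim x₀⟩
  obtain ⟨t, ht, hcov⟩ := TopologicalSpace.countable_cover_nhds
    fun x : M ↦ (chartAt E4 x).open_source.mem_nhds (mem_chart_source E4 x)
  have tne : t.Nonempty := by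
    obtain ⟨x⟩ := hM
    have : x ∈ ⋃ y ∈ t, (chartAt E4 y).source := hcov ▸ Set.mem_univ x
    simp only [Set.mem_iUnion] at this
    exact ⟨_, this.choose_spec.choose⟩
  obtain ⟨c, rfl⟩ := ht.exists_eq_range tne
  set A := disjointed fun n ↦ (chartAt E4 (c n)).source
  have mA : ∀ n, MeasurableSet (A n) :=
    MeasurableSet.disjointed fun n ↦ (chartAt E4 (c n)).open_source.measurableSet
  have dA : Pairwise (Function.onFun Disjoint A) := disjoint_disjointed _
  have uA : ⋃ n, A n = Set.univ := by
    rw [iUnion_disjointed, ← hcov]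
    simp
  have sA : ∀ n, A n ⊆ (chartAt E4 (c n)).source := disjointed_le _
  refine ⟨Measure.sum fun n ↦ (chartMeasure g (c n)).restrict (A n), fun x₀ S hS hS' ↦ ?_⟩
  rw [← chartMeasure_apply hS hS', Measure.sum_apply _ hS]
  have e : S = ⋃ n, S ∩ A n := by rw [← Set.inter_iUnion, uA, Set.inter_univ]
  conv_rhs => rw [e]
  rw [measure_iUnion (fun i j hij ↦ (dA hij).mono Set.inter_subset_right Set.inter_subset_right)
    fun n ↦ hS.inter (mA n)]
  refine tsum_congr fun n ↦ ?_
  rw [Measure.restrict_apply hS]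
  exact chartMeasure_congr (hS.inter (mA n)) (Set.inter_subset_left.trans hS')
    (Set.inter_subset_right.trans (sA n))

variable (g) in
/-- The volume measure, a choice by Hilbert's epsilon, has the property that it is chosen for. -/
lemma isVolumeMeasure_volumeMeasure [SigmaCompactSpace M] : g.IsVolumeMeasure g.volumeMeasure :=
  Classical.epsilon_spec (exists_isVolumeMeasure g)

variable {μ : Measure M}

lemma restrict_eq_chartMeasure (hμ : g.IsVolumeMeasure μ) (x₀ : M) :
    μ.restrict (chartAt E4 x₀).source = chartMeasure g x₀ := by
  have ms := (chartAt E4 x₀).open_source.measurableSet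
  have h0 : chartMeasure g x₀ (chartAt E4 x₀).sourceᶜ = 0 := by
    rw [chartMeasure, Measure.map_apply_of_aemeasurable aemeasurable_chart_symm ms.compl,
      withDensity_apply', Measure.restrict_restrict' measurableSet_target]
    have : (extChartAt (𝓡 4) x₀).symm ⁻¹' (chartAt E4 x₀).sourceᶜ ∩ (extChartAt (𝓡 4) x₀).target
        = ∅ := Set.eq_empty_of_forall_notMem fun y hy ↦ hy.1 (chart_map_target hy.2)
    rw [this, Measure.restrict_empty, lintegral_zero_measure]
  have h1 : (chartMeasure g x₀).restrict (chartAt E4 x₀).source = chartMeasure g x₀ :=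
    Measure.restrict_eq_self_of_ae_mem (by rwa [ae_iff])
  rw [← h1]
  ext S hS
  rw [Measure.restrict_apply hS, Measure.restrict_apply hS,
    hμ x₀ _ (hS.inter ms) Set.inter_subset_right,
    chartMeasure_apply (hS.inter ms) Set.inter_subset_right]

/-- The integral of a function supported in the domain of a chart. -/
lemma integral_eq_setIntegral_chart (hμ : g.IsVolumeMeasure μ) {F : M → ℂ} (hF : Continuous F)
    (h0 : ∀ x ∉ (chartAt E4 x₀).source, F x = 0) :
    ∫ x, F x ∂μ = ∫ y in (extChartAt (𝓡 4) x₀).target,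
      (density g x₀ ((extChartAt (𝓡 4) x₀).symm y) : ℂ) * F ((extChartAt (𝓡 4) x₀).symm y) := by
  rw [← setIntegral_eq_integral_of_forall_compl_eq_zero h0, restrict_eq_chartMeasure hμ,
    chartMeasure, integral_map aemeasurable_chart_symm hF.aestronglyMeasurable,
    integral_withDensity_eq_integral_toReal_smul₀]
  · refine setIntegral_congr_fun measurableSet_target fun y hy ↦ ?_
    simp only [sqrt_gramDet_eq hy, Complex.real_smul]
    rw [ENNReal.toReal_ofReal (density_pos g (chart_map_target hy)).le]
  · exact ((continuousOn_sqrt_gramDet.aemeasurable measurableSet_target)).ennreal_ofReal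
  · exact Filter.Eventually.of_forall fun _ ↦ ENNReal.ofReal_lt_top

/-- The volume measure is locally finite, as the density is bounded on a small coordinate ball. -/
lemma isLocallyFiniteMeasure (hμ : g.IsVolumeMeasure μ) : IsLocallyFiniteMeasure μ := by
  refine ⟨fun x ↦ ?_⟩
  have hy : extChartAt (𝓡 4) x x ∈ (extChartAt (𝓡 4) x).target := mem_extChartAt_target x
  have ho := (isOpen_extChartAt_target (I := 𝓡 4) x).mem_nhds hy
  have hc := (continuousOn_sqrt_gramDet (g := g) (x₀ := x)).continuousAt ho
  set D := fun y ↦ Real.sqrt |g.gramDet x y|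
  have hb : ∀ᶠ y in 𝓝 (extChartAt (𝓡 4) x x), D y < D (extChartAt (𝓡 4) x x) + 1 :=
    hc.eventually_lt_const (lt_add_one _)
  obtain ⟨r, hr, hball⟩ := Metric.mem_nhds_iff.1 hb
  set B := Metric.ball (extChartAt (𝓡 4) x x) r
  have hS : (extChartAt (𝓡 4) x).source ∩ extChartAt (𝓡 4) x ⁻¹' B ∈ 𝓝 x :=
    (isOpen_extChartAt_preimage' (I := 𝓡 4) x Metric.isOpen_ball).mem_nhds
      ⟨mem_extChartAt_source x, Metric.mem_ball_self hr⟩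
  have hm : MeasurableSet ((extChartAt (𝓡 4) x).source ∩ extChartAt (𝓡 4) x ⁻¹' B) :=
    (isOpen_extChartAt_preimage' (I := 𝓡 4) x Metric.isOpen_ball).measurableSet
  refine ⟨_, hS, ?_⟩
  have hsub : (extChartAt (𝓡 4) x).source ∩ extChartAt (𝓡 4) x ⁻¹' B ⊆ (chartAt E4 x).source := by
    rw [← extChartAt_source (𝓡 4)]; exact Set.inter_subset_left
  rw [hμ x _ hm hsub]
  calc _ ≤ ∫⁻ y in B, ENNReal.ofReal (D y) := lintegral_mono_set (by
          rintro _ ⟨z, hz, rfl⟩; exact hz.2)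
    _ ≤ ∫⁻ y in B, ENNReal.ofReal (D (extChartAt (𝓡 4) x x) + 1) :=
        setLIntegral_mono' Metric.isOpen_ball.measurableSet fun y hy ↦
          ENNReal.ofReal_le_ofReal (le_of_lt (hball hy))
    _ < ⊤ := by
        rw [setLIntegral_const]
        exact ENNReal.mul_lt_top ENNReal.ofReal_lt_top Metric.isBounded_ball.measure_lt_top

end Measure

/-! ### The divergence theorem -/

section DivergenceTheorem

variable {𝔐 : Background M} {x₀ x : M}

/-- The integral of a partial derivative of a function with compact support vanishes. -/
lemma integral_fderiv_eq_zero {w : E4 → ℂ} (hw : ContDiff ℝ 1 w) (hc : HasCompactSupport w)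
    (v : E4) : ∫ y, fderiv ℝ w y v = 0 := by
  have h1 : Continuous fun y ↦ fderiv ℝ w y v :=
    (hw.continuous_fderiv one_ne_zero).clm_apply continuous_const
  have h2 : HasCompactSupport fun y ↦ fderiv ℝ w y v := hc.fderiv_apply ℝ v
  have key := integral_mul_fderiv_eq_neg_fderiv_mul_of_integrable (μ := volume) (𝕜 := ℂ)
    (f := fun _ : E4 ↦ (1 : ℂ)) (g := w) (v := v) (by simp)
    (by simpa using h1.integrable_of_hasCompactSupport h2)
    (by simpa using hw.continuous.integrable_of_hasCompactSupport hc)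
    (fun _ _ ↦ differentiableAt_const _) (fun y _ ↦ hw.differentiable one_ne_zero y)
  simpa using key

/-- Derivatives along coordinate fields are derivatives in the chart. -/
lemma cderiv_coordField (hx : x ∈ (chartAt E4 x₀).source) {u : M → ℂ} (hu : DiF u x) (v : E4) :
    cderiv (fun y ↦ ofReal (coordField x₀ v y)) u x
      = fderiv ℝ (fun y ↦ u ((extChartAt (𝓡 4) x₀).symm y)) (extChartAt (𝓡 4) x₀ x) v := by
  have hy : extChartAt (𝓡 4) x₀ x ∈ (extChartAt (𝓡 4) x₀).target :=
    (extChartAt (𝓡 4) x₀).map_source (by rwa [extChartAt_source])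
  have hz := chart_left_inv hx
  have d1 : MDifferentiableAt 𝓘(ℝ, E4) (𝓡 4) (extChartAt (𝓡 4) x₀).symm
      (extChartAt (𝓡 4) x₀ x) := by
    have := mdifferentiableWithinAt_extChartAt_symm (I := 𝓡 4) hy
    rwa [ModelWithCorners.range_eq_univ, mdifferentiableWithinAt_univ] at this
  have d2 : DiF u ((extChartAt (𝓡 4) x₀).symm (extChartAt (𝓡 4) x₀ x)) := by rwa [hz]
  let L : E4 →L[ℝ] ℂ := (mfderiv (𝓡 4) 𝓘(ℝ, ℂ) u
    ((extChartAt (𝓡 4) x₀).symm (extChartAt (𝓡 4) x₀ x)) : E4 →L[ℝ] ℂ).comp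
      (mfderiv 𝓘(ℝ, E4) (𝓡 4) (extChartAt (𝓡 4) x₀).symm (extChartAt (𝓡 4) x₀ x) : E4 →L[ℝ] E4)
  have h0 : HasFDerivAt (𝕜 := ℝ) (E := E4) (F := ℂ) (fun y : E4 ↦ u ((extChartAt (𝓡 4) x₀).symm y))
      L (extChartAt (𝓡 4) x₀ x) :=
    (d2.hasMFDerivAt.comp _ d1.hasMFDerivAt).hasFDerivAt
  have h : fderiv ℝ (fun y : E4 ↦ u ((extChartAt (𝓡 4) x₀).symm y)) (extChartAt (𝓡 4) x₀ x) = L :=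
    HasFDerivAt.fderiv (𝕜 := ℝ) (E := E4) (F := ℂ) h0
  have e : ∀ (z : M) (_ : z = x) (v : E4),
      (mfderiv (𝓡 4) 𝓘(ℝ, ℂ) u z : E4 →L[ℝ] ℂ) v = (mfderiv (𝓡 4) 𝓘(ℝ, ℂ) u x : E4 →L[ℝ] ℂ) v := by
    rintro z rfl v; rfl
  have h2 : cderiv (fun y ↦ ofReal (coordField x₀ v y)) u x
      = (mfderiv (𝓡 4) 𝓘(ℝ, ℂ) u x : E4 →L[ℝ] ℂ) (coordField x₀ v x) := by
    simp only [cderiv, ofReal, map_zero, mul_zero, add_zero]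
    rfl
  rw [h2]
  refine Eq.trans ?_ (congrArg (fun L : E4 →L[ℝ] ℂ ↦ L v) h.symm)
  refine Eq.trans ?_ (e _ hz _).symm
  exact congrArg (fun w : E4 ↦ (mfderiv (𝓡 4) 𝓘(ℝ, ℂ) u x : E4 →L[ℝ] ℂ) w) (coordField_eq hx v)

variable [T2Space M] [MeasurableSpace M] [BorelSpace M] {μ : Measure M}

/-- The divergence theorem for a vector field with compact support in the domain of a chart. -/
lemma integral_frameDiv_eq_zero (hμ : 𝔐.g.IsVolumeMeasure μ) {A : TetradField 𝔐} {U C : Set M}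
    (hA : ∀ x ∈ U, A.SmoothNear x) (hUs : U ⊆ (chartAt E4 x₀).source)
    (hC : IsCompact C) (hCU : C ⊆ U) {J : CVField M} (hJ : ∀ x ∈ U, J.SmAt x)
    (hJ0 : ∀ x ∉ C, J x = 0) {F : M → ℂ} (hFc : Continuous F)
    (hF : ∀ x ∈ U, F x = frameDiv 𝔐 A.L A.N A.Mv A.Mbar J x) (hF0 : ∀ x ∉ U, F x = 0) :
    ∫ x, F x ∂μ = 0 := by
  classical
  set φ := extChartAt (𝓡 4) x₀
  -- `u i` is the `i`-th component of the current times the density, as a function on the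
  -- manifold, and `w i` is the same function in the chart, extended by zero
  let u (i : Fin 4) : M → ℂ := fun y ↦
    (density 𝔐.g x₀ y : ℂ) * cderiv J (fun z ↦ (coordFun x₀ i z : ℂ)) y
  let w (i : Fin 4) : E4 → ℂ := φ.target.indicator fun y ↦ u i (φ.symm y)
  have su : ∀ i, ∀ x ∈ U, SmF (u i) x := fun i x hx ↦
    (smF_ofReal (smF_density 𝔐.g (hUs hx))).cmul
      ((smF_ofReal (smF_coordFun (hUs hx) i)).cderiv (hJ x hx))
  have u0 : ∀ i, ∀ x ∉ C, u i x = 0 := by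
    intro i x hx
    simp [u, cderiv, hJ0 x hx]
  have hC' : IsCompact (φ '' C) := hC.image_of_continuousOn
    ((continuousOn_extChartAt x₀).mono (by rw [extChartAt_source]; exact hCU.trans hUs))
  have w0 : ∀ i, ∀ y ∉ φ '' C, w i y = 0 := by
    intro i y hy
    by_cases hyt : y ∈ φ.target
    · exact (Set.indicator_of_mem hyt _).trans (u0 i _ fun h ↦ hy ⟨_, h, φ.right_inv hyt⟩)
    · exact Set.indicator_of_notMem hyt _
  have w0' : ∀ i, ∀ y ∉ φ '' C, w i =ᶠ[𝓝 y] fun _ ↦ 0 := by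
    intro i y hy
    filter_upwards [hC'.isClosed.isOpen_compl.mem_nhds hy] with z hz using w0 i z hz
  have wu : ∀ i, ∀ y ∈ φ.target, w i =ᶠ[𝓝 y] fun y ↦ u i (φ.symm y) := by
    intro i y hy
    filter_upwards [(isOpen_extChartAt_target x₀).mem_nhds hy] with z hz
    exact Set.indicator_of_mem hz _
  have inU : ∀ y ∈ φ '' C, y ∈ φ.target ∧ φ.symm y ∈ U := by
    rintro _ ⟨x, hx, rfl⟩
    have hs : x ∈ φ.source := by rw [extChartAt_source]; exact hUs (hCU hx)
    exact ⟨φ.map_source hs, by rw [φ.left_inv hs]; exact hCU hx⟩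
  have sw : ∀ i, ContDiff ℝ 1 (w i) := by
    intro i
    rw [contDiff_iff_contDiffAt]
    intro y
    rcases em (y ∈ φ '' C) with hy | hy
    · obtain ⟨ht, hyU⟩ := inU y hy
      have h1 : ContMDiffAt 𝓘(ℝ, E4) (𝓡 4) ∞ φ.symm y :=
        (contMDiffOn_extChartAt_symm x₀).contMDiffAt ((isOpen_extChartAt_target x₀).mem_nhds ht)
      have h2 := (ContMDiffAt.comp y (su i _ hyU) h1).contDiffAt
      exact (h2.of_le (by simp)).congr_of_eventuallyEq (wu i y ht)
    · exact contDiffAt_const.congr_of_eventuallyEq (w0' i y hy)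
  have cw : ∀ i, HasCompactSupport (w i) := fun i ↦ HasCompactSupport.intro hC' (w0 i)
  have key : ∀ y, φ.target.indicator (fun y ↦ (density 𝔐.g x₀ (φ.symm y) : ℂ) * F (φ.symm y)) y
      = ∑ i, fderiv ℝ (w i) y (EuclideanSpace.single i 1) := by
    intro y
    by_cases ht : y ∈ φ.target
    · rw [Set.indicator_of_mem ht]
      by_cases hyU : φ.symm y ∈ U
      · rw [hF _ hyU, density_mul_frameDiv (hA _ hyU) (hUs hyU) (hJ _ hyU)]
        refine Finset.sum_congr rfl fun i _ ↦ ?_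
        have := cderiv_coordField (hUs hyU) (su i _ hyU).diF (EuclideanSpace.single i 1)
        rw [show extChartAt (𝓡 4) x₀ (φ.symm y) = y from φ.right_inv ht,
          ← (wu i y ht).fderiv_eq] at this
        exact this
      · have hy : y ∉ φ '' C := fun h ↦ hyU (inU y h).2
        rw [hF0 _ hyU, mul_zero]
        refine (Finset.sum_eq_zero fun i _ ↦ ?_).symm
        rw [(w0' i y hy).fderiv_eq]
        simp
    · have hy : y ∉ φ '' C := fun h ↦ ht (inU y h).1
      rw [Set.indicator_of_notMem ht]
      refine (Finset.sum_eq_zero fun i _ ↦ ?_).symm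
      rw [(w0' i y hy).fderiv_eq]
      simp
  rw [integral_eq_setIntegral_chart hμ hFc fun x hx ↦ hF0 x fun h ↦ hx (hUs h),
    ← integral_indicator measurableSet_target]
  refine (integral_congr_ae (Filter.Eventually.of_forall key)).trans ?_
  rw [integral_finsetSum]
  · exact Finset.sum_eq_zero fun i _ ↦ integral_fderiv_eq_zero (sw i) (cw i) _
  · intro i _
    exact (((sw i).continuous_fderiv one_ne_zero).clm_apply
      continuous_const).integrable_of_hasCompactSupport ((cw i).fderiv_apply ℝ _)

end DivergenceTheorem

/-! ### Linearity and locality of the Teukolsky operators -/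

section Adjoint

variable {𝔐 : Background M} {x : M} {s w : ℤ} {f f' h : SWF 𝔐}

/-- Expressions in a local tetrad only depend on their values for fields that are smooth near the
point. -/
lemma inLocalTetrad_congr {a : NullTetrad 𝔐 x} {Φ Φ' : TetradField 𝔐 → ℂ}
    (e : ∀ A : TetradField 𝔐, A.SmoothNear x → Φ A = Φ' A) :
    inLocalTetrad a Φ = inLocalTetrad a Φ' := by
  unfold inLocalTetrad
  split_ifs with ha
  · exact e _ ha.choose_spec.1
  · rfl

lemma inLocalTetrad_add {a : NullTetrad 𝔐 x} {Φ Φ' : TetradField 𝔐 → ℂ} :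
    (inLocalTetrad a fun A ↦ Φ A + Φ' A) = inLocalTetrad a Φ + inLocalTetrad a Φ' := by
  unfold inLocalTetrad
  split_ifs <;> simp

lemma theta_add (hf : IsSection s w f) (hf' : IsSection s w f') {A : TetradField 𝔐}
    (hA : A.SmoothNear x) (X : CVField M) :
    A.theta s w X (f + f') x = A.theta s w X f x + A.theta s w X f' x := by
  have := cderiv_add (X := X) (SmF.diF (hf.2 A x hA)) (SmF.diF (hf'.2 A x hA))
  simp only [TetradField.theta, Pi.add_apply] at this ⊢
  rw [this]
  ring

lemma theta_congr (e : ∀ᶠ y in 𝓝 x, f y = f' y) (A : TetradField 𝔐) (X : CVField M) :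
    A.theta s w X f x = A.theta s w X f' x := by
  have h1 : (fun y ↦ f y (A y)) =ᶠ[𝓝 x] fun y ↦ f' y (A y) := by
    filter_upwards [e] with y hy using by rw [hy]
  rw [TetradField.theta, TetradField.theta, cderiv_congr h1, e.self_of_nhds]

lemma IsSection.add (hf : IsSection s w f) (hh : IsSection s w h) : IsSection s w (f + h) :=
  ⟨fun x ↦ (spinFibre 𝔐 s w x).add_mem (hf.1 x) (hh.1 x),
    fun A x hA ↦ SmF.cadd (hf.2 A x hA) (hh.2 A x hA)⟩

lemma isSection_zero : IsSection s w (0 : SWF 𝔐) :=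
  ⟨fun x ↦ (spinFibre 𝔐 s w x).zero_mem, fun _ _ _ ↦ smF_const 0⟩

/-- Sections can be localized by a cut-off function. -/
lemma IsSection.smul_smooth (hf : IsSection s w f) {χ : M → ℝ} (hχ : ∀ x, SmF χ x) :
    IsSection s w fun x ↦ (χ x : ℂ) • f x :=
  ⟨fun x ↦ (spinFibre 𝔐 s w x).smul_mem _ (hf.1 x),
    fun A x hA ↦ (smF_ofReal (hχ x)).cmul (hf.2 A x hA)⟩

lemma teukolsky_add (hf : IsSection s s f) (hf' : IsSection s s f') :
    teukolsky s (f + f') = teukolsky s f + teukolsky s f' := by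
  have key : ∀ {s w : ℤ} {f f' : SWF 𝔐} (_ : IsSection s w f) (_ : IsSection s w f')
      (X : TetradField 𝔐 → CVField M),
      (fun (x : M) (a : NullTetrad 𝔐 x) ↦ inLocalTetrad a fun A ↦ A.theta s w (X A) (f + f') x)
        = (fun (x : M) (a : NullTetrad 𝔐 x) ↦ inLocalTetrad a fun A ↦ A.theta s w (X A) f x)
          + fun (x : M) (a : NullTetrad 𝔐 x) ↦ inLocalTetrad a fun A ↦ A.theta s w (X A) f' x :=
    fun hf hf' X ↦ funext fun x ↦ funext fun a ↦
      (inLocalTetrad_congr fun A hA ↦ theta_add hf hf' hA (X A)).trans inLocalTetrad_add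
  obtain ⟨su, sv, -⟩ := teukolsky_factor_spec hf
  obtain ⟨su', sv', -⟩ := teukolsky_factor_spec hf'
  have eu : thoP s s (f + f') - rhoP 𝔐 * (f + f')
      = (thoP s s f - rhoP 𝔐 * f) + (thoP s s f' - rhoP 𝔐 * f') := by
    rw [show thoP s s (f + f') = thoP s s f + thoP s s f' from key hf hf' fun A ↦ A.N]
    ring
  have ev : edtP s s (f + f') - tauP 𝔐 * (f + f')
      = (edtP s s f - tauP 𝔐 * f) + (edtP s s f' - tauP 𝔐 * f') := by
    rw [show edtP s s (f + f') = edtP s s f + edtP s s f' from key hf hf' fun A ↦ A.Mbar]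
    ring
  have e1 : tho s (s - 1) ((thoP s s f - rhoP 𝔐 * f) + (thoP s s f' - rhoP 𝔐 * f'))
      = tho s (s - 1) (thoP s s f - rhoP 𝔐 * f) + tho s (s - 1) (thoP s s f' - rhoP 𝔐 * f') :=
    key su su' fun A ↦ A.L
  have e2 : edt (s - 1) s ((edtP s s f - tauP 𝔐 * f) + (edtP s s f' - tauP 𝔐 * f'))
      = edt (s - 1) s (edtP s s f - tauP 𝔐 * f) + edt (s - 1) s (edtP s s f' - tauP 𝔐 * f') :=
    key sv sv' fun A ↦ A.Mv
  unfold teukolsky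
  simp only [eu, ev, e1, e2]
  funext x a
  simp only [Pi.add_apply, Pi.sub_apply, Pi.smul_apply, Pi.mul_apply, smul_eq_mul]
  ring

/-- The Teukolsky operator is local. -/
lemma teukolsky_congr (e : ∀ᶠ y in 𝓝 x, f y = f' y) : teukolsky s f x = teukolsky s f' x := by
  have key : ∀ {s w : ℤ} {f f' : SWF 𝔐} {x : M} (_ : ∀ᶠ y in 𝓝 x, f y = f' y)
      (X : TetradField 𝔐 → CVField M),
      (fun (a : NullTetrad 𝔐 x) ↦ inLocalTetrad a fun A ↦ A.theta s w (X A) f x)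
        = fun (a : NullTetrad 𝔐 x) ↦ inLocalTetrad a fun A ↦ A.theta s w (X A) f' x :=
    fun e X ↦ funext fun a ↦ inLocalTetrad_congr fun A _ ↦ theta_congr e A (X A)
  have eu : ∀ᶠ y in 𝓝 x, (thoP s s f - rhoP 𝔐 * f) y = (thoP s s f' - rhoP 𝔐 * f') y := by
    filter_upwards [e.eventually_nhds] with y hy
    rw [Pi.sub_apply, Pi.sub_apply, Pi.mul_apply, Pi.mul_apply, hy.self_of_nhds,
      show thoP s s f y = thoP s s f' y from key hy fun A ↦ A.N]
  have ev : ∀ᶠ y in 𝓝 x, (edtP s s f - tauP 𝔐 * f) y = (edtP s s f' - tauP 𝔐 * f') y := by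
    filter_upwards [e.eventually_nhds] with y hy
    rw [Pi.sub_apply, Pi.sub_apply, Pi.mul_apply, Pi.mul_apply, hy.self_of_nhds,
      show edtP s s f y = edtP s s f' y from key hy fun A ↦ A.Mbar]
  have e1 : tho s (s - 1) (thoP s s f - rhoP 𝔐 * f) x =
      tho s (s - 1) (thoP s s f' - rhoP 𝔐 * f') x :=
    key eu fun A ↦ A.L
  have e2 : edt (s - 1) s (edtP s s f - tauP 𝔐 * f) x =
      edt (s - 1) s (edtP s s f' - tauP 𝔐 * f') x :=
    key ev fun A ↦ A.Mv
  have e3 : thoP s s f x = thoP s s f' x := key e fun A ↦ A.N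
  have e4 : edtP s s f x = edtP s s f' x := key e fun A ↦ A.Mbar
  simp only [teukolsky, Pi.sub_apply, Pi.smul_apply, Pi.mul_apply, e1, e2, e3, e4, e.self_of_nhds]

lemma teukolsky_zero : teukolsky s (0 : SWF 𝔐) = 0 := by
  have := teukolsky_add (s := s) (isSection_zero (𝔐 := 𝔐)) isSection_zero
  rwa [add_zero, left_eq_add] at this

lemma eventually_eq_zero_of_notMem_supp (hx : x ∉ supp f) : ∀ᶠ y in 𝓝 x, f y = 0 := by
  filter_upwards [isClosed_closure.isOpen_compl.mem_nhds hx] with y hy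
  by_contra hne
  exact hy (subset_closure hne)

lemma teukolsky_eq_zero (e : ∀ᶠ y in 𝓝 x, f y = 0) : teukolsky s f x = 0 := by
  rw [teukolsky_congr (f' := 0) e, teukolsky_zero]
  rfl

/-! ### The Teukolsky operators with opposite spins are formally adjoint -/

lemma dualEval_comm {c d : NullTetrad 𝔐 x → ℂ} : dualEval d c = dualEval c d := by
  unfold dualEval
  split_ifs
  · exact mul_comm _ _
  · rfl

lemma dualEval_add_left {c d d' : NullTetrad 𝔐 x → ℂ} :
    dualEval (d + d') c = dualEval d c + dualEval d' c := by
  unfold dualEval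
  split_ifs
  · exact add_mul _ _ _
  · simp

lemma dualEval_zero_left {c : NullTetrad 𝔐 x → ℂ} : dualEval 0 c = 0 := by
  unfold dualEval
  split_ifs <;> simp

lemma dualEval_conjFib_conjFib {c d : NullTetrad 𝔐 x → ℂ} :
    dualEval (conjFib d) (conjFib c) = star (dualEval d c) := by
  unfold dualEval
  split_ifs
  · exact (star_mul' _ _).symm
  · simp

lemma smF_dualEval (hf : IsSection s w f) (hh : IsSection (-s) (-w) h) (x : M) :
    SmF (fun y ↦ dualEval (f y) (h y)) x := by
  obtain ⟨A, hA⟩ := exists_smoothNear 𝔐 x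
  exact (SmF.cmul (hf.2 A x hA) (hh.2 A x hA)).congr_of_eventuallyEq
    (Filter.Eventually.of_forall fun y ↦ dualEval_eq (hf.1 y) (hh.1 y) (A y))

/-- The failure of `T_s` and `T_{-s}` to be pointwise adjoint. -/
def greenDensity (s : ℤ) (f h : SWF 𝔐) (x : M) : ℂ :=
  dualEval (f x) (teukolsky s h x) - dualEval (h x) (teukolsky (-s) f x)

lemma continuous_greenDensity (hf : IsSection (-s) (-s) f) (hh : IsSection s s h) :
    Continuous (greenDensity s f h) := by
  refine continuous_iff_continuousAt.2 fun x ↦ ?_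
  exact (SmF.csub (smF_dualEval hf (teukolsky_spec hh).1.cast x)
    (smF_dualEval hh (teukolsky_spec hf).1 x)).continuousAt

lemma greenDensity_eq_zero (e : ∀ᶠ y in 𝓝 x, f y = 0) : greenDensity s f h x = 0 := by
  rw [greenDensity, teukolsky_eq_zero e, e.self_of_nhds, dualEval_comm (d := h x),
    dualEval_zero_left, dualEval_zero_left, sub_zero]

lemma greenDensity_eq_zero' (e : ∀ᶠ y in 𝓝 x, h y = 0) : greenDensity s f h x = 0 := by
  rw [greenDensity, teukolsky_eq_zero e, e.self_of_nhds, dualEval_comm (d := f x),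
    dualEval_zero_left, dualEval_zero_left, sub_zero]

lemma greenDensity_congr (e : ∀ᶠ y in 𝓝 x, f y = f' y) :
    greenDensity s f h x = greenDensity s f' h x := by
  rw [greenDensity, greenDensity, teukolsky_congr e, e.self_of_nhds]

lemma greenDensity_add (hf : IsSection (-s) (-s) f) (hf' : IsSection (-s) (-s) f') :
    greenDensity s (f + f') h x = greenDensity s f h x + greenDensity s f' h x := by
  rw [greenDensity, greenDensity, greenDensity, teukolsky_add hf hf', Pi.add_apply, Pi.add_apply,
    dualEval_add_left, dualEval_comm (d := h x), dualEval_add_left, dualEval_comm (d := h x),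
    dualEval_comm (d := h x)]
  ring

lemma greenDensity_sum {ι : Type*} (t : Finset ι) {φ : ι → SWF 𝔐}
    (hφ : ∀ i, IsSection (-s) (-s) (φ i)) (h : SWF 𝔐) (x : M) :
    greenDensity s (∑ i ∈ t, φ i) h x = ∑ i ∈ t, greenDensity s (φ i) h x := by
  classical
  have key : IsSection (-s) (-s) (∑ i ∈ t, φ i) ∧
      greenDensity s (∑ i ∈ t, φ i) h x = ∑ i ∈ t, greenDensity s (φ i) h x := by
    induction t using Finset.induction_on with
    | empty => exact ⟨by simpa using isSection_zero,
        greenDensity_eq_zero (Filter.Eventually.of_forall fun _ ↦ rfl)⟩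
    | insert i t hi ih =>
      rw [Finset.sum_insert hi, Finset.sum_insert hi, greenDensity_add (hφ i) ih.1, ih.2]
      exact ⟨(hφ i).add ih.1, rfl⟩
  exact key.2

/-- Green's identity. -/
lemma greenDensity_eq_frameDiv (hf : IsSection (-s) (-s) f) (hh : IsSection s s h)
    {A : TetradField 𝔐} (hA : A.SmoothNear x) :
    greenDensity s f h x = frameDiv 𝔐 A.L A.N A.Mv A.Mbar
      (current 𝔐 A.L A.N A.Mv A.Mbar s (fun y ↦ f y (A y)) (fun y ↦ h y (A y))) x := by
  obtain ⟨U, hx, fr⟩ := hA.frameField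
  rw [← fr.teukolsky_identity hx (A x).psi_ne_zero s (hf.2 A x hA) (hh.2 A x hA), greenDensity,
    dualEval_eq (hf.1 x) ((teukolsky_spec hh).1.cast.1 x) (A x),
    dualEval_eq (hh.1 x) ((teukolsky_spec hf).1.1 x) (A x), (teukolsky_spec hh).2 A x hA,
    (teukolsky_spec hf).2 A x hA]
  push_cast
  rfl

/-- The current vanishes where the first section vanishes locally. -/
lemma current_eq_zero {l n m k : CVField M} {c : ℂ} {u v : M → ℂ} (e : u =ᶠ[𝓝 x] fun _ ↦ 0) :
    current 𝔐 l n m k c u v x = 0 := by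
  have h1 : ∀ X : CVField M, cderiv X u x = 0 := fun X ↦ by rw [cderiv_congr e, cderiv_const]
  have h2 : u x = 0 := e.self_of_nhds
  have h3 : ∀ X : CTangent x, smulT 0 X = 0 := fun X ↦ by simp [smulT]
  simp only [current, frameY, frameZ, h1, h2, mul_zero, zero_mul, add_zero, h3]

end Adjoint

/-! ### Formal self-adjointness -/

section FormalAdjoint

variable {𝔐 : Background M} {s w : ℤ} {f h : SWF 𝔐} [T2Space M] [MeasurableSpace M] [BorelSpace M]
  {μ : Measure M}

/-- The integral of Green's identity, for a section with small support. -/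
lemma integral_greenDensity_of_subset_chart (hμ : 𝔐.g.IsVolumeMeasure μ)
    (hf : IsSection (-s) (-s) f) (hh : IsSection s s h) {A : TetradField 𝔐} {U C : Set M} {x₀ : M}
    (hA : ∀ x ∈ U, A.SmoothNear x) (hUs : U ⊆ (chartAt E4 x₀).source) (hC : IsCompact C)
    (hCU : C ⊆ U) (hfC : ∀ x ∉ C, f x = 0) : ∫ x, greenDensity s f h x ∂μ = 0 := by
  have h0 : ∀ x ∉ C, ∀ᶠ y in 𝓝 x, f y = 0 := fun x hx ↦ by
    filter_upwards [hC.isClosed.isOpen_compl.mem_nhds hx] with y hy using hfC y hy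
  refine integral_frameDiv_eq_zero hμ hA hUs hC hCU
    (J := current 𝔐 A.L A.N A.Mv A.Mbar s (fun y ↦ f y (A y)) (fun y ↦ h y (A y)))
    (fun x hx ↦ ?_) (fun x hx ↦ current_eq_zero ?_) (continuous_greenDensity hf hh)
    (fun x hx ↦ greenDensity_eq_frameDiv hf hh (hA x hx))
    (fun x hx ↦ greenDensity_eq_zero (h0 x fun hC ↦ hx (hCU hC)))
  · obtain ⟨V, hxV, fr⟩ := (hA x hx).frameField
    exact fr.smAt_current hxV s (hf.2 A x (hA x hx)) (hh.2 A x (hA x hx))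
  · filter_upwards [h0 x hx] with y hy
    rw [hy, Pi.zero_apply]

lemma integrable_of_forall_notMem_eq_zero (hμ : 𝔐.g.IsVolumeMeasure μ) {F : M → ℂ}
    (hF : Continuous F) {K : Set M} (hK : IsCompact K) (h0 : ∀ x ∉ K, F x = 0) :
    Integrable F μ := by
  have := isLocallyFiniteMeasure hμ
  exact hF.integrable_of_hasCompactSupport (HasCompactSupport.intro hK h0)

/-- The globalization of Green's identity by a partition of unity. -/
lemma integral_greenDensity [SigmaCompactSpace M] (hμ : 𝔐.g.IsVolumeMeasure μ)
    (hf : IsSection (-s) (-s) f) (hh : IsSection s s h) (hc : IsCompact (supp f ∩ supp h)) :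
    ∫ x, greenDensity s f h x ∂μ = 0 := by
  classical
  have : LocallyCompactSpace M := ChartedSpace.locallyCompactSpace E4 M
  have hloc : ∀ x : M, ∃ (A : TetradField 𝔐) (V C : Set M), (∀ y ∈ V, A.SmoothNear y) ∧
      V ⊆ (chartAt E4 x).source ∧ IsCompact C ∧ C ⊆ V ∧ x ∈ interior C := by
    intro x
    obtain ⟨A, hA⟩ := exists_smoothNear 𝔐 x
    obtain ⟨W, hW, hWo, hxW⟩ := eventually_nhds_iff.1 hA.eventually
    obtain ⟨C, hC, hxC, hCW⟩ := exists_compact_subset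
      (hWo.inter (chartAt E4 x).open_source) ⟨hxW, mem_chart_source E4 x⟩
    exact ⟨A, _, C, fun y hy ↦ hW y hy.1, Set.inter_subset_right, hC, hCW, hxC⟩
  choose A V C hA hVs hC hCV hxC using hloc
  obtain ⟨χ, hχ⟩ := SmoothPartitionOfUnity.exists_isSubordinate (𝓡 4) (s := Set.univ) isClosed_univ
    (fun x ↦ interior (C x)) (fun _ ↦ isOpen_interior)
    (fun x _ ↦ Set.mem_iUnion_of_mem x (hxC x))
  have χ0 : ∀ i, ∀ x ∉ C i, χ i x = 0 := fun i x hx ↦ by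
    by_contra hne
    exact hx (interior_subset (hχ i (subset_tsupport _ hne)))
  obtain ⟨K, hK, hcK⟩ := exists_compact_superset hc
  -- only finitely many functions of the partition of unity matter near the common support
  have hfin := χ.locallyFinite.finite_nonempty_inter_compact hK
  have hsum : ∀ x ∈ K, ∑ i ∈ hfin.toFinset, χ i x = 1 := fun x hx ↦ by
    rw [← χ.sum_eq_one (Set.mem_univ x)]
    refine (finsum_eq_sum_of_support_subset _ fun i hi ↦ ?_).symm
    exact hfin.mem_toFinset.2 ⟨x, hi, hx⟩
  let φ (i : M) : SWF 𝔐 := fun x ↦ (χ i x : ℂ) • f x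
  have hφ : ∀ i, IsSection (-s) (-s) (φ i) := fun i ↦ hf.smul_smooth fun x ↦ (χ i).contMDiff x
  have φ0 : ∀ i, ∀ x ∉ C i, φ i x = 0 := fun i x hx ↦ by simp [φ, χ0 i x hx]
  have key : ∀ x, greenDensity s f h x = ∑ i ∈ hfin.toFinset, greenDensity s (φ i) h x := by
    intro x
    by_cases hxf : x ∈ supp f
    · by_cases hxh : x ∈ supp h
      · rw [← greenDensity_sum _ hφ]
        refine greenDensity_congr ?_
        filter_upwards [isOpen_interior.mem_nhds (hcK ⟨hxf, hxh⟩)] with y hy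
        have := hsum y (interior_subset hy)
        rw [Finset.sum_apply, ← Finset.sum_smul, ← Complex.ofReal_sum, this, Complex.ofReal_one,
          one_smul]
      · have e := eventually_eq_zero_of_notMem_supp hxh
        rw [greenDensity_eq_zero' e, Finset.sum_eq_zero fun i _ ↦ greenDensity_eq_zero' e]
    · have e := eventually_eq_zero_of_notMem_supp hxf
      rw [greenDensity_eq_zero e, Finset.sum_eq_zero fun i _ ↦ greenDensity_eq_zero ?_]
      filter_upwards [e] with y hy
      simp only [φ, hy, smul_zero]
  simp_rw [key]
  rw [integral_finsetSum]
  · exact Finset.sum_eq_zero fun i _ ↦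
      integral_greenDensity_of_subset_chart hμ (hφ i) hh (hA i) (hVs i) (hC i) (hCV i) (φ0 i)
  · intro i _
    refine integrable_of_forall_notMem_eq_zero hμ (continuous_greenDensity (hφ i) hh) (hC i)
      fun x hx ↦ greenDensity_eq_zero ?_
    filter_upwards [(hC i).isClosed.isOpen_compl.mem_nhds hx] with y hy using φ0 i y hy

/-- The Teukolsky operators with spins `s` and `-s` are formal transposes of each other. -/
lemma integral_dualEval_teukolsky [SigmaCompactSpace M] (hμ : 𝔐.g.IsVolumeMeasure μ)
    (hf : IsSection (-s) (-s) f) (hh : IsSection s s h) (hc : IsCompact (supp f ∩ supp h)) :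
    Integrable (fun x ↦ dualEval (f x) (teukolsky s h x)) μ ∧
    Integrable (fun x ↦ dualEval (teukolsky (-s) f x) (h x)) μ ∧
    ∫ x, dualEval (f x) (teukolsky s h x) ∂μ = ∫ x, dualEval (teukolsky (-s) f x) (h x) ∂μ := by
  have z : ∀ x ∉ supp f ∩ supp h, dualEval (f x) (teukolsky s h x) = 0 ∧
      dualEval (teukolsky (-s) f x) (h x) = 0 := by
    intro x hx
    by_cases hxf : x ∈ supp f
    · have e := eventually_eq_zero_of_notMem_supp fun hxh ↦ hx ⟨hxf, hxh⟩
      rw [teukolsky_eq_zero e, e.self_of_nhds, dualEval_comm, dualEval_zero_left, dualEval_comm,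
        dualEval_zero_left]
      exact ⟨rfl, rfl⟩
    · have e := eventually_eq_zero_of_notMem_supp hxf
      rw [teukolsky_eq_zero e, e.self_of_nhds, dualEval_zero_left, dualEval_zero_left]
      exact ⟨rfl, rfl⟩
  have i1 : Integrable (fun x ↦ dualEval (f x) (teukolsky s h x)) μ :=
    integrable_of_forall_notMem_eq_zero hμ (continuous_iff_continuousAt.2 fun x ↦
      (smF_dualEval hf (teukolsky_spec hh).1.cast x).continuousAt) hc fun x hx ↦ (z x hx).1
  have i2 : Integrable (fun x ↦ dualEval (teukolsky (-s) f x) (h x)) μ :=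
    integrable_of_forall_notMem_eq_zero hμ (continuous_iff_continuousAt.2 fun x ↦
      (smF_dualEval (teukolsky_spec hf).1 hh.cast x).continuousAt) hc fun x hx ↦ (z x hx).2
  refine ⟨i1, i2, sub_eq_zero.1 ?_⟩
  rw [← integral_sub i1 i2, ← integral_greenDensity hμ hf hh hc]
  refine integral_congr_ae (Filter.Eventually.of_forall fun x ↦ ?_)
  simp only [greenDensity, dualEval_comm (d := h x)]

lemma conjSec_conjSec (f : SWF 𝔐) : conjSec (conjSec f) = f :=
  funext fun _ ↦ funext fun _ ↦ star_star _

lemma supp_conjSec (f : SWF 𝔐) : supp (conjSec f) = supp f := by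
  have : ∀ x, conjSec f x = 0 ↔ f x = 0 := fun x ↦ by
    simp only [funext_iff, conjSec, conjFib, Pi.zero_apply, star_eq_zero]
  simp only [supp, ne_eq, this]

lemma isSection_conjOp_teukolsky (hf : IsSection s (-s) f) :
    IsSection s (-s) (conjOp (teukolsky (-s)) f) :=
  (teukolsky_spec hf.conj).1.conj.cast

/-- The formal anti-dual: the operators with spins `s` and `-s` are formal transposes, which is
applied to the conjugate of the first section and conjugated. -/
lemma isFormalAntidual_teukolsky [SigmaCompactSpace M] (s : ℤ) :
    IsFormalAntidual s (teukolsky (𝔐 := 𝔐) s) (conjOp (teukolsky (-s))) := by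
  intro f h hf hh hc
  obtain ⟨i1, i2, e⟩ := integral_dualEval_teukolsky
    (isVolumeMeasure_volumeMeasure 𝔐.g) hf.conj hh (by rwa [supp_conjSec])
  have e1 : (fun x ↦ dualEval (f x) (conjFib (teukolsky s h x)))
      = fun x ↦ star (dualEval (conjSec f x) (teukolsky s h x)) := by
    funext x
    rw [← dualEval_conjFib_conjFib]
    exact congrArg (fun c ↦ dualEval (c x) _) (conjSec_conjSec f).symm
  have e2 : (fun x ↦ dualEval (conjOp (teukolsky (-s)) f x) (conjFib (h x)))
      = fun x ↦ star (dualEval (teukolsky (-s) (conjSec f) x) (h x)) :=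
    funext fun x ↦ dualEval_conjFib_conjFib
  rw [e1, e2]
  refine ⟨Complex.conjCLE.toContinuousLinearMap.integrable_comp i1,
    Complex.conjCLE.toContinuousLinearMap.integrable_comp i2, ?_⟩
  have := congrArg star e
  rwa [← starRingEnd_apply, ← starRingEnd_apply, ← integral_conj, ← integral_conj] at this

/-- The pairing of `F` and `P_s H` is a sum of two terms, and the identity for each of them is an
instance of `isFormalAntidual_teukolsky`, one of them conjugated. -/
lemma isFormallyHermitian_extTeukolsky [SigmaCompactSpace M] (s : ℤ) :
    IsFormallyHermitian s (extTeukolsky (𝔐 := 𝔐) s) := by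
  intro F H hF hH hc
  have hF1 : supp F.1 ⊆ suppD F := closure_mono fun x hx ↦ Or.inl hx
  have hF2 : supp F.2 ⊆ suppD F := closure_mono fun x hx ↦ Or.inr hx
  have hH1 : supp H.1 ⊆ suppD H := closure_mono fun x hx ↦ Or.inl hx
  have hH2 : supp H.2 ⊆ suppD H := closure_mono fun x hx ↦ Or.inr hx
  obtain ⟨a1, a2, a⟩ := isFormalAntidual_teukolsky s H.2 F.1 hH.2 hF.1
    (hc.of_isClosed_subset (isClosed_closure.inter isClosed_closure)
      fun x hx ↦ ⟨hF1 hx.2, hH2 hx.1⟩)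
  obtain ⟨b1, b2, b⟩ := isFormalAntidual_teukolsky s F.2 H.1 hF.2 hH.1
    (hc.of_isClosed_subset (isClosed_closure.inter isClosed_closure)
      fun x hx ↦ ⟨hF2 hx.1, hH1 hx.2⟩)
  have key : ∀ {x : M} (c d : NullTetrad 𝔐 x → ℂ),
      dualEval c (conjFib d) = star (dualEval d (conjFib c)) := fun c d ↦ by
    rw [← dualEval_conjFib_conjFib, dualEval_comm]
    congr 1
    exact funext fun _ ↦ (star_star _).symm
  have e1 : pointForm F (extTeukolsky s H) = fun x ↦
      dualEval (conjOp (teukolsky (-s)) H.2 x) (conjFib (F.1 x))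
        + star (dualEval (F.2 x) (conjFib (teukolsky s H.1 x))) :=
    funext fun x ↦ congrArg (_ + ·) (key _ _)
  have e2 : pointForm (extTeukolsky s F) H = fun x ↦
      dualEval (H.2 x) (conjFib (teukolsky s F.1 x))
        + star (dualEval (conjOp (teukolsky (-s)) F.2 x) (conjFib (H.1 x))) :=
    funext fun x ↦ congrArg (_ + ·) (key _ _)
  rw [e1, e2]
  have b1s : Integrable (fun x ↦ star (dualEval (F.2 x) (conjFib (teukolsky s H.1 x))))
      𝔐.g.volumeMeasure := Complex.conjCLE.toContinuousLinearMap.integrable_comp b1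
  have b2s : Integrable (fun x ↦ star (dualEval (conjOp (teukolsky (-s)) F.2 x) (conjFib (H.1 x))))
      𝔐.g.volumeMeasure := Complex.conjCLE.toContinuousLinearMap.integrable_comp b2
  refine ⟨a2.add b1s, a1.add b2s, ?_⟩
  rw [integral_add a2 b1s, integral_add a1 b2s, a]
  have := congrArg star b
  rw [← starRingEnd_apply, ← starRingEnd_apply, ← integral_conj, ← integral_conj] at this
  exact congrArg _ this

end FormalAdjoint

end

end Teukolsky

end

theorem mainTheorem10 {M : Type*} [TopologicalSpace M] [ChartedSpace Teukolsky.E4 M]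
    [IsManifold (𝓡 4) ∞ M] [T2Space M] [SigmaCompactSpace M] [MeasurableSpace M] [BorelSpace M]
    (𝔐 : Teukolsky.Background M) (s : ℤ) :
    -- the volume measure, the fibre pairing and the operators are well defined; the pairing is
    -- hermitian, non-degenerate and indefinite
    𝔐.g.IsVolumeMeasure 𝔐.g.volumeMeasure ∧
    (∀ x : M, Nonempty (Teukolsky.NullTetrad 𝔐 x) ∧
      (∀ u ∈ Teukolsky.doubleFibre 𝔐 s x, ∀ v ∈ Teukolsky.doubleFibre 𝔐 s x,
        (∀ a : Teukolsky.NullTetrad 𝔐 x,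
          Teukolsky.fibreForm u v = star (u.1 a) * v.2 a + star (u.2 a) * v.1 a) ∧
        Teukolsky.fibreForm v u = star (Teukolsky.fibreForm u v)) ∧
      (∀ v ∈ Teukolsky.doubleFibre 𝔐 s x,
        (∀ u ∈ Teukolsky.doubleFibre 𝔐 s x, Teukolsky.fibreForm u v = 0) → v = 0) ∧
      (∃ u ∈ Teukolsky.doubleFibre 𝔐 s x, 0 < (Teukolsky.fibreForm u u).re) ∧
      (∃ u ∈ Teukolsky.doubleFibre 𝔐 s x, (Teukolsky.fibreForm u u).re < 0)) ∧
    (∀ f : Teukolsky.SWF 𝔐, Teukolsky.IsSection s s f →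
      Teukolsky.IsSection s s (Teukolsky.teukolsky s f)) ∧
    (∀ F : Teukolsky.SWF 𝔐 × Teukolsky.SWF 𝔐, Teukolsky.IsDoubleSection s F →
      Teukolsky.IsDoubleSection s (Teukolsky.extTeukolsky s F)) ∧
    -- the complex conjugate of `T_{-s}` is the formal anti-dual of `T_s`
    Teukolsky.IsFormalAntidual s (Teukolsky.teukolsky (𝔐 := 𝔐) s)
      (Teukolsky.conjOp (Teukolsky.teukolsky (-s))) ∧
    -- the extended operator is formally hermitian
    Teukolsky.IsFormallyHermitian s (Teukolsky.extTeukolsky (𝔐 := 𝔐) s) := by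
  refine ⟨Teukolsky.isVolumeMeasure_volumeMeasure 𝔐.g, fun x ↦
    ⟨Teukolsky.nonempty_nullTetrad 𝔐 x, fun u hu v hv ↦
      ⟨Teukolsky.fibreForm_eq hu hv, Teukolsky.fibreForm_conj hu hv⟩,
      fun v hv h ↦ Teukolsky.fibreForm_nondegenerate hv h, ?_, ?_⟩,
    fun f hf ↦ (Teukolsky.teukolsky_spec hf).1,
    fun F hF ↦ ⟨(Teukolsky.teukolsky_spec hF.1).1, Teukolsky.isSection_conjOp_teukolsky hF.2⟩,
    Teukolsky.isFormalAntidual_teukolsky s, Teukolsky.isFormallyHermitian_extTeukolsky s⟩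
  · obtain ⟨u, hu, h⟩ := Teukolsky.exists_fibreForm_self (𝔐 := 𝔐) x s 1
    exact ⟨u, hu, by rw [h]; norm_num⟩
  · obtain ⟨u, hu, h⟩ := Teukolsky.exists_fibreForm_self (𝔐 := 𝔐) x s (-1)
    exact ⟨u, hu, by rw [h]; norm_num⟩
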